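/- **Theorem.** Let $m\ge 2$ and let $X$ be an oriented Riemannian manifold of dimension $2m$ with its Levi-Civita connection (or, more generally, with any smooth connection $\nabla$ on $TX$ that preserves the metric). Let $\phi\colon S^1\to X$ be a smooth loop, where $S^1=\mathbb R/\ell\mathbb Z$ is a circle of length $\ell>0$ with coordinate $t$ and $\xi=d/dt$, and let $L\to S^1$ be the real line bundle of a spin structure on $S^1$: the trivial bundle (nonbounding spin structure) or the Möbius bundle (bounding spin structure). Put $E=\phi^*TX$, let $D_\phi=\nabla_\xi$ be the real skew-adjoint Dirac operator on the smooth sections of $L\otimes E\to S^1$, and let $\Gamma_\phi$ be the space of continuous sections of the oriented orthonormal frame bundle $SO(E)\to S^1$. The Pfaffian line $\operatorname{Pfaff}D_\phi$ is the real line obtained by gluing the lines $(\operatorname{Det}V)^*$, for the finite-dimensional $D_\phi$-invariant spaces $V\supseteq\ker D_\phi$ of smooth sections of $L\otimes E$, where for $V\subseteq V'$ the lines $(\operatorname{Det}V)^*$ and $(\operatorname{Det}V')^*$ are identified by multiplication by $\operatorname{pfaff}\bigl(D_\phi|_{V'\cap V^\perp}\bigr)$, the orthogonal complement being taken in $L^2$.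 Fix a path $g\colon[0,1]\to SO_{2m}$ from $1$ to $-1$ (the universal choice; it is independent of $X,\phi$ and $L$, and is used only for the bounding spin structure). Then: 1. $\operatorname{Pfaff}D_\phi$ is one-dimensional, and $\pi_0\bigl(\operatorname{Pfaff}D_\phi\setminus\{0\}\bigr)$ is a $\mathbb Z/2$-torsor, with the nontrivial element acting by $-1$. 2. $\pi_0\bigl(\operatorname{Map}(S^1,SO_{2m})\bigr)$ has order two, and the action of $\operatorname{Map}(S^1,SO_{2m})$ on $\Gamma_\phi$ by $e\mapsto e\cdot\gamma$ makes $\pi_0(\Gamma_\phi)$ a torsor under this group: $\pi_0(\Gamma_\phi)$ has two elements, and $[e\cdot\gamma]=[e]$ if and only if $\gamma$ is in the component of the constant loop $1$. 3. There is a canonical isomorphism of $\mathbb Z/2$-torsors $$\Phi\colon\ \pi_0\bigl(\operatorname{Pfaff}D_\phi\setminus\{0\}\bigr)\xrightarrow{\ \cong\ }\pi_0(\Gamma_\phi).$$ It is the unique isomorphism of $\mathbb Z/2$-torsors with the following property. Let $e=(e_1,\dots,e_{2m})$ be any smooth oriented orthonormal frame of $L\otimes E\to S^1$ such that $\nabla_\xi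 e=e\cdot A$ for a constant skew-symmetric matrix $A$ all of whose eigenvalues lie in $\sqrt{-1}\,[-\pi/\ell,\pi/\ell]$. Let $W$ be the span of $e_1,\dots,e_{2m}$, which contains $\ker D_\phi$, so that $\operatorname{Pfaff}D_\phi=(\operatorname{Det}W)^*$. Then $\Phi$ sends the component of the elements of $(\operatorname{Det}W)^*$ that are positive on $e_1\wedge\dots\wedge e_{2m}$ to the component of $e$ if $L$ is trivial, and to the component of the section $t\mapsto e(t)\cdot g(t/\ell)$, $0\le t\le\ell$, of $SO(E)$ if $L$ is the Möbius bundle. -/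

import Mathlib

open scoped Manifold ContDiff Topology Bundle

noncomputable section

/-- The Pfaffian `(2 ^ k * k!)⁻¹ * ∑ σ, sign σ * ∏ i, A (σ (2 i)) (σ (2 i + 1))` of a real matrix
of size `2 k` (indices starting at `0`). -/
def matrixPfaffian {k : ℕ} (A : Matrix (Fin (2 * k)) (Fin (2 * k)) ℝ) : ℝ :=
  ((2 : ℝ) ^ k * (k.factorial : ℝ))⁻¹ *
    ∑ σ : Equiv.Perm (Fin (2 * k)), ((Equiv.Perm.sign σ : ℤ) : ℝ) *
      ∏ i : Fin k, A (σ ⟨2 * i.1, by omega⟩) (σ ⟨2 * i.1 + 1, by omega⟩)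

/-- The two spin structures on a circle, up to isomorphism. The real line bundle `L` is trivial for
the nonbounding one and the Möbius bundle for the bounding one. -/
inductive CircleSpin where
  | nonbounding
  | bounding

/-- The sign `ε` such that `L` is the quotient of `ℝ × ℝ` by `(t + ℓ, x) ∼ (t, ε x)`. -/
def CircleSpin.sign : CircleSpin → ℝ
  | .nonbounding => 1
  | .bounding => -1

section Manifold

variable {n : ℕ} (X : Type*) [TopologicalSpace X] [ChartedSpace (EuclideanSpace ℝ (Fin n)) X]
  [IsManifold (𝓡 n) ∞ X]

/-- An orientation of the `n`-manifold `X`: an orientation of every tangent space, such that near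
every point there is a continuous frame that is positively oriented. -/
structure ManifoldOrientation where
  at_point : ∀ x : X, Orientation ℝ (TangentSpace (𝓡 n) x) (Fin n)
  locally_framed : ∀ x₀ : X, ∃ U ∈ 𝓝 x₀, ∃ b : (x : X) → Fin n → TangentSpace (𝓡 n) x,
    (∀ i, ContinuousOn (fun x => (⟨x, b x i⟩ : TangentBundle (𝓡 n) X)) U) ∧
    ∀ x ∈ U, ∃ B : Module.Basis (Fin n) ℝ (TangentSpace (𝓡 n) x),
      ⇑B = b x ∧ B.orientation = at_point x

end Manifold

section Loop

variable {n : ℕ} {X : Type*} [TopologicalSpace X] [ChartedSpace (EuclideanSpace ℝ (Fin n)) X]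
  [IsManifold (𝓡 n) ∞ X]

/-- Vector fields along `φ : ℝ → X`, that is, sections of the pullback of the tangent bundle
(without any condition of regularity). -/
abbrev FieldAlong (φ : ℝ → X) : Type _ := (t : ℝ) → TangentSpace (𝓡 n) (φ t)

/-- The smooth spinor fields with coefficients in `E = φ^* TX` on the circle `ℝ / ℓ ℤ`, that is, the
smooth sections of `L ⊗ E`: the smooth fields `s` along `φ : ℝ → X` with `s (t + ℓ) = ε s t`.
(The equation is between elements of `TX`, over the point `φ (t + ℓ) = φ t`.) -/
structure IsSpinorField (ℓ : ℝ) (spin : CircleSpin) (φ : ℝ → X) (s : FieldAlong (n := n) φ) :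
    Prop where
  smooth : ContMDiff 𝓘(ℝ, ℝ) ((𝓡 n).prod 𝓘(ℝ, EuclideanSpace ℝ (Fin n))) ∞
    (fun t => (⟨φ t, s t⟩ : TangentBundle (𝓡 n) X))
  periodic : ∀ t, (⟨φ (t + ℓ), s (t + ℓ)⟩ : TangentBundle (𝓡 n) X) = ⟨φ t, spin.sign • s t⟩

/-- The Dirac operator `D_φ`, which is the covariant derivative `∇_ξ`, `ξ = d/dt`, for the pullback
to `ℝ` of the connection `∇` on `TX`. In the local frame `b_i` of `TX` near `φ t` given by a
trivialization, a field `s = ∑ i, u_i (b_i ∘ φ)` along `φ` has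
`(∇_ξ s) t = ∑ i, u_i' t • b_i (φ t) + ∑ i, u_i t • ∇_{φ' t} b_i`.
In the second sum, the local section `∑ i, u_i t • b_i` has constant coordinates. -/
def dirac (cov : CovariantDerivative (𝓡 n) (EuclideanSpace ℝ (Fin n))
      (fun x : X => TangentSpace (𝓡 n) x))
    (φ : ℝ → X) (s : FieldAlong (n := n) φ) : FieldAlong (n := n) φ := fun t =>
  let τ := trivializationAt (EuclideanSpace ℝ (Fin n)) (fun x : X => TangentSpace (𝓡 n) x) (φ t)
  τ.symm (φ t) (deriv (fun r => (τ (⟨φ r, s r⟩ : TangentBundle (𝓡 n) X)).2) t) +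
    cov (fun x => τ.symm x (τ (⟨φ t, s t⟩ : TangentBundle (𝓡 n) X)).2) (φ t)
      (mfderiv 𝓘(ℝ, ℝ) (𝓡 n) φ t (1 : ℝ))

variable [Bundle.RiemannianBundle (fun x : X => TangentSpace (𝓡 n) x)]

set_option synthInstance.maxHeartbeats 400000 in
/-- `∇` is a smooth connection on `TX` that is compatible with the Riemannian metric. -/
structure IsSmoothMetricConnection
    [IsContMDiffRiemannianBundle (𝓡 n) ∞ (EuclideanSpace ℝ (Fin n))
      (fun x : X => TangentSpace (𝓡 n) x)]
    (cov : CovariantDerivative (𝓡 n) (EuclideanSpace ℝ (Fin n))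
      (fun x : X => TangentSpace (𝓡 n) x)) : Prop where
  smooth : CovariantDerivative.ContMDiffCovariantDerivative cov ∞
  metric : cov.IsMetricCompatible

/-- The `L²` inner product of spinor fields on the circle of length `ℓ`. -/
def spinorInner (ℓ : ℝ) {φ : ℝ → X} (s s' : FieldAlong (n := n) φ) : ℝ :=
  ∫ t in (0 : ℝ)..ℓ, inner ℝ (s t) (s' t)

/-- A finite-dimensional space of smooth spinor fields that is invariant under the Dirac operator
and contains its kernel. For example, for every `a > 0` the sum of the eigenspaces of `D^* D` with
eigenvalue less than `a` is such a space. -/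
structure DiracInvariantSpace (ℓ : ℝ) (spin : CircleSpin)
    (cov : CovariantDerivative (𝓡 n) (EuclideanSpace ℝ (Fin n))
      (fun x : X => TangentSpace (𝓡 n) x)) (φ : ℝ → X) where
  space : Submodule ℝ (FieldAlong (n := n) φ)
  finite : FiniteDimensional ℝ space
  isSpinorField : ∀ s ∈ space, IsSpinorField ℓ spin φ s
  invariant : ∀ s ∈ space, dirac cov φ s ∈ space
  kernel_le : ∀ s, IsSpinorField ℓ spin φ s → dirac cov φ s = 0 → s ∈ space

/-- The Pfaffian line `Pfaff D_φ` of the skew-adjoint Dirac operator `D_φ`. It is glued from the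
lines `(Det V)^* = Λ^top V^*`, for the finite-dimensional invariant spaces `V ⊇ ker D_φ`: for
`V ⊆ V'` the lines `(Det V)^*` and `(Det V')^*` are identified through the multiplication by the
nonzero element `pfaff (D_φ)` of `(Det U)^*`, where `U` is the orthogonal complement of `V` in `V'`.
So an element of the line is a compatible family of top forms `η V` on the spaces `V`. -/
def PfaffianLine (ℓ : ℝ) (spin : CircleSpin)
    (cov : CovariantDerivative (𝓡 n) (EuclideanSpace ℝ (Fin n))
      (fun x : X => TangentSpace (𝓡 n) x)) (φ : ℝ → X) :
    Submodule ℝ ((V : DiracInvariantSpace ℓ spin cov φ) →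
      V.space [⋀^Fin (Module.finrank ℝ V.space)]→ₗ[ℝ] ℝ) where
  carrier := {η | ∀ (V V' : DiracInvariantSpace ℓ spin cov φ) (hle : V.space ≤ V'.space) (k : ℕ)
    (hk : Module.finrank ℝ V'.space = Module.finrank ℝ V.space + 2 * k)
    (u : Fin (Module.finrank ℝ V.space) → V.space) (w : Fin (2 * k) → V'.space),
    (∀ i, ∀ v ∈ V.space, spinorInner ℓ v (w i : FieldAlong (n := n) φ) = 0) →
    η V' (fun i => Fin.append (fun j => Submodule.inclusion hle (u j)) w (Fin.cast hk i)) =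
      η V u * matrixPfaffian (Matrix.of fun i j =>
        spinorInner ℓ (w i : FieldAlong (n := n) φ) (dirac cov φ (w j)))}
  add_mem' := by
    intro η η' h h' V V' hle k hk u w hw
    simp only [Pi.add_apply, AlternatingMap.add_apply, add_mul]
    rw [h V V' hle k hk u w hw, h' V V' hle k hk u w hw]
  zero_mem' := by
    intro V V' hle k hk u w hw
    simp
  smul_mem' := by
    intro c η h V V' hle k hk u w hw
    simp only [Pi.smul_apply, AlternatingMap.smul_apply, smul_eq_mul, mul_assoc]
    rw [h V V' hle k hk u w hw]

/-- The set `Pfaff D_φ \ {0}`. -/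
def PfaffianNonzero (ℓ : ℝ) (spin : CircleSpin)
    (cov : CovariantDerivative (𝓡 n) (EuclideanSpace ℝ (Fin n))
      (fun x : X => TangentSpace (𝓡 n) x)) (φ : ℝ → X) : Type _ :=
  {η : PfaffianLine ℓ spin cov φ // η ≠ 0}

/-- The topology of `Pfaff D_φ \ {0}`, induced from the canonical topology of the real vector space
`Pfaff D_φ`. -/
instance (ℓ : ℝ) (spin : CircleSpin)
    (cov : CovariantDerivative (𝓡 n) (EuclideanSpace ℝ (Fin n))
      (fun x : X => TangentSpace (𝓡 n) x)) (φ : ℝ → X) :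
    TopologicalSpace (PfaffianNonzero ℓ spin cov φ) :=
  TopologicalSpace.induced Subtype.val (moduleTopology ℝ (PfaffianLine ℓ spin cov φ))

/-- The nontrivial element of `ℤ/2` acts on `Pfaff D_φ \ {0}` by `-1`. -/
instance (ℓ : ℝ) (spin : CircleSpin)
    (cov : CovariantDerivative (𝓡 n) (EuclideanSpace ℝ (Fin n))
      (fun x : X => TangentSpace (𝓡 n) x)) (φ : ℝ → X) :
    Neg (PfaffianNonzero ℓ spin cov φ) :=
  ⟨fun η => ⟨-η.1, fun h => η.2 (Subtype.ext (neg_eq_zero.1 (congrArg Subtype.val h)))⟩⟩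

/-- The continuous sections of the bundle `SO(E ⊗ L)` of oriented orthonormal frames of `E ⊗ L`,
where `E = φ^* TX` on the circle `ℝ / ℓ ℤ`. For the nonbounding spin structure `L` is trivial, and
these are the sections of `SO(E)`. -/
structure IsFrameField (ℓ : ℝ) (spin : CircleSpin) (o : ManifoldOrientation (n := n) X)
    (φ : ℝ → X) (e : Fin n → FieldAlong (n := n) φ) : Prop where
  continuous : ∀ j, Continuous (fun t => (⟨φ t, e j t⟩ : TangentBundle (𝓡 n) X))
  periodic : ∀ j t,
    (⟨φ (t + ℓ), e j (t + ℓ)⟩ : TangentBundle (𝓡 n) X) = ⟨φ t, spin.sign • e j t⟩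
  orthonormal : ∀ t, Orthonormal ℝ (fun j => e j t)
  oriented : ∀ t, ∃ B : Module.Basis (Fin n) ℝ (TangentSpace (𝓡 n) (φ t)),
    ⇑B = (fun j => e j t) ∧ B.orientation = o.at_point (φ t)

/-- The space `Γ_φ` of sections of `SO(E)`, `E = φ^* TX`. -/
def FrameSections (ℓ : ℝ) (o : ManifoldOrientation (n := n) X) (φ : ℝ → X) : Type _ :=
  {e : Fin n → FieldAlong (n := n) φ // IsFrameField ℓ .nonbounding o φ e}

/-- The members of a frame field as continuous maps to the total space `TX`. -/
def FrameSections.toMaps {ℓ : ℝ} {o : ManifoldOrientation (n := n) X} {φ : ℝ → X}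
    (e : FrameSections ℓ o φ) : Fin n → C(ℝ, TangentBundle (𝓡 n) X) :=
  fun j => ⟨fun t => ⟨φ t, e.1 j t⟩, e.2.continuous j⟩

/-- The compact-open topology on `Γ_φ`. -/
instance (ℓ : ℝ) (o : ManifoldOrientation (n := n) X) (φ : ℝ → X) :
    TopologicalSpace (FrameSections ℓ o φ) :=
  TopologicalSpace.induced FrameSections.toMaps inferInstance

/-- `f = e · γ` for frame fields `e`, `f` and a loop `γ` in `SO_n`. -/
def IsRightTranslate {ℓ : ℝ} {o : ManifoldOrientation (n := n) X} {φ : ℝ → X}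
    (e f : FrameSections ℓ o φ)
    (γ : C(AddCircle ℓ, Matrix.specialOrthogonalGroup (Fin n) ℝ)) : Prop :=
  ∀ j t, f.1 j t = ∑ i, (γ (t : AddCircle ℓ)).1 i j • e.1 i t

/-- The frame field `e` of `E ⊗ L` satisfies `∇_ξ e = e · A` for a constant skew-symmetric matrix
`A`, whose eigenvalues lie between `-iπ/ℓ` and `iπ/ℓ`. -/
structure IsLowEnergyFrame (ℓ : ℝ) (spin : CircleSpin)
    (cov : CovariantDerivative (𝓡 n) (EuclideanSpace ℝ (Fin n))
      (fun x : X => TangentSpace (𝓡 n) x))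
    (o : ManifoldOrientation (n := n) X) (φ : ℝ → X)
    (e : Fin n → FieldAlong (n := n) φ) (A : Matrix (Fin n) (Fin n) ℝ) : Prop where
  frame : IsFrameField ℓ spin o φ e
  isSpinorField : ∀ j, IsSpinorField ℓ spin φ (e j)
  skew : A.transpose = -A
  dirac_eq : ∀ j, dirac cov φ (e j) = ∑ i, A i j • e i
  spectrum_le : ∀ z ∈ spectrum ℂ (A.map (algebraMap ℝ ℂ)), ‖z‖ ≤ Real.pi / ℓ

/-- The section `f` of `SO(E)` is `e` for the nonbounding spin structure, and `e · g` for the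
bounding one, where `g` is a path of matrices, run through on `[0, ℓ]`. -/
def IsUntwisted (ℓ : ℝ) {φ : ℝ → X} (e f : Fin n → FieldAlong (n := n) φ)
    (g : ℝ → Matrix (Fin n) (Fin n) ℝ) : CircleSpin → Prop
  | .nonbounding => f = e
  | .bounding => ∀ t ∈ Set.Icc (0 : ℝ) ℓ, ∀ j, f j t = ∑ i, g (t / ℓ) i j • e i t

/-- The rule that determines the isomorphism. Let `e` be a frame field of `E ⊗ L` with constant
connection matrix, whose eigenvalues lie between `-iπ/ℓ` and `iπ/ℓ`, and let `W` be the span of its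
members, so that `Pfaff D_φ` is identified with `(Det W)^*`. Then the elements of `Pfaff D_φ` that
are positive on the basis `e` of `W` correspond to the class of `e` (or of `e · g`, for the bounding
spin structure) in `π_0(Γ_φ)`. -/
def FollowsFrameRule {ℓ : ℝ} {spin : CircleSpin}
    {cov : CovariantDerivative (𝓡 n) (EuclideanSpace ℝ (Fin n))
      (fun x : X => TangentSpace (𝓡 n) x)}
    {o : ManifoldOrientation (n := n) X} {φ : ℝ → X} (g : ℝ → Matrix (Fin n) (Fin n) ℝ)
    (Φ : ZerothHomotopy (PfaffianNonzero ℓ spin cov φ) →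
      ZerothHomotopy (FrameSections ℓ o φ)) : Prop :=
  ∀ (e : Fin n → FieldAlong (n := n) φ) (A : Matrix (Fin n) (Fin n) ℝ),
    IsLowEnergyFrame ℓ spin cov o φ e A →
    ∀ W : DiracInvariantSpace ℓ spin cov φ, W.space = Submodule.span ℝ (Set.range e) →
    ∀ (hdim : Module.finrank ℝ W.space = n) (he : ∀ j, e j ∈ W.space)
      (η : PfaffianNonzero ℓ spin cov φ) (f : FrameSections ℓ o φ),
      0 < η.1.1 W (fun i => ⟨e (Fin.cast hdim i), he _⟩) →
      IsUntwisted ℓ e f.1 g spin →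
      Φ (ZerothHomotopy.mk η) = ZerothHomotopy.mk f

end Loop

end

/-! Parallel transport along `φ` turns the problem into linear algebra. In a parallel, positive,
orthonormal frame (`nonempty_parallelFrame`) the Dirac operator is `d/dt` on functions `u : ℝ →
ℝ^n`, `n = 2m`, with `u (t + ℓ) = h u(t)`, where `h ∈ SO_n` is the inverse holonomy times the sign
of the spin structure. Frame fields become functions with values in `SO_n`, so that two sections of
`SO(E)` differ by a loop in `SO_n`.

The loops in `SO_n` have two components. There are at most two: as long as three dimensions are
left, the orbit of a further basis vector can be made constant (`exists_loopHomotopic_fix_succ`),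
and a rotation of the last plane matters only through its winding number modulo 2. They are
different by a spinorial invariant: on a fine grid the increments of a loop are lifted to the
Clifford algebra, and the product of the lifts is a nonzero scalar whose sign is a homotopy
invariant, negative for a full turn (`not_loopHomotopic_planeRotation`).

For the Pfaffian line, the derivative is perturbed on its kernel by a skew-symmetric `K`
(`IsKernelForm`). The perturbed operator is injective, and on the complement of an invariant space
that contains the kernel it is still the derivative. Hence its Pfaffians on the invariant spaces are
a compatible, nowhere vanishing family (`exists_pfaffianLine`). Since a compatible family is
determined by its value on the kernel, the line is spanned by this element (`exists_eq_smul`).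

Frames with constant connection matrix consist of the columns of `exp (t A) B`, with `B ∈ SO_n` and
`A` a skew-symmetric logarithm of `h` in the sense that `exp (ℓ A) = h`, with eigenvalues in `i
[-π/ℓ, π/ℓ]`. Such an `A` exists (`exists_exp_eq`). It is unique except on the eigenspace of `h` for
`-1`, and two choices satisfy `A = C A₀ Cᵀ` with `C` orthogonal and equal to the identity away from
that eigenspace (`exists_conj_of_exp_eq`).

The heart of the theorem is that `det C` controls both sides (`sign_iff_joined`). As `C` fixes the
vectors fixed by `h`, `C K Cᵀ = K`, so the Pfaffian of `A + K` is `det C` times that of `A₀ + K`. On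
the other side, the loop `exp (-t A₀) exp (t A)` is null-homotopic if and only if `det C = 1`
(`exists_conj_loopHomotopic_iff`): for `det C = 1` the matrix `C` is deformed to `1` within the
matrices that commute with `h`, and for `det C = -1` one reflection is left over, whose commutator
with `exp (t A₀)` is a full turn. So changing the frame flips the sign of the Pfaffian exactly when
it changes the component of the frame.

For the bounding spin structure the path `g` extends to an antiperiodic function `G`, and right
multiplication by `G` turns frames of `L ⊗ E` into frames of `E` without affecting the comparison of
two frames. Finally both sets of components have two elements, so one reference frame determines
`Φ`. -/

open scoped Manifold ContDiff Topology Bundle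

set_option linter.unusedSectionVars false

/-! ### Covariant differentiation of fields along a curve. -/

noncomputable section

section AlongCurve

variable {n : ℕ} {X : Type*} [TopologicalSpace X] [ChartedSpace (EuclideanSpace ℝ (Fin n)) X]
  [IsManifold (𝓡 n) ∞ X]

/-- The field `s` along the curve `φ` is smooth at the parameter `t`. -/
def SmoothAlongAt (φ : ℝ → X) (s : FieldAlong (n := n) φ) (t : ℝ) : Prop :=
  ContMDiffAt 𝓘(ℝ, ℝ) ((𝓡 n).prod 𝓘(ℝ, EuclideanSpace ℝ (Fin n))) ∞
    (fun r => (⟨φ r, s r⟩ : TangentBundle (𝓡 n) X)) t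

variable {φ : ℝ → X} {t : ℝ}

/-- The trivialization of the tangent bundle around `φ t`. -/
abbrev trivAlong (φ : ℝ → X) (t : ℝ) :=
  trivializationAt (EuclideanSpace ℝ (Fin n)) (fun x : X => TangentSpace (𝓡 n) x) (φ t)

/-- Coordinates of a field along `φ` in the trivialization around `φ t`. -/
def coordAlong (φ : ℝ → X) (s : FieldAlong (n := n) φ) (t : ℝ) (r : ℝ) :
    EuclideanSpace ℝ (Fin n) :=
  (trivAlong (n := n) φ t (⟨φ r, s r⟩ : TangentBundle (𝓡 n) X)).2

lemma smoothAlongAt_iff {s : FieldAlong (n := n) φ} :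
    SmoothAlongAt φ s t ↔ ContMDiffAt 𝓘(ℝ, ℝ) (𝓡 n) ∞ φ t ∧
      ContDiffAt ℝ ∞ (coordAlong φ s t) t := by
  unfold SmoothAlongAt
  rw [Bundle.contMDiffAt_totalSpace, contMDiffAt_iff_contDiffAt]
  rfl

lemma eventually_mem_trivAlong (hφ : ContinuousAt φ t) :
    ∀ᶠ r in 𝓝 t, φ r ∈ (trivAlong (n := n) φ t).baseSet :=
  hφ.eventually ((trivAlong (n := n) φ t).open_baseSet.mem_nhds
    (FiberBundle.mem_baseSet_trivializationAt' (φ t)))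

lemma mem_trivAlong : φ t ∈ (trivAlong (n := n) φ t).baseSet :=
  FiberBundle.mem_baseSet_trivializationAt' (φ t)

lemma coordAlong_eq {s : FieldAlong (n := n) φ} {r : ℝ}
    (hr : φ r ∈ (trivAlong (n := n) φ t).baseSet) :
    coordAlong φ s t r = (trivAlong (n := n) φ t).linearEquivAt ℝ (φ r) hr (s r) := rfl

lemma coordAlong_add {s s' : FieldAlong (n := n) φ} {r : ℝ}
    (hr : φ r ∈ (trivAlong (n := n) φ t).baseSet) :
    coordAlong φ (s + s') t r = coordAlong φ s t r + coordAlong φ s' t r := by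
  rw [coordAlong_eq hr, coordAlong_eq hr, coordAlong_eq hr, ← map_add]; rfl

lemma coordAlong_smul {s : FieldAlong (n := n) φ} {c : ℝ → ℝ} {r : ℝ}
    (hr : φ r ∈ (trivAlong (n := n) φ t).baseSet) :
    coordAlong φ (fun r => c r • s r) t r = c r • coordAlong φ s t r := by
  rw [coordAlong_eq hr, coordAlong_eq hr, ← map_smul]

lemma SmoothAlongAt.base {s : FieldAlong (n := n) φ} (h : SmoothAlongAt φ s t) :
    ContMDiffAt 𝓘(ℝ, ℝ) (𝓡 n) ∞ φ t := (smoothAlongAt_iff.1 h).1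

lemma SmoothAlongAt.congr {s s' : FieldAlong (n := n) φ} (h : SmoothAlongAt φ s t)
    (hs : ∀ᶠ r in 𝓝 t, s' r = s r) : SmoothAlongAt φ s' t := by
  refine ContMDiffAt.congr_of_eventuallyEq h ?_
  filter_upwards [hs] with r hr
  rw [hr]

lemma SmoothAlongAt.add {s s' : FieldAlong (n := n) φ} (h : SmoothAlongAt φ s t)
    (h' : SmoothAlongAt φ s' t) : SmoothAlongAt φ (s + s') t := by
  rw [smoothAlongAt_iff] at *
  refine ⟨h.1, (h.2.add h'.2).congr_of_eventuallyEq ?_⟩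
  filter_upwards [eventually_mem_trivAlong (n := n) h.1.continuousAt] with r hr
  exact coordAlong_add hr

lemma SmoothAlongAt.smul {s : FieldAlong (n := n) φ} {c : ℝ → ℝ} (h : SmoothAlongAt φ s t)
    (hc : ContDiffAt ℝ ∞ c t) : SmoothAlongAt φ (fun r => c r • s r) t := by
  rw [smoothAlongAt_iff] at *
  refine ⟨h.1, (hc.smul h.2).congr_of_eventuallyEq ?_⟩
  filter_upwards [eventually_mem_trivAlong (n := n) h.1.continuousAt] with r hr
  exact coordAlong_smul hr

lemma smoothAlongAt_zero (hφ : ContMDiffAt 𝓘(ℝ, ℝ) (𝓡 n) ∞ φ t) :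
    SmoothAlongAt φ (0 : FieldAlong (n := n) φ) t := by
  rw [smoothAlongAt_iff]
  refine ⟨hφ, (contDiffAt_const (c := 0)).congr_of_eventuallyEq ?_⟩
  filter_upwards [eventually_mem_trivAlong (n := n) hφ.continuousAt] with r hr
  rw [coordAlong_eq hr]
  exact map_zero _

lemma smoothAlongAt_sum {ι : Type*} {u : Finset ι} {s : ι → FieldAlong (n := n) φ}
    {c : ι → ℝ → ℝ} (hφ : ContMDiffAt 𝓘(ℝ, ℝ) (𝓡 n) ∞ φ t)
    (h : ∀ i ∈ u, SmoothAlongAt φ (s i) t) (hc : ∀ i ∈ u, ContDiffAt ℝ ∞ (c i) t) :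
    SmoothAlongAt φ (fun r => ∑ i ∈ u, c i r • s i r) t := by
  classical
  induction u using Finset.induction_on with
  | empty => simpa using! smoothAlongAt_zero hφ
  | insert a u ha ih =>
    have h1 := ih (fun i hi => h i (Finset.mem_insert_of_mem hi))
      (fun i hi => hc i (Finset.mem_insert_of_mem hi))
    have h2 := (h a (Finset.mem_insert_self _ _)).smul (hc a (Finset.mem_insert_self _ _))
    convert h2.add h1 using 2 with r
    rw [Finset.sum_insert ha]; rfl

/-- A section of the tangent bundle along `φ`. -/
lemma SmoothAlongAt.of_section {σ : (x : X) → TangentSpace (𝓡 n) x}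
    (hφ : ContMDiffAt 𝓘(ℝ, ℝ) (𝓡 n) ∞ φ t)
    (hσ : ContMDiffAt (𝓡 n) ((𝓡 n).prod 𝓘(ℝ, EuclideanSpace ℝ (Fin n))) ∞
      (fun x => (⟨x, σ x⟩ : TangentBundle (𝓡 n) X)) (φ t)) :
    SmoothAlongAt φ (fun r => σ (φ r)) t :=
  ContMDiffAt.comp t hσ hφ

variable (cov : CovariantDerivative (𝓡 n) (EuclideanSpace ℝ (Fin n))
      (fun x : X => TangentSpace (𝓡 n) x))

/-- The local section with constant coordinates. -/
def constSection (x₀ : X) (v : EuclideanSpace ℝ (Fin n)) (x : X) : TangentSpace (𝓡 n) x :=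
  (trivializationAt (EuclideanSpace ℝ (Fin n)) (fun x : X => TangentSpace (𝓡 n) x) x₀).symmₗ ℝ x v

/-- `dirac` is written with `symm`, while `constSection` uses the linear map `symmₗ`: this makes it
linear in the vector as an identity between global sections, which is what the axioms of a covariant
derivative are applied to. -/
lemma constSection_eq_symm {x₀ x : X} (hx : x ∈ (trivializationAt (EuclideanSpace ℝ (Fin n))
      (fun x : X => TangentSpace (𝓡 n) x) x₀).baseSet) (v : EuclideanSpace ℝ (Fin n)) :
    constSection x₀ v x = (trivializationAt (EuclideanSpace ℝ (Fin n))
      (fun x : X => TangentSpace (𝓡 n) x) x₀).symm x v :=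
  Bundle.Trivialization.symmₗ_apply _ hx v

lemma contMDiffAt_constSection (x₀ : X) (v : EuclideanSpace ℝ (Fin n)) {x : X}
    (hx : x ∈ (trivializationAt (EuclideanSpace ℝ (Fin n))
      (fun x : X => TangentSpace (𝓡 n) x) x₀).baseSet) :
    ContMDiffAt (𝓡 n) ((𝓡 n).prod 𝓘(ℝ, EuclideanSpace ℝ (Fin n))) ∞
      (fun x => (⟨x, constSection x₀ v x⟩ : TangentBundle (𝓡 n) X)) x := by
  set τ := trivializationAt (EuclideanSpace ℝ (Fin n)) (fun x : X => TangentSpace (𝓡 n) x) x₀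
  rw [τ.contMDiffAt_section_iff (IB := 𝓡 n) hx]
  refine contMDiffAt_const (c := v) |>.congr_of_eventuallyEq ?_
  filter_upwards [τ.open_baseSet.mem_nhds hx] with y hy
  rw [constSection_eq_symm hy]
  exact congrArg Prod.snd (τ.apply_mk_symm hy v)

lemma constSection_add (x₀ : X) (v w : EuclideanSpace ℝ (Fin n)) :
    constSection x₀ (v + w) = constSection x₀ v + constSection x₀ w := by
  funext x
  exact map_add ((trivializationAt (EuclideanSpace ℝ (Fin n))
    (fun x : X => TangentSpace (𝓡 n) x) x₀).symmₗ ℝ x) v w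

lemma constSection_smul (x₀ : X) (c : ℝ) (w : EuclideanSpace ℝ (Fin n)) :
    constSection x₀ (c • w) = c • constSection x₀ w := by
  funext x
  exact map_smul ((trivializationAt (EuclideanSpace ℝ (Fin n))
    (fun x : X => TangentSpace (𝓡 n) x) x₀).symmₗ ℝ x) c w

lemma mdifferentiableAt_constSection (x₀ : X) (v : EuclideanSpace ℝ (Fin n)) {x : X}
    (hx : x ∈ (trivializationAt (EuclideanSpace ℝ (Fin n))
      (fun x : X => TangentSpace (𝓡 n) x) x₀).baseSet) :
    MDifferentiableAt (𝓡 n) ((𝓡 n).prod 𝓘(ℝ, EuclideanSpace ℝ (Fin n)))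
      (fun x => (⟨x, constSection x₀ v x⟩ : TangentBundle (𝓡 n) X)) x :=
  (contMDiffAt_constSection x₀ v hx).mdifferentiableAt (by simp)

/-- A covariant derivative depends only on the germ of a section, so the section in the definition
of `dirac` may be exchanged for `constSection`. -/
lemma dirac_eq_coord (s : FieldAlong (n := n) φ) :
    dirac cov φ s t = constSection (φ t) (deriv (coordAlong φ s t) t) (φ t) +
      cov (constSection (φ t) (coordAlong φ s t t)) (φ t)
        (mfderiv 𝓘(ℝ, ℝ) (𝓡 n) φ t (1 : ℝ)) := by
  have h1 := mdifferentiableAt_constSection (φ t) (coordAlong φ s t t) (mem_trivAlong (n := n))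
  have h2 : ∀ᶠ x in 𝓝 (φ t), constSection (φ t) (coordAlong φ s t t) x =
      (trivAlong (n := n) φ t).symm x (coordAlong φ s t t) := by
    filter_upwards [(trivAlong (n := n) φ t).open_baseSet.mem_nhds mem_trivAlong] with x hx
    exact constSection_eq_symm hx _
  rw [cov.isCovariantDerivativeOnUniv.congr_of_eventuallyEq h1
    (h1.congr_of_eventuallyEq (h2.mono fun x hx => by beta_reduce; rw [hx])) Filter.univ_mem h2,
    constSection_eq_symm mem_trivAlong]
  rfl

lemma cov_constSection_add {x₀ x : X} (hx : x ∈ (trivializationAt (EuclideanSpace ℝ (Fin n))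
      (fun x : X => TangentSpace (𝓡 n) x) x₀).baseSet) (v w : EuclideanSpace ℝ (Fin n)) :
    cov (constSection x₀ (v + w)) x = cov (constSection x₀ v) x + cov (constSection x₀ w) x := by
  rw [constSection_add]
  exact cov.isCovariantDerivativeOnUniv.add (mdifferentiableAt_constSection x₀ v hx)
    (mdifferentiableAt_constSection x₀ w hx)

lemma cov_constSection_smul {x₀ x : X} (hx : x ∈ (trivializationAt (EuclideanSpace ℝ (Fin n))
      (fun x : X => TangentSpace (𝓡 n) x) x₀).baseSet) (c : ℝ) (w : EuclideanSpace ℝ (Fin n)) :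
    cov (constSection x₀ (c • w)) x = c • cov (constSection x₀ w) x := by
  rw [constSection_smul]
  exact cov.isCovariantDerivativeOnUniv.smul_const c (mdifferentiableAt_constSection x₀ w hx)

lemma dirac_congr {s s' : FieldAlong (n := n) φ} (h : ∀ᶠ r in 𝓝 t, s' r = s r) :
    dirac cov φ s' t = dirac cov φ s t := by
  have h1 : coordAlong φ s' t =ᶠ[𝓝 t] coordAlong φ s t := by
    filter_upwards [h] with r hr
    unfold coordAlong
    rw [hr]
  rw [dirac_eq_coord, dirac_eq_coord, h1.deriv_eq, h1.eq_of_nhds]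

lemma dirac_add {s s' : FieldAlong (n := n) φ} (h : SmoothAlongAt φ s t)
    (h' : SmoothAlongAt φ s' t) :
    dirac cov φ (s + s') t = dirac cov φ s t + dirac cov φ s' t := by
  have hb := h.base.continuousAt
  rw [smoothAlongAt_iff] at h h'
  have h1 : coordAlong φ (s + s') t =ᶠ[𝓝 t] coordAlong φ s t + coordAlong φ s' t := by
    filter_upwards [eventually_mem_trivAlong (n := n) hb] with r hr
    exact coordAlong_add hr
  rw [dirac_eq_coord, dirac_eq_coord, dirac_eq_coord, h1.deriv_eq, h1.eq_of_nhds,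
    deriv_add (h.2.differentiableAt (by simp)) (h'.2.differentiableAt (by simp)), Pi.add_apply,
    cov_constSection_add cov mem_trivAlong, constSection_add]
  simp only [Pi.add_apply, add_apply]
  abel

lemma dirac_smul {s : FieldAlong (n := n) φ} {c : ℝ → ℝ} (h : SmoothAlongAt φ s t)
    (hc : DifferentiableAt ℝ c t) :
    dirac cov φ (fun r => c r • s r) t = deriv c t • s t + c t • dirac cov φ s t := by
  have hb := h.base.continuousAt
  rw [smoothAlongAt_iff] at h
  have h1 : coordAlong φ (fun r => c r • s r) t =ᶠ[𝓝 t] fun r => c r • coordAlong φ s t r := by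
    filter_upwards [eventually_mem_trivAlong (n := n) hb] with r hr
    exact coordAlong_smul hr
  have h2 : constSection (φ t) (coordAlong φ s t t) (φ t) = s t :=
    (constSection_eq_symm mem_trivAlong _).trans <| (trivAlong (n := n) φ t).symm_apply_apply_mk mem_trivAlong (s t)
  rw [dirac_eq_coord, dirac_eq_coord, h1.deriv_eq, h1.eq_of_nhds,
    deriv_fun_smul hc (h.2.differentiableAt (by simp)), 
    cov_constSection_smul cov mem_trivAlong, constSection_add, constSection_smul, constSection_smul]
  simp only [Pi.add_apply, Pi.smul_apply, smul_apply, h2, smul_add]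
  abel

lemma dirac_zero (hφ : ContinuousAt φ t) : dirac cov φ (0 : FieldAlong (n := n) φ) t = 0 := by
  have h1 : coordAlong φ (0 : FieldAlong (n := n) φ) t =ᶠ[𝓝 t] fun r => 0 := by
    filter_upwards [eventually_mem_trivAlong (n := n) hφ] with r hr
    rw [coordAlong_eq hr]
    exact map_zero _
  have h3 : constSection (X := X) (φ t) (0 : EuclideanSpace ℝ (Fin n)) = 0 := by
    simpa using constSection_smul (X := X) (φ t) 0 (0 : EuclideanSpace ℝ (Fin n))
  rw [dirac_eq_coord, h1.deriv_eq, h1.eq_of_nhds, deriv_const, h3,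
    CovariantDerivative.zero]
  simp

lemma dirac_sum_smul {ι : Type*} {u : Finset ι} {s : ι → FieldAlong (n := n) φ}
    {c : ι → ℝ → ℝ} (hφ : ContMDiffAt 𝓘(ℝ, ℝ) (𝓡 n) ∞ φ t)
    (h : ∀ i ∈ u, SmoothAlongAt φ (s i) t) (hc : ∀ i ∈ u, ContDiffAt ℝ ∞ (c i) t) :
    dirac cov φ (fun r => ∑ i ∈ u, c i r • s i r) t =
      ∑ i ∈ u, (deriv (c i) t • s i t + c i t • dirac cov φ (s i) t) := by
  classical
  induction u using Finset.induction_on with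
  | empty => simpa using! dirac_zero cov hφ.continuousAt
  | insert a u ha ih =>
    have h1 := smoothAlongAt_sum hφ (fun i hi => h i (Finset.mem_insert_of_mem hi))
      (fun i hi => hc i (Finset.mem_insert_of_mem hi))
    have h2 := (h a (Finset.mem_insert_self _ _)).smul (hc a (Finset.mem_insert_self _ _))
    have h3 : (fun r => ∑ i ∈ insert a u, c i r • s i r) =
        (fun r => c a r • s a r) + fun r => ∑ i ∈ u, c i r • s i r := by
      funext r
      rw [Finset.sum_insert ha]; rfl
    rw [h3, dirac_add cov h2 h1, Finset.sum_insert ha, dirac_smul cov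
      (h a (Finset.mem_insert_self _ _))
      ((hc a (Finset.mem_insert_self _ _)).differentiableAt (by simp)),
      ih (fun i hi => h i (Finset.mem_insert_of_mem hi))
      (fun i hi => hc i (Finset.mem_insert_of_mem hi))]

lemma cov_sum_smul {ι : Type*} (u : Finset ι) {x : X} (σ : ι → (x : X) → TangentSpace (𝓡 n) x)
    (g : ι → X → ℝ) (hσ : ∀ i ∈ u, MDifferentiableAt (𝓡 n)
      ((𝓡 n).prod 𝓘(ℝ, EuclideanSpace ℝ (Fin n)))
      (fun x => (⟨x, σ i x⟩ : TangentBundle (𝓡 n) X)) x)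
    (hg : ∀ i ∈ u, MDifferentiableAt (𝓡 n) 𝓘(ℝ, ℝ) (g i) x) (v : TangentSpace (𝓡 n) x) :
    cov (∑ i ∈ u, g i • σ i) x v =
      ∑ i ∈ u, (g i x • cov (σ i) x v + mvfderiv (𝓡 n) (g i) x v • σ i x) := by
  classical
  induction u using Finset.induction_on with
  | empty => simp
  | insert a u ha ih =>
    have ha' := Finset.mem_insert_self a u
    have h1 : MDifferentiableAt (𝓡 n) ((𝓡 n).prod 𝓘(ℝ, EuclideanSpace ℝ (Fin n)))
      (fun x => (⟨x, (∑ i ∈ u, g i • σ i) x⟩ : TangentBundle (𝓡 n) X)) x := by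
      have := MDifferentiableAt.sum_section (I := 𝓡 n) (x₀ := x) (s := u) (t := fun i => g i • σ i)
        (fun i hi => (hg i (Finset.mem_insert_of_mem hi)).smul_section
          (hσ i (Finset.mem_insert_of_mem hi)))
      simpa only [Finset.sum_apply] using! this
    have h2 := (hg a ha').smul_section (hσ a ha')
    rw [Finset.sum_insert ha, Finset.sum_insert ha,
      cov.isCovariantDerivativeOnUniv.add h2 h1, 
      cov.isCovariantDerivativeOnUniv.leibniz (hσ a ha') (hg a ha'), add_apply,
      ih (fun i hi => hσ i (Finset.mem_insert_of_mem hi))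
        (fun i hi => hg i (Finset.mem_insert_of_mem hi))]
    rfl

/-- The Dirac operator on the restriction of a section to the curve. -/
lemma dirac_section {σ : (x : X) → TangentSpace (𝓡 n) x}
    (hφ : ContMDiffAt 𝓘(ℝ, ℝ) (𝓡 n) ∞ φ t)
    (hσ : ContMDiffAt (𝓡 n) ((𝓡 n).prod 𝓘(ℝ, EuclideanSpace ℝ (Fin n))) ∞
      (fun x => (⟨x, σ x⟩ : TangentBundle (𝓡 n) X)) (φ t)) :
    dirac cov φ (fun r => σ (φ r)) t =
      cov σ (φ t) (mfderiv 𝓘(ℝ, ℝ) (𝓡 n) φ t (1 : ℝ)) := by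
  set τ := trivAlong (n := n) φ t with hτ
  set G : X → EuclideanSpace ℝ (Fin n) := fun x => (τ (⟨x, σ x⟩ : TangentBundle (𝓡 n) X)).2
  have hx : φ t ∈ τ.baseSet := mem_trivAlong
  have hG : ContMDiffAt (𝓡 n) 𝓘(ℝ, EuclideanSpace ℝ (Fin n)) ∞ G (φ t) :=
    (τ.contMDiffAt_section_iff (IB := 𝓡 n) hx).1 hσ
  have hGi : ∀ i, ContMDiffAt (𝓡 n) 𝓘(ℝ, ℝ) ∞ (fun x => G x i) (φ t) := fun i =>
    ((EuclideanSpace.proj i : EuclideanSpace ℝ (Fin n) →L[ℝ] ℝ).contMDiff.contMDiffAt).comp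
      (φ t) hG
  let ε : Fin n → EuclideanSpace ℝ (Fin n) := fun i => EuclideanSpace.single i 1
  have hsum : ∀ v : EuclideanSpace ℝ (Fin n), v = ∑ i, v i • ε i := fun v => by
    have := (EuclideanSpace.basisFun (Fin n) ℝ).sum_repr v
    simpa [ε] using this.symm
  have hcs : ∀ x v, constSection (φ t) v x =
      ∑ i, v i • constSection (φ t) (ε i) x := fun x v => by
    conv_lhs => rw [hsum v]
    have h := map_sum (τ.symmₗ ℝ x) (fun i => v i • ε i) Finset.univ
    simp only [map_smul] at h
    exact h
  -- Expand `σ` in the local frame. The Leibniz rule for `∇` then produces the differentials of the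
  -- coordinates `G`, and the chain rule identifies these, on the velocity, with the derivative of
  -- the coordinates along `φ`.
  have h1 : cov σ (φ t) = cov (∑ i, (fun x => G x i) • constSection (φ t) (ε i)) (φ t) := by
    refine cov.isCovariantDerivativeOnUniv.congr_of_eventuallyEq
      (hσ.mdifferentiableAt (by simp)) ?_ Filter.univ_mem ?_
    · have := MDifferentiableAt.sum_section (I := 𝓡 n) (x₀ := φ t) (s := Finset.univ)
        (t := fun i => (fun x => G x i) • constSection (φ t) (ε i))
        (fun i hi => ((hGi i).mdifferentiableAt (by simp)).smul_section
          (mdifferentiableAt_constSection _ _ hx))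
      simpa only [Finset.sum_apply] using! this
    · filter_upwards [τ.open_baseSet.mem_nhds hx] with x hx'
      rw [Finset.sum_apply]
      simp only [Pi.smul_apply']
      rw [← hcs]
      exact ((constSection_eq_symm hx' _).trans (τ.symm_apply_apply_mk hx' (σ x))).symm
  have h2 : deriv (coordAlong φ (fun r => σ (φ r)) t) t =
      mvfderiv (𝓡 n) G (φ t)
        (mfderiv 𝓘(ℝ, ℝ) (𝓡 n) φ t (1 : ℝ)) := by
    have h3 : coordAlong φ (fun r => σ (φ r)) t = G ∘ φ := rfl
    have h4 := mfderiv_comp t (hG.mdifferentiableAt (by simp)) (hφ.mdifferentiableAt (by simp))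
    rw [h3, ← fderiv_apply_one_eq_deriv, ← mfderiv_eq_fderiv, h4]
    rfl
  have h5 : ∀ i v, mvfderiv (𝓡 n) (fun x => G x i) (φ t) v =
      (mvfderiv (𝓡 n) G (φ t) v) i := by
    intro i v
    have h6 : HasMFDerivAt (𝓡 n) 𝓘(ℝ, ℝ) (fun x => G x i) (φ t) _ :=
      ((EuclideanSpace.proj i : EuclideanSpace ℝ (Fin n) →L[ℝ] ℝ).hasMFDerivAt
      (x := G (φ t))).comp (φ t) (hG.mdifferentiableAt (by simp)).hasMFDerivAt
    rw [mvfderiv, h6.mfderiv]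
    rfl
  have h7 : constSection (φ t) (G (φ t)) = ∑ i, G (φ t) i • constSection (φ t) (ε i) := by
    funext x
    rw [hcs, Finset.sum_apply]
    rfl
  rw [h1, cov_sum_smul cov _ _ _ (fun i _ => mdifferentiableAt_constSection _ _ hx)
    (fun i _ => (hGi i).mdifferentiableAt (by simp)), dirac_eq_coord, h2, hcs,
    Finset.sum_add_distrib, add_comm]
  congr 1
  · change cov (constSection (φ t) (G (φ t))) (φ t) _ = _
    -- The same sum rule with the coefficients frozen at `φ t`, whose differentials vanish.
    have h8 := cov_sum_smul cov Finset.univ (x := φ t) (fun i => constSection (φ t) (ε i))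
      (fun i _ => G (φ t) i) (fun i _ => mdifferentiableAt_constSection _ _ hx)
      (fun i _ => mdifferentiableAt_const) (mfderiv 𝓘(ℝ, ℝ) (𝓡 n) φ t (1 : ℝ))
    have h9 : (∑ i, (fun _ : X => G (φ t) i) • constSection (φ t) (ε i)) =
      constSection (φ t) (G (φ t)) := h7.symm
    rw [← h9, h8]
    refine Finset.sum_congr rfl fun i _ => ?_
    rw [mvfderiv, mfderiv_const]
    simp
  · exact Finset.sum_congr rfl fun i _ => by rw [h5]

end AlongCurve
end

/-! ### Compatibility with the metric along a curve. -/

noncomputable section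

section AlongCurve

variable {n : ℕ} {X : Type*} [TopologicalSpace X] [ChartedSpace (EuclideanSpace ℝ (Fin n)) X]
  [IsManifold (𝓡 n) ∞ X] {φ : ℝ → X} {t : ℝ}

lemma constSection_eq_sum (x₀ x : X) (v : EuclideanSpace ℝ (Fin n)) :
    constSection x₀ v x = ∑ i, v i • constSection x₀ (EuclideanSpace.single i (1 : ℝ)) x := by
  have hsum : v = ∑ i, v i • EuclideanSpace.single i (1 : ℝ) := by
    simpa using ((EuclideanSpace.basisFun (Fin n) ℝ).sum_repr v).symm
  conv_lhs => rw [hsum]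
  have h := map_sum ((trivializationAt (EuclideanSpace ℝ (Fin n))
    (fun x : X => TangentSpace (𝓡 n) x) x₀).symmₗ ℝ x)
    (fun i => v i • EuclideanSpace.single i (1 : ℝ)) Finset.univ
  simp only [map_smul] at h
  exact h

lemma eventually_eq_sum_constSection (hφ : ContinuousAt φ t) (s : FieldAlong (n := n) φ) :
    ∀ᶠ r in 𝓝 t, s r = ∑ i, coordAlong φ s t r i •
      constSection (φ t) (EuclideanSpace.single i (1 : ℝ)) (φ r) := by
  filter_upwards [eventually_mem_trivAlong (n := n) hφ] with r hr
  rw [← constSection_eq_sum]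
  exact ((constSection_eq_symm hr _).trans
    ((trivAlong (n := n) φ t).symm_apply_apply_mk hr (s r))).symm

lemma contDiffAt_coordAlong {s : FieldAlong (n := n) φ} (h : SmoothAlongAt φ s t) (i : Fin n) :
    ContDiffAt ℝ ∞ (fun r => coordAlong φ s t r i) t :=
  (EuclideanSpace.proj i : EuclideanSpace ℝ (Fin n) →L[ℝ] ℝ).contDiff.contDiffAt.comp t
    (smoothAlongAt_iff.1 h).2

section Metric

variable [Bundle.RiemannianBundle (fun x : X => TangentSpace (𝓡 n) x)]
  {cov : CovariantDerivative (𝓡 n) (EuclideanSpace ℝ (Fin n))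
      (fun x : X => TangentSpace (𝓡 n) x)}

/-- The Leibniz rule for the inner product of two fields along `φ`. -/
def InnerLeibniz (cov : CovariantDerivative (𝓡 n) (EuclideanSpace ℝ (Fin n))
      (fun x : X => TangentSpace (𝓡 n) x)) (s s' : FieldAlong (n := n) φ) (t : ℝ) : Prop :=
  HasDerivAt (fun r => inner ℝ (s r) (s' r))
    (inner ℝ (dirac cov φ s t) (s' t) + inner ℝ (s t) (dirac cov φ s' t)) t

lemma InnerLeibniz.symm {s s' : FieldAlong (n := n) φ} (h : InnerLeibniz cov s s' t) :
    InnerLeibniz cov s' s t := by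
  unfold InnerLeibniz at *
  convert h using 1
  · funext r
    exact real_inner_comm _ _
  · rw [add_comm, real_inner_comm, real_inner_comm (s t)]

lemma InnerLeibniz.sum_smul {ι : Type*} {u : Finset ι} {s : ι → FieldAlong (n := n) φ}
    {s' : FieldAlong (n := n) φ} {c : ι → ℝ → ℝ} (hφ : ContMDiffAt 𝓘(ℝ, ℝ) (𝓡 n) ∞ φ t)
    (hs : ∀ i ∈ u, SmoothAlongAt φ (s i) t) (hc : ∀ i ∈ u, ContDiffAt ℝ ∞ (c i) t)
    (h : ∀ i ∈ u, InnerLeibniz cov (s i) s' t) :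
    InnerLeibniz cov (fun r => ∑ i ∈ u, c i r • s i r) s' t := by
  unfold InnerLeibniz at *
  rw [dirac_sum_smul cov hφ hs hc]
  simp only [sum_inner, inner_add_left, real_inner_smul_left]
  rw [← Finset.sum_add_distrib]
  refine HasDerivAt.fun_sum fun i hi => ?_
  have := ((hc i hi).differentiableAt (by simp)).hasDerivAt.mul (h i hi)
  exact this.congr_deriv (by ring)

lemma InnerLeibniz.congr {s s₁ s' : FieldAlong (n := n) φ} (h : InnerLeibniz cov s s' t)
    (hs : ∀ᶠ r in 𝓝 t, s₁ r = s r) : InnerLeibniz cov s₁ s' t := by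
  unfold InnerLeibniz at *
  rw [dirac_congr cov hs, hs.self_of_nhds]
  refine h.congr_of_eventuallyEq ?_
  filter_upwards [hs] with r hr
  rw [hr]

variable [IsContMDiffRiemannianBundle (𝓡 n) ∞ (EuclideanSpace ℝ (Fin n))
      (fun x : X => TangentSpace (𝓡 n) x)]

lemma SmoothAlongAt.inner {s s' : FieldAlong (n := n) φ} (h : SmoothAlongAt φ s t)
    (h' : SmoothAlongAt φ s' t) : ContDiffAt ℝ ∞ (fun r => inner ℝ (s r) (s' r)) t := by
  rw [← contMDiffAt_iff_contDiffAt]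
  exact ContMDiffAt.inner_bundle (IB := 𝓡 n) (F := EuclideanSpace ℝ (Fin n)) h h'

set_option synthInstance.maxHeartbeats 400000 in
lemma innerLeibniz_section (hcov : IsSmoothMetricConnection cov)
    (hφ : ContMDiffAt 𝓘(ℝ, ℝ) (𝓡 n) ∞ φ t) {σ σ' : (x : X) → TangentSpace (𝓡 n) x}
    (hσ : ContMDiffAt (𝓡 n) ((𝓡 n).prod 𝓘(ℝ, EuclideanSpace ℝ (Fin n))) ∞
      (fun x => (⟨x, σ x⟩ : TangentBundle (𝓡 n) X)) (φ t))
    (hσ' : ContMDiffAt (𝓡 n) ((𝓡 n).prod 𝓘(ℝ, EuclideanSpace ℝ (Fin n))) ∞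
      (fun x => (⟨x, σ' x⟩ : TangentBundle (𝓡 n) X)) (φ t)) :
    InnerLeibniz cov (fun r => σ (φ r)) (fun r => σ' (φ r)) t := by
  unfold InnerLeibniz
  rw [dirac_section cov hφ hσ, dirac_section cov hφ hσ']
  set v : EuclideanSpace ℝ (Fin n) := mfderiv 𝓘(ℝ, ℝ) (𝓡 n) φ t (1 : ℝ) with hv
  have h1 := hcov.metric.mvfderiv_inner_eq (x := φ t) (fun _ => v) (hσ.mdifferentiableAt (by simp))
    (hσ'.mdifferentiableAt (by simp))
  have hd : ContMDiffAt (𝓡 n) 𝓘(ℝ, ℝ) ∞ (fun x => inner ℝ (σ x) (σ' x)) (φ t) :=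
    ContMDiffAt.inner_bundle (IB := 𝓡 n) (F := EuclideanSpace ℝ (Fin n)) hσ hσ'
  have h2 : HasMFDerivAt 𝓘(ℝ, ℝ) 𝓘(ℝ, ℝ) ((fun x => inner ℝ (σ x) (σ' x)) ∘ φ) t _ :=
    (hd.mdifferentiableAt (by simp)).hasMFDerivAt.comp t
      (hφ.mdifferentiableAt (by simp)).hasMFDerivAt
  have h3 : HasFDerivAt ((fun x => inner ℝ (σ x) (σ' x)) ∘ φ)
    ((mvfderiv (𝓡 n) (fun x => inner ℝ (σ x) (σ' x)) (φ t)).comp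
      (mfderiv 𝓘(ℝ, ℝ) (𝓡 n) φ t) : ℝ →L[ℝ] ℝ) t := h2.hasFDerivAt
  have h4 := h3.hasDerivAt
  have h5 : (((mvfderiv (𝓡 n) (fun x => inner ℝ (σ x) (σ' x)) (φ t)).comp
      (mfderiv 𝓘(ℝ, ℝ) (𝓡 n) φ t) : ℝ →L[ℝ] ℝ)) 1 =
    inner ℝ (cov σ (φ t) v) (σ' (φ t)) + inner ℝ (σ (φ t)) (cov σ' (φ t) v) := h1
  rw [h5] at h4
  exact h4

/-- In each argument the rule passes to combinations with smooth coefficients, and near `t` every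
field is such a combination of restrictions of local sections. For these it is the metric
compatibility of `∇`, evaluated on the velocity. -/
theorem innerLeibniz (hcov : IsSmoothMetricConnection cov) {s s' : FieldAlong (n := n) φ}
    (h : SmoothAlongAt φ s t) (h' : SmoothAlongAt φ s' t) : InnerLeibniz cov s s' t := by
  have hφ := h.base
  have hx := mem_trivAlong (n := n) (φ := φ) (t := t)
  have hc : ∀ i : Fin n, SmoothAlongAt φ
      (fun r => constSection (φ t) (EuclideanSpace.single i (1 : ℝ)) (φ r)) t := fun i =>
    SmoothAlongAt.of_section hφ (contMDiffAt_constSection _ _ hx)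
  refine InnerLeibniz.congr ?_ (eventually_eq_sum_constSection hφ.continuousAt s)
  refine InnerLeibniz.sum_smul hφ (fun i _ => hc i) (fun i _ => contDiffAt_coordAlong h i)
    fun i _ => InnerLeibniz.symm ?_
  refine InnerLeibniz.congr ?_ (eventually_eq_sum_constSection hφ.continuousAt s')
  refine InnerLeibniz.sum_smul hφ (fun i _ => hc i) (fun i _ => contDiffAt_coordAlong h' i)
    fun j _ => ?_
  exact innerLeibniz_section hcov hφ (contMDiffAt_constSection _ _ hx)
    (contMDiffAt_constSection _ _ hx)

end Metric

/-- Cut off by a bump function with support in the domain of the trivialization. Global sections are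
wanted because `smoothAlongAt_cov` applies the smoothness of `∇` to sections that are smooth
everywhere. -/
lemma exists_smooth_section_eq_constSection [T2Space X] (x₀ : X) (v : EuclideanSpace ℝ (Fin n)) :
    ∃ σ : (x : X) → TangentSpace (𝓡 n) x,
      ContMDiff (𝓡 n) ((𝓡 n).prod 𝓘(ℝ, EuclideanSpace ℝ (Fin n))) ∞
        (fun x => (⟨x, σ x⟩ : TangentBundle (𝓡 n) X)) ∧
      ∀ᶠ x in 𝓝 x₀, σ x = constSection x₀ v x := by
  set τ := trivializationAt (EuclideanSpace ℝ (Fin n)) (fun x : X => TangentSpace (𝓡 n) x) x₀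
  have hx : x₀ ∈ τ.baseSet := FiberBundle.mem_baseSet_trivializationAt' x₀
  obtain ⟨f, -, hf⟩ := (SmoothBumpFunction.nhds_basis_tsupport (I := 𝓡 n) x₀).mem_iff.1
    (τ.open_baseSet.mem_nhds hx)
  refine ⟨fun x => f x • constSection x₀ v x, fun x => ?_, ?_⟩
  · by_cases h : x ∈ τ.baseSet
    · exact (f.contMDiff x).smul_section (contMDiffAt_constSection x₀ v h)
    · have h1 : (tsupport f)ᶜ ∈ 𝓝 x :=
        (isClosed_tsupport f).isOpen_compl.mem_nhds fun h2 => h (hf h2)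
      have h3 : ContMDiffAt (𝓡 n) ((𝓡 n).prod 𝓘(ℝ, EuclideanSpace ℝ (Fin n))) ∞
          (fun x => (⟨x, (0 : (x : X) → TangentSpace (𝓡 n) x) x⟩ : TangentBundle (𝓡 n) X)) x :=
        (Bundle.contMDiff_zeroSection ℝ (fun x : X => TangentSpace (𝓡 n) x)).contMDiffAt
      refine h3.congr_of_eventuallyEq ?_
      filter_upwards [h1] with y hy
      rw [image_eq_zero_of_notMem_tsupport hy, zero_smul]
      rfl
  · filter_upwards [f.eventuallyEq_one] with x hx
    rw [hx, Pi.one_apply, one_smul]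

lemma smoothAlongAt_velocity (hφ : ContMDiff 𝓘(ℝ, ℝ) (𝓡 n) ∞ φ) :
    SmoothAlongAt φ (fun r => mfderiv 𝓘(ℝ, ℝ) (𝓡 n) φ r (1 : ℝ)) t := by
  have h1 : ContMDiff (𝓘(ℝ, ℝ).prod 𝓘(ℝ, ℝ)) ((𝓡 n).prod 𝓘(ℝ, EuclideanSpace ℝ (Fin n))) ∞
      (tangentMap 𝓘(ℝ, ℝ) (𝓡 n) φ) := hφ.contMDiff_tangentMap (by simp)
  have h2 : ContMDiff 𝓘(ℝ, ℝ) (𝓘(ℝ, ℝ).prod 𝓘(ℝ, ℝ)) ∞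
      (fun r : ℝ => (⟨r, (1 : ℝ)⟩ : TangentBundle 𝓘(ℝ, ℝ) ℝ)) := by
    intro r
    rw [Bundle.contMDiffAt_totalSpace]
    refine ⟨contMDiffAt_id, ?_⟩
    simpa using! contMDiffAt_const
  exact (h1.comp h2) t

lemma smoothAlongAt_cov [Bundle.RiemannianBundle (fun x : X => TangentSpace (𝓡 n) x)]
  [IsContMDiffRiemannianBundle (𝓡 n) ∞ (EuclideanSpace ℝ (Fin n))
      (fun x : X => TangentSpace (𝓡 n) x)]
  {cov : CovariantDerivative (𝓡 n) (EuclideanSpace ℝ (Fin n))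
      (fun x : X => TangentSpace (𝓡 n) x)} (hcov : IsSmoothMetricConnection cov)
    (hφ : ContMDiff 𝓘(ℝ, ℝ) (𝓡 n) ∞ φ) {σ : (x : X) → TangentSpace (𝓡 n) x}
    (hσ : ContMDiff (𝓡 n) ((𝓡 n).prod 𝓘(ℝ, EuclideanSpace ℝ (Fin n))) ∞
        (fun x => (⟨x, σ x⟩ : TangentBundle (𝓡 n) X))) :
    SmoothAlongAt φ (fun r => cov σ (φ r) (mfderiv 𝓘(ℝ, ℝ) (𝓡 n) φ r (1 : ℝ))) t := by
  have h1 := hcov.smooth.contMDiff.contMDiff (σ := σ) (by rw [contMDiffOn_univ]; exact hσ)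
  rw [contMDiffOn_univ] at h1
  exact ContMDiffAt.clm_bundle_apply (IB := 𝓡 n) (F₁ := EuclideanSpace ℝ (Fin n))
    (F₂ := EuclideanSpace ℝ (Fin n)) ((h1.comp hφ) t) (smoothAlongAt_velocity hφ)

end AlongCurve
end

/-! ### Local parallel transport as a linear differential equation. -/

noncomputable section

/-- The existence theorem for autonomous vector fields is applied to the system in which time is an
additional unknown with derivative 1. -/
lemma exists_fundamental_matrix {n : ℕ} (Γ : ℝ → Fin n → Fin n → ℝ) (t₀ : ℝ)
    (hΓ : ∀ᶠ t in 𝓝 t₀, ∀ i j, ContDiffAt ℝ ∞ (fun r => Γ r i j) t) :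
    ∃ U : ℝ → Fin n → Fin n → ℝ, (∀ i k, U t₀ i k = if i = k then 1 else 0) ∧
      ∀ᶠ t in 𝓝 t₀, ∀ i k, ContDiffAt ℝ ∞ (fun r => U r i k) t ∧
        deriv (fun r => U r i k) t = -∑ j, Γ t i j * U t j k := by
  let F : ℝ × (Fin n → Fin n → ℝ) → ℝ × (Fin n → Fin n → ℝ) :=
    fun p => (1, fun i k => -∑ j, Γ p.1 i j * p.2 j k)
  let u₀ : Fin n → Fin n → ℝ := fun i k => if i = k then 1 else 0
  have hF : ContDiffAt ℝ 1 F (t₀, u₀) := by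
    refine contDiffAt_const.prodMk ?_
    rw [contDiffAt_pi]
    intro i
    rw [contDiffAt_pi]
    intro k
    refine ContDiffAt.neg (ContDiffAt.sum fun j _ => ContDiffAt.mul ?_ ?_)
    · exact ((hΓ.self_of_nhds i j).of_le (show (1 : WithTop ℕ∞) ≤ ∞ by exact_mod_cast le_top)).comp (t₀, u₀) contDiffAt_fst
    · exact (contDiff_apply_apply ℝ ℝ j k).contDiffAt.comp (t₀, u₀) contDiffAt_snd
  obtain ⟨α, hα0, ε, hε, hα⟩ :=
    ContDiffAt.exists_forall_mem_closedBall_exists_eq_forall_mem_Ioo_hasDerivAt₀ hF t₀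
  -- The additional unknown is indeed the time.
  have h1 : ∀ t ∈ Set.Ioo (t₀ - ε) (t₀ + ε), (α t).1 = t := by
    have hd : ∀ t ∈ Set.Ioo (t₀ - ε) (t₀ + ε),
        HasDerivAt (fun t => (α t).1 - t) 0 t := fun t ht => by
      have h := (ContinuousLinearMap.fst ℝ ℝ (Fin n → Fin n → ℝ)).hasFDerivAt.comp_hasDerivAt t
        (hα t ht)
      exact (h.sub (hasDerivAt_id t)).congr_deriv (by simp [F])
    intro t ht
    have h2 : (α t).1 - t = (α t₀).1 - t₀ := by
      refine isOpen_Ioo.is_const_of_deriv_eq_zero isPreconnected_Ioo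
        (fun x hx => (hd x hx).differentiableAt.differentiableWithinAt)
        (fun x hx => (hd x hx).deriv) ht ⟨by linarith, by linarith⟩
    rw [hα0] at h2
    simp at h2
    linarith
  obtain ⟨δ, hδ, hΓδ⟩ := Metric.eventually_nhds_iff_ball.1 hΓ
  let η := min ε δ
  have hη : 0 < η := lt_min hε hδ
  have hsub : Set.Ioo (t₀ - η) (t₀ + η) ⊆ Set.Ioo (t₀ - ε) (t₀ + ε) :=
    Set.Ioo_subset_Ioo (by linarith [min_le_left ε δ]) (by linarith [min_le_left ε δ])
  have hder : ∀ t ∈ Set.Ioo (t₀ - η) (t₀ + η), ∀ i k,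
      HasDerivAt (fun r => (α r).2 i k) (-∑ j, Γ t i j * (α t).2 j k) t := by
    intro t ht i k
    have h2 := (ContinuousLinearMap.snd ℝ ℝ (Fin n → Fin n → ℝ)).hasFDerivAt.comp_hasDerivAt t
      (hα t (hsub ht))
    rw [hasDerivAt_pi] at h2
    have h3 := h2 i
    rw [hasDerivAt_pi] at h3
    have h4 := h3 k
    exact h4.congr_deriv (by simp [F, h1 t (hsub ht)])
  -- Bootstrap: the equation expresses the derivative through the solution, so each degree of
  -- differentiability gives the next.
  have hsmooth : ∀ m : ℕ, ∀ i k, ContDiffOn ℝ m (fun r => (α r).2 i k)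
      (Set.Ioo (t₀ - η) (t₀ + η)) := by
    intro m
    induction m with
    | zero =>
      intro i k
      rw [Nat.cast_zero, contDiffOn_zero]
      exact fun t ht => (hder t ht i k).continuousAt.continuousWithinAt
    | succ m ih =>
      intro i k
      rw [Nat.cast_succ, contDiffOn_succ_iff_deriv_of_isOpen isOpen_Ioo]
      refine ⟨fun t ht => (hder t ht i k).differentiableAt.differentiableWithinAt, by simp, ?_⟩
      refine ContDiffOn.congr (f := fun t => -∑ j, Γ t i j * (α t).2 j k) ?_
        fun t ht => (hder t ht i k).deriv
      refine ContDiffOn.neg (ContDiffOn.sum fun j _ => ContDiffOn.mul ?_ (ih j k))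
      intro t ht
      refine ((hΓδ t ?_ i j).of_le (by exact_mod_cast le_top)).contDiffWithinAt
      rw [Real.ball_eq_Ioo]
      exact Set.Ioo_subset_Ioo (by linarith [min_le_right ε δ]) (by linarith [min_le_right ε δ]) ht
  refine ⟨fun r => (α r).2, fun i k => by simp only [hα0]; rfl, ?_⟩
  filter_upwards [Ioo_mem_nhds (show t₀ - η < t₀ by linarith) (show t₀ < t₀ + η by linarith)]
    with t ht i k
  exact ⟨(contDiffOn_infty.2 fun m => hsmooth m i k).contDiffAt (isOpen_Ioo.mem_nhds ht),
    (hder t ht i k).deriv⟩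

section AlongCurve

variable {n : ℕ} {X : Type*} [TopologicalSpace X] [ChartedSpace (EuclideanSpace ℝ (Fin n)) X]
  [IsManifold (𝓡 n) ∞ X] {φ : ℝ → X} {t : ℝ}

/-- `s` is smooth and parallel along `φ` on `I`. -/
def IsParallelOn (cov : CovariantDerivative (𝓡 n) (EuclideanSpace ℝ (Fin n))
      (fun x : X => TangentSpace (𝓡 n) x)) (s : FieldAlong (n := n) φ) (I : Set ℝ) : Prop :=
  ∀ t ∈ I, SmoothAlongAt φ s t ∧ dirac cov φ s t = 0

/-- `SmoothAlongAt` at `r` refers to the trivialization around `φ r`, but the coefficients of the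
differential equation are coordinates in the single trivialization around `φ t`. -/
lemma eventually_contDiffAt_coord {s : FieldAlong (n := n) φ}
    (hφ : ContMDiff 𝓘(ℝ, ℝ) (𝓡 n) ∞ φ) (h : ∀ r, SmoothAlongAt φ s r) :
    ∀ᶠ r in 𝓝 t, ∀ i, ContDiffAt ℝ ∞ (fun r => coordAlong φ s t r i) r := by
  filter_upwards [eventually_mem_trivAlong (n := n) (hφ t).continuousAt] with r hr i
  have h1 := (Bundle.Trivialization.contMDiffAt_iff (e := trivAlong (n := n) φ t)
    (f := fun r => (⟨φ r, s r⟩ : TangentBundle (𝓡 n) X)) (IB := 𝓡 n) (n := ∞)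
    (IM := 𝓘(ℝ, ℝ)) (x₀ := r) ((trivAlong (n := n) φ t).mem_source.2 hr)).1 (h r)
  exact (EuclideanSpace.proj i : EuclideanSpace ℝ (Fin n) →L[ℝ] ℝ).contDiff.contDiffAt.comp r
    h1.2.contDiffAt

variable [T2Space X] [Bundle.RiemannianBundle (fun x : X => TangentSpace (𝓡 n) x)]
  [IsContMDiffRiemannianBundle (𝓡 n) ∞ (EuclideanSpace ℝ (Fin n))
      (fun x : X => TangentSpace (𝓡 n) x)]
  {cov : CovariantDerivative (𝓡 n) (EuclideanSpace ℝ (Fin n))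
      (fun x : X => TangentSpace (𝓡 n) x)}

lemma IsParallelOn.sum_smul {ι : Type*} {u : Finset ι} {s : ι → FieldAlong (n := n) φ} {I : Set ℝ}
    (hφ : ContMDiff 𝓘(ℝ, ℝ) (𝓡 n) ∞ φ) (c : ι → ℝ) (h : ∀ i ∈ u, IsParallelOn cov (s i) I) :
    IsParallelOn cov (fun r => ∑ i ∈ u, c i • s i r) I := fun t ht => by
  refine ⟨smoothAlongAt_sum (hφ t) (fun i hi => (h i hi t ht).1) fun i hi => contDiffAt_const, ?_⟩
  rw [dirac_sum_smul cov (c := fun i _ => c i) (hφ t) (fun i hi => (h i hi t ht).1)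
    fun i hi => contDiffAt_const]
  refine Finset.sum_eq_zero fun i hi => ?_
  rw [(h i hi t ht).2, deriv_const]
  simp

lemma IsParallelOn.congr {s s' : FieldAlong (n := n) φ} {I : Set ℝ} (hI : IsOpen I)
    (h : IsParallelOn cov s I) (hs : ∀ t ∈ I, s' t = s t) : IsParallelOn cov s' I := fun t ht => by
  have h1 : ∀ᶠ r in 𝓝 t, s' r = s r := Filter.mem_of_superset (hI.mem_nhds ht) hs
  exact ⟨(h t ht).1.congr h1, by rw [dirac_congr cov h1, (h t ht).2]⟩

lemma IsParallelOn.inner_eq (hcov : IsSmoothMetricConnection cov) {s s' : FieldAlong (n := n) φ}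
    {I : Set ℝ} (hI : IsOpen I) (hI' : IsPreconnected I) (h : IsParallelOn cov s I)
    (h' : IsParallelOn cov s' I) {a b : ℝ} (ha : a ∈ I) (hb : b ∈ I) :
    inner ℝ (s a) (s' a) = inner ℝ (s b) (s' b) := by
  have hd : ∀ t ∈ I, HasDerivAt (fun r => inner ℝ (s r) (s' r)) 0 t := fun t ht => by
    have h1 : HasDerivAt _ _ _ := innerLeibniz hcov (h t ht).1 (h' t ht).1
    rw [(h t ht).2, (h' t ht).2, inner_zero_left, inner_zero_right, add_zero] at h1
    exact h1
  exact hI.is_const_of_deriv_eq_zero hI'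
    (fun x hx => (hd x hx).differentiableAt.differentiableWithinAt)
    (fun x hx => (hd x hx).deriv) ha hb

/-- The difference of the fields is parallel, so its norm is constant. The metric thus replaces a
uniqueness theorem for the differential equation. -/
lemma IsParallelOn.eq_of_eq (hcov : IsSmoothMetricConnection cov)
    (hφ : ContMDiff 𝓘(ℝ, ℝ) (𝓡 n) ∞ φ) {s s' : FieldAlong (n := n) φ}
    {I : Set ℝ} (hI : IsOpen I) (hI' : IsPreconnected I) (h : IsParallelOn cov s I)
    (h' : IsParallelOn cov s' I) {a b : ℝ} (ha : a ∈ I) (hb : b ∈ I) (hab : s a = s' a) :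
    s b = s' b := by
  have h1 : IsParallelOn cov (fun r => s r - s' r) I := by
    have := IsParallelOn.sum_smul (cov := cov) (u := Finset.univ) (s := ![s, s']) (I := I) hφ
      ![1, -1] (by intro i _; fin_cases i <;> assumption)
    simpa [Fin.sum_univ_two, sub_eq_add_neg] using! this
  have h2 := h1.inner_eq hcov hI hI' h1 ha hb
  rw [hab, sub_self, inner_zero_left] at h2
  exact sub_eq_zero.1 (inner_self_eq_zero.1 h2.symm)

/-- If `∇_ξ σ_j = ∑ i, Γ_ij σ_i` along `φ`, then `∑ i, U_ik σ_i` is parallel as soon as `U' = -Γ U`.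
The equation is linear, so one interval serves for all initial vectors. -/
lemma exists_local_parallel (hcov : IsSmoothMetricConnection cov)
    (hφ : ContMDiff 𝓘(ℝ, ℝ) (𝓡 n) ∞ φ) (t₀ : ℝ) :
    ∃ ε > 0, ∀ v : TangentSpace (𝓡 n) (φ t₀), ∃ s : FieldAlong (n := n) φ, s t₀ = v ∧
      IsParallelOn cov s (Set.Ioo (t₀ - ε) (t₀ + ε)) := by
  choose σ hσ hσ' using fun i : Fin n => exists_smooth_section_eq_constSection (n := n) (φ t₀)
    (EuclideanSpace.single i (1 : ℝ))
  let d : Fin n → FieldAlong (n := n) φ :=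
    fun i r => cov (σ i) (φ r) (mfderiv 𝓘(ℝ, ℝ) (𝓡 n) φ r (1 : ℝ))
  have hd : ∀ i t, SmoothAlongAt φ (d i) t := fun i t => smoothAlongAt_cov hcov hφ (hσ i)
  obtain ⟨U, hU0, hU⟩ := exists_fundamental_matrix
    (fun r i j => coordAlong φ (d j) t₀ r i) t₀ (by
      have := fun j => eventually_contDiffAt_coord (t := t₀) hφ (hd j)
      filter_upwards [Filter.eventually_all.2 this] with r hr i j using hr j i)
  have hσφ : ∀ᶠ r in 𝓝 t₀, ∀ i,
      σ i (φ r) = constSection (φ t₀) (EuclideanSpace.single i (1 : ℝ)) (φ r) :=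
    Filter.eventually_all.2 fun i => (hφ t₀).continuousAt.eventually (hσ' i)
  have hdσ : ∀ᶠ r in 𝓝 t₀, ∀ j, d j r = ∑ i, coordAlong φ (d j) t₀ r i • σ i (φ r) := by
    have := fun j => eventually_eq_sum_constSection (hφ t₀).continuousAt (d j)
    filter_upwards [Filter.eventually_all.2 this, hσφ] with r hr hr' j
    rw [hr j]
    exact Finset.sum_congr rfl fun i _ => by rw [hr' i]
  obtain ⟨ε, hε, hε'⟩ := Metric.eventually_nhds_iff_ball.1 (hU.and hdσ)
  rw [Real.ball_eq_Ioo] at hε'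
  have hpar : ∀ k, IsParallelOn cov (fun r => ∑ i, U r i k • σ i (φ r))
      (Set.Ioo (t₀ - ε) (t₀ + ε)) := by
    intro k t ht
    have h1 : ∀ i, SmoothAlongAt φ (fun r => σ i (φ r)) t :=
      fun i => SmoothAlongAt.of_section (hφ t) (hσ i _)
    refine ⟨smoothAlongAt_sum (s := fun i r => σ i (φ r)) (c := fun i r => U r i k) (hφ t)
      (fun i _ => h1 i) (fun i _ => ((hε' t ht).1 i k).1), ?_⟩
    rw [dirac_sum_smul cov (s := fun i r => σ i (φ r)) (c := fun i r => U r i k) (hφ t)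
      (fun i _ => h1 i) (fun i _ => ((hε' t ht).1 i k).1)]
    have h2 : ∀ i, dirac cov φ (fun r => σ i (φ r)) t = d i t :=
      fun i => dirac_section cov (hφ t) (hσ i _)
    simp only [h2, ((hε' t ht).1 _ k).2, Finset.sum_add_distrib]
    have h3 : ∀ i, U t i k • d i t =
        ∑ j, (coordAlong φ (d i) t₀ t j * U t i k) • σ j (φ t) := fun i => by
      rw [(hε' t ht).2 i, Finset.smul_sum]
      exact Finset.sum_congr rfl fun j _ => by rw [smul_smul, mul_comm]
    simp only [h3, neg_smul, Finset.sum_neg_distrib, Finset.sum_smul]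
    rw [Finset.sum_comm, neg_add_cancel]
  refine ⟨ε, hε, fun v => ⟨fun r => ∑ k, coordAlong φ (fun r => (v : EuclideanSpace ℝ (Fin n)))
    t₀ t₀ k • ∑ i, U r i k • σ i (φ r), ?_, IsParallelOn.sum_smul
      (s := fun k r => ∑ i, U r i k • σ i (φ r)) hφ _ fun k _ => hpar k⟩⟩
  have h4 := (eventually_eq_sum_constSection (hφ t₀).continuousAt
    (fun r => (v : EuclideanSpace ℝ (Fin n)))).self_of_nhds
  have h5 : ∀ k, ∑ i, U t₀ i k • σ i (φ t₀) = σ k (φ t₀) := fun k => by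
    simp [hU0]
  simp only [h5]
  simp only [hσφ.self_of_nhds]
  exact h4.symm

end AlongCurve
end

/-! ### Parallel transport along the whole curve. -/

noncomputable section

section AlongCurve

variable {n : ℕ} {X : Type*} [TopologicalSpace X] [ChartedSpace (EuclideanSpace ℝ (Fin n)) X]
  [IsManifold (𝓡 n) ∞ X] {φ : ℝ → X} {t : ℝ}
  [T2Space X] [Bundle.RiemannianBundle (fun x : X => TangentSpace (𝓡 n) x)]
  [IsContMDiffRiemannianBundle (𝓡 n) ∞ (EuclideanSpace ℝ (Fin n))
      (fun x : X => TangentSpace (𝓡 n) x)]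
  {cov : CovariantDerivative (𝓡 n) (EuclideanSpace ℝ (Fin n))
      (fun x : X => TangentSpace (𝓡 n) x)}

instance (x : X) : FiniteDimensional ℝ (TangentSpace (𝓡 n) x) :=
  inferInstanceAs (FiniteDimensional ℝ (EuclideanSpace ℝ (Fin n)))

lemma finrank_tangentSpace (x : X) : Module.finrank ℝ (TangentSpace (𝓡 n) x) = n :=
  finrank_euclideanSpace_fin

/-- A family that is orthonormal at a point expands every tangent vector. -/
lemma sum_inner_smul_of_orthonormal {x : X} {b : Fin n → TangentSpace (𝓡 n) x}
    (hb : Orthonormal ℝ b) (v : TangentSpace (𝓡 n) x) : ∑ i, inner ℝ (b i) v • b i = v := by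
  have h : ⊤ ≤ Submodule.span ℝ (Set.range b) := by
    rw [hb.linearIndependent.span_eq_top_of_card_eq_finrank' (by simp [finrank_tangentSpace])]
  simpa using (OrthonormalBasis.mk hb h).sum_repr' v

/-- There is a parallel orthonormal frame along `φ` on an interval containing `a` and `b`. -/
def ParallelLinked (cov : CovariantDerivative (𝓡 n) (EuclideanSpace ℝ (Fin n))
      (fun x : X => TangentSpace (𝓡 n) x)) (φ : ℝ → X) (a b : ℝ) : Prop :=
  ∃ c d : ℝ, a ∈ Set.Ioo c d ∧ b ∈ Set.Ioo c d ∧ ∀ v : TangentSpace (𝓡 n) (φ a),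
    ∃ s : FieldAlong (n := n) φ, s a = v ∧ IsParallelOn cov s (Set.Ioo c d)

lemma exists_parallel_of_orthonormal (hφ : ContMDiff 𝓘(ℝ, ℝ) (𝓡 n) ∞ φ) {I : Set ℝ} {b : ℝ}
    {p : Fin n → FieldAlong (n := n) φ} (hp : ∀ i, IsParallelOn cov (p i) I)
    (ho : Orthonormal ℝ fun i => p i b) (v : TangentSpace (𝓡 n) (φ b)) :
    ∃ s : FieldAlong (n := n) φ, s b = v ∧ IsParallelOn cov s I :=
  ⟨fun r => ∑ i, inner ℝ (p i b) v • p i r, sum_inner_smul_of_orthonormal ho v,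
    IsParallelOn.sum_smul hφ _ fun i _ => hp i⟩

lemma exists_orthonormal_tangentSpace (x : X) :
    ∃ b : Fin n → TangentSpace (𝓡 n) x, Orthonormal ℝ b :=
  ⟨_, ((stdOrthonormalBasis ℝ (TangentSpace (𝓡 n) x)).reindex
    (finCongr (finrank_tangentSpace x))).orthonormal⟩

/-- An orthonormal basis at `a` is transported to an orthonormal basis at `b`, so combinations of
the transported fields realize every initial value at `b`. -/
lemma ParallelLinked.symm (hcov : IsSmoothMetricConnection cov)
    (hφ : ContMDiff 𝓘(ℝ, ℝ) (𝓡 n) ∞ φ) {a b : ℝ} (h : ParallelLinked cov φ a b) :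
    ParallelLinked cov φ b a := by
  obtain ⟨c, d, ha, hb, h⟩ := h
  obtain ⟨e, he⟩ := exists_orthonormal_tangentSpace (n := n) (φ a)
  choose p hpa hp using fun i => h (e i)
  refine ⟨c, d, hb, ha, exists_parallel_of_orthonormal hφ hp ?_⟩
  rw [orthonormal_iff_ite] at he ⊢
  intro i j
  rw [← he i j, ← hpa i, ← hpa j]
  exact (hp i).inner_eq hcov isOpen_Ioo isPreconnected_Ioo (hp j) hb ha

/-- Parallel fields on two overlapping intervals that agree at `b` agree on the intersection, which
is again an interval, and can be glued. -/
lemma ParallelLinked.trans (hcov : IsSmoothMetricConnection cov)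
    (hφ : ContMDiff 𝓘(ℝ, ℝ) (𝓡 n) ∞ φ) {a b c : ℝ} (h : ParallelLinked cov φ a b)
    (h' : ParallelLinked cov φ b c) : ParallelLinked cov φ a c := by
  classical
  obtain ⟨k, l, ha, hb, h⟩ := h
  obtain ⟨k', l', hb', hc', h'⟩ := h'
  refine ⟨min k k', max l l', ⟨(min_le_left _ _).trans_lt ha.1, ha.2.trans_le (le_max_left _ _)⟩,
    ⟨(min_le_right _ _).trans_lt hc'.1, hc'.2.trans_le (le_max_right _ _)⟩, fun v => ?_⟩
  obtain ⟨s, hsa, hs⟩ := h v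
  obtain ⟨s', hsb, hs'⟩ := h' (s b)
  have heq : ∀ t ∈ Set.Ioo k l ∩ Set.Ioo k' l', s t = s' t := fun t ht => by
    refine IsParallelOn.eq_of_eq hcov hφ (I := Set.Ioo k l ∩ Set.Ioo k' l') (a := b)
      (isOpen_Ioo.inter isOpen_Ioo) ?_ (fun x hx => hs x hx.1) (fun x hx => hs' x hx.2)
      ⟨hb, hb'⟩ ht hsb.symm
    rw [Set.Ioo_inter_Ioo]
    exact isPreconnected_Ioo
  let q : FieldAlong (n := n) φ := fun t => if t ∈ Set.Ioo k l then s t else s' t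
  have hq1 : IsParallelOn cov q (Set.Ioo k l) :=
    hs.congr isOpen_Ioo fun t ht => if_pos ht
  have hq2 : IsParallelOn cov q (Set.Ioo k' l') := by
    refine hs'.congr isOpen_Ioo fun t ht => ?_
    by_cases h1 : t ∈ Set.Ioo k l
    · exact (if_pos h1).trans (heq t ⟨h1, ht⟩)
    · exact if_neg h1
  refine ⟨q, (if_pos ha).trans hsa, fun t ht => ?_⟩
  by_cases h1 : t ∈ Set.Ioo k l
  · exact hq1 t h1
  · refine hq2 t ?_
    by_contra h2
    have hmin := min_lt_iff.1 ht.1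
    have hmax := lt_max_iff.1 ht.2
    simp only [Set.mem_Ioo, not_and_or, not_lt] at h1 h2 ha hb hb' hc'
    rcases h1 with h1 | h1 <;> rcases h2 with h2 | h2 <;> rcases hmin with h3 | h3 <;>
      rcases hmax with h4 | h4 <;> linarith

/-- Being linked is symmetric and transitive, and holds between nearby parameters; the line is
connected. -/
lemma parallelLinked (hcov : IsSmoothMetricConnection cov)
    (hφ : ContMDiff 𝓘(ℝ, ℝ) (𝓡 n) ∞ φ) (a b : ℝ) : ParallelLinked cov φ a b := by
  have : Std.Symm (ParallelLinked cov φ) := ⟨fun _ _ h => h.symm hcov hφ⟩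
  have : IsTrans ℝ (ParallelLinked cov φ) := ⟨fun _ _ _ h h' => h.trans hcov hφ h'⟩
  refine PreconnectedSpace.induction₂ (ParallelLinked cov φ) (fun t => ?_) this a b
  obtain ⟨ε, hε, h⟩ := exists_local_parallel hcov hφ t
  filter_upwards [Ioo_mem_nhds (show t - ε < t by linarith) (show t < t + ε by linarith)]
    with r hr
  exact ⟨t - ε, t + ε, ⟨by linarith, by linarith⟩, hr, h⟩

/-- Parallel transport along the whole curve. -/
theorem exists_parallel (hcov : IsSmoothMetricConnection cov)
    (hφ : ContMDiff 𝓘(ℝ, ℝ) (𝓡 n) ∞ φ) (v : TangentSpace (𝓡 n) (φ 0)) :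
    ∃ s : FieldAlong (n := n) φ, s 0 = v ∧ IsParallelOn cov s Set.univ := by
  choose c d h0 ht h using parallelLinked hcov hφ 0
  choose S hS0 hS using fun t => h t v
  -- The value at `t` is taken from a field that is parallel on an interval containing `0` and `t`.
  -- Near `t` these fields coincide, because all have the value `v` at `0`.
  refine ⟨fun t => S t t, hS0 0, fun t _ => ?_⟩
  have h1 : IsParallelOn cov (fun t => S t t) (Set.Ioo (c t) (d t)) := by
    refine (hS t).congr isOpen_Ioo fun r hr => ?_
    refine IsParallelOn.eq_of_eq hcov hφ (I := Set.Ioo (c r) (d r) ∩ Set.Ioo (c t) (d t)) (a := 0)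
      (isOpen_Ioo.inter isOpen_Ioo) ?_ (fun x hx => hS r x hx.1) (fun x hx => hS t x hx.2)
      ⟨h0 r, h0 t⟩ ⟨ht r, hr⟩ ((hS0 r).trans (hS0 t).symm)
    rw [Set.Ioo_inter_Ioo]
    exact isPreconnected_Ioo
  exact h1 t (ht t)

end AlongCurve
end

/-! ### Orientation along a curve. -/

noncomputable section

section AlongCurve

variable {n : ℕ} {X : Type*} [TopologicalSpace X] [ChartedSpace (EuclideanSpace ℝ (Fin n)) X]
  [IsManifold (𝓡 n) ∞ X]

lemma continuous_sum_smul_along {M ι : Type*} [TopologicalSpace M] (u : Finset ι) {b : M → X}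
    (hb : Continuous b) {s : ι → (m : M) → TangentSpace (𝓡 n) (b m)} {c : ι → M → ℝ}
    (hs : ∀ i, Continuous fun m => (⟨b m, s i m⟩ : TangentBundle (𝓡 n) X))
    (hc : ∀ i, Continuous (c i)) :
    Continuous fun m => (⟨b m, ∑ i ∈ u, c i m • s i m⟩ : TangentBundle (𝓡 n) X) := by
  rw [continuous_iff_continuousAt]
  intro m₀
  set τ := trivializationAt (EuclideanSpace ℝ (Fin n)) (fun x : X => TangentSpace (𝓡 n) x) (b m₀)
  have hx : b m₀ ∈ τ.baseSet := FiberBundle.mem_baseSet_trivializationAt' (b m₀)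
  rw [FiberBundle.continuousAt_totalSpace]
  refine ⟨hb.continuousAt, ?_⟩
  have h1 : ∀ i, ContinuousAt (fun m => (τ (⟨b m, s i m⟩ : TangentBundle (𝓡 n) X)).2) m₀ :=
    fun i => ((FiberBundle.continuousAt_totalSpace _ _).1 (hs i).continuousAt).2
  have h2 : ContinuousAt (fun m => ∑ i ∈ u,
      c i m • (τ (⟨b m, s i m⟩ : TangentBundle (𝓡 n) X)).2) m₀ :=
    tendsto_finsetSum _ fun i _ => (hc i).continuousAt.smul (h1 i)
  refine h2.congr ?_
  filter_upwards [hb.continuousAt.eventually (τ.open_baseSet.mem_nhds hx)] with m hm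
  have h3 := map_sum (τ.linearEquivAt ℝ (b m) hm) (fun i => c i m • s i m) u
  simp only [map_smul] at h3
  exact h3.symm

/-- The vectors `v` form a positively oriented basis of the tangent space at `x`. -/
def IsPositiveAt (o : ManifoldOrientation (n := n) X) (x : X)
    (v : Fin n → TangentSpace (𝓡 n) x) : Prop :=
  ∃ B : Module.Basis (Fin n) ℝ (TangentSpace (𝓡 n) x), ⇑B = v ∧ B.orientation = o.at_point x

/-- The coordinates `L` need not respect the orientation, so only the product of the two
determinants has a meaningful sign. -/
lemma IsPositiveAt.iff_det {o : ManifoldOrientation (n := n) X} {x : X}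
    {v w : Fin n → TangentSpace (𝓡 n) x} (hv : IsPositiveAt o x v)
    (L : TangentSpace (𝓡 n) x ≃ₗ[ℝ] EuclideanSpace ℝ (Fin n)) :
    IsPositiveAt o x w ↔
      0 < (Matrix.of fun i j => L (v j) i).det * (Matrix.of fun i j => L (w j) i).det := by
  obtain ⟨B, rfl, hB⟩ := hv
  let e : Module.Basis (Fin n) ℝ (TangentSpace (𝓡 n) x) :=
    (EuclideanSpace.basisFun (Fin n) ℝ).toBasis.map L.symm
  have hdet : ∀ u : Fin n → TangentSpace (𝓡 n) x,
      (Matrix.of fun i j => L (u j) i).det = e.det u := fun u => by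
    rw [Module.Basis.det_apply]
    congr 1
  have h1 : ∀ u : Fin n → TangentSpace (𝓡 n) x, e.det B * B.det u = e.det u := fun u => by
    simp only [Module.Basis.det_apply, ← Matrix.det_mul, Module.Basis.toMatrix_mul_toMatrix]
  have h0 : e.det B ≠ 0 := (e.isUnit_det B).ne_zero
  rw [hdet, hdet, ← h1 w, ← mul_assoc, mul_pos_iff_of_pos_left (mul_self_pos.2 h0)]
  constructor
  · rintro ⟨B', rfl, hB'⟩
    exact (B.orientation_eq_iff_det_pos B').1 (hB.trans hB'.symm)
  · intro h
    obtain ⟨h2, h3⟩ := (Module.Basis.is_basis_iff_det B).2 (IsUnit.mk0 _ h.ne')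
    refine ⟨Module.Basis.mk h2 h3.ge, Module.Basis.coe_mk _ _, ?_⟩
    rw [← hB]
    refine ((B.orientation_eq_iff_det_pos _).2 ?_).symm
    rwa [Module.Basis.coe_mk]

/-- Near each parameter, the determinants of the given fields and of a positive local frame are
continuous and nonzero, so their relative sign is locally constant. The parameters at which the
fields are positive form a clopen set. -/
lemma isPositiveAt_const {o : ManifoldOrientation (n := n) X} {φ : ℝ → X} (hφ : Continuous φ)
    {p : Fin n → FieldAlong (n := n) φ}
    (hp : ∀ j, Continuous fun t => (⟨φ t, p j t⟩ : TangentBundle (𝓡 n) X))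
    (hli : ∀ t, LinearIndependent ℝ fun j => p j t) {a b : ℝ}
    (ha : IsPositiveAt o (φ a) fun j => p j a) : IsPositiveAt o (φ b) fun j => p j b := by
  have key : ∀ t, ∀ᶠ r in 𝓝 t, (IsPositiveAt o (φ r) (fun j => p j r) ↔
      IsPositiveAt o (φ t) fun j => p j t) := by
    intro t
    obtain ⟨U, hU, f, hf, hfo⟩ := o.locally_framed (φ t)
    set τ := trivAlong (n := n) φ t
    have hx : φ t ∈ τ.baseSet := mem_trivAlong
    have hP : ContinuousAt (fun r => (Matrix.of fun i j => coordAlong φ (p j) t r i).det) t := by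
      refine ContinuousAt.comp (g := Matrix.det) (continuous_id.matrix_det).continuousAt (continuousAt_pi.2 fun i => continuousAt_pi.2 fun j => ?_)
      have h1 := ((FiberBundle.continuousAt_totalSpace _ _).1 ((hp j).continuousAt (x := t))).2
      exact (EuclideanSpace.proj i :
        EuclideanSpace ℝ (Fin n) →L[ℝ] ℝ).continuous.continuousAt.comp h1
    have hF : ContinuousAt (fun r => (Matrix.of fun i j =>
        coordAlong φ (fun r => f (φ r) j) t r i).det) t := by
      refine ContinuousAt.comp (g := Matrix.det) (continuous_id.matrix_det).continuousAt (continuousAt_pi.2 fun i => continuousAt_pi.2 fun j => ?_)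
      have h0 : ContinuousAt (fun r => (⟨φ r, f (φ r) j⟩ : TangentBundle (𝓡 n) X)) t :=
        ContinuousAt.comp (f := φ) (g := fun x => (⟨x, f x j⟩ : TangentBundle (𝓡 n) X))
          ((hf j).continuousAt hU) hφ.continuousAt
      have h1 := ((FiberBundle.continuousAt_totalSpace _ _).1 h0).2
      exact (EuclideanSpace.proj i :
        EuclideanSpace ℝ (Fin n) →L[ℝ] ℝ).continuous.continuousAt.comp h1
    have hPF := hF.mul hP
    have hne : ∀ r, φ r ∈ U → φ r ∈ τ.baseSet → ((Matrix.of fun i j =>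
        coordAlong φ (fun r => f (φ r) j) t r i).det *
        (Matrix.of fun i j => coordAlong φ (p j) t r i).det ≠ 0 ∧
        (IsPositiveAt o (φ r) (fun j => p j r) ↔ 0 < (Matrix.of fun i j =>
        coordAlong φ (fun r => f (φ r) j) t r i).det *
        (Matrix.of fun i j => coordAlong φ (p j) t r i).det)) := by
      intro r hr hr'
      have h2 := IsPositiveAt.iff_det (w := fun j => p j r) (hfo (φ r) hr)
        (τ.linearEquivAt ℝ (φ r) hr')
      refine ⟨?_, h2⟩
      have hdet : ∀ u : Fin n → TangentSpace (𝓡 n) (φ r), LinearIndependent ℝ u →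
          (Matrix.of fun i j => τ.linearEquivAt ℝ (φ r) hr' (u j) i).det ≠ 0 := by
        intro u hu
        have h3 := hu.map' (τ.linearEquivAt ℝ (φ r) hr').toLinearMap (LinearEquiv.ker _)
        have h4 := h3.map' (WithLp.linearEquiv 2 ℝ (Fin n → ℝ)).toLinearMap (LinearEquiv.ker _)
        have h5 := (Matrix.linearIndependent_rows_iff_isUnit
          (A := Matrix.of fun j i => τ.linearEquivAt ℝ (φ r) hr' (u j) i)).1 h4
        rw [← Matrix.det_transpose]
        exact ((Matrix.isUnit_iff_isUnit_det _).1 h5).ne_zero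
      obtain ⟨B, hB, -⟩ := hfo (φ r) hr
      refine mul_ne_zero (hdet _ ?_) (hdet _ (hli r))
      have := B.linearIndependent
      rwa [hB] at this
    have hU' := hφ.continuousAt.eventually hU
    have hτ := eventually_mem_trivAlong (n := n) (hφ.continuousAt (x := t))
    obtain ⟨h0, h0'⟩ := hne t hU'.self_of_nhds hτ.self_of_nhds
    rcases h0.lt_or_gt with h | h
    · filter_upwards [hU', hτ, hPF.eventually_lt continuousAt_const h] with r h1 h2 h3
      rw [(hne r h1 h2).2, h0']
      exact ⟨fun h4 => absurd h3 h4.not_gt, fun h4 => absurd h h4.not_gt⟩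
    · filter_upwards [hU', hτ, continuousAt_const.eventually_lt hPF h] with r h1 h2 h3
      rw [(hne r h1 h2).2, h0']
      exact ⟨fun _ => h, fun _ => h3⟩
  have h1 : IsClopen {t | IsPositiveAt o (φ t) fun j => p j t} := by
    constructor
    · rw [← isOpen_compl_iff, isOpen_iff_mem_nhds]
      intro t ht
      filter_upwards [key t] with r hr h using ht (hr.1 h)
    · rw [isOpen_iff_mem_nhds]
      intro t ht
      filter_upwards [key t] with r hr using hr.2 ht
  have h2 := h1.eq_univ ⟨a, ha⟩
  exact h2.ge (Set.mem_univ b)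

end AlongCurve
end

/-! ### Periodicity, holonomy and parallel frames. -/

noncomputable section

section AlongCurve

variable {n : ℕ} {X : Type*} [TopologicalSpace X] [ChartedSpace (EuclideanSpace ℝ (Fin n)) X]
  [IsManifold (𝓡 n) ∞ X] {φ : ℝ → X} {ℓ : ℝ}

/-- All tangent spaces are the same type `EuclideanSpace ℝ (Fin n)`, so a vector can be moved
between the fibres over equal points without a cast. This is how `shiftField` compares the fibres
over `φ (t + ℓ)` and `φ t`. -/
lemma mk_tangent_congr {x y : X} (h : x = y) (v : EuclideanSpace ℝ (Fin n)) :
    (⟨x, (v : TangentSpace (𝓡 n) x)⟩ : TangentBundle (𝓡 n) X) =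
      ⟨y, (v : TangentSpace (𝓡 n) y)⟩ := by
  subst h; rfl

lemma mk_tangent_inj {x : X} {v w : TangentSpace (𝓡 n) x}
    (h : (⟨x, v⟩ : TangentBundle (𝓡 n) X) = ⟨x, w⟩) : v = w := by
  simpa using h

/-- The translate of a field along a periodic curve. -/
def shiftField (ℓ : ℝ) (φ : ℝ → X) (s : FieldAlong (n := n) φ) : FieldAlong (n := n) φ :=
  fun t => (s (t + ℓ) : EuclideanSpace ℝ (Fin n))

lemma mk_shiftField (hper : Function.Periodic φ ℓ) (s : FieldAlong (n := n) φ) (t : ℝ) :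
    (⟨φ t, shiftField ℓ φ s t⟩ : TangentBundle (𝓡 n) X) = ⟨φ (t + ℓ), s (t + ℓ)⟩ :=
  mk_tangent_congr (hper t).symm _

lemma periodic_iff_shiftField (hper : Function.Periodic φ ℓ) (s : FieldAlong (n := n) φ) (t c : ℝ) :
    (⟨φ (t + ℓ), s (t + ℓ)⟩ : TangentBundle (𝓡 n) X) = ⟨φ t, c • s t⟩ ↔
      shiftField ℓ φ s t = c • s t := by
  rw [← mk_shiftField hper]
  exact ⟨mk_tangent_inj, fun h => by rw [h]⟩

lemma shiftField_sum_smul (hper : Function.Periodic φ ℓ) {ι : Type*} (u : Finset ι) (c : ι → ℝ → ℝ)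
    (s : ι → FieldAlong (n := n) φ) (t : ℝ) :
    shiftField ℓ φ (fun r => ∑ i ∈ u, c i r • s i r) t =
      ∑ i ∈ u, c i (t + ℓ) • shiftField ℓ φ (s i) t := by
  have key : ∀ (x y : X), x = y → ∀ v : ι → EuclideanSpace ℝ (Fin n),
      ((∑ i ∈ u, c i (t + ℓ) • (v i : TangentSpace (𝓡 n) x) : TangentSpace (𝓡 n) x) :
        EuclideanSpace ℝ (Fin n)) =
      (∑ i ∈ u, c i (t + ℓ) • (v i : TangentSpace (𝓡 n) y) : TangentSpace (𝓡 n) y) := by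
    rintro x _ rfl v; rfl
  exact key _ _ (hper t) fun i => s i (t + ℓ)

lemma SmoothAlongAt.shift (hper : Function.Periodic φ ℓ) {s : FieldAlong (n := n) φ} {t : ℝ}
    (h : SmoothAlongAt φ s (t + ℓ)) : SmoothAlongAt φ (shiftField ℓ φ s) t := by
  unfold SmoothAlongAt at *
  simp only [mk_shiftField hper]
  exact ContMDiffAt.comp t h (contMDiff_id.add contMDiff_const).contMDiffAt

/-- The translated curve equals `φ` as a function, so its operator may be replaced by that of `φ`.
What remains is the invariance of derivatives under translation of the parameter. -/
lemma dirac_shift (cov : CovariantDerivative (𝓡 n) (EuclideanSpace ℝ (Fin n))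
      (fun x : X => TangentSpace (𝓡 n) x)) (hper : Function.Periodic φ ℓ)
    (hφ : ContMDiff 𝓘(ℝ, ℝ) (𝓡 n) ∞ φ) (s : FieldAlong (n := n) φ) :
    dirac cov φ (shiftField ℓ φ s) = shiftField ℓ φ (dirac cov φ s) := by
  have hψ : (fun r => φ (r + ℓ)) = φ := funext hper
  have key : ∀ ψ : ℝ → X, ψ = φ → ∀ u : ℝ → EuclideanSpace ℝ (Fin n), ∀ t,
      (dirac cov ψ (fun r => u r) t : EuclideanSpace ℝ (Fin n)) = dirac cov φ (fun r => u r) t := by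
    rintro _ rfl u t; rfl
  funext t
  refine (key _ hψ (fun r => s (r + ℓ)) t).symm.trans ?_
  have h1 : deriv (fun r => (trivializationAt (EuclideanSpace ℝ (Fin n))
      (fun x : X => TangentSpace (𝓡 n) x) (φ (t + ℓ))
      (⟨φ (r + ℓ), s (r + ℓ)⟩ : TangentBundle (𝓡 n) X)).2) t = deriv (fun r =>
      (trivializationAt (EuclideanSpace ℝ (Fin n))
      (fun x : X => TangentSpace (𝓡 n) x) (φ (t + ℓ))
      (⟨φ r, s r⟩ : TangentBundle (𝓡 n) X)).2) (t + ℓ) :=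
    deriv_comp_add_const (fun r => (trivializationAt (EuclideanSpace ℝ (Fin n))
      (fun x : X => TangentSpace (𝓡 n) x) (φ (t + ℓ))
      (⟨φ r, s r⟩ : TangentBundle (𝓡 n) X)).2) ℓ t
  have h2 : (mfderiv 𝓘(ℝ, ℝ) (𝓡 n) (fun r => φ (r + ℓ)) t (1 : ℝ) :
      EuclideanSpace ℝ (Fin n)) = mfderiv 𝓘(ℝ, ℝ) (𝓡 n) φ (t + ℓ) (1 : ℝ) := by
    have h3 : HasMFDerivAt 𝓘(ℝ, ℝ) 𝓘(ℝ, ℝ) (fun r : ℝ => r + ℓ) t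
        (ContinuousLinearMap.id ℝ ℝ) := by
      exact ((hasFDerivAt_id t).add_const ℓ).hasMFDerivAt
    have h4 := (((hφ (t + ℓ)).mdifferentiableAt (by simp)).hasMFDerivAt.comp t h3).mfderiv
    have h5 : φ ∘ (fun r : ℝ => r + ℓ) = fun r => φ (r + ℓ) := rfl
    rw [h5] at h4
    exact congrArg (fun f : ℝ →L[ℝ] EuclideanSpace ℝ (Fin n) => f 1) h4
  unfold dirac shiftField
  simp only
  rw [h1]
  exact congrArg (fun w : EuclideanSpace ℝ (Fin n) => (trivializationAt (EuclideanSpace ℝ (Fin n))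
    (fun x : X => TangentSpace (𝓡 n) x) (φ (t + ℓ))).symm (φ (t + ℓ)) (deriv (fun r =>
      (trivializationAt (EuclideanSpace ℝ (Fin n))
      (fun x : X => TangentSpace (𝓡 n) x) (φ (t + ℓ))
      (⟨φ r, s r⟩ : TangentBundle (𝓡 n) X)).2) (t + ℓ)) +
    cov (fun x => (trivializationAt (EuclideanSpace ℝ (Fin n))
      (fun x : X => TangentSpace (𝓡 n) x) (φ (t + ℓ))).symm x ((trivializationAt
      (EuclideanSpace ℝ (Fin n)) (fun x : X => TangentSpace (𝓡 n) x) (φ (t + ℓ)))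
      (⟨φ (t + ℓ), s (t + ℓ)⟩ : TangentBundle (𝓡 n) X)).2) (φ (t + ℓ)) w) h2

variable [Bundle.RiemannianBundle (fun x : X => TangentSpace (𝓡 n) x)]

lemma inner_shiftField (hper : Function.Periodic φ ℓ) (s s' : FieldAlong (n := n) φ) (t : ℝ) :
    inner ℝ (shiftField ℓ φ s t) (shiftField ℓ φ s' t) = inner ℝ (s (t + ℓ)) (s' (t + ℓ)) := by
  have key : ∀ (x y : X), x = y → ∀ v w : EuclideanSpace ℝ (Fin n),
      @inner ℝ (TangentSpace (𝓡 n) x) _ v w = @inner ℝ (TangentSpace (𝓡 n) y) _ v w := by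
    rintro x _ rfl v w; rfl
  exact key _ _ (hper t).symm _ _

lemma isPositiveAt_shiftField (hper : Function.Periodic φ ℓ) (o : ManifoldOrientation (n := n) X)
    {p : Fin n → FieldAlong (n := n) φ} {t : ℝ}
    (h : IsPositiveAt o (φ (t + ℓ)) fun j => p j (t + ℓ)) :
    IsPositiveAt o (φ t) fun j => shiftField ℓ φ (p j) t := by
  have key : ∀ (x y : X), x = y → ∀ v : Fin n → EuclideanSpace ℝ (Fin n),
      IsPositiveAt o x (fun j => (v j : TangentSpace (𝓡 n) x)) →
      IsPositiveAt o y (fun j => (v j : TangentSpace (𝓡 n) y)) := by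
    rintro x _ rfl v h; exact h
  exact key _ _ (hper t) _ h

/-- A parallel, positively oriented, orthonormal frame along the periodic curve `φ`, with its
holonomy matrix. -/
structure ParallelFrame (cov : CovariantDerivative (𝓡 n) (EuclideanSpace ℝ (Fin n))
      (fun x : X => TangentSpace (𝓡 n) x)) (o : ManifoldOrientation (n := n) X) (ℓ : ℝ)
    (φ : ℝ → X) where
  toFun : Fin n → FieldAlong (n := n) φ
  parallel : ∀ i, IsParallelOn cov (toFun i) Set.univ
  orthonormal : ∀ t, Orthonormal ℝ fun i => toFun i t
  positive : ∀ t, IsPositiveAt o (φ t) fun i => toFun i t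
  holonomy : Matrix (Fin n) (Fin n) ℝ
  holonomy_mem : holonomy ∈ Matrix.specialOrthogonalGroup (Fin n) ℝ
  shift : ∀ j t, shiftField ℓ φ (toFun j) t = ∑ i, holonomy i j • toFun i t

lemma isPositiveAt_sum_iff {o : ManifoldOrientation (n := n) X} {x : X}
    {v : Fin n → TangentSpace (𝓡 n) x} (hv : IsPositiveAt o x v) (F : Matrix (Fin n) (Fin n) ℝ) :
    IsPositiveAt o x (fun j => ∑ i, F i j • v i) ↔ 0 < F.det := by
  let L : TangentSpace (𝓡 n) x ≃ₗ[ℝ] EuclideanSpace ℝ (Fin n) := LinearEquiv.refl ℝ _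
  have h1 : (Matrix.of fun i j => L (∑ k, F k j • v k) i) =
      (Matrix.of fun i j => L (v j) i) * F := by
    ext i j
    rw [Matrix.mul_apply]
    simp only [Matrix.of_apply, map_sum, map_smul]
    rw [WithLp.ofLp_sum, Finset.sum_apply]
    exact Finset.sum_congr rfl fun k _ => mul_comm _ _
  have h2 := (hv.iff_det (w := v) L).1 hv
  rw [hv.iff_det L, h1, Matrix.det_mul, ← mul_assoc, mul_pos_iff_of_pos_left h2]

lemma orthonormal_sum_iff {x : X} {v : Fin n → TangentSpace (𝓡 n) x} (hv : Orthonormal ℝ v)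
    (F : Matrix (Fin n) (Fin n) ℝ) :
    Orthonormal ℝ (fun j => ∑ i, F i j • v i) ↔ F.transpose * F = 1 := by
  rw [orthonormal_iff_ite, ← Matrix.ext_iff]
  have h : ∀ i j, inner ℝ (∑ k, F k i • v k) (∑ k, F k j • v k) = (F.transpose * F) i j := by
    intro i j
    rw [hv.inner_sum, Matrix.mul_apply]
    simp
  simp only [h, Matrix.one_apply]

variable [IsContMDiffRiemannianBundle (𝓡 n) ∞ (EuclideanSpace ℝ (Fin n))
      (fun x : X => TangentSpace (𝓡 n) x)] [T2Space X]
  {cov : CovariantDerivative (𝓡 n) (EuclideanSpace ℝ (Fin n))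
      (fun x : X => TangentSpace (𝓡 n) x)} {o : ManifoldOrientation (n := n) X}

/-- Adjusting a basis to an orientation only changes signs of its members, which keeps it
orthonormal. For `n = 0` there would be no member to change. -/
lemma exists_orthonormal_positive (hn : 0 < n) (o : ManifoldOrientation (n := n) X) (x : X) :
    ∃ b : Fin n → TangentSpace (𝓡 n) x, Orthonormal ℝ b ∧ IsPositiveAt o x b := by
  have : Nonempty (Fin n) := ⟨⟨0, hn⟩⟩
  obtain ⟨b, hb⟩ := exists_orthonormal_tangentSpace (n := n) x
  have h : ⊤ ≤ Submodule.span ℝ (Set.range b) := by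
    rw [hb.linearIndependent.span_eq_top_of_card_eq_finrank' (by simp [finrank_tangentSpace])]
  let B : Module.Basis (Fin n) ℝ (TangentSpace (𝓡 n) x) := Module.Basis.mk hb.linearIndependent h
  have hB : ∀ i, B i = b i := fun i => Module.Basis.mk_apply _ _ i
  refine ⟨B.adjustToOrientation (o.at_point x), ?_, _, rfl,
    B.orientation_adjustToOrientation (o.at_point x)⟩
  have hB' : ∀ i, B.adjustToOrientation (o.at_point x) i = b i ∨
      B.adjustToOrientation (o.at_point x) i = -b i := fun i => by
    rw [← hB]; exact B.adjustToOrientation_apply_eq_or_eq_neg _ i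
  refine ⟨fun i => ?_, fun i j hij => ?_⟩
  · rcases hB' i with h | h <;> rw [h]
    · exact hb.1 i
    · rw [norm_neg]; exact hb.1 i
  · have h1 := hb.2 hij
    rcases hB' i with h | h <;> rcases hB' j with h' | h' <;>
      simp only [h, h', inner_neg_left, inner_neg_right, h1, neg_zero]

/-- Transport a positive orthonormal basis from `φ 0`. The translates by `ℓ` of the resulting fields
are again parallel, hence combinations of the frame with constant coefficients. These form the
holonomy, which lies in `SO_n` because translation preserves inner products and orientation. -/
theorem nonempty_parallelFrame (hn : 0 < n) (hcov : IsSmoothMetricConnection cov)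
    (hφ : ContMDiff 𝓘(ℝ, ℝ) (𝓡 n) ∞ φ) (hper : Function.Periodic φ ℓ) :
    Nonempty (ParallelFrame cov o ℓ φ) := by
  obtain ⟨b, hbo, hbp⟩ := exists_orthonormal_positive hn o (φ 0)
  choose p hp0 hp using fun i => exists_parallel hcov hφ (b i)
  have ho : ∀ t, Orthonormal ℝ fun i => p i t := fun t => by
    have h := hbo
    rw [orthonormal_iff_ite] at h ⊢
    intro i j
    rw [← h i j, ← hp0 i, ← hp0 j]
    exact (hp i).inner_eq hcov isOpen_univ isPreconnected_univ (hp j) trivial trivial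
  have hpos : ∀ t, IsPositiveAt o (φ t) fun i => p i t := fun t => by
    refine isPositiveAt_const (a := 0) hφ.continuous (fun j => ?_)
      (fun t => (ho t).linearIndependent) ?_
    · exact continuous_iff_continuousAt.2 fun t => ((hp j) t trivial).1.continuousAt
    · rwa [show (fun j => p j 0) = b from funext hp0]
  let H : Matrix (Fin n) (Fin n) ℝ :=
    Matrix.of fun i j => inner ℝ (p i 0) (shiftField ℓ φ (p j) 0)
  have hshift : ∀ j, IsParallelOn cov (shiftField ℓ φ (p j)) Set.univ := fun j t _ => by
    refine ⟨(hp j _ trivial).1.shift hper, ?_⟩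
    rw [dirac_shift cov hper hφ]
    exact (hp j (t + ℓ) trivial).2
  have hH : ∀ j t, shiftField ℓ φ (p j) t = ∑ i, H i j • p i t := fun j t =>
    (hshift j).eq_of_eq (a := 0) hcov hφ isOpen_univ isPreconnected_univ
      (IsParallelOn.sum_smul hφ (fun i => H i j) fun i _ => hp i) trivial trivial
      (sum_inner_smul_of_orthonormal (ho 0) _).symm
  refine ⟨⟨p, hp, ho, hpos, H, ?_, hH⟩⟩
  have h1 : H.transpose * H = 1 := by
    rw [← orthonormal_sum_iff (ho 0)]
    have h2 : (fun j => ∑ i, H i j • p i 0) = fun j => shiftField ℓ φ (p j) 0 :=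
      funext fun j => (hH j 0).symm
    rw [h2]
    have h3 := ho (0 + ℓ)
    rw [orthonormal_iff_ite] at h3 ⊢
    intro i j
    rw [← h3 i j, inner_shiftField hper]
  have h2 : 0 < H.det := by
    rw [← isPositiveAt_sum_iff (hpos 0)]
    have h2 : (fun j => ∑ i, H i j • p i 0) = fun j => shiftField ℓ φ (p j) 0 :=
      funext fun j => (hH j 0).symm
    rw [h2]
    exact isPositiveAt_shiftField hper o (hpos _)
  rw [Matrix.mem_specialOrthogonalGroup_iff, Matrix.mem_orthogonalGroup_iff']
  refine ⟨h1, ?_⟩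
  have h3 := congrArg Matrix.det h1
  rw [Matrix.det_mul, Matrix.det_transpose, Matrix.det_one] at h3
  nlinarith

end AlongCurve
end

/-! ### Dictionary between fields along the curve and their components in a parallel frame. -/

noncomputable section

open scoped Matrix

section AlongCurve

variable {n : ℕ} {X : Type*} [TopologicalSpace X] [ChartedSpace (EuclideanSpace ℝ (Fin n)) X]
  [IsManifold (𝓡 n) ∞ X] {φ : ℝ → X} {ℓ : ℝ}
  [Bundle.RiemannianBundle (fun x : X => TangentSpace (𝓡 n) x)]
  [IsContMDiffRiemannianBundle (𝓡 n) ∞ (EuclideanSpace ℝ (Fin n))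
      (fun x : X => TangentSpace (𝓡 n) x)] [T2Space X]
  {cov : CovariantDerivative (𝓡 n) (EuclideanSpace ℝ (Fin n))
      (fun x : X => TangentSpace (𝓡 n) x)} {o : ManifoldOrientation (n := n) X}

namespace ParallelFrame

variable (P : ParallelFrame cov o ℓ φ)

/-- The fields along `φ` correspond to vector-valued functions, their components with respect to
the parallel frame. -/
def field : (ℝ → Fin n → ℝ) ≃ₗ[ℝ] FieldAlong (n := n) φ where
  toFun u t := ∑ i, u t i • P.toFun i t
  invFun s t i := inner ℝ (P.toFun i t) (s t)
  map_add' u v := by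
    funext t
    simp only [Pi.add_apply, add_smul, Finset.sum_add_distrib]
  map_smul' c u := by
    funext t
    simp only [Pi.smul_apply, smul_eq_mul, mul_smul, Finset.smul_sum, RingHom.id_apply]
  left_inv u := by
    funext t i
    simp only [(P.orthonormal t).inner_right_fintype]
  right_inv s := by
    funext t
    exact sum_inner_smul_of_orthonormal (P.orthonormal t) (s t)

lemma field_apply (u : ℝ → Fin n → ℝ) (t : ℝ) : P.field u t = ∑ i, u t i • P.toFun i t := rfl

lemma field_symm_apply (s : FieldAlong (n := n) φ) (t : ℝ) (i : Fin n) :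
    P.field.symm s t i = inner ℝ (P.toFun i t) (s t) := rfl

lemma inner_field (u v : ℝ → Fin n → ℝ) (t : ℝ) :
    inner ℝ (P.field u t) (P.field v t) = u t ⬝ᵥ v t := by
  rw [field_apply, field_apply, (P.orthonormal t).inner_sum]
  simp [dotProduct]

lemma field_apply_inj {u v : ℝ → Fin n → ℝ} {t : ℝ} (h : P.field u t = P.field v t) :
    u t = v t := by
  funext i
  have h1 := congrFun (congrFun (P.field.symm_apply_apply u) t) i
  have h2 := congrFun (congrFun (P.field.symm_apply_apply v) t) i
  rw [← h1, ← h2, field_symm_apply, field_symm_apply, h]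

lemma smul_field_apply (c : ℝ) (u : ℝ → Fin n → ℝ) (t : ℝ) :
    c • P.field u t = P.field (c • u) t := by
  rw [map_smul]; rfl

lemma dirac_field (hφ : ContMDiff 𝓘(ℝ, ℝ) (𝓡 n) ∞ φ) {u : ℝ → Fin n → ℝ}
    (hu : ContDiff ℝ ∞ u) : dirac cov φ (P.field u) = P.field (deriv u) := by
  funext t
  have h1 : ∀ i, ContDiff ℝ ∞ fun r => u r i := fun i => contDiff_pi.1 hu i
  have h := dirac_sum_smul cov (u := Finset.univ) (s := P.toFun) (c := fun i r => u r i) (hφ t)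
    (fun i _ => (P.parallel i t trivial).1) (fun i _ => (h1 i).contDiffAt)
  refine h.trans ?_
  rw [field_apply]
  refine Finset.sum_congr rfl fun i _ => ?_
  rw [(P.parallel i t trivial).2, smul_zero, add_zero,
    deriv_pi fun i => ((h1 i).differentiable (by simp)) t]

lemma shift_field (hper : Function.Periodic φ ℓ) (u : ℝ → Fin n → ℝ) :
    shiftField ℓ φ (P.field u) = P.field fun t => P.holonomy *ᵥ u (t + ℓ) := by
  funext t
  have h := shiftField_sum_smul hper Finset.univ (fun i r => u r i) P.toFun t
  refine h.trans ?_
  rw [field_apply]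
  simp only [P.shift, Finset.smul_sum, Matrix.mulVec, dotProduct, Finset.sum_smul, smul_smul]
  rw [Finset.sum_comm]
  exact Finset.sum_congr rfl fun i _ => Finset.sum_congr rfl fun j _ => by rw [mul_comm]

lemma periodic_field_iff (hper : Function.Periodic φ ℓ) (u : ℝ → Fin n → ℝ) (c t : ℝ) :
    (⟨φ (t + ℓ), P.field u (t + ℓ)⟩ : TangentBundle (𝓡 n) X) = ⟨φ t, c • P.field u t⟩ ↔
      P.holonomy *ᵥ u (t + ℓ) = c • u t := by
  rw [periodic_iff_shiftField hper, P.shift_field hper, smul_field_apply]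
  exact ⟨fun h => P.field_apply_inj h, fun h => by rw [field_apply, field_apply, h]; rfl⟩

lemma contMDiff_toFun (i : Fin n) : ContMDiff 𝓘(ℝ, ℝ) ((𝓡 n).prod 𝓘(ℝ, EuclideanSpace ℝ (Fin n))) ∞
    (fun t => (⟨φ t, P.toFun i t⟩ : TangentBundle (𝓡 n) X)) :=
  fun t => (P.parallel i t trivial).1

lemma contMDiff_field_iff (hφ : ContMDiff 𝓘(ℝ, ℝ) (𝓡 n) ∞ φ) (u : ℝ → Fin n → ℝ) :
    ContMDiff 𝓘(ℝ, ℝ) ((𝓡 n).prod 𝓘(ℝ, EuclideanSpace ℝ (Fin n))) ∞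
      (fun t => (⟨φ t, P.field u t⟩ : TangentBundle (𝓡 n) X)) ↔ ContDiff ℝ ∞ u := by
  constructor
  · intro h
    rw [contDiff_pi]
    intro i
    rw [contDiff_iff_contDiffAt]
    intro t
    have h1 := SmoothAlongAt.inner (P.parallel i t trivial).1 (h t)
    have h2 : (fun r => inner ℝ (P.toFun i r) (P.field u r)) = fun r => u r i :=
      funext fun r => congrFun (congrFun (P.field.symm_apply_apply u) r) i
    rwa [h2] at h1
  · intro h t
    exact smoothAlongAt_sum (u := Finset.univ) (c := fun i r => u r i) (hφ t) (fun i _ => (P.parallel i t trivial).1)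
      (fun i _ => (contDiff_pi.1 h i).contDiffAt)

lemma isSpinorField_iff (hφ : ContMDiff 𝓘(ℝ, ℝ) (𝓡 n) ∞ φ) (hper : Function.Periodic φ ℓ)
    {spin : CircleSpin} (u : ℝ → Fin n → ℝ) :
    IsSpinorField ℓ spin φ (P.field u) ↔
      ContDiff ℝ ∞ u ∧ ∀ t, P.holonomy *ᵥ u (t + ℓ) = spin.sign • u t := by
  rw [← P.contMDiff_field_iff hφ]
  simp only [← P.periodic_field_iff hper]
  exact ⟨fun h => ⟨h.1, h.2⟩, fun h => ⟨h.1, h.2⟩⟩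

/-- The parameter space `M` is general so that the lemma also covers `I × ℝ`, where it turns
homotopies of sections into homotopies of matrix functions. -/
lemma continuous_field_iff {M : Type*} [TopologicalSpace M] (hφ : Continuous φ) {τ : M → ℝ}
    (hτ : Continuous τ) (u : M → Fin n → ℝ) :
    Continuous (fun m => (⟨φ (τ m), ∑ i, u m i • P.toFun i (τ m)⟩ : TangentBundle (𝓡 n) X)) ↔
      Continuous u := by
  have hp : ∀ i, Continuous fun m => (⟨φ (τ m), P.toFun i (τ m)⟩ : TangentBundle (𝓡 n) X) :=
    fun i => (P.contMDiff_toFun i).continuous.comp hτ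
  have : IsContinuousRiemannianBundle (EuclideanSpace ℝ (Fin n))
      (fun x : X => TangentSpace (𝓡 n) x) := by
    obtain ⟨g, hg, hg'⟩ := IsContMDiffRiemannianBundle.exists_contMDiff (IB := 𝓡 n) (n := ∞)
      (F := EuclideanSpace ℝ (Fin n)) (E := fun x : X => TangentSpace (𝓡 n) x)
    exact ⟨g, hg.continuous, hg'⟩
  constructor
  · intro h
    refine continuous_pi fun i => ?_
    have h1 := Continuous.inner_bundle (hp i) h
    refine h1.congr fun m => ?_
    exact (P.orthonormal (τ m)).inner_right_fintype _ _
  · intro h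
    exact continuous_sum_smul_along _ (hφ.comp hτ) hp fun i => (continuous_apply i).comp h

/-- The family of fields whose components are the columns of a matrix function. -/
def frame (F : ℝ → Matrix (Fin n) (Fin n) ℝ) : Fin n → FieldAlong (n := n) φ :=
  fun j => P.field fun t i => F t i j

lemma frame_apply (F : ℝ → Matrix (Fin n) (Fin n) ℝ) (j : Fin n) (t : ℝ) :
    P.frame F j t = ∑ i, F t i j • P.toFun i t := rfl

lemma exists_frame_eq (e : Fin n → FieldAlong (n := n) φ) : ∃ F, P.frame F = e :=
  ⟨fun t => Matrix.of fun i j => P.field.symm (e j) t i, funext fun _ => P.field.apply_symm_apply _⟩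

lemma frame_injective : Function.Injective P.frame := fun F G h => by
  funext t
  ext i j
  exact congrFun (congrFun (P.field.injective (congrFun h j)) t) i

lemma frame_mul_apply (F G : ℝ → Matrix (Fin n) (Fin n) ℝ) (j : Fin n) (t : ℝ) :
    P.frame (fun t => F t * G t) j t = ∑ i, G t i j • P.frame F i t := by
  simp only [frame_apply, Matrix.mul_apply, Finset.sum_smul, Finset.smul_sum, smul_smul]
  rw [Finset.sum_comm]
  exact Finset.sum_congr rfl fun i _ => Finset.sum_congr rfl fun j _ => by rw [mul_comm]

/-- The parallel frame is itself positive and orthonormal, so pointwise both conditions on the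
fields become conditions on the matrix. Orthogonality leaves the determinants `1` and `-1`, and
positivity selects `1`. -/
lemma isFrameField_iff (hφ : Continuous φ) (hper : Function.Periodic φ ℓ) {spin : CircleSpin}
    (F : ℝ → Matrix (Fin n) (Fin n) ℝ) :
    IsFrameField ℓ spin o φ (P.frame F) ↔ Continuous F ∧
      (∀ t, F t ∈ Matrix.specialOrthogonalGroup (Fin n) ℝ) ∧
      ∀ t, P.holonomy * F (t + ℓ) = spin.sign • F t := by
  have h1 : (∀ j, Continuous fun t => (⟨φ t, P.frame F j t⟩ : TangentBundle (𝓡 n) X)) ↔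
      Continuous F := by
    have h2 := fun j : Fin n => P.continuous_field_iff hφ continuous_id fun t i => F t i j
    refine (forall_congr' h2).trans ?_
    constructor
    · exact fun h => continuous_matrix fun i j => (continuous_apply i).comp (h j)
    · exact fun h j => continuous_pi fun i => h.matrix_elem i j
  have h2 : (∀ j t, (⟨φ (t + ℓ), P.frame F j (t + ℓ)⟩ : TangentBundle (𝓡 n) X) =
      ⟨φ t, spin.sign • P.frame F j t⟩) ↔ ∀ t, P.holonomy * F (t + ℓ) = spin.sign • F t := by
    refine (forall_congr' fun j => forall_congr' fun t =>
      P.periodic_field_iff hper (fun t i => F t i j) spin.sign t).trans ?_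
    rw [forall_comm]
    refine forall_congr' fun t => ?_
    rw [← Matrix.ext_iff]
    have h5 : ∀ i j, (P.holonomy * F (t + ℓ)) i j = (P.holonomy *ᵥ fun k => F (t + ℓ) k j) i :=
      fun i j => Matrix.mul_apply
    simp only [h5]
    exact ⟨fun h i j => congrFun (h j) i, fun h j => funext fun i => h i j⟩
  have h3 : ∀ t, (Orthonormal ℝ (fun j => P.frame F j t) ∧
      IsPositiveAt o (φ t) (fun j => P.frame F j t)) ↔
      F t ∈ Matrix.specialOrthogonalGroup (Fin n) ℝ := by
    intro t
    rw [Matrix.mem_specialOrthogonalGroup_iff, Matrix.mem_orthogonalGroup_iff',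
      ← orthonormal_sum_iff (P.orthonormal t) (F t)]
    refine and_congr_right fun h => ?_
    refine (isPositiveAt_sum_iff (P.positive t) (F t)).trans ?_
    have h4 := congrArg Matrix.det ((orthonormal_sum_iff (P.orthonormal t) (F t)).1 h)
    rw [Matrix.det_mul, Matrix.det_transpose, Matrix.det_one] at h4
    constructor
    · intro h5; nlinarith
    · intro h5; rw [h5]; norm_num
  rw [← h1, ← h2]
  simp only [← h3]
  exact ⟨fun h => ⟨h.1, fun t => ⟨h.3 t, h.4 t⟩, h.2⟩,
    fun h => ⟨h.1, h.2.2, fun t => (h.2.1 t).1, fun t => (h.2.1 t).2⟩⟩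

end ParallelFrame

end AlongCurve
end

/-! ### A matrix model of the Clifford algebra. -/

noncomputable section

open scoped Matrix

section Clifford

/-- The sum of the `a S * c Sᵗ` over the sub-products of the list of indices. -/
def intertwiner {ι R : Type*} [Ring R] (a c : ι → R) : List ι → R
  | [] => 1
  | i :: l => intertwiner a c l + a i * intertwiner a c l * c i

/-- An averaging argument: `X ↦ a k * X * c k` permutes the summands. Moving `a k` and `c k` to
their places in the product costs a sign on the left and the same sign on the right, and the two
cancel. -/
lemma intertwiner_conj {ι R : Type*} [Ring R] {a c : ι → R} (ha : ∀ i, a i * a i = 1)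
    (hc : ∀ i, c i * c i = 1) (ha' : ∀ i j, i ≠ j → a i * a j = -(a j * a i))
    (hc' : ∀ i j, i ≠ j → c i * c j = -(c j * c i)) {l : List ι} {k : ι} (hk : k ∈ l) :
    a k * intertwiner a c l * c k = intertwiner a c l := by
  induction l with
  | nil => simp at hk
  | cons i l ih =>
    rw [intertwiner]
    by_cases h : k = i
    · subst h
      have h1 : a k * (intertwiner a c l + a k * intertwiner a c l * c k) * c k =
          a k * intertwiner a c l * c k + a k * a k * intertwiner a c l * (c k * c k) := by
        noncomm_ring
      rw [h1, ha, hc, one_mul, mul_one, add_comm]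
    · have h2 := ih ((List.mem_cons.1 hk).resolve_left h)
      have h1 : a k * (intertwiner a c l + a i * intertwiner a c l * c i) * c k =
          a k * intertwiner a c l * c k + (a k * a i) * intertwiner a c l * (c i * c k) := by
        noncomm_ring
      have h3 : -(a i * a k) * intertwiner a c l * -(c k * c i) =
          a i * (a k * intertwiner a c l * c k) * c i := by
        noncomm_ring
      rw [h1, ha' k i h, hc' i k (Ne.symm h), h3, h2]

variable {n : ℕ}

/-- The sign `(-1) ^ x`. -/
def zsign (x : ZMod 2) : ℝ := if x = 0 then 1 else -1

lemma zsign_mul_self (x : ZMod 2) : zsign x * zsign x = 1 := by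
  unfold zsign; split_ifs <;> norm_num

lemma zsign_add (x y : ZMod 2) : zsign (x + y) = zsign x * zsign y := by
  unfold zsign
  have : ∀ x : ZMod 2, x = 0 ∨ x = 1 := by decide
  have h : (1 : ZMod 2) + 1 = 0 := by decide
  rcases this x with rfl | rfl <;> rcases this y with rfl | rfl <;> simp [h]

lemma zsign_inj {x y : ZMod 2} (h : zsign x = zsign y) : x = y := by
  revert h; unfold zsign
  have : ∀ x : ZMod 2, x = 0 ∨ x = 1 := by decide
  rcases this x with rfl | rfl <;> rcases this y with rfl | rfl <;> norm_num

/-- The matrix of the operator `f ↦ σ * f (· + d)` on functions on `(ℤ/2)^n`. -/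
def shiftMatrix (σ : (Fin n → ZMod 2) → ℝ) (d : Fin n → ZMod 2) :
    Matrix (Fin n → ZMod 2) (Fin n → ZMod 2) ℝ :=
  Matrix.of fun x y => if y = x + d then σ x else 0

lemma shiftMatrix_mul (σ τ : (Fin n → ZMod 2) → ℝ) (d e : Fin n → ZMod 2) :
    shiftMatrix σ d * shiftMatrix τ e = shiftMatrix (fun x => σ x * τ (x + d)) (d + e) := by
  ext x y
  rw [Matrix.mul_apply, Finset.sum_eq_single (x + d)]
  · simp [shiftMatrix, add_assoc]
  · intro z _ hz
    simp [shiftMatrix, hz]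
  · simp

lemma mul_shiftMatrix_apply (M : Matrix (Fin n → ZMod 2) (Fin n → ZMod 2) ℝ)
    (σ : (Fin n → ZMod 2) → ℝ) (d x y : Fin n → ZMod 2) :
    (M * shiftMatrix σ d) x (y + d) = M x y * σ y := by
  rw [Matrix.mul_apply, Finset.sum_eq_single y]
  · simp [shiftMatrix]
  · intro z _ hz
    simp [shiftMatrix, hz.symm]
  · simp

lemma shiftMatrix_mul_apply (M : Matrix (Fin n → ZMod 2) (Fin n → ZMod 2) ℝ)
    (σ : (Fin n → ZMod 2) → ℝ) (d x y : Fin n → ZMod 2) :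
    (shiftMatrix σ d * M) x y = σ x * M (x + d) y := by
  rw [Matrix.mul_apply, Finset.sum_eq_single (x + d)]
  · simp [shiftMatrix]
  · intro z _ hz
    simp [shiftMatrix, hz]
  · simp

lemma shiftMatrix_zero_one : shiftMatrix (n := n) (fun _ => 1) 0 = 1 := by
  ext x y
  simp [shiftMatrix, Matrix.one_apply, eq_comm]

lemma neg_shiftMatrix (σ : (Fin n → ZMod 2) → ℝ) (d : Fin n → ZMod 2) :
    -shiftMatrix σ d = shiftMatrix (fun x => -σ x) d := by
  ext x y
  simp only [shiftMatrix, Matrix.neg_apply, Matrix.of_apply]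
  split_ifs <;> simp

/-- `(-1)` to the sum of the coordinates of `x` in `s`. -/
def partialSign (s : Finset (Fin n)) (x : Fin n → ZMod 2) : ℝ := zsign (∑ j ∈ s, x j)

lemma partialSign_add (s : Finset (Fin n)) (x y : Fin n → ZMod 2) :
    partialSign s (x + y) = partialSign s x * partialSign s y := by
  simp only [partialSign, Pi.add_apply, Finset.sum_add_distrib, zsign_add]

lemma partialSign_single (s : Finset (Fin n)) (i : Fin n) :
    partialSign s (Pi.single i 1) = if i ∈ s then -1 else 1 := by
  have h : ∑ j ∈ s, (Pi.single i 1 : Fin n → ZMod 2) j = if i ∈ s then 1 else 0 := by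
    simp only [Pi.single_apply, Finset.sum_ite_eq']
  rw [partialSign, h]
  split_ifs <;> simp [zsign]

lemma partialSign_mul_self (s : Finset (Fin n)) (x : Fin n → ZMod 2) :
    partialSign s x * partialSign s x = 1 := zsign_mul_self _

/-- Left multiplication by the generators of the Clifford algebra. -/
def cliffordLeft (i : Fin n) : Matrix (Fin n → ZMod 2) (Fin n → ZMod 2) ℝ :=
  shiftMatrix (partialSign (Finset.Iio i)) (Pi.single i 1)

/-- Right multiplication by the generators of the Clifford algebra. -/
def cliffordRight (i : Fin n) : Matrix (Fin n → ZMod 2) (Fin n → ZMod 2) ℝ :=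
  shiftMatrix (partialSign (Finset.Ioi i)) (Pi.single i 1)

lemma single_add_single (i : Fin n) :
    (Pi.single i 1 + Pi.single i 1 : Fin n → ZMod 2) = 0 := by
  rw [← Pi.single_add]; rw [show (1 : ZMod 2) + 1 = 0 by decide, Pi.single_zero]

lemma cliffordLeft_mul_self (i : Fin n) : cliffordLeft i * cliffordLeft i = 1 := by
  rw [cliffordLeft, shiftMatrix_mul, single_add_single, ← shiftMatrix_zero_one]
  congr 1
  funext x
  rw [partialSign_add, ← mul_assoc, partialSign_mul_self, partialSign_single]
  simp

lemma cliffordLeft_anticomm {i j : Fin n} (h : i ≠ j) :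
    cliffordLeft i * cliffordLeft j = -(cliffordLeft j * cliffordLeft i) := by
  rw [cliffordLeft, cliffordLeft, shiftMatrix_mul, shiftMatrix_mul, neg_shiftMatrix,
    add_comm (Pi.single j 1 : Fin n → ZMod 2)]
  congr 1
  funext x
  simp only [partialSign_add, partialSign_single, Finset.mem_Iio]
  rcases h.lt_or_gt with h | h
  · rw [if_pos h, if_neg h.not_gt]; ring
  · rw [if_pos h, if_neg h.not_gt]; ring

/-- The shift in the coordinate `j` changes the sign of the left factor when `j < i`; the shift in
`i` changes that of the right factor when `i > j`. These are the same condition. -/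
lemma cliffordLeft_comm_right (i j : Fin n) :
    cliffordLeft i * cliffordRight j = cliffordRight j * cliffordLeft i := by
  rw [cliffordLeft, cliffordRight, shiftMatrix_mul, shiftMatrix_mul,
    add_comm (Pi.single j 1 : Fin n → ZMod 2)]
  congr 1
  funext x
  simp only [partialSign_add, partialSign_single, Finset.mem_Iio, Finset.mem_Ioi]
  split_ifs <;> ring

/-- For even `n` the centre of the Clifford algebra consists of the scalars. -/
lemma eq_smul_one_of_commute (hn : Even n) {M : Matrix (Fin n → ZMod 2) (Fin n → ZMod 2) ℝ}
    (hl : ∀ i, cliffordLeft i * M = M * cliffordLeft i)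
    (hr : ∀ i, cliffordRight i * M = M * cliffordRight i) : M = M 0 0 • 1 := by
  -- The product of the left and the right multiplication by the generator `i` shifts twice, so it
  -- is diagonal. Its entries are the parities of the coordinates other than `i`.
  have h1 : ∀ i x y, partialSign (Finset.univ.erase i) x * M x y =
      M x y * partialSign (Finset.univ.erase i) y := by
    intro i x y
    have h2 : cliffordLeft i * cliffordRight i * M = M * (cliffordLeft i * cliffordRight i) := by
      rw [mul_assoc, hr, ← mul_assoc, hl, mul_assoc]
    have h3 : (fun x => partialSign (Finset.Iio i) x *
        partialSign (Finset.Ioi i) (x + Pi.single i 1)) = partialSign (Finset.univ.erase i) := by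
      funext x
      rw [partialSign_add, partialSign_single, if_neg (by simp), mul_one]
      simp only [partialSign, ← zsign_add]
      rw [← Finset.sum_union]
      · congr 2
        ext j
        simp [lt_or_lt_iff_ne]
      · rw [Finset.disjoint_left]
        intro j hj hj'
        exact absurd (Finset.mem_Iio.1 hj) (Finset.mem_Ioi.1 hj').not_gt
    rw [cliffordLeft, cliffordRight, shiftMatrix_mul, single_add_single, h3] at h2
    have h4 := congrFun (congrFun h2 x) (y + 0)
    rw [mul_shiftMatrix_apply, shiftMatrix_mul_apply, add_zero, add_zero] at h4
    exact h4
  -- A nonzero entry at `(x, y)` forces those parities of `x` and `y` to agree for every `i`. Then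
  -- all differences `x i - y i` are equal to the difference of the total sums, which is `n` times
  -- itself and vanishes because `n` is even.
  have hdiag : ∀ x y, x ≠ y → M x y = 0 := by
    intro x y hxy
    by_contra hM
    have h2 : ∀ i, ∑ j ∈ Finset.univ.erase i, x j = ∑ j ∈ Finset.univ.erase i, y j := by
      intro i
      have h3 := h1 i x y
      rw [mul_comm] at h3
      exact zsign_inj (mul_left_cancel₀ hM h3)
    have h3 : ∀ i, x i - y i = ∑ j, x j - ∑ j, y j := by
      intro i
      rw [← Finset.add_sum_erase _ x (Finset.mem_univ i),
        ← Finset.add_sum_erase _ y (Finset.mem_univ i), h2 i]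
      ring
    have h4 : (∑ j, x j - ∑ j, y j : ZMod 2) = 0 := by
      rw [← Finset.sum_sub_distrib, Finset.sum_congr rfl fun i _ => h3 i]
      obtain ⟨k, hk⟩ := hn
      generalize (∑ j, x j - ∑ j, y j : ZMod 2) = d
      rw [Finset.sum_const, Finset.card_univ, Fintype.card_fin, hk, add_smul,
        CharTwo.add_self_eq_zero]
    exact hxy (funext fun i => sub_eq_zero.1 ((h3 i).trans h4))
  -- Commuting with the left generators makes the diagonal invariant under all shifts, hence
  -- constant.
  have hshift : ∀ i x, M (x + Pi.single i 1) (x + Pi.single i 1) = M x x := by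
    intro i x
    have h2 := congrFun (congrFun (hl i) x) (x + Pi.single i 1)
    rw [cliffordLeft, mul_shiftMatrix_apply, shiftMatrix_mul_apply, mul_comm] at h2
    refine mul_right_cancel₀ ?_ h2
    intro h5
    have h6 := partialSign_mul_self (Finset.Iio i) x
    rw [h5] at h6
    norm_num at h6
  have hall : ∀ (s : Finset (Fin n)) (x : Fin n → ZMod 2), M (∑ i ∈ s, Pi.single i (x i)) (∑ i ∈ s, Pi.single i (x i))
      = M 0 0 := by
    intro s x
    induction s using Finset.induction_on with
    | empty => simp
    | insert i s hi ih =>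
      rw [Finset.sum_insert hi, add_comm]
      have h2 : ∀ z : ZMod 2, z = 0 ∨ z = 1 := by decide
      rcases h2 (x i) with h | h
      · rw [h, Pi.single_zero, add_zero, ih]
      · rw [h, hshift, ih]
  ext x y
  rw [Matrix.smul_apply, Matrix.one_apply]
  split_ifs with h
  · subst h
    rw [smul_eq_mul, mul_one, ← hall Finset.univ x, Finset.univ_sum_single]
  · rw [hdiag x y h, smul_zero]

/-- The element of the Clifford algebra given by a vector. -/
def clifford (v : Fin n → ℝ) : Matrix (Fin n → ZMod 2) (Fin n → ZMod 2) ℝ :=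
  ∑ i, v i • cliffordLeft i

lemma clifford_mul_add (v w : Fin n → ℝ) :
    clifford v * clifford w + clifford w * clifford v = (2 * (v ⬝ᵥ w)) • 1 := by
  have h : ∀ k l : Fin n, cliffordLeft k * cliffordLeft l + cliffordLeft l * cliffordLeft k =
      if k = l then (2 : ℝ) • (1 : Matrix (Fin n → ZMod 2) (Fin n → ZMod 2) ℝ) else 0 := by
    intro k l
    split_ifs with h
    · subst h; rw [cliffordLeft_mul_self, two_smul]
    · rw [cliffordLeft_anticomm h, neg_add_cancel]
  have h2 : clifford v * clifford w + clifford w * clifford v = ∑ k, ∑ l, (v k * w l) •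
        (cliffordLeft k * cliffordLeft l + cliffordLeft l * cliffordLeft k) := by
    simp only [clifford, Finset.sum_mul_sum, smul_add, Finset.sum_add_distrib, smul_mul_smul_comm]
    congr 1
    rw [Finset.sum_comm]
    exact Finset.sum_congr rfl fun k _ => Finset.sum_congr rfl fun l _ => by rw [mul_comm]
  rw [h2, dotProduct]
  simp only [h, smul_ite, smul_zero, Finset.sum_ite_eq, Finset.mem_univ, if_true, smul_smul,
    ← Finset.sum_smul, Finset.mul_sum]
  congr 1
  exact Finset.sum_congr rfl fun k _ => by ring

lemma clifford_add (v w : Fin n → ℝ) : clifford (v + w) = clifford v + clifford w := by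
  simp [clifford, add_smul, Finset.sum_add_distrib]

lemma clifford_smul (c : ℝ) (v : Fin n → ℝ) : clifford (c • v) = c • clifford v := by
  simp [clifford, mul_smul, Finset.smul_sum]

lemma clifford_comm_right (v : Fin n → ℝ) (i : Fin n) :
    clifford v * cliffordRight i = cliffordRight i * clifford v := by
  simp only [clifford, Finset.mul_sum, Finset.sum_mul, mul_smul_comm, smul_mul_assoc,
    cliffordLeft_comm_right]

/-- The Clifford generators rotated by the matrix `A`. -/
def rotatedClifford (A : Matrix (Fin n) (Fin n) ℝ) (j : Fin n) :
    Matrix (Fin n → ZMod 2) (Fin n → ZMod 2) ℝ := clifford fun i => A i j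

lemma rotatedClifford_mul_add (A : Matrix (Fin n) (Fin n) ℝ) (i j : Fin n) :
    rotatedClifford A i * rotatedClifford A j + rotatedClifford A j * rotatedClifford A i =
      (2 * (A.transpose * A) i j) • 1 :=
  clifford_mul_add _ _

/-- A lift of the orthogonal matrix `A` to the Clifford algebra, up to a factor, which may be zero
unless `A` is close to `1`. -/
def cliffordLift (A : Matrix (Fin n) (Fin n) ℝ) :
    Matrix (Fin n → ZMod 2) (Fin n → ZMod 2) ℝ :=
  intertwiner (rotatedClifford A) cliffordLeft (List.finRange n)

lemma rotatedClifford_mul_self {A : Matrix (Fin n) (Fin n) ℝ} (hA : A.transpose * A = 1)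
    (i : Fin n) : rotatedClifford A i * rotatedClifford A i = 1 := by
  have h := rotatedClifford_mul_add A i i
  rw [hA, Matrix.one_apply_eq, mul_one, ← two_smul ℝ] at h
  exact smul_right_injective _ (two_ne_zero (α := ℝ)) h

lemma rotatedClifford_anticomm {A : Matrix (Fin n) (Fin n) ℝ} (hA : A.transpose * A = 1)
    {i j : Fin n} (h : i ≠ j) :
    rotatedClifford A i * rotatedClifford A j =
      -(rotatedClifford A j * rotatedClifford A i) := by
  have h1 := rotatedClifford_mul_add A i j
  rw [hA, Matrix.one_apply_ne h, mul_zero, zero_smul] at h1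
  exact eq_neg_of_add_eq_zero_left h1

/-- This is the invariance of the average `intertwiner`, with one generator moved to the other side
by means of its square being `1`. -/
lemma rotatedClifford_mul_lift {A : Matrix (Fin n) (Fin n) ℝ} (hA : A.transpose * A = 1)
    (j : Fin n) : rotatedClifford A j * cliffordLift A = cliffordLift A * cliffordLeft j := by
  have h := intertwiner_conj (rotatedClifford_mul_self hA) cliffordLeft_mul_self
    (fun i j h => rotatedClifford_anticomm hA h) (fun i j h => cliffordLeft_anticomm h)
    (List.mem_finRange j)
  rw [cliffordLift]
  conv_rhs => rw [← h]
  rw [mul_assoc, mul_assoc, cliffordLeft_mul_self, mul_one]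

lemma rotatedClifford_mul (A B : Matrix (Fin n) (Fin n) ℝ) (j : Fin n) :
    rotatedClifford (A * B) j = ∑ k, B k j • rotatedClifford A k := by
  simp only [rotatedClifford, clifford, Matrix.mul_apply, Finset.sum_smul, Finset.smul_sum, smul_smul]
  rw [Finset.sum_comm]
  exact Finset.sum_congr rfl fun i _ => Finset.sum_congr rfl fun j _ => by rw [mul_comm]

lemma rotatedClifford_one (j : Fin n) : rotatedClifford 1 j = cliffordLeft j := by
  simp [rotatedClifford, clifford, Matrix.one_apply]

lemma continuous_cliffordLift : Continuous (cliffordLift (n := n)) := by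
  have h : ∀ j, Continuous fun A : Matrix (Fin n) (Fin n) ℝ => rotatedClifford A j := fun j => by
    unfold rotatedClifford clifford
    fun_prop
  have h2 : ∀ l, Continuous fun A : Matrix (Fin n) (Fin n) ℝ =>
      intertwiner (rotatedClifford A) cliffordLeft l := by
    intro l
    induction l with
    | nil => exact continuous_const
    | cons i l ih => exact ih.add (((h i).mul ih).mul continuous_const)
  exact h2 _

/-- At the identity all `2 ^ n` summands of the average equal `1`. By continuity the lift is
invertible near the identity, although it may vanish elsewhere. -/
lemma cliffordLift_one : cliffordLift (1 : Matrix (Fin n) (Fin n) ℝ) = (2 : ℝ) ^ n • 1 := by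
  have h : ∀ l : List (Fin n), intertwiner (rotatedClifford 1) cliffordLeft l =
      (2 : ℝ) ^ l.length • 1 := by
    intro l
    induction l with
    | nil => simp [intertwiner]
    | cons i l ih =>
      rw [intertwiner, ih, rotatedClifford_one, mul_smul_comm, smul_mul_assoc, mul_one,
        cliffordLeft_mul_self, ← two_smul ℝ, smul_smul, List.length_cons, pow_succ']
  rw [cliffordLift, h, List.length_finRange]

/-- `M` implements the rotation `A` on the Clifford generators and commutes with the right
multiplications. -/
def Implements (A : Matrix (Fin n) (Fin n) ℝ)
    (M : Matrix (Fin n → ZMod 2) (Fin n → ZMod 2) ℝ) : Prop :=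
  (∀ j, rotatedClifford A j * M = M * cliffordLeft j) ∧
    ∀ i, cliffordRight i * M = M * cliffordRight i

lemma implements_cliffordLift {A : Matrix (Fin n) (Fin n) ℝ} (hA : A.transpose * A = 1) :
    Implements A (cliffordLift A) := by
  refine ⟨rotatedClifford_mul_lift hA, fun i => ?_⟩
  have h : ∀ l, Commute (cliffordRight i) (intertwiner (rotatedClifford A) cliffordLeft l) := by
    intro l
    induction l with
    | nil => exact Commute.one_right _
    | cons k l ih =>
      exact ih.add_right (((show Commute _ _ from (clifford_comm_right _ i).symm).mul_right ih).mul_right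
        (cliffordLeft_comm_right k i).symm)
  exact h _

lemma Implements.mul {A B : Matrix (Fin n) (Fin n) ℝ}
    {M N : Matrix (Fin n → ZMod 2) (Fin n → ZMod 2) ℝ} (hM : Implements A M)
    (hN : Implements B N) : Implements (A * B) (M * N) := by
  refine ⟨fun j => ?_, fun i => ?_⟩
  · rw [mul_assoc, ← hN.1, ← mul_assoc, rotatedClifford_mul, Finset.sum_mul]
    simp only [smul_mul_assoc, hM.1]
    rw [rotatedClifford, clifford]
    simp only [← mul_smul_comm, ← Finset.mul_sum, mul_assoc]
  · rw [← mul_assoc, hM.2, mul_assoc, hN.2, mul_assoc]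

lemma implements_one : Implements (1 : Matrix (Fin n) (Fin n) ℝ) 1 :=
  ⟨fun j => by rw [rotatedClifford_one, mul_one, one_mul], fun i => by rw [mul_one, one_mul]⟩

/-- What implements the identity commutes with all left and right multiplications, so it is central.
For a closed loop, the sign of this scalar is the homotopy invariant. -/
lemma Implements.eq_smul_one (hn : Even n) {M : Matrix (Fin n → ZMod 2) (Fin n → ZMod 2) ℝ}
    (hM : Implements (1 : Matrix (Fin n) (Fin n) ℝ) M) : M = M 0 0 • 1 :=
  eq_smul_one_of_commute hn (fun i => by rw [← rotatedClifford_one, hM.1, rotatedClifford_one])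
    hM.2

end Clifford

end

/-! ### Rotations of a plane and their spinors. -/

noncomputable section

open scoped Matrix unitInterval

section Rotation

variable {n : ℕ}

lemma mem_specialOrthogonal_iff {A : Matrix (Fin n) (Fin n) ℝ} :
    A ∈ Matrix.specialOrthogonalGroup (Fin n) ℝ ↔ Aᵀ * A = 1 ∧ A.det = 1 := by
  rw [Matrix.mem_specialOrthogonalGroup_iff, Matrix.mem_orthogonalGroup_iff']

lemma transpose_mul_of_mem {A : Matrix (Fin n) (Fin n) ℝ}
    (hA : A ∈ Matrix.specialOrthogonalGroup (Fin n) ℝ) : Aᵀ * A = 1 :=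
  (mem_specialOrthogonal_iff.1 hA).1

lemma mul_transpose_of_mem {A : Matrix (Fin n) (Fin n) ℝ}
    (hA : A ∈ Matrix.specialOrthogonalGroup (Fin n) ℝ) : A * Aᵀ = 1 :=
  mul_eq_one_comm.1 (transpose_mul_of_mem hA)

lemma transpose_mem_specialOrthogonal {A : Matrix (Fin n) (Fin n) ℝ}
    (hA : A ∈ Matrix.specialOrthogonalGroup (Fin n) ℝ) :
    Aᵀ ∈ Matrix.specialOrthogonalGroup (Fin n) ℝ := by
  rw [mem_specialOrthogonal_iff, Matrix.transpose_transpose, Matrix.det_transpose]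
  exact ⟨mul_transpose_of_mem hA, (mem_specialOrthogonal_iff.1 hA).2⟩

/-- The rotation by the angle `θ` in the plane with the orthonormal basis `x`, `y`. -/
def planeRotation (x y : Fin n → ℝ) (θ : ℝ) : Matrix (Fin n) (Fin n) ℝ :=
  1 + (Real.cos θ - 1) • (Matrix.vecMulVec x x + Matrix.vecMulVec y y) +
    Real.sin θ • (Matrix.vecMulVec y x - Matrix.vecMulVec x y)

lemma planeRotation_mulVec (x y v : Fin n → ℝ) (θ : ℝ) : planeRotation x y θ *ᵥ v =
    v + (Real.cos θ - 1) • ((x ⬝ᵥ v) • x + (y ⬝ᵥ v) • y) +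
      Real.sin θ • ((x ⬝ᵥ v) • y - (y ⬝ᵥ v) • x) := by
  simp [planeRotation, Matrix.add_mulVec, Matrix.smul_mulVec, Matrix.sub_mulVec,
    Matrix.vecMulVec_mulVec]

lemma planeRotation_zero (x y : Fin n → ℝ) : planeRotation x y 0 = 1 := by
  simp [planeRotation]

lemma planeRotation_transpose (x y : Fin n → ℝ) (θ : ℝ) :
    (planeRotation x y θ)ᵀ = planeRotation x y (-θ) := by
  simp only [planeRotation, Matrix.transpose_add, Matrix.transpose_smul, Matrix.transpose_sub,
    Matrix.transpose_vecMulVec, Matrix.transpose_one, Real.cos_neg, Real.sin_neg, neg_smul,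
    ← smul_neg, neg_sub]

lemma continuous_planeRotation {M : Type*} [TopologicalSpace M] {θ : M → ℝ} (x y : Fin n → ℝ)
    (hθ : Continuous θ) : Continuous fun m => planeRotation x y (θ m) := by
  unfold planeRotation
  fun_prop

variable {x y : Fin n → ℝ} (hx : x ⬝ᵥ x = 1) (hy : y ⬝ᵥ y = 1) (hxy : x ⬝ᵥ y = 0)
include hx hy hxy

lemma planeRotation_mul (α β : ℝ) :
    planeRotation x y α * planeRotation x y β = planeRotation x y (α + β) := by
  have hyx : y ⬝ᵥ x = 0 := by rw [dotProduct_comm, hxy]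
  refine Matrix.ext_of_mulVec_single fun i => ?_
  generalize (Pi.single i 1 : Fin n → ℝ) = v
  rw [← Matrix.mulVec_mulVec]
  simp only [planeRotation_mulVec, dotProduct_add, dotProduct_smul, dotProduct_sub, hx, hy, hxy,
    hyx, Real.cos_add, Real.sin_add, smul_eq_mul]
  module

lemma planeRotation_mem (θ : ℝ) :
    planeRotation x y θ ∈ Matrix.specialOrthogonalGroup (Fin n) ℝ := by
  have h : ∀ θ, (planeRotation x y θ)ᵀ * planeRotation x y θ = 1 := fun θ => by
    rw [planeRotation_transpose, planeRotation_mul hx hy hxy, neg_add_cancel, planeRotation_zero]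
  rw [mem_specialOrthogonal_iff]
  refine ⟨h θ, ?_⟩
  -- The rotation is the square of the one by half the angle, so its determinant is a square.
  have h1 := congrArg Matrix.det (h (θ / 2))
  rw [Matrix.det_mul, Matrix.det_transpose, Matrix.det_one] at h1
  rw [← add_halves θ, ← planeRotation_mul hx hy hxy, Matrix.det_mul, h1]

/-- The lift to the Clifford algebra of the rotation by the angle `2 α`. -/
def planeSpinor (x y : Fin n → ℝ) (α : ℝ) : Matrix (Fin n → ZMod 2) (Fin n → ZMod 2) ℝ :=
  Real.cos α • 1 + Real.sin α • (clifford y * clifford x)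

omit hx hy hxy in
lemma continuous_planeSpinor (x y : Fin n → ℝ) : Continuous (planeSpinor x y) := by
  unfold planeSpinor
  fun_prop

omit hx hy hxy in
lemma clifford_mul_self {x : Fin n → ℝ} (hx : x ⬝ᵥ x = 1) : clifford x * clifford x = 1 := by
  have h := clifford_mul_add x x
  rw [hx, mul_one, ← two_smul ℝ] at h
  exact smul_right_injective _ (two_ne_zero (α := ℝ)) h

/-- The product of the Clifford elements of `y` and `x` has the square `-1`, so spinors multiply
like `exp (i α)`. -/
lemma planeSpinor_mul (α β : ℝ) :
    planeSpinor x y α * planeSpinor x y β = planeSpinor x y (α + β) := by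
  have h1 := clifford_mul_add x y
  rw [hxy, mul_zero, zero_smul] at h1
  have h2 : clifford y * clifford x * (clifford y * clifford x) = -1 := by
    have h3 : clifford y * clifford x * (clifford y * clifford x) =
        clifford y * (clifford x * clifford y) * clifford x := by noncomm_ring
    rw [h3, eq_neg_of_add_eq_zero_left h1]
    have h4 : clifford y * -(clifford y * clifford x) * clifford x =
        -((clifford y * clifford y) * (clifford x * clifford x)) := by noncomm_ring
    rw [h4, clifford_mul_self hx, clifford_mul_self hy, mul_one]
  simp only [planeSpinor, add_mul, mul_add, smul_mul_smul_comm, h2, one_mul, mul_one,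
    Real.cos_add, Real.sin_add]
  module

/-- The angle is doubled: a full turn, `α = π`, corresponds to the spinor `-1`. This sign separates
the two classes of loops. -/
lemma implements_planeSpinor (α : ℝ) :
    Implements (planeRotation x y (2 * α)) (planeSpinor x y α) := by
  constructor
  · intro j
    set v : Fin n → ℝ := Pi.single j 1
    have h0 : clifford v = cliffordLeft j := by
      rw [← rotatedClifford_one, rotatedClifford]
      congr 1
      funext i
      simp [v, Matrix.one_apply, Pi.single_apply]
    have h1 : rotatedClifford (planeRotation x y (2 * α)) j =
        clifford (planeRotation x y (2 * α) *ᵥ v) := by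
      rw [Matrix.mulVec_single_one]; rfl
    rw [h1, ← h0, planeRotation_mulVec]
    have hXY := clifford_mul_add x y
    rw [hxy, mul_zero, zero_smul] at hXY
    have hXX := clifford_mul_self hx
    have hYY := clifford_mul_self hy
    have hXV := clifford_mul_add x v
    have hYV := clifford_mul_add y v
    simp only [clifford_add, clifford_smul, sub_eq_add_neg, ← neg_smul]
    rw [planeSpinor]
    set X := clifford x
    set Y := clifford y
    set V := clifford v
    set a := x ⬝ᵥ v
    set b := y ⬝ᵥ v
    have e1 : X * (Y * X) = -Y := by
      rw [← mul_assoc, eq_neg_of_add_eq_zero_left hXY, neg_mul, mul_assoc, hXX, mul_one]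
    have e2 : Y * (Y * X) = X := by rw [← mul_assoc, hYY, one_mul]
    have e3 : Y * X * V = V * (Y * X) + (2 * a) • Y - (2 * b) • X := by
      have h2 : X * V = (2 * a) • 1 - V * X := eq_sub_of_add_eq hXV
      have h3 : Y * V = (2 * b) • 1 - V * Y := eq_sub_of_add_eq hYV
      rw [mul_assoc, h2, mul_sub, ← mul_assoc, h3, sub_mul, mul_smul_comm, mul_one,
        smul_mul_assoc, one_mul, mul_assoc]
      abel
    simp only [add_mul, mul_add, smul_mul_assoc, mul_smul_comm, mul_one, one_mul, e1, e2, e3,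
      Real.cos_two_mul, Real.sin_two_mul, smul_add, smul_sub, smul_smul]
    have hs : Real.sin α ^ 2 = 1 - Real.cos α ^ 2 := Real.sin_sq α
    match_scalars <;> ring_nf <;> (try simp only [hs]) <;> ring
  · intro i
    have h : Commute (cliffordRight i) (planeSpinor x y α) := by
      have h1 : ∀ v : Fin n → ℝ, Commute (cliffordRight i) (clifford v) :=
        fun v => (clifford_comm_right v i).symm
      exact ((Commute.one_right _).smul_right _).add_right
        (((h1 y).mul_right (h1 x)).smul_right _)
    exact h

end Rotation

end

/-! ### A full turn is not null-homotopic. -/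

noncomputable section

open scoped Matrix unitInterval

section Loops

variable {n : ℕ} {ℓ : ℝ}

/-- A homotopy through `ℓ`-periodic functions with values in `SO_n`. -/
structure IsLoopHomotopy (ℓ : ℝ) (H : I × ℝ → Matrix (Fin n) (Fin n) ℝ) : Prop where
  continuous : Continuous H
  mem : ∀ a, H a ∈ Matrix.specialOrthogonalGroup (Fin n) ℝ
  periodic : ∀ s t, H (s, t + ℓ) = H (s, t)

/-- The functions `F` and `G` are homotopic through `ℓ`-periodic functions with values in `SO_n`. -/
def LoopHomotopic (ℓ : ℝ) (F G : ℝ → Matrix (Fin n) (Fin n) ℝ) : Prop :=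
  ∃ H : I × ℝ → Matrix (Fin n) (Fin n) ℝ, IsLoopHomotopy ℓ H ∧ (∀ t, H (0, t) = F t) ∧
    ∀ t, H (1, t) = G t

lemma IsLoopHomotopy.transpose_mul {H : I × ℝ → Matrix (Fin n) (Fin n) ℝ}
    (h : IsLoopHomotopy ℓ H) (a : I × ℝ) : (H a)ᵀ * H a = 1 :=
  transpose_mul_of_mem (h.mem a)

lemma IsLoopHomotopy.mul_transpose {H : I × ℝ → Matrix (Fin n) (Fin n) ℝ}
    (h : IsLoopHomotopy ℓ H) (a : I × ℝ) : H a * (H a)ᵀ = 1 :=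
  mul_transpose_of_mem (h.mem a)

/-- The product of the lifts of the increments of `F` on a grid of mesh `d`. -/
def liftAlong (F : ℝ → Matrix (Fin n) (Fin n) ℝ) (d : ℝ) :
    ℕ → Matrix (Fin n → ZMod 2) (Fin n → ZMod 2) ℝ
  | 0 => 1
  | k + 1 => liftAlong F d k * cliffordLift ((F (k * d))ᵀ * F (k * d + d))

lemma implements_liftAlong {F : ℝ → Matrix (Fin n) (Fin n) ℝ} (h : ∀ t, (F t)ᵀ * F t = 1)
    (h' : ∀ t, F t * (F t)ᵀ = 1) (d : ℝ) (k : ℕ) :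
    Implements ((F 0)ᵀ * F (k * d)) (liftAlong F d k) := by
  induction k with
  | zero =>
    rw [Nat.cast_zero, zero_mul, h]
    exact implements_one
  | succ k ih =>
    have h1 := ih.mul (implements_cliffordLift (A := (F (k * d))ᵀ * F (k * d + d)) ?_)
    · rwa [mul_assoc, ← mul_assoc (F (k * d)), h', one_mul,
        show (F 0)ᵀ * F (k * d + d) = (F 0)ᵀ * F ((k + 1 : ℕ) * d) by
          rw [show (k : ℝ) * d + d = ((k + 1 : ℕ) : ℝ) * d by push_cast; ring]] at h1
    · rw [Matrix.transpose_mul, Matrix.transpose_transpose, mul_assoc, ← mul_assoc (F (k * d)), h',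
        one_mul, h]

/-- For `d = 0` the increment is `1`, where the lift is `2 ^ n`. Compactness of `I × [0, ℓ]` gives
one bound on the mesh for all points of the homotopy. -/
lemma eventually_det_cliffordLift_ne_zero {H : I × ℝ → Matrix (Fin n) (Fin n) ℝ}
    (h : IsLoopHomotopy ℓ H) : ∀ᶠ d in 𝓝 (0 : ℝ), ∀ a ∈ (Set.univ : Set I) ×ˢ Set.Icc 0 ℓ,
      (cliffordLift ((H a)ᵀ * H (a.1, a.2 + d))).det ≠ 0 := by
  refine (isCompact_univ.prod isCompact_Icc).eventually_forall_of_forall_eventually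
    fun a _ => ?_
  have h1 : Continuous fun z : ℝ × (I × ℝ) =>
      (cliffordLift ((H z.2)ᵀ * H (z.2.1, z.2.2 + z.1))).det := by
    refine (continuous_cliffordLift.comp ?_).matrix_det
    have h2 : Continuous fun z : ℝ × (I × ℝ) => H (z.2.1, z.2.2 + z.1) :=
      h.continuous.comp (by fun_prop)
    exact ((h.continuous.comp continuous_snd).matrix_transpose).mul h2
  refine h1.continuousAt.eventually_ne ?_
  simp only [add_zero, h.transpose_mul, cliffordLift_one, Matrix.det_smul, Matrix.det_one, mul_one]
  positivity

/-- Lift and spinor implement the same rotation, so they differ by a scalar. It depends continuously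
on `α` and is positive at `α = 0`. -/
lemma eventually_cliffordLift_planeRotation (hn : Even n) {x y : Fin n → ℝ} (hx : x ⬝ᵥ x = 1)
    (hy : y ⬝ᵥ y = 1) (hxy : x ⬝ᵥ y = 0) : ∀ᶠ α in 𝓝 (0 : ℝ), ∃ μ : ℝ, 0 < μ ∧
      cliffordLift (planeRotation x y (2 * α)) = μ • planeSpinor x y α := by
  have h1 : Continuous fun α : ℝ => (cliffordLift (planeRotation x y (2 * α)) *
      planeSpinor x y (-α)) 0 0 := by
    have h2 : Continuous fun α : ℝ => cliffordLift (planeRotation x y (2 * α)) :=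
      continuous_cliffordLift.comp (continuous_planeRotation x y (by fun_prop))
    exact (h2.mul ((continuous_planeSpinor x y).comp continuous_neg)).matrix_elem 0 0
  have h2 : 0 < (fun α : ℝ => (cliffordLift (planeRotation x y (2 * α)) *
      planeSpinor x y (-α)) 0 0) 0 := by
    simp only [mul_zero, neg_zero, planeRotation_zero, cliffordLift_one]
    simp [planeSpinor]
  filter_upwards [h1.continuousAt.eventually (lt_mem_nhds h2)] with α hα
  refine ⟨_, hα, ?_⟩
  have h3 := ((implements_cliffordLift (transpose_mul_of_mem (planeRotation_mem hx hy hxy (2 * α)))).mul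
    (implements_planeSpinor hx hy hxy (-α)))
  rw [planeRotation_mul hx hy hxy, mul_neg, add_neg_cancel, planeRotation_zero] at h3
  have h4 := congrArg (· * planeSpinor x y α) (h3.eq_smul_one hn)
  simp only [mul_assoc, planeSpinor_mul hx hy hxy, neg_add_cancel, smul_mul_assoc, one_mul] at h4
  simpa [planeSpinor] using h4

/-- A full turn in a plane is not homotopic to a constant loop. -/
theorem not_loopHomotopic_planeRotation (hn : Even n) (hℓ : 0 < ℓ) {x y : Fin n → ℝ}
    (hx : x ⬝ᵥ x = 1) (hy : y ⬝ᵥ y = 1) (hxy : x ⬝ᵥ y = 0) :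
    ¬ LoopHomotopic ℓ (fun _ => 1) fun t => planeRotation x y (2 * Real.pi * t / ℓ) := by
  rintro ⟨H, hH, h0, h1⟩
  have e1 : Filter.Tendsto (fun N : ℕ => ℓ / (N : ℝ)) Filter.atTop (𝓝 0) :=
    tendsto_const_div_atTop_nhds_zero_nat ℓ
  have e2 : Filter.Tendsto (fun N : ℕ => Real.pi / (N : ℝ)) Filter.atTop (𝓝 0) :=
    tendsto_const_div_atTop_nhds_zero_nat _
  obtain ⟨N, hN1, hN2, hN0⟩ := ((e1.eventually (eventually_det_cliffordLift_ne_zero hH)).and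
    ((e2.eventually (eventually_cliffordLift_planeRotation hn hx hy hxy)).and
      (Filter.eventually_gt_atTop 0))).exists
  have hN0' : (0 : ℝ) < N := Nat.cast_pos.2 hN0
  set d := ℓ / (N : ℝ) with hd
  have hNd : (N : ℝ) * d = ℓ := by rw [hd]; field_simp
  -- For each `s` the loop closes after `N` steps, so `S s N` is a scalar. It is continuous in `s`
  -- and never zero for this mesh, but positive for the constant loop and negative for the full
  -- turn.
  let S : I → ℕ → Matrix (Fin n → ZMod 2) (Fin n → ZMod 2) ℝ := fun s k =>
    liftAlong (fun t => H (s, t)) d k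
  have hS : ∀ s, S s N = S s N 0 0 • 1 := fun s => by
    have h2 := implements_liftAlong (F := fun t => H (s, t)) (fun t => hH.transpose_mul _)
      (fun t => hH.mul_transpose _) d N
    have h3 : H (s, ℓ) = H (s, 0) := by simpa using hH.periodic s 0
    simp only [hNd, h3, hH.transpose_mul] at h2
    exact h2.eq_smul_one hn
  have hdet : ∀ s, ∀ k ≤ N, (S s k).det ≠ 0 := by
    intro s k hk
    induction k with
    | zero => simp [S, liftAlong]
    | succ k ih =>
      simp only [S, liftAlong, Matrix.det_mul]
      refine mul_ne_zero (ih (by omega)) (hN1 (s, k * d) ⟨trivial, ?_, ?_⟩)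
      · have : 0 ≤ d := by positivity
        positivity
      · rw [← hNd]
        have : (k : ℝ) ≤ N := by exact_mod_cast (Nat.le_of_succ_le hk)
        have : 0 ≤ d := by positivity
        simp only
        gcongr
  have hcont : Continuous fun s => S s N 0 0 := by
    have h2 : ∀ k, Continuous fun s => S s k := by
      intro k
      induction k with
      | zero => exact continuous_const
      | succ k ih =>
        refine ih.mul (continuous_cliffordLift.comp ?_)
        have h3 : ∀ t : ℝ, Continuous fun s : I => H (s, t) := fun t =>
          hH.continuous.comp (by fun_prop)
        exact (h3 _).matrix_transpose.mul (h3 _)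
    exact (h2 N).matrix_elem 0 0
  have hne : ∀ s, S s N 0 0 ≠ 0 := fun s h2 => by
    have h3 := hdet s N le_rfl
    rw [hS s, h2, zero_smul] at h3
    exact h3 (Matrix.det_zero)
  have hS0 : 0 < S 0 N 0 0 := by
    have h2 : ∀ k, S 0 k = ((2 : ℝ) ^ n) ^ k • 1 := by
      intro k
      induction k with
      | zero => simp [S, liftAlong]
      | succ k ih =>
        have h3 : S 0 (k + 1) = S 0 k * cliffordLift 1 := by
          simp only [S, liftAlong, h0, Matrix.transpose_one, mul_one]
        rw [h3, ih, cliffordLift_one, smul_mul_smul_comm, mul_one, pow_succ]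
    rw [h2, Matrix.smul_apply, Matrix.one_apply_eq]
    positivity
  -- Each of the `N` steps is a rotation by `2π / N` with a spinor of angle `π / N`, so the total
  -- angle of the spinor is `π`.
  have hS1 : S 1 N 0 0 < 0 := by
    obtain ⟨μ, hμ, h2⟩ := hN2
    have h3 : ∀ k : ℕ, S 1 k = μ ^ k • planeSpinor x y (k * (Real.pi / N)) := by
      intro k
      induction k with
      | zero => simp [S, liftAlong, planeSpinor]
      | succ k ih =>
        have h4 : S 1 (k + 1) = S 1 k * cliffordLift (planeRotation x y (2 * (Real.pi / N))) := by
          simp only [S, liftAlong, h1, planeRotation_transpose, planeRotation_mul hx hy hxy]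
          congr 3
          rw [hd]
          field_simp
          ring
        rw [h4, ih, h2, smul_mul_smul_comm, planeSpinor_mul hx hy hxy, pow_succ]
        congr 2
        push_cast
        ring
    rw [h3, mul_div_cancel₀ _ hN0'.ne']
    have : 0 < μ ^ N := by positivity
    simpa [planeSpinor] using this
  obtain ⟨s, hs⟩ := mem_range_of_exists_le_of_exists_ge hcont ⟨1, hS1.le⟩ ⟨0, hS0.le⟩
  exact hne s hs

end Loops

end

/-! ### Operations on loops, and reflections. -/

noncomputable section

open scoped Matrix unitInterval

section LoopAlgebra

variable {n : ℕ} {ℓ : ℝ}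

/-- `ℓ`-periodic continuous functions with values in `SO_n`. -/
structure IsLoop (ℓ : ℝ) (F : ℝ → Matrix (Fin n) (Fin n) ℝ) : Prop where
  continuous : Continuous F
  mem : ∀ t, F t ∈ Matrix.specialOrthogonalGroup (Fin n) ℝ
  periodic : ∀ t, F (t + ℓ) = F t

lemma isLoop_const {A : Matrix (Fin n) (Fin n) ℝ}
    (hA : A ∈ Matrix.specialOrthogonalGroup (Fin n) ℝ) : IsLoop ℓ fun _ => A :=
  ⟨continuous_const, fun _ => hA, fun _ => rfl⟩

lemma IsLoopHomotopy.isLoop {H : I × ℝ → Matrix (Fin n) (Fin n) ℝ} (h : IsLoopHomotopy ℓ H)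
    (s : I) : IsLoop ℓ fun t => H (s, t) :=
  ⟨h.continuous.comp (by fun_prop), fun _ => h.mem _, fun t => h.periodic s t⟩

namespace LoopHomotopic

variable {F G K F' G' : ℝ → Matrix (Fin n) (Fin n) ℝ}

lemma left (h : LoopHomotopic ℓ F G) : IsLoop ℓ F := by
  obtain ⟨H, hH, h0, -⟩ := h
  have := hH.isLoop 0
  rwa [funext h0] at this

lemma right (h : LoopHomotopic ℓ F G) : IsLoop ℓ G := by
  obtain ⟨H, hH, -, h1⟩ := h
  have := hH.isLoop 1
  rwa [funext h1] at this

lemma refl (h : IsLoop ℓ F) : LoopHomotopic ℓ F F :=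
  ⟨fun a => F a.2, ⟨h.1.comp continuous_snd, fun _ => h.2 _, fun _ _ => h.3 _⟩,
    fun _ => rfl, fun _ => rfl⟩

lemma symm (h : LoopHomotopic ℓ F G) : LoopHomotopic ℓ G F := by
  obtain ⟨H, hH, h0, h1⟩ := h
  exact ⟨fun a => H (unitInterval.symm a.1, a.2), ⟨hH.1.comp (by fun_prop), fun _ => hH.2 _,
    fun _ _ => hH.3 _ _⟩, fun t => by simp [h1], fun t => by simp [h0]⟩

/-- Lets transitivity be taken from `ContinuousMap.HomotopicWith`. -/
lemma iff_homotopicWith (hF : Continuous F) (hG : Continuous G) : LoopHomotopic ℓ F G ↔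
    ContinuousMap.HomotopicWith ⟨F, hF⟩ ⟨G, hG⟩ fun f => IsLoop ℓ (f : ℝ → _) := by
  constructor
  · rintro ⟨H, hH, h0, h1⟩
    exact ⟨{ toFun := H, continuous_toFun := hH.1, map_zero_left := h0, map_one_left := h1,
             prop' := fun s => hH.isLoop s }⟩
  · rintro ⟨H⟩
    exact ⟨H.toContinuousMap, ⟨H.continuous, fun a => (H.prop a.1).mem a.2,
      fun s t => (H.prop s).periodic t⟩, H.apply_zero, H.apply_one⟩

lemma trans (h : LoopHomotopic ℓ F G) (h' : LoopHomotopic ℓ G K) : LoopHomotopic ℓ F K := by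
  have h1 := (iff_homotopicWith h.left.1 h.right.1).1 h
  have h2 := (iff_homotopicWith h'.left.1 h'.right.1).1 h'
  exact (iff_homotopicWith h.left.1 h'.right.1).2 (h1.trans h2)

lemma mul (h : LoopHomotopic ℓ F G) (h' : LoopHomotopic ℓ F' G') :
    LoopHomotopic ℓ (fun t => F t * F' t) fun t => G t * G' t := by
  obtain ⟨H, hH, h0, h1⟩ := h
  obtain ⟨H', hH', h0', h1'⟩ := h'
  exact ⟨fun a => H a * H' a, ⟨hH.1.mul hH'.1, fun a => mul_mem (hH.2 a) (hH'.2 a),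
    fun s t => by rw [hH.3, hH'.3]⟩, fun t => by simp only [h0, h0'], fun t => by simp only [h1, h1']⟩

lemma transpose (h : LoopHomotopic ℓ F G) :
    LoopHomotopic ℓ (fun t => (F t)ᵀ) fun t => (G t)ᵀ := by
  obtain ⟨H, hH, h0, h1⟩ := h
  exact ⟨fun a => (H a)ᵀ, ⟨hH.1.matrix_transpose, fun a => transpose_mem_specialOrthogonal (hH.2 a),
    fun s t => by rw [hH.3]⟩, fun t => by simp only [h0], fun t => by simp only [h1]⟩

end LoopHomotopic

section Reflection

/-- The reflection in the hyperplane orthogonal to the vector `u`. -/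
def vecReflection (u : Fin n → ℝ) : Matrix (Fin n) (Fin n) ℝ :=
  1 - (2 / (u ⬝ᵥ u)) • Matrix.vecMulVec u u

lemma vecReflection_mulVec (u v : Fin n → ℝ) :
    vecReflection u *ᵥ v = v - (2 * (u ⬝ᵥ v) / (u ⬝ᵥ u)) • u := by
  simp only [vecReflection, Matrix.sub_mulVec, Matrix.one_mulVec, Matrix.smul_mulVec,
    Matrix.vecMulVec_mulVec, op_smul_eq_smul, smul_smul]
  ring_nf

lemma vecReflection_transpose (u : Fin n → ℝ) : (vecReflection u)ᵀ = vecReflection u := by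
  simp [vecReflection, Matrix.transpose_sub, Matrix.transpose_vecMulVec]

lemma vecReflection_mul_self {u : Fin n → ℝ} (hu : u ≠ 0) :
    vecReflection u * vecReflection u = 1 := by
  have h : u ⬝ᵥ u ≠ 0 := fun h => hu (dotProduct_self_eq_zero.1 h)
  refine Matrix.ext_of_mulVec_single fun i => ?_
  rw [← Matrix.mulVec_mulVec, vecReflection_mulVec, vecReflection_mulVec, Matrix.one_mulVec,
    dotProduct_sub, dotProduct_smul, smul_eq_mul]
  field_simp
  module

lemma vecReflection_det {u : Fin n → ℝ} (hu : u ≠ 0) : (vecReflection u).det = -1 := by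
  have h : u ⬝ᵥ u ≠ 0 := fun h => hu (dotProduct_self_eq_zero.1 h)
  have h1 : vecReflection u = 1 + Matrix.replicateCol Unit (-(2 / (u ⬝ᵥ u)) • u) *
      Matrix.replicateRow Unit u := by
    ext i j
    simp [vecReflection, Matrix.vecMulVec_apply, Matrix.mul_apply]
    ring
  rw [h1, Matrix.det_one_add_replicateCol_mul_replicateRow, dotProduct_smul, smul_eq_mul]
  field_simp
  norm_num

lemma vecReflection_mul_mem {u v : Fin n → ℝ} (hu : u ≠ 0) (hv : v ≠ 0) :
    vecReflection u * vecReflection v ∈ Matrix.specialOrthogonalGroup (Fin n) ℝ := by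
  rw [mem_specialOrthogonal_iff, Matrix.transpose_mul, vecReflection_transpose,
    vecReflection_transpose, Matrix.det_mul, vecReflection_det hu, vecReflection_det hv]
  refine ⟨?_, by norm_num⟩
  rw [mul_assoc, ← mul_assoc (vecReflection u), vecReflection_mul_self hu, one_mul,
    vecReflection_mul_self hv]

lemma Continuous.vecReflection {M : Type*} [TopologicalSpace M] {u : M → Fin n → ℝ}
    (hu : Continuous u) (h : ∀ m, u m ≠ 0) : Continuous fun m => vecReflection (u m) := by
  have h1 : Continuous fun m => 2 / (u m ⬝ᵥ u m) :=
    continuous_const.div (hu.dotProduct hu) fun m h2 => h m (dotProduct_self_eq_zero.1 h2)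
  exact continuous_const.sub (h1.smul (hu.matrix_vecMulVec hu))

lemma add_smul_ne_zero_of_unit {a b : Fin n → ℝ} (ha : a ⬝ᵥ a = 1) (hb : b ⬝ᵥ b = 1)
    (hab : a + b ≠ 0) (s : I) : a + (s : ℝ) • b ≠ 0 := by
  intro h
  have h1 : a = (-(s : ℝ)) • b := by rw [neg_smul]; exact eq_neg_of_add_eq_zero_left h
  have h2 : (s : ℝ) * s = 1 := by
    rw [h1, smul_dotProduct, dotProduct_smul, hb, smul_eq_mul, smul_eq_mul] at ha
    linarith
  have h3 : (s : ℝ) = 1 := by nlinarith [s.2.1]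
  rw [h3, one_smul] at h
  exact hab h

/-- The orbit of a vector under a loop can be moved to any curve that avoids the antipodes. -/
lemma exists_loopHomotopic_mulVec_eq {F : ℝ → Matrix (Fin n) (Fin n) ℝ} (hF : IsLoop ℓ F)
    {T : Set (Fin n → ℝ)} (hT : ∀ v ∈ T, ∀ t, F t *ᵥ v = v) {x : Fin n → ℝ} (hx : x ⬝ᵥ x = 1)
    (hxT : ∀ v ∈ T, x ⬝ᵥ v = 0) {w : ℝ → Fin n → ℝ} (hw : Continuous w)
    (hper : ∀ t, w (t + ℓ) = w t) (hw1 : ∀ t, w t ⬝ᵥ w t = 1) (hwT : ∀ v ∈ T, ∀ t, w t ⬝ᵥ v = 0)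
    (hne : ∀ t, F t *ᵥ x + w t ≠ 0) :
    ∃ G, LoopHomotopic ℓ F G ∧ (∀ v ∈ T, ∀ t, G t *ᵥ v = v) ∧ ∀ t, G t *ᵥ x = w t := by
  have hFF : ∀ t v v', (F t *ᵥ v) ⬝ᵥ (F t *ᵥ v') = v ⬝ᵥ v' := fun t v v' => by
    rw [Matrix.dotProduct_mulVec, Matrix.vecMul_mulVec, transpose_mul_of_mem (hF.mem t),
      Matrix.vecMul_one]
  set a : ℝ → Fin n → ℝ := fun t => F t *ᵥ x with ha
  have ha1 : ∀ t, a t ⬝ᵥ a t = 1 := fun t => (hFF t x x).trans hx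
  have haT : ∀ v ∈ T, ∀ t, a t ⬝ᵥ v = 0 := fun v hv t => by
    rw [← hxT v hv, ← hFF t x v, hT v hv]
  have ha0 : ∀ t, a t ≠ 0 := fun t h => by have := ha1 t; simp [h] at this
  have hac : Continuous a := hF.continuous.matrix_mulVec continuous_const
  have hu0 : ∀ p : I × ℝ, a p.2 + (p.1 : ℝ) • w p.2 ≠ 0 := fun p =>
    add_smul_ne_zero_of_unit (ha1 _) (hw1 _) (hne _) _
  have hfix : ∀ v ∈ T, ∀ t (s : ℝ), vecReflection (a t + s • w t) *ᵥ v = v := fun v hv t s => by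
    rw [vecReflection_mulVec, add_dotProduct, smul_dotProduct, haT v hv, hwT v hv]
    simp
  -- The loop is multiplied by the reflection in `a + s w` after the reflection in `a`. For `s = 0`
  -- this product is the identity, and for `s = 1` it takes `a` to `w`. The vectors of `T` are
  -- orthogonal to `a` and `w`, so they stay fixed.
  refine ⟨fun t => vecReflection (a t + (1 : ℝ) • w t) * vecReflection (a t) * F t,
    ⟨fun p => vecReflection (a p.2 + (p.1 : ℝ) • w p.2) * vecReflection (a p.2) * F p.2,
      ⟨?_, ?_, ?_⟩, ?_, ?_⟩, ?_, ?_⟩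
  · have h1 : Continuous fun p : I × ℝ => a p.2 + (p.1 : ℝ) • w p.2 := by fun_prop
    exact ((h1.vecReflection hu0).mul ((hac.comp continuous_snd).vecReflection
      fun p => ha0 p.2)).mul (hF.continuous.comp continuous_snd)
  · exact fun p => mul_mem (vecReflection_mul_mem (hu0 p) (ha0 _)) (hF.mem _)
  · intro s t
    simp only [ha, hF.periodic, hper]
  · intro t
    simp [vecReflection_mul_self (ha0 t)]
  · intro t
    simp
  · intro v hv t
    have h1 := hfix v hv t 0
    rw [zero_smul, add_zero] at h1
    rw [← Matrix.mulVec_mulVec, ← Matrix.mulVec_mulVec, hT v hv, h1, hfix v hv]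
  · intro t
    rw [← Matrix.mulVec_mulVec, ← Matrix.mulVec_mulVec]
    change vecReflection (a t + (1 : ℝ) • w t) *ᵥ (vecReflection (a t) *ᵥ a t) = w t
    have h1 : vecReflection (a t) *ᵥ a t = -a t := by
      rw [vecReflection_mulVec, ha1]
      module
    have h2 : (a t + w t) ⬝ᵥ (a t + w t) ≠ 0 := fun h => hne t (dotProduct_self_eq_zero.1 h)
    have h3 : (a t + w t) ⬝ᵥ (a t + w t) = 2 * ((a t + w t) ⬝ᵥ a t) := by
      simp only [add_dotProduct, dotProduct_add, ha1, hw1, dotProduct_comm (w t) (a t)]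
      ring
    rw [h1, one_smul, vecReflection_mulVec, dotProduct_neg]
    rw [show 2 * -((a t + w t) ⬝ᵥ a t) / ((a t + w t) ⬝ᵥ (a t + w t)) = -1 by
      rw [div_eq_iff h2, h3]; ring]
    module

end Reflection

end LoopAlgebra

end

/-! ### Making the orbit of one more basis vector constant. -/

noncomputable section

open scoped Matrix unitInterval

section LoopReduction

variable {n : ℕ} {ℓ : ℝ}

/-- A continuous periodic function is approximated by a periodic `C¹` function, which vanishes if
the given function vanishes. -/
lemma exists_contDiff_periodic_near (hℓ : 0 < ℓ) {a : ℝ → ℝ} (ha : Continuous a)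
    (hper : Function.Periodic a ℓ) {δ : ℝ} (hδ : 0 < δ) :
    ∃ w : ℝ → ℝ, ContDiff ℝ 1 w ∧ Function.Periodic w ℓ ∧ (∀ t, |w t - a t| ≤ δ) ∧
      ((∀ t, a t = 0) → ∀ t, w t = 0) := by
  have h1 : ∀ᶠ d in 𝓝 (0 : ℝ), ∀ t ∈ Set.Icc 0 ℓ, |a (t + d) - a t| < δ := by
    refine isCompact_Icc.eventually_forall_of_forall_eventually fun t _ => ?_
    have h2 : Continuous fun z : ℝ × ℝ => |a (z.2 + z.1) - a z.2| := by fun_prop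
    refine h2.continuousAt.eventually (gt_mem_nhds ?_)
    simpa using hδ
  obtain ⟨ε, hε, h2⟩ := Metric.eventually_nhds_iff.1 h1
  -- Periodicity extends the modulus of continuity from `[0, ℓ]` to the line.
  have h3 : ∀ t, ∀ d, |d| < ε → |a (t + d) - a t| < δ := by
    intro t d hd
    obtain ⟨r, hr, hrt⟩ := hper.exists_mem_Ico₀ hℓ t
    obtain ⟨r', hr', hrt'⟩ : ∃ r' : ℝ, r' ∈ Set.Ico 0 ℓ ∧ ∃ k : ℤ, t = r' + k * ℓ := by
      refine ⟨toIcoMod hℓ 0 t, by simpa using toIcoMod_mem_Ico hℓ 0 t, toIcoDiv hℓ 0 t, ?_⟩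
      have := toIcoMod_add_toIcoDiv_zsmul hℓ 0 t
      rw [zsmul_eq_mul] at this
      exact this.symm
    obtain ⟨k, rfl⟩ := hrt'
    have h4 := h2 (y := d) (by simpa using hd) r' ⟨hr'.1, hr'.2.le⟩
    have h5 := hper.int_mul k
    rw [add_right_comm, h5, h5]
    exact h4
  -- The approximation is the mean of `a` over the window `[t, t + h]`. It is continuously
  -- differentiable and inherits the period, and it differs from `a` by at most `δ` since `h < ε`.
  set h := ε / 2 with hh
  have hh0 : 0 < h := by positivity
  refine ⟨fun t => h⁻¹ * ∫ r in t..t + h, a r, ?_, ?_, ?_, ?_⟩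
  · have h4 : ContDiff ℝ 1 fun t => ∫ r in (0 : ℝ)..t, a r := by
      rw [contDiff_one_iff_deriv]
      have h5 : ∀ t, HasDerivAt (fun t => ∫ r in (0 : ℝ)..t, a r) (a t) t := fun t =>
        intervalIntegral.integral_hasDerivAt_right (ha.intervalIntegrable _ _)
          (ha.stronglyMeasurableAtFilter _ _) ha.continuousAt
      refine ⟨fun t => (h5 t).differentiableAt, ?_⟩
      rwa [show deriv (fun t => ∫ r in (0 : ℝ)..t, a r) = a from funext fun t => (h5 t).deriv]
    have h6 : (fun t => ∫ r in t..t + h, a r) =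
        fun t => (∫ r in (0 : ℝ)..(t + h), a r) - ∫ r in (0 : ℝ)..t, a r := by
      funext t
      rw [intervalIntegral.integral_interval_sub_left] <;> exact ha.intervalIntegrable _ _
    have h7 : ContDiff ℝ 1 fun t => ∫ r in (0 : ℝ)..(t + h), a r :=
      h4.comp (contDiff_id.add contDiff_const)
    refine contDiff_const.mul ?_
    rw [h6]
    exact h7.sub h4
  · intro t
    simp only
    congr 1
    rw [add_right_comm, ← intervalIntegral.integral_comp_add_right]
    simp only [hper _]
  · intro t
    have h4 : (∫ r in t..t + h, (a r - a t)) = (∫ r in t..t + h, a r) - h * a t := by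
      rw [intervalIntegral.integral_sub (ha.intervalIntegrable _ _)
        (continuous_const.intervalIntegrable _ _)]
      simp
    have h5 : ‖∫ r in t..t + h, (a r - a t)‖ ≤ δ * |t + h - t| := by
      refine intervalIntegral.norm_integral_le_of_norm_le_const fun r hr => ?_
      rw [Set.uIoc_of_le (by linarith)] at hr
      have h6 := h3 t (r - t) (by rw [abs_of_pos (by linarith [hr.1])]; linarith [hr.2])
      rw [add_sub_cancel] at h6
      exact h6.le
    rw [h4, add_sub_cancel_left, abs_of_pos hh0, Real.norm_eq_abs] at h5
    have h6 : h⁻¹ * (∫ r in t..t + h, a r) - a t = h⁻¹ * ((∫ r in t..t + h, a r) - h * a t) := by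
      field_simp
    rw [h6, abs_mul, abs_of_pos (inv_pos.2 hh0), inv_mul_le_iff₀ hh0, mul_comm h δ]
    exact h5
  · intro h0 t
    simp [h0]

/-- A loop that fixes the first `k` basis vectors, where `k + 3 ≤ n`, can be moved to a loop that
fixes one more. -/
lemma exists_loopHomotopic_fix_succ (hℓ : 0 < ℓ) {k : ℕ} (hk : k + 3 ≤ n)
    {F : ℝ → Matrix (Fin n) (Fin n) ℝ} (hF : IsLoop ℓ F)
    (hfix : ∀ j : Fin n, j.1 < k → ∀ t, F t *ᵥ Pi.single j 1 = Pi.single j 1) :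
    ∃ G, LoopHomotopic ℓ F G ∧
      ∀ j : Fin n, j.1 < k + 1 → ∀ t, G t *ᵥ Pi.single j 1 = Pi.single j 1 := by
  set T : Set (Fin n → ℝ) := {v | ∃ j : Fin n, j.1 < k ∧ v = Pi.single j 1} with hTdef
  have hTof : ∀ {G : ℝ → Matrix (Fin n) (Fin n) ℝ},
      (∀ j : Fin n, j.1 < k → ∀ t, G t *ᵥ Pi.single j 1 = Pi.single j 1) →
      ∀ v ∈ T, ∀ t, G t *ᵥ v = v := by
    rintro G hG _ ⟨j, hj, rfl⟩ t
    exact hG j hj t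
  have hToperp : ∀ {u : Fin n → ℝ}, (∀ j : Fin n, j.1 < k → u j = 0) → ∀ v ∈ T, u ⬝ᵥ v = 0 := by
    rintro u hu _ ⟨j, hj, rfl⟩
    rw [dotProduct_single, hu j hj, zero_mul]
  -- Indices start at `0`, so this is the first basis vector that is not fixed yet.
  let i₀ : Fin n := ⟨k, by omega⟩
  set x : Fin n → ℝ := Pi.single i₀ 1 with hx
  have hx1 : x ⬝ᵥ x = 1 := by simp [hx]
  have hxT : ∀ j : Fin n, j.1 < k → x j = 0 := fun j hj => by
    rw [hx, Pi.single_eq_of_ne]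
    rintro rfl
    exact absurd hj (lt_irrefl _)
  have hFF : ∀ t v v', (F t *ᵥ v) ⬝ᵥ (F t *ᵥ v') = v ⬝ᵥ v' := fun t v v' => by
    rw [Matrix.dotProduct_mulVec, Matrix.vecMul_mulVec, transpose_mul_of_mem (hF.mem t),
      Matrix.vecMul_one]
  set a : ℝ → Fin n → ℝ := fun t => F t *ᵥ x with ha
  have ha1 : ∀ t, a t ⬝ᵥ a t = 1 := fun t => (hFF t x x).trans hx1
  have ha0 : ∀ j : Fin n, j.1 < k → ∀ t, a t j = 0 := fun j hj t => by
    have h := hFF t x (Pi.single j 1)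
    rw [hfix j hj, dotProduct_single_one, dotProduct_single_one, hxT j hj] at h
    exact h
  have hac : Continuous a := hF.continuous.matrix_mulVec continuous_const
  have haper : ∀ t, a (t + ℓ) = a t := fun t => by simp only [ha, hF.periodic]
  -- With this bound for each coordinate the squared distance of `w` and `a` is at most `n / (n + 1)
  -- ^ 2 < 1`, so `w` is never zero and never a negative multiple of the unit vector `a`.
  choose w₀ hw1 hw2 hw3 hw4 using fun j : Fin n =>
    exists_contDiff_periodic_near hℓ (a := fun t => a t j) ((continuous_apply j).comp hac)
      (fun t => congrFun (haper t) j) (δ := 1 / (n + 1)) (by positivity)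
  let w : ℝ → Fin n → ℝ := fun t j => w₀ j t
  have hwper : ∀ t, w (t + ℓ) = w t := fun t => funext fun j => hw2 j t
  have hwz : ∀ j : Fin n, j.1 < k → ∀ t, w t j = 0 := fun j hj t => hw4 j (ha0 j hj) t
  have hwc : Continuous w := continuous_pi fun j => (hw1 j).continuous
  have hnear : ∀ (t c : ℝ), 0 ≤ c → w t ≠ -(c • a t) := by
    intro t c hc h
    have h1 : (w t - a t) ⬝ᵥ (w t - a t) = (1 + c) ^ 2 := by
      rw [h, show -(c • a t) - a t = (-(1 + c)) • a t by module, smul_dotProduct, dotProduct_smul,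
        ha1]
      simp only [smul_eq_mul]
      ring
    have h2 : (w t - a t) ⬝ᵥ (w t - a t) ≤ n * (1 / (n + 1)) ^ 2 := by
      calc (w t - a t) ⬝ᵥ (w t - a t) ≤ ∑ j : Fin n, (1 / ((n : ℝ) + 1)) ^ 2 := by
            refine Finset.sum_le_sum fun j _ => ?_
            rw [← sq, sq_le_sq, abs_of_pos (show (0 : ℝ) < 1 / (n + 1) by positivity)]
            exact hw3 j t
        _ = n * (1 / (n + 1)) ^ 2 := by simp
    have h3 : (n : ℝ) * (1 / (n + 1)) ^ 2 < 1 := by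
      have hn : (0 : ℝ) ≤ n := Nat.cast_nonneg n
      rw [div_pow, one_pow, mul_one_div, div_lt_one (by positivity)]
      nlinarith
    nlinarith
  have hw0 : ∀ t, w t ≠ 0 := fun t h => hnear t 0 le_rfl (by simp [h])
  -- a direction that is avoided by the curve `w`
  let J := {j : Fin n // k ≤ j.1}
  have hJ : 3 ≤ Fintype.card J := by
    have h1 : Fintype.card J = (Finset.Ici i₀).card :=
      Fintype.card_of_subtype _ fun j => by simp [i₀, Fin.le_def]
    rw [h1, Fin.card_Ici]
    simp only [i₀]
    omega
  -- The lines through the points of the `C¹` curve `w` form the image of a plane under a `C¹` map.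
  -- As at least three coordinates are free, the complement of this image is dense. This is the only
  -- use of the differentiability of `w`.
  have hdense := ContDiff.dense_compl_range_of_finrank_lt_finrank
    (f := fun p : ℝ × ℝ => fun j : J => p.2 * w p.1 j.1)
    (contDiff_pi.2 fun j => contDiff_snd.mul ((hw1 j.1).comp contDiff_fst))
    (by simp only [Module.finrank_prod, Module.finrank_self, Module.finrank_fintype_fun_eq_card]
        omega)
  -- Density also leaves room for a nonzero coordinate other than `i₀`, so that `z` is not a
  -- multiple of `x` either.
  obtain ⟨z', hz', hz1⟩ : ∃ z' : J → ℝ, (∀ p : ℝ × ℝ, z' ≠ fun j : J => p.2 * w p.1 j.1) ∧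
      ∃ j : J, j.1 ≠ i₀ ∧ z' j ≠ 0 := by
    have h1 : k + 1 < n := by omega
    let j₁ : J := ⟨⟨k + 1, h1⟩, by simp⟩
    have ho : IsOpen {z : J → ℝ | z j₁ ≠ 0} := isOpen_ne_fun (continuous_apply _) continuous_const
    obtain ⟨z, hz, hz'⟩ := hdense.inter_open_nonempty _ ho ⟨fun _ => 1, one_ne_zero⟩
    refine ⟨z, fun p hp => hz' ⟨p, hp.symm⟩, j₁, ?_, hz⟩
    intro h
    have := congrArg Fin.val h
    simp [j₁, i₀] at this
  let z : Fin n → ℝ := fun j => if hj : k ≤ j.1 then z' ⟨j, hj⟩ else 0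
  have hzJ : ∀ j : J, z j.1 = z' j := fun j => dif_pos j.2
  have hzz : ∀ j : Fin n, j.1 < k → z j = 0 := fun j hj => dif_neg hj.not_ge
  have hzw : ∀ t c, z ≠ c • w t := fun t c h => hz' (t, c) (funext fun j => by
    rw [← hzJ, h]; rfl)
  have hzx : ∀ c : ℝ, z ≠ c • x := by
    rintro c h
    obtain ⟨j, hj, hj'⟩ := hz1
    rw [← hzJ, h, Pi.smul_apply, hx, Pi.single_eq_of_ne hj, smul_zero] at hj'
    exact hj' rfl
  have hz0 : z ≠ 0 := fun h => hzx 0 (by rw [h, zero_smul])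
  -- normalization
  have hsq : ∀ u : Fin n → ℝ, u ≠ 0 → 0 < Real.sqrt (u ⬝ᵥ u) := fun u hu => by
    refine Real.sqrt_pos.2 (lt_of_le_of_ne ?_ fun h => hu (dotProduct_self_eq_zero.1 h.symm))
    exact Finset.sum_nonneg fun i _ => mul_self_nonneg _
  have hunit : ∀ u : Fin n → ℝ, u ≠ 0 →
      ((Real.sqrt (u ⬝ᵥ u))⁻¹ • u) ⬝ᵥ ((Real.sqrt (u ⬝ᵥ u))⁻¹ • u) = 1 := fun u hu => by
    have h1 := hsq u hu
    have h2 : Real.sqrt (u ⬝ᵥ u) * Real.sqrt (u ⬝ᵥ u) = u ⬝ᵥ u :=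
      Real.mul_self_sqrt (Real.sqrt_pos.1 h1).le
    rw [smul_dotProduct, dotProduct_smul, smul_eq_mul, smul_eq_mul, ← mul_assoc, ← mul_inv, h2,
      inv_mul_cancel₀ (Real.sqrt_pos.1 h1).ne']
  -- The orbit of `x` is moved three times: to the normalized curve `w`, then to the constant
  -- direction of `z`, then to `x`. Antipodes are avoided by `hnear`, `hzw` and `hzx`, respectively.
  obtain ⟨G₁, hG₁, hG₁f, hG₁x⟩ := exists_loopHomotopic_mulVec_eq hF (hTof hfix) hx1
    (hToperp hxT) (w := fun t => (Real.sqrt (w t ⬝ᵥ w t))⁻¹ • w t)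
    (((hwc.dotProduct hwc).sqrt.inv₀ fun t => (hsq _ (hw0 t)).ne').smul hwc)
    (fun t => by simp only [hwper]) (fun t => hunit _ (hw0 t))
    (fun v hv t => by rw [smul_dotProduct, hToperp (fun j hj => hwz j hj t) v hv, smul_zero])
    (fun t h => hnear t (Real.sqrt (w t ⬝ᵥ w t)) (Real.sqrt_nonneg _) (by
      have h1 := (hsq _ (hw0 t)).ne'
      rw [show a t = _ from eq_neg_of_add_eq_zero_left h, smul_neg, neg_neg, smul_smul,
        mul_inv_cancel₀ h1, one_smul]))
  obtain ⟨G₂, hG₂, hG₂f, hG₂x⟩ := exists_loopHomotopic_mulVec_eq hG₁.right hG₁f hx1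
    (hToperp hxT) (w := fun _ => (Real.sqrt (z ⬝ᵥ z))⁻¹ • z) continuous_const
    (fun _ => rfl) (fun _ => hunit _ hz0)
    (fun v hv _ => by rw [smul_dotProduct, hToperp hzz v hv, smul_zero])
    (fun t h => by
      rw [hG₁x] at h
      refine hzw t (-(Real.sqrt (z ⬝ᵥ z)) * (Real.sqrt (w t ⬝ᵥ w t))⁻¹) ?_
      rw [mul_smul, eq_neg_of_add_eq_zero_left h, neg_smul, smul_neg, neg_neg, smul_smul,
        mul_inv_cancel₀ (hsq _ hz0).ne', one_smul])
  obtain ⟨G₃, hG₃, hG₃f, hG₃x⟩ := exists_loopHomotopic_mulVec_eq hG₂.right hG₂f hx1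
    (hToperp hxT) (w := fun _ => x) continuous_const (fun _ => rfl) (fun _ => hx1)
    (fun v hv _ => hToperp hxT v hv)
    (fun t h => by
      rw [hG₂x] at h
      refine hzx (-(Real.sqrt (z ⬝ᵥ z))) ?_
      rw [neg_smul, ← smul_neg, ← eq_neg_of_add_eq_zero_left h, smul_smul,
        mul_inv_cancel₀ (hsq _ hz0).ne', one_smul])
  refine ⟨G₃, (hG₁.trans hG₂).trans hG₃, fun j hj t => ?_⟩
  rcases Nat.lt_succ_iff_lt_or_eq.1 hj with h | h
  · exact hG₃f _ ⟨j, h, rfl⟩ t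
  · have : j = i₀ := Fin.ext h
    rw [this]
    exact hG₃x t

end LoopReduction

end

/-! ### Classification of the loops in `SO_n`. -/

noncomputable section

open scoped Matrix unitInterval

section LoopReduction

variable {n : ℕ} {ℓ : ℝ}

/-- The induction stops with two free basis vectors, because each step needs three free dimensions
before it. -/
lemma exists_loopHomotopic_fix (hℓ : 0 < ℓ) {F : ℝ → Matrix (Fin n) (Fin n) ℝ} (hF : IsLoop ℓ F)
    (k : ℕ) (hk : k + 2 ≤ n) : ∃ G, LoopHomotopic ℓ F G ∧
      ∀ j : Fin n, j.1 < k → ∀ t, G t *ᵥ Pi.single j 1 = Pi.single j 1 := by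
  induction k with
  | zero => exact ⟨F, .refl hF, fun j hj => absurd hj (Nat.not_lt_zero _)⟩
  | succ k ih =>
    obtain ⟨G, hG, hG'⟩ := ih (by omega)
    obtain ⟨K, hK, hK'⟩ := exists_loopHomotopic_fix_succ hℓ (k := k) (by omega) hG.right hG'
    exact ⟨K, hG.trans hK, hK'⟩

/-- A matrix in `SO_n` that fixes all basis vectors but one is the identity. -/
lemma eq_one_of_fix {A : Matrix (Fin n) (Fin n) ℝ}
    (hA : A ∈ Matrix.specialOrthogonalGroup (Fin n) ℝ) (q : Fin n)
    (h : ∀ j, j ≠ q → A *ᵥ Pi.single j 1 = Pi.single j 1) : A = 1 := by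
  have h1 : ∀ i j, j ≠ q → A i j = if i = j then 1 else 0 := fun i j hj => by
    have := congrFun (h j hj) i
    rwa [Matrix.mulVec_single_one, Pi.single_apply] at this
  have h2 : ∀ j, j ≠ q → A j q = 0 := fun j hj => by
    have h3 := congrFun (congrFun (transpose_mul_of_mem hA) j) q
    rw [Matrix.mul_apply, Matrix.one_apply_ne hj] at h3
    simpa [h1 _ j hj] using h3
  have h3 : A = Matrix.diagonal fun j => if j = q then A q q else 1 := by
    ext i j
    rw [Matrix.diagonal_apply]
    by_cases hj : j = q
    · subst hj
      by_cases hi : i = j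
      · simp [hi]
      · simp [hi, h2 i hi]
    · rw [h1 i j hj]
      by_cases hi : i = j
      · simp [hi, hj]
      · simp [hi]
  have h4 := (mem_specialOrthogonal_iff.1 hA).2
  rw [h3, Matrix.det_diagonal, Finset.prod_ite_eq' Finset.univ q] at h4
  simp only [Finset.mem_univ, if_true] at h4
  rw [h3, h4]
  simp

lemma isLoop_planeRotation {x y : Fin n → ℝ} (hx : x ⬝ᵥ x = 1) (hy : y ⬝ᵥ y = 1)
    (hxy : x ⬝ᵥ y = 0) (hℓ : 0 < ℓ) (k : ℤ) :
    IsLoop ℓ fun t => planeRotation x y (2 * Real.pi * k * t / ℓ) := by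
  refine ⟨continuous_planeRotation x y (by fun_prop), fun t => planeRotation_mem hx hy hxy _,
    fun t => ?_⟩
  have h : 2 * Real.pi * k * (t + ℓ) / ℓ = 2 * Real.pi * k * t / ℓ + k * (2 * Real.pi) := by
    field_simp
  simp only [h, planeRotation, Real.cos_add_int_mul_two_pi, Real.sin_add_int_mul_two_pi]

/-- Conjugation by the rotations of the plane of `y` and `z` up to the angle `π`, which reverses `y`
and fixes `x`, deforms the full turn to its inverse. So the double turn deforms to the product of
the full turn and its inverse. -/
lemma loopHomotopic_planeRotation_two {x y z : Fin n → ℝ} (hx : x ⬝ᵥ x = 1) (hy : y ⬝ᵥ y = 1)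
    (hxy : x ⬝ᵥ y = 0) (hz : z ⬝ᵥ z = 1) (hxz : x ⬝ᵥ z = 0) (hyz : y ⬝ᵥ z = 0) (hℓ : 0 < ℓ) :
    LoopHomotopic ℓ (fun t => planeRotation x y (2 * Real.pi * (2 : ℤ) * t / ℓ)) fun _ => 1 := by
  have hρ := isLoop_planeRotation hx hy hxy hℓ 1
  have h1 : LoopHomotopic ℓ (fun t => planeRotation x y (2 * Real.pi * (1 : ℤ) * t / ℓ))
      fun t => planeRotation x y (-(2 * Real.pi * (1 : ℤ) * t / ℓ)) := by
    refine ⟨fun p => planeRotation y z (Real.pi * p.1) *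
      planeRotation x y (2 * Real.pi * (1 : ℤ) * p.2 / ℓ) * (planeRotation y z (Real.pi * p.1))ᵀ,
      ⟨?_, fun p => ?_, fun s t => ?_⟩, fun t => ?_, fun t => ?_⟩
    · have h2 : Continuous fun p : I × ℝ => planeRotation y z (Real.pi * p.1) :=
        continuous_planeRotation y z (by fun_prop)
      exact (h2.mul (hρ.continuous.comp continuous_snd)).mul h2.matrix_transpose
    · exact mul_mem (mul_mem (planeRotation_mem hy hz hyz _) (hρ.mem _))
        (transpose_mem_specialOrthogonal (planeRotation_mem hy hz hyz _))
    · exact congrArg (fun A => planeRotation y z (Real.pi * s) * A *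
        (planeRotation y z (Real.pi * s))ᵀ) (hρ.periodic t)
    · simp [planeRotation_zero]
    · have hyx : y ⬝ᵥ x = 0 := by rw [dotProduct_comm, hxy]
      have hzx : z ⬝ᵥ x = 0 := by rw [dotProduct_comm, hxz]
      have hzy : z ⬝ᵥ y = 0 := by rw [dotProduct_comm, hyz]
      refine Matrix.ext_of_mulVec_single fun i => ?_
      generalize (Pi.single i 1 : Fin n → ℝ) = v
      simp only [planeRotation_transpose, ← Matrix.mulVec_mulVec]
      simp only [planeRotation_mulVec, Set.Icc.coe_one, mul_one, Real.cos_neg, Real.sin_neg,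
        Real.cos_pi, Real.sin_pi, dotProduct_add, dotProduct_smul, dotProduct_sub, hy, hz, hxy,
        hxz, hyz, hyx, hzx, hzy, smul_eq_mul]
      module
  have h2 := (LoopHomotopic.refl hρ).mul h1
  simp only [planeRotation_mul hx hy hxy, add_neg_cancel, planeRotation_zero] at h2
  convert h2 using 3
  push_cast
  ring

lemma loopHomotopic_planeRotation_int {x y z : Fin n → ℝ} (hx : x ⬝ᵥ x = 1) (hy : y ⬝ᵥ y = 1)
    (hxy : x ⬝ᵥ y = 0) (hz : z ⬝ᵥ z = 1) (hxz : x ⬝ᵥ z = 0) (hyz : y ⬝ᵥ z = 0) (hℓ : 0 < ℓ)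
    (k : ℤ) :
    LoopHomotopic ℓ (fun t => planeRotation x y (2 * Real.pi * k * t / ℓ)) (fun _ => 1) ∨
    LoopHomotopic ℓ (fun t => planeRotation x y (2 * Real.pi * k * t / ℓ))
      fun t => planeRotation x y (2 * Real.pi * t / ℓ) := by
  have h2 := loopHomotopic_planeRotation_two hx hy hxy hz hxz hyz hℓ
  have hnat : ∀ j : ℕ, LoopHomotopic ℓ
      (fun t => planeRotation x y (2 * Real.pi * (2 * j : ℤ) * t / ℓ)) (fun _ => 1) := by
    intro j
    induction j with
    | zero =>
      have h3 : LoopHomotopic ℓ (fun _ => (1 : Matrix (Fin n) (Fin n) ℝ)) (fun _ => 1) :=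
        .refl (isLoop_const (one_mem _))
      simpa [planeRotation_zero] using h3
    | succ j ih =>
      have h3 := ih.mul h2
      simp only [planeRotation_mul hx hy hxy, mul_one] at h3
      convert h3 using 3
      push_cast
      ring
  have hint : ∀ j : ℤ, LoopHomotopic ℓ
      (fun t => planeRotation x y (2 * Real.pi * (2 * j : ℤ) * t / ℓ)) (fun _ => 1) := by
    intro j
    rcases Int.eq_nat_or_neg j with ⟨i, rfl | rfl⟩
    · exact hnat i
    · have h3 := (hnat i).transpose
      simp only [planeRotation_transpose, Matrix.transpose_one] at h3
      convert h3 using 3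
      push_cast
      ring
  rcases Int.even_or_odd' k with ⟨j, rfl | rfl⟩
  · exact Or.inl (hint j)
  · right
    have h3 := (hint j).mul (.refl (isLoop_planeRotation hx hy hxy hℓ 1))
    simp only [planeRotation_mul hx hy hxy, one_mul] at h3
    convert h3 using 3
    · push_cast
      ring
    · push_cast
      ring

/-- Every loop in `SO_n`, `n ≥ 3`, is homotopic to the constant loop or to a full turn in the plane
of the last two coordinates. -/
theorem loopHomotopic_one_or (hn : 3 ≤ n) (hℓ : 0 < ℓ) {p q : Fin n} (hp : p.1 + 2 = n)
    (hq : q.1 + 1 = n) {F : ℝ → Matrix (Fin n) (Fin n) ℝ} (hF : IsLoop ℓ F) :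
    LoopHomotopic ℓ F (fun _ => 1) ∨ LoopHomotopic ℓ F fun t =>
      planeRotation (Pi.single p 1) (Pi.single q 1) (2 * Real.pi * t / ℓ) := by
  -- Only the last two coordinates move under `G`, so the column `p` is a curve in a circle, and its
  -- angle determines `G`.
  obtain ⟨G, hFG, hG⟩ := exists_loopHomotopic_fix hℓ hF p.1 hp.le
  have hGl := hFG.right
  set x : Fin n → ℝ := Pi.single p 1 with hxdef
  set y : Fin n → ℝ := Pi.single q 1 with hydef
  have hpq : p ≠ q := fun h => by rw [h] at hp; omega
  have hx : x ⬝ᵥ x = 1 := by simp [hxdef]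
  have hy : y ⬝ᵥ y = 1 := by simp [hydef]
  have hxy : x ⬝ᵥ y = 0 := by simp [hxdef, hydef, hpq.symm]
  let r : Fin n := ⟨0, by omega⟩
  have hrp : p ≠ r := fun h => by have := congrArg Fin.val h; simp only [r] at this; omega
  have hrq : q ≠ r := fun h => by have := congrArg Fin.val h; simp only [r] at this; omega
  have hzero : ∀ j : Fin n, j.1 < p.1 → ∀ t i, G t j i = if j = i then 1 else 0 := by
    intro j hj t i
    have h1 : (G t)ᵀ *ᵥ Pi.single j 1 = Pi.single j 1 := by
      conv_lhs => rw [← hG j hj t]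
      rw [Matrix.mulVec_mulVec, transpose_mul_of_mem (hGl.mem t), Matrix.one_mulVec]
    have h2 := congrFun h1 i
    rw [Matrix.mulVec_single_one, Pi.single_apply] at h2
    rw [show G t j i = (G t).transpose.col j i from rfl, h2]
    simp only [eq_comm]
  have hcol : ∀ t, G t p p ^ 2 + G t q p ^ 2 = 1 := by
    intro t
    have h1 := congrFun (congrFun (transpose_mul_of_mem (hGl.mem t)) p) p
    rw [Matrix.mul_apply, Matrix.one_apply_eq] at h1
    rw [← h1]
    have h2 : ∑ j, (G t)ᵀ p j * G t j p = ∑ j ∈ {p, q}, (G t)ᵀ p j * G t j p := by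
      refine (Finset.sum_subset (Finset.subset_univ _) fun j _ hj => ?_).symm
      have h3 : j.1 < p.1 := by
        by_contra h3
        refine hj ?_
        have := j.2
        rcases (show j.1 = p.1 ∨ j.1 = q.1 by omega) with h | h
        · simp [Fin.ext h]
        · simp [Fin.ext h]
      rw [hzero j h3, if_neg (fun h => by rw [h] at h3; exact lt_irrefl _ h3), mul_zero]
    rw [h2, Finset.sum_pair hpq, Matrix.transpose_apply, Matrix.transpose_apply]
    ring
  let c : C(ℝ, Circle) := ⟨fun t => ⟨⟨G t p p, G t q p⟩, by
      refine mem_sphere_zero_iff_norm.2 ?_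
      rw [← sq_eq_sq₀ (norm_nonneg _) zero_le_one, Complex.sq_norm, Complex.normSq_apply,
        one_pow, ← hcol t]
      ring⟩, by
    refine Continuous.subtype_mk ?_ _
    have h1 : (fun t => (⟨G t p p, G t q p⟩ : ℂ)) =
        fun t => ((G t p p : ℝ) : ℂ) + ((G t q p : ℝ) : ℂ) * Complex.I := by
      funext t
      exact Complex.mk_eq_add_mul_I _ _
    rw [h1]
    have := hGl.continuous
    fun_prop⟩
  -- The angle is a lift of the curve along the covering `Circle.exp`.
  obtain ⟨θ, ⟨-, hθ⟩, -⟩ := Circle.isCoveringMap_exp.existsUnique_continuousMap_lifts c 0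
    (Complex.arg (c 0)) (Circle.exp_arg _)
  have hθ' : ∀ t, (Circle.exp (θ t) : ℂ) = ⟨G t p p, G t q p⟩ := fun t =>
    congrArg (fun z : Circle => (z : ℂ)) (congrFun hθ t)
  have hcos : ∀ t, G t p p = Real.cos (θ t) := fun t => by
    have := congrArg Complex.re (hθ' t)
    rw [Circle.coe_exp, Complex.exp_ofReal_mul_I_re] at this
    exact this.symm
  have hsin : ∀ t, G t q p = Real.sin (θ t) := fun t => by
    have := congrArg Complex.im (hθ' t)
    rw [Circle.coe_exp, Complex.exp_ofReal_mul_I_im] at this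
    exact this.symm
  -- After the rotation by `-θ` all basis vectors but the last are fixed, so the last one is as well
  -- since the determinant is `1`.
  have hGrot : ∀ t, G t = planeRotation x y (θ t) := by
    intro t
    have h1 : planeRotation x y (-(θ t)) * G t = 1 := by
      refine eq_one_of_fix (mul_mem (planeRotation_mem hx hy hxy _) (hGl.mem t)) q fun j hj => ?_
      rw [← Matrix.mulVec_mulVec]
      have hj' := j.2
      rcases (show j.1 < p.1 ∨ j.1 = p.1 by
        have : j.1 ≠ q.1 := fun h => hj (Fin.ext h)
        omega) with h | h
      · rw [hG j h, planeRotation_mulVec]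
        have h2 : p ≠ j := fun h2 => by rw [h2] at h; exact lt_irrefl _ h
        simp [hxdef, hydef, h2, hj.symm]
      · obtain rfl : j = p := Fin.ext h
        have h2 : G t *ᵥ Pi.single j 1 = Real.cos (θ t) • x + Real.sin (θ t) • y := by
          rw [← hcos, ← hsin, Matrix.mulVec_single_one]
          funext i
          have hi := i.2
          rcases (show i.1 < j.1 ∨ i.1 = j.1 ∨ i.1 = q.1 by omega) with h3 | h3 | h3
          · have h4 : i ≠ j := fun h4 => by rw [h4] at h3; exact lt_irrefl _ h3
            have h5 : i ≠ q := fun h5 => by rw [h5] at h3; omega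
            simp [hxdef, hydef, h4, h5, hzero i h3]
          · obtain rfl : i = j := Fin.ext h3
            simp [hxdef, hydef, hpq]
          · obtain rfl : i = q := Fin.ext h3
            simp [hxdef, hydef, hpq.symm]
        have hyx : y ⬝ᵥ x = 0 := by rw [dotProduct_comm, hxy]
        rw [h2, planeRotation_mulVec]
        simp only [dotProduct_add, dotProduct_smul, hx, hy, hxy, hyx, Real.cos_neg, Real.sin_neg,
          smul_eq_mul]
        have h3 := Real.sin_sq_add_cos_sq (θ t)
        have h4 : x = (Real.sin (θ t) ^ 2 + Real.cos (θ t) ^ 2) • x := by rw [h3, one_smul]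
        change _ = x
        conv_rhs => rw [h4]
        module
    have h2 := congrArg (planeRotation x y (θ t) * ·) h1
    simpa [← mul_assoc, planeRotation_mul hx hy hxy, planeRotation_zero] using h2
  -- The increment of the angle over a period is an integral multiple of `2π` that depends
  -- continuously on `t`: the winding number.
  obtain ⟨k, hk⟩ : ∃ k : ℤ, ∀ t, θ (t + ℓ) = θ t + k * (2 * Real.pi) := by
    have h1 : ∀ t, ∃ k : ℤ, θ (t + ℓ) = θ t + k * (2 * Real.pi) := by
      intro t
      refine Circle.exp_eq_exp.1 (Subtype.ext ?_)
      rw [hθ', hθ', hGl.periodic]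
    choose κ hκ using h1
    have h2 : Continuous κ := by
      have h3 : Continuous fun t => (κ t : ℝ) := by
        have h4 : (fun t => (κ t : ℝ)) = fun t => (θ (t + ℓ) - θ t) / (2 * Real.pi) := by
          funext t
          rw [hκ t]
          field_simp
          ring
        rw [h4]
        fun_prop
      exact Int.isClosedEmbedding_coe_real.isInducing.continuous_iff.2 h3
    exact ⟨κ 0, fun t => by rw [hκ t, PreconnectedSpace.constant inferInstance h2 (x := t) (y := 0)]⟩
  -- Affine interpolation between `θ` and the uniform angle. Both increase by `2π k` over a period,
  -- so every intermediate function is a loop.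
  have h1 : LoopHomotopic ℓ G fun t => planeRotation x y (2 * Real.pi * k * t / ℓ) := by
    refine ⟨fun a => planeRotation x y ((1 - (a.1 : ℝ)) * θ a.2 + a.1 * (2 * Real.pi * k * a.2 / ℓ)),
      ⟨continuous_planeRotation x y (by fun_prop), fun a => planeRotation_mem hx hy hxy _,
        fun s t => ?_⟩, fun t => ?_, fun t => ?_⟩
    · have h2 : (1 - (s : ℝ)) * θ (t + ℓ) + s * (2 * Real.pi * k * (t + ℓ) / ℓ) =
          ((1 - (s : ℝ)) * θ t + s * (2 * Real.pi * k * t / ℓ)) + k * (2 * Real.pi) := by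
        rw [hk]
        field_simp
        ring
      simp only [h2, planeRotation, Real.cos_add_int_mul_two_pi, Real.sin_add_int_mul_two_pi]
    · simp [hGrot]
    · simp
  rcases loopHomotopic_planeRotation_int hx hy hxy (z := Pi.single r 1) (by simp)
    (by simp [hxdef, hrp]) (by simp [hydef, hrq]) hℓ k with h2 | h2
  · exact Or.inl ((hFG.trans h1).trans h2)
  · exact Or.inr ((hFG.trans h1).trans h2)

/-- Two loops that are not homotopic to a constant loop are homotopic to each other. -/
theorem loopHomotopic_of_not (hn : 3 ≤ n) (hℓ : 0 < ℓ) {F G : ℝ → Matrix (Fin n) (Fin n) ℝ}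
    (hF : IsLoop ℓ F) (hG : IsLoop ℓ G) (hF' : ¬ LoopHomotopic ℓ F fun _ => 1)
    (hG' : ¬ LoopHomotopic ℓ G fun _ => 1) : LoopHomotopic ℓ F G := by
  have h1 : n - 2 + 2 = n := by omega
  have h2 : n - 1 + 1 = n := by omega
  exact ((loopHomotopic_one_or hn hℓ (p := ⟨n - 2, by omega⟩) (q := ⟨n - 1, by omega⟩) h1 h2
    hF).resolve_left hF').trans ((loopHomotopic_one_or hn hℓ (p := ⟨n - 2, by omega⟩)
    (q := ⟨n - 1, by omega⟩) h1 h2 hG).resolve_left hG').symm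

end LoopReduction

end

/-! ### Components of the space of loops in `SO_n`. -/

noncomputable section

open scoped Matrix unitInterval

section LoopSpace

variable {n : ℕ} {ℓ : ℝ}

/-- The periodic matrix function that belongs to a map from the circle to `SO_n`. -/
def circleLoop (γ : C(AddCircle ℓ, Matrix.specialOrthogonalGroup (Fin n) ℝ)) (t : ℝ) :
    Matrix (Fin n) (Fin n) ℝ := (γ (t : AddCircle ℓ)).1

lemma isLoop_circleLoop (γ : C(AddCircle ℓ, Matrix.specialOrthogonalGroup (Fin n) ℝ)) :
    IsLoop ℓ (circleLoop γ) :=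
  ⟨continuous_subtype_val.comp (γ.continuous.comp (AddCircle.continuous_mk' ℓ)),
    fun _ => (γ _).2, fun t => by simp only [circleLoop, AddCircle.coe_add_period]⟩

lemma circleLoop_one :
    circleLoop (1 : C(AddCircle ℓ, Matrix.specialOrthogonalGroup (Fin n) ℝ)) = fun _ => 1 := rfl

/-- The product of the identity of `I` with the projection to the circle is an open quotient map, so
a periodic homotopy descends with joint continuity. -/
lemma exists_continuous_lift {H : I × ℝ → Matrix (Fin n) (Fin n) ℝ} (hH : IsLoopHomotopy ℓ H) :
    ∃ K : C(I × AddCircle ℓ, Matrix.specialOrthogonalGroup (Fin n) ℝ),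
      ∀ (s : I) (t : ℝ), (K (s, (t : AddCircle ℓ))).1 = H (s, t) := by
  have hper : ∀ s, Function.Periodic (fun t => (⟨H (s, t), hH.mem _⟩ :
      Matrix.specialOrthogonalGroup (Fin n) ℝ)) ℓ := fun s t => Subtype.ext (hH.periodic s t)
  refine ⟨⟨fun a => (hper a.1).lift a.2, ?_⟩, fun s t => rfl⟩
  have hq : IsOpenQuotientMap (Prod.map id (QuotientAddGroup.mk : ℝ → AddCircle ℓ) :
      I × ℝ → I × AddCircle ℓ) :=
    IsOpenQuotientMap.id.prodMap QuotientAddGroup.isOpenQuotientMap_mk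
  rw [hq.isQuotientMap.continuous_iff]
  exact hH.continuous.subtype_mk _

lemma joined_iff_loopHomotopic (hℓ : 0 < ℓ)
    {γ γ' : C(AddCircle ℓ, Matrix.specialOrthogonalGroup (Fin n) ℝ)} :
    Joined γ γ' ↔ LoopHomotopic ℓ (circleLoop γ) (circleLoop γ') := by
  have : Fact (0 < ℓ) := ⟨hℓ⟩
  constructor
  · rintro ⟨p⟩
    refine ⟨fun a => circleLoop (p a.1) a.2, ⟨?_, fun a => (isLoop_circleLoop _).mem _,
      fun s t => (isLoop_circleLoop _).periodic _⟩, fun t => by simp, fun t => by simp⟩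
    refine continuous_subtype_val.comp ?_
    exact (p.continuous.comp continuous_fst).eval
      ((AddCircle.continuous_mk' ℓ).comp continuous_snd)
  · rintro ⟨H, hH, h0, h1⟩
    obtain ⟨K, hK⟩ := exists_continuous_lift hH
    refine ⟨⟨K.curry, ?_, ?_⟩⟩
    · ext a : 1
      induction a using QuotientAddGroup.induction_on with
      | H t => exact Subtype.ext ((hK 0 t).trans (h0 t))
    · ext a : 1
      induction a using QuotientAddGroup.induction_on with
      | H t => exact Subtype.ext ((hK 1 t).trans (h1 t))

lemma exists_circleLoop_eq {F : ℝ → Matrix (Fin n) (Fin n) ℝ} (hF : IsLoop ℓ F) :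
    ∃ γ : C(AddCircle ℓ, Matrix.specialOrthogonalGroup (Fin n) ℝ), circleLoop γ = F := by
  obtain ⟨H, hH, h0, -⟩ := LoopHomotopic.refl hF
  obtain ⟨K, hK⟩ := exists_continuous_lift hH
  exact ⟨K.curry 0, funext fun t => (hK 0 t).trans (h0 t)⟩

lemma card_zerothHomotopy_eq_two {Z : Type*} [TopologicalSpace Z] {a b : Z} (hab : ¬ Joined a b)
    (h : ∀ c, Joined a c ∨ Joined b c) : Nat.card (ZerothHomotopy Z) = 2 := by
  rw [Nat.card_eq_two_iff]
  refine ⟨ZerothHomotopy.mk a, ZerothHomotopy.mk b, fun h1 => hab (Quotient.exact h1), ?_⟩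
  rw [Set.eq_univ_iff_forall]
  intro c
  induction c using Quotient.inductionOn with
  | h c =>
    rcases h c with h | h
    · exact Or.inl (Quotient.sound h.symm)
    · exact Or.inr (Quotient.sound h.symm)

/-- A nontrivial loop: the full turn in a coordinate plane. -/
lemma exists_isLoop_not_loopHomotopic (hn : Even n) (hn3 : 3 ≤ n) (hℓ : 0 < ℓ) :
    ∃ F : ℝ → Matrix (Fin n) (Fin n) ℝ, IsLoop ℓ F ∧ ¬ LoopHomotopic ℓ (fun _ => 1) F := by
  have h01 : (⟨0, by omega⟩ : Fin n) ≠ ⟨1, by omega⟩ := by simp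
  have hx : (Pi.single ⟨0, by omega⟩ 1 : Fin n → ℝ) ⬝ᵥ Pi.single ⟨0, by omega⟩ 1 = 1 := by simp
  have hy : (Pi.single ⟨1, by omega⟩ 1 : Fin n → ℝ) ⬝ᵥ Pi.single ⟨1, by omega⟩ 1 = 1 := by simp
  have hxy : (Pi.single ⟨0, by omega⟩ 1 : Fin n → ℝ) ⬝ᵥ Pi.single ⟨1, by omega⟩ 1 = 0 := by simp
  refine ⟨_, ?_, not_loopHomotopic_planeRotation hn hℓ hx hy hxy⟩
  simpa using isLoop_planeRotation hx hy hxy hℓ 1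

theorem card_zerothHomotopy_loops (hn : Even n) (hn3 : 3 ≤ n) (hℓ : 0 < ℓ) :
    Nat.card (ZerothHomotopy C(AddCircle ℓ, Matrix.specialOrthogonalGroup (Fin n) ℝ)) = 2 := by
  obtain ⟨F, hF, hF'⟩ := exists_isLoop_not_loopHomotopic (ℓ := ℓ) hn hn3 hℓ
  obtain ⟨γ, rfl⟩ := exists_circleLoop_eq hF
  refine card_zerothHomotopy_eq_two (a := 1) (b := γ) ?_ fun γ' => ?_
  · rwa [joined_iff_loopHomotopic hℓ]
  · rw [joined_iff_loopHomotopic hℓ, joined_iff_loopHomotopic hℓ, circleLoop_one]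
    by_cases h : LoopHomotopic ℓ (fun _ => 1) (circleLoop γ')
    · exact Or.inl h
    · exact Or.inr (loopHomotopic_of_not hn3 hℓ hF (isLoop_circleLoop γ') (fun h => hF' h.symm)
        fun h' => h h'.symm)

end LoopSpace

end

/-! ### Components of the space of sections of `SO(E)`. -/

noncomputable section

open scoped Matrix unitInterval

section AlongCurve

variable {n : ℕ} {X : Type*} [TopologicalSpace X] [ChartedSpace (EuclideanSpace ℝ (Fin n)) X]
  [IsManifold (𝓡 n) ∞ X] {φ : ℝ → X} {ℓ : ℝ}
  [Bundle.RiemannianBundle (fun x : X => TangentSpace (𝓡 n) x)]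
  [IsContMDiffRiemannianBundle (𝓡 n) ∞ (EuclideanSpace ℝ (Fin n))
      (fun x : X => TangentSpace (𝓡 n) x)] [T2Space X]
  {cov : CovariantDerivative (𝓡 n) (EuclideanSpace ℝ (Fin n))
      (fun x : X => TangentSpace (𝓡 n) x)} {o : ManifoldOrientation (n := n) X}

namespace ParallelFrame

variable (P : ParallelFrame cov o ℓ φ)

/-- `F` is the matrix of a section of `SO(E)` with respect to the parallel frame `P`. -/
structure IsSection (F : ℝ → Matrix (Fin n) (Fin n) ℝ) : Prop where
  continuous : Continuous F
  mem : ∀ t, F t ∈ Matrix.specialOrthogonalGroup (Fin n) ℝ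
  holonomy_mul : ∀ t, P.holonomy * F (t + ℓ) = F t

variable {P}

lemma IsSection.mul {F K : ℝ → Matrix (Fin n) (Fin n) ℝ} (hF : P.IsSection F)
    (hK : IsLoop ℓ K) : P.IsSection fun t => F t * K t :=
  ⟨hF.1.mul hK.1, fun t => mul_mem (hF.2 t) (hK.2 t), fun t => by
    rw [hK.3, ← mul_assoc, hF.3]⟩

lemma IsSection.transpose_mul {F G : ℝ → Matrix (Fin n) (Fin n) ℝ} (hF : P.IsSection F)
    (hG : P.IsSection G) : IsLoop ℓ fun t => (F t)ᵀ * G t := by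
  refine ⟨hF.1.matrix_transpose.mul hG.1,
    fun t => mul_mem (transpose_mem_specialOrthogonal (hF.2 t)) (hG.2 t), fun t => ?_⟩
  rw [← hF.3 t, ← hG.3 t, Matrix.transpose_mul, mul_assoc, ← mul_assoc P.holonomyᵀ,
    transpose_mul_of_mem P.holonomy_mem, one_mul]

lemma IsSection.mul_transpose_mul {F G : ℝ → Matrix (Fin n) (Fin n) ℝ} (hF : P.IsSection F)
    (t : ℝ) : F t * ((F t)ᵀ * G t) = G t := by
  rw [← mul_assoc, mul_transpose_of_mem (hF.2 t), one_mul]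

variable (P)

lemma isFrameField_iff_isSection (hφ : Continuous φ) (hper : Function.Periodic φ ℓ)
    (F : ℝ → Matrix (Fin n) (Fin n) ℝ) :
    IsFrameField ℓ .nonbounding o φ (P.frame F) ↔ P.IsSection F := by
  rw [P.isFrameField_iff hφ hper]
  simp only [CircleSpin.sign, one_smul]
  exact ⟨fun h => ⟨h.1, h.2.1, h.2.2⟩, fun h => ⟨h.1, h.2, h.3⟩⟩

lemma exists_isSection_eq (hφ : Continuous φ) (hper : Function.Periodic φ ℓ)
    (e : FrameSections ℓ o φ) : ∃ F, P.IsSection F ∧ P.frame F = e.1 := by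
  obtain ⟨F, hF⟩ := P.exists_frame_eq e.1
  exact ⟨F, (P.isFrameField_iff_isSection hφ hper F).1 (hF ▸ e.2), hF⟩

lemma exists_frameSections_eq (hφ : Continuous φ) (hper : Function.Periodic φ ℓ)
    {F : ℝ → Matrix (Fin n) (Fin n) ℝ} (hF : P.IsSection F) :
    ∃ e : FrameSections ℓ o φ, e.1 = P.frame F :=
  ⟨⟨P.frame F, (P.isFrameField_iff_isSection hφ hper F).2 hF⟩, rfl⟩

/-- Two sections of `SO(E)` are in the same component if and only if they differ by a loop that is
homotopic to a constant. -/
theorem joined_iff (hφ : Continuous φ) (hper : Function.Periodic φ ℓ)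
    {e f : FrameSections ℓ o φ} {F G : ℝ → Matrix (Fin n) (Fin n) ℝ} (hF : P.frame F = e.1)
    (hG : P.frame G = f.1) :
    Joined e f ↔ LoopHomotopic ℓ (fun _ => 1) fun t => (F t)ᵀ * G t := by
  have hF' : P.IsSection F := (P.isFrameField_iff_isSection hφ hper F).1 (hF ▸ e.2)
  have hG' : P.IsSection G := (P.isFrameField_iff_isSection hφ hper G).1 (hG ▸ f.2)
  constructor
  · rintro ⟨p⟩
    choose K hK hK' using fun s => P.exists_isSection_eq hφ hper (p s)
    have hp : Continuous fun s => (p s).toMaps :=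
      continuous_induced_dom.comp p.continuous
    -- A path in the compact-open topology is jointly continuous in both parameters, and the
    -- components with respect to the parallel frame inherit this.
    have hcont : Continuous fun a : I × ℝ => K a.1 a.2 := by
      refine continuous_matrix fun i j => ?_
      have h1 : Continuous fun s => (p s).toMaps j := (continuous_apply j).comp hp
      have h2 := ContinuousMap.continuous_uncurry_of_continuous ⟨_, h1⟩
      have h3 : Continuous fun a : I × ℝ =>
          (⟨φ a.2, ∑ i, K a.1 a.2 i j • P.toFun i a.2⟩ : TangentBundle (𝓡 n) X) := by
        refine h2.congr fun a => ?_
        change (⟨φ a.2, (p a.1).1 j a.2⟩ : TangentBundle (𝓡 n) X) = _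
        rw [← hK' a.1]
        rfl
      exact (continuous_apply i).comp ((P.continuous_field_iff hφ continuous_snd _).1 h3)
    have hK0 : K 0 = F := P.frame_injective (by rw [hK', hF, p.source])
    have hK1 : K 1 = G := P.frame_injective (by rw [hK', hG, p.target])
    refine ⟨fun a => (F a.2)ᵀ * K a.1 a.2,
      ⟨((hF'.1.comp continuous_snd).matrix_transpose).mul hcont,
        fun a => (hF'.transpose_mul (hK a.1)).mem a.2,
        fun s t => (hF'.transpose_mul (hK s)).periodic t⟩, fun t => ?_, fun t => ?_⟩
    · simp only [hK0, transpose_mul_of_mem (hF'.mem t)]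
    · simp only [hK1]
  · rintro ⟨H, hH, h0, h1⟩
    -- Conversely, the homotopy of the difference loop acts on the section `F` from the right.
    have hsec : ∀ s : I, P.IsSection fun t => F t * H (s, t) := fun s => hF'.mul (hH.isLoop s)
    let p : I → FrameSections ℓ o φ := fun s =>
      ⟨P.frame fun t => F t * H (s, t), (P.isFrameField_iff_isSection hφ hper _).2 (hsec s)⟩
    have hp : Continuous p := by
      refine continuous_induced_rng.2 (continuous_pi fun j => ?_)
      refine ContinuousMap.continuous_of_continuous_uncurry _ ?_
      refine (P.continuous_field_iff hφ continuous_snd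
        fun a : I × ℝ => fun i => (F a.2 * H a) i j).2 ?_
      exact continuous_pi fun i => ((hF'.1.comp continuous_snd).mul hH.continuous).matrix_elem i j
    refine ⟨⟨⟨p, hp⟩, Subtype.ext ?_, Subtype.ext ?_⟩⟩
    · change P.frame _ = _
      simp only [h0, mul_one]
      exact hF
    · change P.frame _ = _
      simp only [h1, hF'.mul_transpose_mul]
      exact hG

lemma isRightTranslate_iff {e f : FrameSections ℓ o φ} {F G : ℝ → Matrix (Fin n) (Fin n) ℝ}
    (hF : P.frame F = e.1) (hG : P.frame G = f.1)
    (γ : C(AddCircle ℓ, Matrix.specialOrthogonalGroup (Fin n) ℝ)) :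
    IsRightTranslate e f γ ↔ ∀ t, G t = F t * circleLoop γ t := by
  have h : IsRightTranslate e f γ ↔ P.frame G = P.frame fun t => F t * circleLoop γ t := by
    rw [hG]
    simp only [funext_iff, P.frame_mul_apply, hF]
    rfl
  rw [h]
  exact ⟨fun h1 t => congrFun (P.frame_injective h1) t, fun h1 => by rw [funext h1]⟩

theorem joined_iff_of_isRightTranslate (P : ParallelFrame cov o ℓ φ) (hℓ : 0 < ℓ) (hφ : Continuous φ)
    (hper : Function.Periodic φ ℓ) {e f : FrameSections ℓ o φ}
    {γ : C(AddCircle ℓ, Matrix.specialOrthogonalGroup (Fin n) ℝ)} (h : IsRightTranslate e f γ) :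
    Joined e f ↔ Joined 1 γ := by
  obtain ⟨F, hF, hFe⟩ := P.exists_isSection_eq hφ hper e
  obtain ⟨G, hG, hGf⟩ := P.exists_isSection_eq hφ hper f
  rw [P.joined_iff hφ hper hFe hGf, joined_iff_loopHomotopic hℓ, circleLoop_one]
  rw [P.isRightTranslate_iff hFe hGf] at h
  have h1 : (fun t => (F t)ᵀ * G t) = circleLoop γ := by
    funext t
    rw [h, ← mul_assoc, transpose_mul_of_mem (hF.mem t), one_mul]
  rw [h1]

/-- If `f` is not joined to `e` and `f'` is not joined to `e` then `f` is joined to `f'`. -/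
theorem joined_of_not_joined (P : ParallelFrame cov o ℓ φ) (hn : 3 ≤ n) (hℓ : 0 < ℓ) (hφ : Continuous φ)
    (hper : Function.Periodic φ ℓ) {e f f' : FrameSections ℓ o φ} (h : ¬ Joined e f)
    (h' : ¬ Joined e f') : Joined f f' := by
  obtain ⟨F, hF, hFe⟩ := P.exists_isSection_eq hφ hper e
  obtain ⟨G, hG, hGf⟩ := P.exists_isSection_eq hφ hper f
  obtain ⟨G', hG', hGf'⟩ := P.exists_isSection_eq hφ hper f'
  rw [P.joined_iff hφ hper hFe hGf] at h
  rw [P.joined_iff hφ hper hFe hGf'] at h'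
  rw [P.joined_iff hφ hper hGf hGf']
  -- The differences of `F` and `G` and of `F` and `G'` are both nontrivial loops, hence homotopic.
  -- Multiplication by the inverse of the first turns this into a statement on the difference of `G`
  -- and `G'`.
  have h1 := loopHomotopic_of_not hn hℓ (hF.transpose_mul hG) (hF.transpose_mul hG')
    (fun h1 => h h1.symm) (fun h1 => h' h1.symm)
  have h2 := (LoopHomotopic.refl (hF.transpose_mul hG)).transpose.mul h1
  have h3 : (fun t => ((F t)ᵀ * G t)ᵀ * ((F t)ᵀ * G t)) = fun _ => 1 :=
    funext fun t => transpose_mul_of_mem ((hF.transpose_mul hG).mem t)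
  have h4 : (fun t => ((F t)ᵀ * G t)ᵀ * ((F t)ᵀ * G' t)) = fun t => (G t)ᵀ * G' t := by
    funext t
    rw [Matrix.transpose_mul, Matrix.transpose_transpose, mul_assoc, hF.mul_transpose_mul]
  rwa [h3, h4] at h2

theorem exists_not_joined (P : ParallelFrame cov o ℓ φ) (hn : Even n) (hn3 : 3 ≤ n) (hℓ : 0 < ℓ) (hφ : Continuous φ)
    (hper : Function.Periodic φ ℓ) (e : FrameSections ℓ o φ) :
    ∃ f : FrameSections ℓ o φ, ¬ Joined e f := by
  obtain ⟨F, hF, hFe⟩ := P.exists_isSection_eq hφ hper e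
  obtain ⟨K, hK, hK'⟩ := exists_isLoop_not_loopHomotopic (ℓ := ℓ) hn hn3 hℓ
  obtain ⟨f, hf⟩ := P.exists_frameSections_eq hφ hper (hF.mul hK)
  refine ⟨f, fun h => hK' ?_⟩
  rw [P.joined_iff hφ hper hFe hf.symm] at h
  have h1 : (fun t => (F t)ᵀ * (F t * K t)) = K := by
    funext t
    rw [← mul_assoc, transpose_mul_of_mem (hF.mem t), one_mul]
  rwa [h1] at h

end ParallelFrame

end AlongCurve
end

/-! ### Exponentials of skew-symmetric matrices. -/

noncomputable section

open scoped Matrix unitInterval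

section Exponential

variable {n : ℕ}

section Deriv

attribute [local instance] Matrix.linftyOpNormedRing Matrix.linftyOpNormedAlgebra

lemma hasDerivAt_exp_mulVec (A : Matrix (Fin n) (Fin n) ℝ) (v : Fin n → ℝ) (t : ℝ) :
    HasDerivAt (fun t : ℝ => NormedSpace.exp (t • A) *ᵥ v)
      (NormedSpace.exp (t • A) *ᵥ (A *ᵥ v)) t := by
  have h := hasDerivAt_exp_smul_const A t
  let L : Matrix (Fin n) (Fin n) ℝ →L[ℝ] (Fin n → ℝ) :=
    LinearMap.toContinuousLinearMap
      { toFun := fun M => M *ᵥ v, map_add' := fun _ _ => Matrix.add_mulVec _ _ _,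
        map_smul' := fun _ _ => Matrix.smul_mulVec _ _ _ }
  have h1 := L.hasFDerivAt.comp_hasDerivAt t h
  rw [Matrix.mulVec_mulVec]
  exact h1

lemma commute_exp_smul (A : Matrix (Fin n) (Fin n) ℝ) (t : ℝ) :
    A * NormedSpace.exp (t • A) = NormedSpace.exp (t • A) * A := by
  let : NormedAlgebra ℚ (Matrix (Fin n) (Fin n) ℝ) := NormedAlgebra.restrictScalars ℚ ℝ _
  exact (((Commute.refl A).smul_right t).exp_right).eq

lemma continuous_matrix_exp :
    Continuous (NormedSpace.exp : Matrix (Fin n) (Fin n) ℝ → Matrix (Fin n) (Fin n) ℝ) := by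
  let : NormedAlgebra ℚ (Matrix (Fin n) (Fin n) ℝ) := NormedAlgebra.restrictScalars ℚ ℝ _
  exact NormedSpace.exp_continuous

end Deriv

/-- The derivative is a function of the same form for the vector `A v`, so the induction runs over
all vectors at once. -/
lemma contDiff_exp_mulVec (A : Matrix (Fin n) (Fin n) ℝ) (v : Fin n → ℝ) :
    ContDiff ℝ ∞ fun t : ℝ => NormedSpace.exp (t • A) *ᵥ v := by
  have key : ∀ (k : ℕ) (v : Fin n → ℝ),
      ContDiff ℝ k fun t : ℝ => NormedSpace.exp (t • A) *ᵥ v := by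
    intro k
    induction k with
    | zero =>
      intro v
      exact contDiff_zero.2
        (continuous_iff_continuousAt.2 fun t => (hasDerivAt_exp_mulVec A v t).continuousAt)
    | succ k ih =>
      intro v
      rw [show ((k + 1 : ℕ) : WithTop ℕ∞) = (k : WithTop ℕ∞) + 1 from rfl]
      refine contDiff_succ_iff_deriv.2
        ⟨fun t => (hasDerivAt_exp_mulVec A v t).differentiableAt, by simp, ?_⟩
      rw [show (deriv fun t : ℝ => NormedSpace.exp (t • A) *ᵥ v) = _ from
        funext fun t => (hasDerivAt_exp_mulVec A v t).deriv]
      exact ih _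
  exact contDiff_infty.2 fun k => key k v

lemma deriv_exp_mulVec (A : Matrix (Fin n) (Fin n) ℝ) (v : Fin n → ℝ) :
    (deriv fun t : ℝ => NormedSpace.exp (t • A) *ᵥ v) =
      fun t => NormedSpace.exp (t • A) *ᵥ (A *ᵥ v) :=
  funext fun t => (hasDerivAt_exp_mulVec A v t).deriv

lemma exp_add_smul (A : Matrix (Fin n) (Fin n) ℝ) (s t : ℝ) :
    NormedSpace.exp ((s + t) • A) = NormedSpace.exp (s • A) * NormedSpace.exp (t • A) := by
  rw [add_smul, Matrix.exp_add_of_commute _ _ (((Commute.refl A).smul_left s).smul_right t)]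

lemma exp_neg_smul_mul (A : Matrix (Fin n) (Fin n) ℝ) (t : ℝ) :
    NormedSpace.exp ((-t) • A) * NormedSpace.exp (t • A) = 1 := by
  rw [← exp_add_smul, neg_add_cancel, zero_smul, NormedSpace.exp_zero]

lemma exp_mul_comm (A : Matrix (Fin n) (Fin n) ℝ) (s t : ℝ) :
    NormedSpace.exp (s • A) * NormedSpace.exp (t • A) =
      NormedSpace.exp (t • A) * NormedSpace.exp (s • A) := by
  rw [← exp_add_smul, ← exp_add_smul, add_comm]

/-- Two curves with `u' = A u` that agree at `0` are equal. -/
lemma eq_exp_mulVec {A : Matrix (Fin n) (Fin n) ℝ} {u : ℝ → Fin n → ℝ}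
    (hu : ∀ t, HasDerivAt u (A *ᵥ u t) t) (t : ℝ) :
    u t = NormedSpace.exp (t • A) *ᵥ u 0 := by
  have h1 : ∀ t, HasDerivAt (fun t : ℝ => NormedSpace.exp (t • A) *ᵥ u 0)
      (A *ᵥ (NormedSpace.exp (t • A) *ᵥ u 0)) t := by
    intro t
    have := hasDerivAt_exp_mulVec A (u 0) t
    rw [Matrix.mulVec_mulVec] at this ⊢
    rwa [commute_exp_smul A t]
  let L : (Fin n → ℝ) →L[ℝ] (Fin n → ℝ) := LinearMap.toContinuousLinearMap (Matrix.mulVecLin A)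
  have := ODE_solution_unique_univ (v := fun _ (x : Fin n → ℝ) => A *ᵥ x) (K := ‖L‖₊) (s := fun _ => Set.univ)
    (f := u) (g := fun t : ℝ => NormedSpace.exp (t • A) *ᵥ u 0) (t₀ := 0)
    (fun t => L.lipschitz.lipschitzOnWith) (fun t => ⟨hu t, trivial⟩) (fun t => ⟨h1 t, trivial⟩)
    (by simp [NormedSpace.exp_zero])
  exact congrFun this t

lemma exp_mulVec_of_rotation {A : Matrix (Fin n) (Fin n) ℝ} {v w : Fin n → ℝ} {μ : ℝ}
    (hv : A *ᵥ v = μ • w) (hw : A *ᵥ w = -(μ • v)) (t : ℝ) :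
    NormedSpace.exp (t • A) *ᵥ v = Real.cos (μ * t) • v + Real.sin (μ * t) • w := by
  have h : ∀ t, HasDerivAt (fun t => Real.cos (μ * t) • v + Real.sin (μ * t) • w)
      (A *ᵥ (Real.cos (μ * t) • v + Real.sin (μ * t) • w)) t := by
    intro t
    have hm : HasDerivAt (fun t => μ * t) μ t := by
      simpa using (hasDerivAt_id t).const_mul μ
    have := (hm.cos.smul_const v).add (hm.sin.smul_const w)
    refine this.congr_deriv ?_
    rw [Matrix.mulVec_add, Matrix.mulVec_smul, Matrix.mulVec_smul, hv, hw]
    module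
  have := eq_exp_mulVec h t
  simp only [mul_zero, Real.cos_zero, one_smul, Real.sin_zero, zero_smul, add_zero] at this
  rw [this]

variable {A : Matrix (Fin n) (Fin n) ℝ} (hA : Aᵀ = -A)
include hA

lemma dotProduct_mulVec_skew (v w : Fin n → ℝ) : (A *ᵥ v) ⬝ᵥ w = -(v ⬝ᵥ A *ᵥ w) := by
  rw [dotProduct_comm, Matrix.dotProduct_mulVec, ← Matrix.mulVec_transpose, hA, Matrix.neg_mulVec,
    neg_dotProduct, dotProduct_comm]

lemma mulVec_eq_zero_of_skew {v : Fin n → ℝ} (h : A *ᵥ (A *ᵥ v) = 0) : A *ᵥ v = 0 := by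
  have := dotProduct_mulVec_skew hA v (A *ᵥ v)
  rw [h, dotProduct_zero, neg_zero] at this
  exact dotProduct_self_eq_zero.1 this

/-- With `sinc` the formula includes `θ = 0`, where skew-symmetry forces `A v = 0`. -/
lemma exp_mulVec_of_sq {v : Fin n → ℝ} {θ : ℝ} (h : A *ᵥ (A *ᵥ v) = -(θ ^ 2 • v)) (t : ℝ) :
    NormedSpace.exp (t • A) *ᵥ v =
      Real.cos (θ * t) • v + (t * Real.sinc (θ * t)) • (A *ᵥ v) := by
  rcases eq_or_ne θ 0 with rfl | hθ
  · have h0 : A *ᵥ v = 0 := mulVec_eq_zero_of_skew hA (by simpa using h)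
    rw [exp_mulVec_of_rotation (w := 0) (μ := 0) (by simpa using h0) (by simp), h0]
    simp
  · rw [exp_mulVec_of_rotation (w := θ⁻¹ • (A *ᵥ v)) (μ := θ) (by simp [smul_smul, hθ])
      (by rw [Matrix.mulVec_smul, h, smul_neg, smul_smul]; congr 2; field_simp), smul_smul]
    congr 2
    rcases eq_or_ne t 0 with rfl | ht
    · simp
    · rw [Real.sinc_of_ne_zero (mul_ne_zero hθ ht)]
      field_simp

lemma exp_smul_transpose (t : ℝ) :
    (NormedSpace.exp (t • A))ᵀ = NormedSpace.exp ((-t) • A) := by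
  rw [← Matrix.exp_transpose, Matrix.transpose_smul, hA, smul_neg, neg_smul]

lemma exp_smul_mem (t : ℝ) :
    NormedSpace.exp (t • A) ∈ Matrix.specialOrthogonalGroup (Fin n) ℝ := by
  have h : ∀ t : ℝ, (NormedSpace.exp (t • A))ᵀ * NormedSpace.exp (t • A) = 1 := by
    intro t
    rw [exp_smul_transpose hA, exp_neg_smul_mul]
  refine mem_specialOrthogonal_iff.2 ⟨h t, ?_⟩
  have h2 : NormedSpace.exp (t • A) = NormedSpace.exp ((t / 2) • A) * NormedSpace.exp ((t / 2) • A) := by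
    rw [← exp_add_smul, add_halves]
  have h3 := congrArg Matrix.det (h (t / 2))
  rw [Matrix.det_mul, Matrix.det_transpose, Matrix.det_one] at h3
  rw [h2, Matrix.det_mul, h3]

end Exponential

end

/-! ### Existence of small logarithms in `SO_n`. -/

noncomputable section

open scoped Matrix unitInterval

section Logarithm

variable {n : ℕ}

lemma exists_diagonalization {S : Matrix (Fin n) (Fin n) ℝ} (hS : Sᵀ = S) :
    ∃ (U : Matrix (Fin n) (Fin n) ℝ) (d : Fin n → ℝ), Uᵀ * U = 1 ∧ U * Uᵀ = 1 ∧
      S = U * Matrix.diagonal d * Uᵀ := by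
  have hS' : S.IsHermitian := by rwa [Matrix.IsHermitian, Matrix.conjTranspose_eq_transpose_of_trivial]
  have h := Unitary.coe_star_mul_self hS'.eigenvectorUnitary
  have h' := Unitary.coe_mul_star_self hS'.eigenvectorUnitary
  rw [Unitary.coe_star] at h'
  rw [Matrix.star_eq_conjTranspose, Matrix.conjTranspose_eq_transpose_of_trivial] at h h'
  refine ⟨_, hS'.eigenvalues, h, h', ?_⟩
  have := hS'.spectral_theorem
  rw [Unitary.conjStarAlgAut_apply, Matrix.star_eq_conjTranspose,
    Matrix.conjTranspose_eq_transpose_of_trivial] at this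
  exact this

lemma exp_of_mul_self {A : Matrix (Fin n) (Fin n) ℝ} (hA : Aᵀ = -A) {θ : Fin n → ℝ}
    (h : A * A = -Matrix.diagonal fun i => θ i ^ 2) :
    NormedSpace.exp A = Matrix.diagonal (fun i => Real.cos (θ i)) +
      A * Matrix.diagonal fun i => Real.sinc (θ i) := by
  refine Matrix.ext_iff_mulVec.2 fun v => ?_
  suffices ∀ i, NormedSpace.exp A *ᵥ Pi.single i 1 = (Matrix.diagonal (fun i => Real.cos (θ i)) +
      A * Matrix.diagonal fun i => Real.sinc (θ i)) *ᵥ Pi.single i 1 by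
    congr 1
    exact Matrix.ext_of_mulVec_single this
  intro i
  have h1 := exp_mulVec_of_sq hA (v := Pi.single i 1) (θ := θ i) (by
    rw [Matrix.mulVec_mulVec, h, Matrix.neg_mulVec, Matrix.diagonal_mulVec_single]
    congr 1
    rw [← Pi.single_smul, smul_eq_mul]) 1
  rw [one_smul, mul_one, one_mul] at h1
  rw [h1, Matrix.add_mulVec, ← Matrix.mulVec_mulVec, Matrix.diagonal_mulVec_single,
    Matrix.diagonal_mulVec_single, mul_one, mul_one, ← Matrix.mulVec_smul, ← Pi.single_smul,
    ← Pi.single_smul, smul_eq_mul, mul_one, smul_eq_mul, mul_one]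

/-- The coordinates with `p` are divided into two halves of equal size, on which the standard
symplectic matrix acts; the others are annihilated. -/
lemma exists_complexStructure {p : Fin n → Prop} [DecidablePred p]
    (hp : Even (Fintype.card {i // p i})) : ∃ J : Matrix (Fin n) (Fin n) ℝ, Jᵀ = -J ∧
      J * J = -Matrix.diagonal (fun i => if p i then 1 else 0) ∧
      ∀ f : Fin n → ℝ, (∀ i, p i → f i = 0) → J * Matrix.diagonal f = 0 := by
  obtain ⟨k, hk⟩ := hp
  have e₀ : Fin k ⊕ Fin k ≃ {i // p i} := Fintype.equivOfCardEq (by simp [hk])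
  let e : (Fin k ⊕ Fin k) ⊕ {i // ¬ p i} ≃ Fin n :=
    (Equiv.sumCongr e₀ (Equiv.refl _)).trans (Equiv.sumCompl p)
  have hd : ∀ f : Fin n → ℝ, Matrix.diagonal f = Matrix.reindex e e
      (Matrix.fromBlocks (Matrix.diagonal fun i => f (e₀ i)) 0 0 (Matrix.diagonal fun i => f i)) := by
    intro f
    rw [Matrix.fromBlocks_diagonal, Matrix.reindex_apply, Matrix.submatrix_diagonal_equiv]
    congr 1
    funext i
    obtain ⟨j, rfl⟩ := e.surjective i
    rcases j with j | j <;> simp [e]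
  refine ⟨Matrix.reindex e e (Matrix.fromBlocks (Matrix.J (Fin k) ℝ) 0 0 0), ?_, ?_, ?_⟩
  · rw [Matrix.transpose_reindex, Matrix.fromBlocks_transpose, Matrix.J_transpose]
    ext i j
    simp only [Matrix.reindex_apply, Matrix.submatrix_apply, Matrix.neg_apply]
    rcases e.symm i with a | a <;> rcases e.symm j with b | b <;> simp
  · rw [hd]
    simp only [Matrix.reindex_apply, Matrix.submatrix_mul_equiv, Matrix.fromBlocks_multiply,
      Matrix.J_squared]
    ext i j
    simp only [Matrix.submatrix_apply, Matrix.neg_apply]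
    rcases e.symm i with a | a <;> rcases e.symm j with b | b <;>
      simp [Matrix.diagonal, Matrix.one_apply, (e₀ _).2]
    intro h1 h2
    exact absurd h2 a.2
  · intro f hf
    rw [hd]
    simp only [Matrix.reindex_apply, Matrix.submatrix_mul_equiv, Matrix.fromBlocks_multiply]
    simp [hf _ (e₀ _).2]

lemma mem_spectrum_iff_exists_mulVec {M : Matrix (Fin n) (Fin n) ℂ} {z : ℂ} :
    z ∈ spectrum ℂ M ↔ ∃ v : Fin n → ℂ, v ≠ 0 ∧ M *ᵥ v = z • v := by
  rw [spectrum.mem_iff, Matrix.isUnit_iff_isUnit_det, isUnit_iff_ne_zero, not_not,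
    ← Matrix.exists_mulVec_eq_zero_iff]
  refine exists_congr fun v => and_congr_right fun _ => ?_
  rw [Matrix.sub_mulVec, sub_eq_zero, Algebra.algebraMap_eq_smul_one, Matrix.smul_mulVec,
    Matrix.one_mulVec, eq_comm]

/-- An eigenvector of `A` for `z` is one of `A * A` for `z ^ 2`. In the coordinates given by `U`,
the latter matrix is diagonal with the entries `-θ i ^ 2`, so `z ^ 2` is one of these. -/
lemma norm_le_of_mul_self {A U : Matrix (Fin n) (Fin n) ℝ} {θ : Fin n → ℝ} {c : ℝ} (hU : Uᵀ * U = 1)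
    (h : A * A = -(U * Matrix.diagonal (fun i => θ i ^ 2) * Uᵀ)) (hc : ∀ i, |θ i| ≤ c) {z : ℂ}
    (hz : z ∈ spectrum ℂ (A.map (algebraMap ℝ ℂ))) : ‖z‖ ≤ c := by
  obtain ⟨v, hv, hAv⟩ := mem_spectrum_iff_exists_mulVec.1 hz
  have hU' : U * Uᵀ = 1 := mul_eq_one_comm.1 hU
  let f : Matrix (Fin n) (Fin n) ℝ →+* Matrix (Fin n) (Fin n) ℂ := (algebraMap ℝ ℂ).mapMatrix
  have hf : f A = A.map (algebraMap ℝ ℂ) := rfl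
  rw [← hf] at hAv
  have h1 : Uᵀ * (A * A) = -(Matrix.diagonal (fun i => θ i ^ 2) * Uᵀ) := by
    rw [h, mul_neg, mul_assoc, ← mul_assoc, hU, one_mul]
  have h2 := congrArg (fun M => f M *ᵥ v) h1
  simp only [map_mul, map_neg, ← Matrix.mulVec_mulVec, Matrix.neg_mulVec, hAv,
    Matrix.mulVec_smul] at h2
  have hw : f Uᵀ *ᵥ v ≠ 0 := by
    intro h0
    apply hv
    rw [← Matrix.one_mulVec v, ← map_one f, ← hU', map_mul, ← Matrix.mulVec_mulVec, h0,
      Matrix.mulVec_zero]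
  obtain ⟨i, hi⟩ := Function.ne_iff.1 hw
  have h3 := congrFun h2 i
  have hd : f (Matrix.diagonal fun i => θ i ^ 2) = Matrix.diagonal fun i => ((θ i : ℂ)) ^ 2 := by
    ext a b
    by_cases hab : a = b
    · subst hab; simp [f]
    · simp [f, hab]
  rw [hd, Pi.neg_apply, Matrix.mulVec_diagonal, Pi.smul_apply, Pi.smul_apply, smul_eq_mul,
    smul_eq_mul, ← mul_assoc, ← neg_mul] at h3
  have h4 := congrArg (‖·‖) (mul_right_cancel₀ hi h3)
  simp only [norm_mul, norm_neg, norm_pow, Complex.norm_real, Real.norm_eq_abs] at h4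
  rw [← sq, sq_eq_sq₀ (norm_nonneg _) (abs_nonneg _)] at h4
  exact h4 ▸ hc i

/-- A logarithm of a special orthogonal matrix with diagonal symmetric part. -/
lemma exists_exp_eq_of_diagonal {h : Matrix (Fin n) (Fin n) ℝ}
    (hh : h ∈ Matrix.specialOrthogonalGroup (Fin n) ℝ) {d : Fin n → ℝ}
    (hd : h + hᵀ = Matrix.diagonal fun i => 2 * d i) :
    ∃ (A : Matrix (Fin n) (Fin n) ℝ) (θ : Fin n → ℝ), Aᵀ = -A ∧ NormedSpace.exp A = h ∧
      (∀ i, |θ i| ≤ Real.pi) ∧ (∀ i, d i = Real.cos (θ i)) ∧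
      A * A = -Matrix.diagonal fun i => θ i ^ 2 := by
  obtain ⟨horth, hdet⟩ := mem_specialOrthogonal_iff.1 hh
  have horth' := mul_transpose_of_mem hh
  set D : Matrix (Fin n) (Fin n) ℝ := Matrix.diagonal d with hD
  have h2D : h + hᵀ = 2 • D := by
    rw [hd, hD, ← Matrix.diagonal_smul]
    congr 1
    funext i
    simp
  have hT : hᵀ = 2 • D - h := by rw [← h2D]; abel
  -- `K` is the skew-symmetric part of `h`. It commutes with the symmetric part `D`, and `K ^ 2 = D
  -- ^ 2 - 1`. On a block with `D = cos θ` it should be `sinc θ` times the logarithm.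
  set K := h - D with hK
  have hKT : Kᵀ = -K := by
    rw [hK, Matrix.transpose_sub, hT, hD, Matrix.diagonal_transpose, two_smul]; abel
  have hcomm : h * D = D * h := by
    have : h * (2 • D) = (2 • D) * h := by
      rw [← h2D, mul_add, add_mul, horth, horth']
    rw [two_smul, mul_add, add_mul] at this
    ext i j
    have := congrFun (congrFun this i) j
    rw [Matrix.add_apply, Matrix.add_apply] at this
    linarith
  have hKK : K * K = D * D - 1 := by
    have : h * h = 2 • (D * h) - 1 := by
      have := horth
      rw [hT, sub_mul, smul_mul_assoc, sub_eq_iff_eq_add] at this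
      rw [this]; abel
    rw [hK, sub_mul, mul_sub, mul_sub, this, hcomm, two_smul]
    abel
  have hKcomm : ∀ i j, K i j ≠ 0 → d i = d j := by
    intro i j hij
    have : K * D = D * K := by rw [hK, sub_mul, mul_sub, hcomm]
    have := congrFun (congrFun this i) j
    rw [hD, Matrix.mul_diagonal, Matrix.diagonal_mul, mul_comm] at this
    exact (mul_right_cancel₀ hij this).symm
  have hKdiag : ∀ f : ℝ → ℝ, K * Matrix.diagonal (fun i => f (d i)) =
      Matrix.diagonal (fun i => f (d i)) * K := by
    intro f
    ext i j
    rw [Matrix.mul_diagonal, Matrix.diagonal_mul]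
    by_cases hij : K i j = 0
    · simp [hij]
    · rw [hKcomm i j hij, mul_comm]
  have hsum : ∀ i, ∑ j, K j i ^ 2 = 1 - d i ^ 2 := by
    intro i
    have : Kᵀ * K = 1 - D * D := by rw [hKT, neg_mul, hKK, neg_sub]
    have := congrFun (congrFun this i) i
    rw [hD, Matrix.diagonal_mul_diagonal, Matrix.sub_apply, Matrix.one_apply_eq,
      Matrix.diagonal_apply_eq, Matrix.mul_apply, ← sq] at this
    rw [← this]
    exact Finset.sum_congr rfl fun j _ => sq _
  have hd1 : ∀ i, |d i| ≤ 1 := by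
    intro i
    rw [← sq_le_one_iff_abs_le_one]
    have := Finset.sum_nonneg fun j (_ : j ∈ Finset.univ) => sq_nonneg (K j i)
    rw [hsum] at this
    linarith
  set θ : Fin n → ℝ := fun i => Real.arccos (d i) with hθ
  have hcos : ∀ i, Real.cos (θ i) = d i := fun i =>
    Real.cos_arccos (abs_le.1 (hd1 i)).1 (abs_le.1 (hd1 i)).2
  have hcol : ∀ i j, θ i = Real.pi → K j i = 0 := by
    intro i j hi
    have := hsum i
    rw [← hcos, hi, Real.cos_pi, neg_one_sq, sub_self,
      Finset.sum_eq_zero_iff_of_nonneg fun _ _ => sq_nonneg _] at this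
    exact pow_eq_zero_iff two_ne_zero |>.1 (this j (Finset.mem_univ _))
  have hsinc : ∀ i, θ i ≠ Real.pi → Real.sinc (θ i) ≠ 0 := by
    intro i hi
    rcases eq_or_ne (θ i) 0 with h0 | h0
    · simp [h0]
    · rw [Real.sinc_of_ne_zero h0]
      refine div_ne_zero (Real.sin_pos_of_pos_of_lt_pi ?_ ?_).ne' h0
      · exact (Real.arccos_nonneg _).lt_of_ne' h0
      · exact (Real.arccos_le_pi _).lt_of_ne hi
  have hsincpi : Real.sinc Real.pi = 0 := by
    rw [Real.sinc_of_ne_zero Real.pi_ne_zero, Real.sin_pi, zero_div]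
  have hsq : ∀ i, (Real.sinc (θ i)) ^ 2 * θ i ^ 2 = 1 - d i ^ 2 := by
    intro i
    rw [← hcos, ← Real.sin_sq]
    rcases eq_or_ne (θ i) 0 with h0 | h0
    · simp [h0]
    · rw [Real.sinc_of_ne_zero h0, div_pow, div_mul_cancel₀ _ (pow_ne_zero _ h0)]
  -- Dividing `K` by `sinc θ` gives the logarithm where `θ ≠ π`. For `θ = π` the value is `0⁻¹ = 0`,
  -- so `A₀` vanishes there.
  set F : Matrix (Fin n) (Fin n) ℝ := Matrix.diagonal fun i => (Real.sinc (θ i))⁻¹ with hF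
  have hKF' : K * F = F * K := hKdiag fun x => (Real.sinc (Real.arccos x))⁻¹
  set A₀ := K * F with hA₀
  have hA₀T : A₀ᵀ = -A₀ := by
    have hFT : Fᵀ = F := Matrix.diagonal_transpose _
    rw [hA₀, Matrix.transpose_mul, hFT, hKT, mul_neg, ← hA₀, hKF']
  have hA₀A₀ : A₀ * A₀ = -Matrix.diagonal fun i => (if θ i = Real.pi then 0 else θ i) ^ 2 := by
    have : A₀ * A₀ = (K * K) * (F * F) := by
      rw [hA₀, mul_assoc, ← mul_assoc F K F, ← hKF', hA₀, mul_assoc, mul_assoc]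
    rw [this, hKK, hD, hF, Matrix.diagonal_mul_diagonal, Matrix.diagonal_mul_diagonal,
      ← Matrix.diagonal_one, Matrix.diagonal_sub, Matrix.diagonal_mul_diagonal, Matrix.diagonal_neg]
    congr 1
    funext i
    have h1 := hsq i
    split_ifs with hi
    · rw [hi, hsincpi]; simp
    · have := hsinc i hi
      field_simp
      linarith
  have hexp₀ := exp_of_mul_self hA₀T hA₀A₀
  -- The exponential of `A₀` agrees with `h` except on the eigenspace for `-1`, where it is the
  -- identity; `ε` is the correction.
  set ε : Fin n → ℝ := fun i => if θ i = Real.pi then -1 else 1 with hε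
  have hA₀d : ∀ i j, A₀ i j = K i j * (Real.sinc (θ j))⁻¹ := fun i j => by
    rw [hA₀, hF, Matrix.mul_diagonal]
  have hh₀ : NormedSpace.exp A₀ * Matrix.diagonal ε = h := by
    rw [hexp₀]
    ext i j
    rw [Matrix.mul_diagonal, Matrix.add_apply, Matrix.mul_diagonal, hA₀d]
    have hhij : h i j = D i j + K i j := by rw [hK, Matrix.sub_apply]; ring
    rw [hhij, hD, Matrix.diagonal_apply, Matrix.diagonal_apply]
    by_cases hj : θ j = Real.pi
    · rw [hcol j i hj]
      by_cases hij : i = j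
      · subst hij
        simp [hε, hj, ← hcos i]
      · simp [hij]
    · simp only [hε, hj, if_false, mul_one]
      rw [mul_assoc, inv_mul_cancel₀ (hsinc j hj), mul_one]
      by_cases hij : i = j
      · subst hij
        simp [hj, hcos]
      · simp [hij]
  -- Comparing determinants shows that `-1` occurs with even multiplicity, since `det h = 1`.
  have hcard : Even (Fintype.card {i // θ i = Real.pi}) := by
    have h1 := congrArg Matrix.det hh₀
    have h2 := exp_smul_mem hA₀T 1
    rw [one_smul] at h2
    rw [Matrix.det_mul, (mem_specialOrthogonal_iff.1 h2).2, hdet, Matrix.det_diagonal, one_mul,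
      Finset.prod_ite, Finset.prod_const, Finset.prod_const_one, mul_one,
      ← Fintype.card_subtype] at h1
    exact (neg_one_pow_eq_one_iff_even (by norm_num)).1 h1
  -- On the eigenspace for `-1` the logarithm is `π` times a complex structure. The choice of the
  -- complex structure is the only ambiguity of small logarithms.
  obtain ⟨J, hJT, hJJ, hJ0⟩ := exists_complexStructure hcard
  have hJF : J * F = 0 := hJ0 _ fun i hi => by rw [hi, hsincpi, inv_zero]
  have hFJ : F * J = 0 := by
    have := congrArg Matrix.transpose hJF
    have hFT : Fᵀ = F := Matrix.diagonal_transpose _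
    rwa [Matrix.transpose_mul, hFT, hJT, mul_neg, Matrix.transpose_zero, neg_eq_zero] at this
  have hA₀J : A₀ * J = 0 := by rw [hA₀, mul_assoc, hFJ, mul_zero]
  have hJA₀ : J * A₀ = 0 := by rw [hKF', ← mul_assoc, hJF, zero_mul]
  have hAT : (A₀ + Real.pi • J)ᵀ = -(A₀ + Real.pi • J) := by
    rw [Matrix.transpose_add, Matrix.transpose_smul, hA₀T, hJT, neg_add, smul_neg]
  have hAA : (A₀ + Real.pi • J) * (A₀ + Real.pi • J) = -Matrix.diagonal fun i => θ i ^ 2 := by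
    rw [add_mul, mul_add, mul_add, mul_smul_comm, smul_mul_assoc, smul_mul_smul_comm, hA₀J, hJA₀,
      hA₀A₀, hJJ, smul_zero, add_zero, zero_add, smul_neg, ← Matrix.diagonal_smul,
      Matrix.diagonal_neg, Matrix.diagonal_neg, Matrix.diagonal_neg, Matrix.diagonal_add]
    congr 1
    funext i
    by_cases hi : θ i = Real.pi
    · simp [hi, sq]
    · simp [hi]
  refine ⟨A₀ + Real.pi • J, θ, hAT, ?_, fun i => ?_, fun i => (hcos i).symm, hAA⟩
  · rw [exp_of_mul_self hAT hAA, add_mul, smul_mul_assoc,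
      hJ0 _ fun i hi => by rw [hi, hsincpi], smul_zero, add_zero]
    ext i j
    rw [Matrix.add_apply, Matrix.mul_diagonal, hA₀d]
    have hhij : h i j = D i j + K i j := by rw [hK, Matrix.sub_apply]; ring
    rw [hhij, hD]
    simp only [hcos]
    congr 1
    by_cases hj : θ j = Real.pi
    · rw [hcol j i hj]; simp
    · rw [mul_assoc, inv_mul_cancel₀ (hsinc j hj), mul_one]
  · rw [abs_of_nonneg (Real.arccos_nonneg _)]
    exact Real.arccos_le_pi _

/-- A special orthogonal matrix is the exponential of a skew-symmetric matrix with eigenvalues in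
`i [-π, π]` that vanishes on the vectors that are fixed by the orthogonal matrix. -/
theorem exists_exp_eq {h : Matrix (Fin n) (Fin n) ℝ}
    (hh : h ∈ Matrix.specialOrthogonalGroup (Fin n) ℝ) :
    ∃ A : Matrix (Fin n) (Fin n) ℝ, Aᵀ = -A ∧ NormedSpace.exp A = h ∧
      (∀ z ∈ spectrum ℂ (A.map (algebraMap ℝ ℂ)), ‖z‖ ≤ Real.pi) ∧
      ∀ v, h *ᵥ v = v → A *ᵥ v = 0 := by
  obtain ⟨horth, hdet⟩ := mem_specialOrthogonal_iff.1 hh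
  -- An orthogonal change of basis makes the symmetric part diagonal. `U` may have determinant `-1`;
  -- in the conjugate of `h` it occurs twice. The numbers `d` are `2 cos θ`, hence the division by 2
  -- below.
  obtain ⟨U, d, hU, hU', hUd⟩ := exists_diagonalization (S := h + hᵀ) (by
    rw [Matrix.transpose_add, Matrix.transpose_transpose, add_comm])
  have hdetU : U.det * U.det = 1 := by
    have := congrArg Matrix.det hU
    rwa [Matrix.det_mul, Matrix.det_transpose, Matrix.det_one] at this
  have hd' : Uᵀ * (h + hᵀ) * U = Matrix.diagonal d := by
    rw [hUd]
    simp only [mul_assoc, hU, mul_one]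
    rw [← mul_assoc, hU, one_mul]
  obtain ⟨A, θ, hAT, hAexp, hθ, hdθ, hAA⟩ := exists_exp_eq_of_diagonal (h := Uᵀ * h * U)
    (d := fun i => d i / 2) (mem_specialOrthogonal_iff.2 ⟨by
      rw [Matrix.transpose_mul, Matrix.transpose_mul, Matrix.transpose_transpose]
      calc Uᵀ * (hᵀ * U) * (Uᵀ * h * U) = Uᵀ * hᵀ * (U * Uᵀ) * h * U := by simp only [mul_assoc]
        _ = 1 := by rw [hU', mul_one, mul_assoc Uᵀ, horth, mul_one, hU], by
      rw [Matrix.det_mul, Matrix.det_mul, hdet, Matrix.det_transpose, mul_one, hdetU]⟩) (by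
    rw [Matrix.transpose_mul, Matrix.transpose_mul, Matrix.transpose_transpose, ← mul_assoc,
      ← add_mul, ← mul_add, hd']
    congr 1
    funext i
    ring)
  have hBT : (U * A * Uᵀ)ᵀ = -(U * A * Uᵀ) := by
    rw [Matrix.transpose_mul, Matrix.transpose_mul, Matrix.transpose_transpose, hAT, mul_assoc,
      neg_mul, mul_neg]
  have hBB : (U * A * Uᵀ) * (U * A * Uᵀ) =
      -(U * Matrix.diagonal (fun i => θ i ^ 2) * Uᵀ) := by
    calc (U * A * Uᵀ) * (U * A * Uᵀ) = U * (A * (Uᵀ * U) * A) * Uᵀ := by simp only [mul_assoc]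
      _ = _ := by rw [hU, mul_one, hAA, mul_neg, neg_mul]
  refine ⟨U * A * Uᵀ, hBT, ?_, fun z hz => norm_le_of_mul_self hU hBB hθ hz, ?_⟩
  · have hUi : U⁻¹ = Uᵀ := Matrix.inv_eq_left_inv hU
    rw [← hUi, Matrix.exp_conj _ _ (IsUnit.of_mul_eq_one _ hU'), hAexp, hUi]
    calc U * (Uᵀ * h * U) * Uᵀ = (U * Uᵀ) * h * (U * Uᵀ) := by simp only [mul_assoc]
      _ = h := by rw [hU', one_mul, mul_one]
  · intro v hv
    apply mulVec_eq_zero_of_skew hBT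
    -- A fixed vector of `h` is fixed by the inverse as well, so its coordinates are supported where
    -- `cos θ = 1`, that is `θ = 0`.
    have hv' : hᵀ *ᵥ v = v := by
      conv_lhs => rw [← hv]
      rw [Matrix.mulVec_mulVec, horth, Matrix.one_mulVec]
    have h1 : Matrix.diagonal d *ᵥ (Uᵀ *ᵥ v) = (2 : ℝ) • (Uᵀ *ᵥ v) := by
      rw [← hd', Matrix.mulVec_mulVec, mul_assoc, hU', mul_one, ← Matrix.mulVec_mulVec,
        Matrix.add_mulVec, hv, hv', ← two_smul ℝ v, Matrix.mulVec_smul]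
    have h2 : Matrix.diagonal (fun i => θ i ^ 2) *ᵥ (Uᵀ *ᵥ v) = 0 := by
      funext i
      have := congrFun h1 i
      rw [Matrix.mulVec_diagonal, Pi.smul_apply, smul_eq_mul] at this
      rw [Matrix.mulVec_diagonal]
      by_cases h0 : (Uᵀ *ᵥ v) i = 0
      · rw [h0, mul_zero, Pi.zero_apply]
      · have hdi := mul_right_cancel₀ h0 this
        have hc := hdθ i
        rw [hdi, div_self two_ne_zero] at hc
        have hb := abs_le.1 (hθ i)
        rw [(Real.cos_eq_one_iff_of_lt_of_lt (by linarith [Real.pi_pos])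
          (by linarith [Real.pi_pos])).1 hc.symm]
        simp
    rw [Matrix.mulVec_mulVec, hBB, Matrix.neg_mulVec, ← Matrix.mulVec_mulVec,
      ← Matrix.mulVec_mulVec, h2, Matrix.mulVec_zero, neg_zero]

end Logarithm

end

/-! ### Normal form of skew-symmetric endomorphisms. -/

noncomputable section

open scoped Matrix unitInterval

section SkewBasis

variable {V : Type*} [AddCommGroup V] [Module ℝ V]

/-- For a symmetric bilinear form `B` and an endomorphism `a`, the vectors `x i`, `y i` form a
`B`-orthonormal basis of `U`, and `a` acts on the plane of `x i` and `y i` as the infinitesimal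
rotation with the speed `μ i`. -/
structure IsSkewBasis (B : V →ₗ[ℝ] V →ₗ[ℝ] ℝ) (a : V →ₗ[ℝ] V) (U : Submodule ℝ V) {k : ℕ}
    (x y : Fin k → V) (μ : Fin k → ℝ) : Prop where
  mem_left : ∀ i, x i ∈ U
  mem_right : ∀ i, y i ∈ U
  pos : ∀ i, 0 < μ i
  map_left : ∀ i, a (x i) = μ i • y i
  map_right : ∀ i, a (y i) = -(μ i • x i)
  left_left : ∀ i j, B (x i) (x j) = if i = j then 1 else 0
  right_right : ∀ i j, B (y i) (y j) = if i = j then 1 else 0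
  left_right : ∀ i j, B (x i) (y j) = 0
  sum_eq : ∀ v ∈ U, ∑ i, (B (x i) v • x i + B (y i) v • y i) = v

variable {B : V →ₗ[ℝ] V →ₗ[ℝ] ℝ} {a : V →ₗ[ℝ] V} (hsymm : ∀ x y, B x y = B y x)
  (hpos : ∀ x, x ≠ 0 → 0 < B x x) (hskew : ∀ x y, B (a x) y = -B x (a y))
include hsymm hpos hskew

/-- The square of a skew-symmetric endomorphism is symmetric, so the spectral theorem applies to it
on the finite-dimensional space `U`, with the inner product `B`. -/
lemma exists_eigenvector_sq {U : Submodule ℝ V} [FiniteDimensional ℝ U] (hU : ∀ x ∈ U, a x ∈ U)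
    (h0 : U ≠ ⊥) : ∃ x ∈ U, x ≠ 0 ∧ ∃ c : ℝ, a (a x) = c • x := by
  let core : InnerProductSpace.Core ℝ U :=
    { inner := fun x y => B x y
      conj_inner_symm := fun x y => hsymm _ _
      re_inner_nonneg := fun x => by
        by_cases hx : (x : V) = 0
        · simp [hx]
        · exact (hpos _ hx).le
      add_left := fun x y z => by simp
      smul_left := fun x y r => by simp
      definite := fun x hx => by
        by_contra h
        exact (hpos x fun h' => h (Subtype.ext h')).ne' hx }
  let : NormedAddCommGroup U := core.toNormedAddCommGroup
  let : InnerProductSpace ℝ U := InnerProductSpace.ofCore core.toCore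
  let T : U →ₗ[ℝ] U := (a ∘ₗ a).restrict fun x hx => hU _ (hU x hx)
  have hT : T.IsSymmetric := fun x y => by
    change B (a (a x)) y = B x (a (a y))
    rw [hskew, hskew, neg_neg]
  have : Nontrivial U := Submodule.nontrivial_iff_ne_bot.2 h0
  have hd : 0 < Module.finrank ℝ U := Module.finrank_pos
  have h1 := hT.apply_eigenvectorBasis rfl ⟨0, hd⟩
  refine ⟨_, (hT.eigenvectorBasis rfl ⟨0, hd⟩).2, ?_, hT.eigenvalues rfl ⟨0, hd⟩,
    congrArg Subtype.val h1⟩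
  intro h
  exact (hT.eigenvectorBasis rfl).toBasis.ne_zero ⟨0, hd⟩ (by
    rw [OrthonormalBasis.coe_toBasis]; exact Subtype.ext h)

/-- A unit eigenvector `x` of the square and the normalized image `y` of `x` span an invariant
plane. Its orthogonal complement in `U` is invariant by skew-symmetry and has smaller dimension.
Injectivity ensures that the image of `x` is not zero. -/
theorem exists_isSkewBasis (U : Submodule ℝ V) [FiniteDimensional ℝ U] (hU : ∀ x ∈ U, a x ∈ U)
    (hinj : ∀ x ∈ U, a x = 0 → x = 0) :
    ∃ (k : ℕ) (x y : Fin k → V) (μ : Fin k → ℝ), IsSkewBasis B a U x y μ := by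
  induction hd : Module.finrank ℝ U using Nat.strong_induction_on generalizing U with
  | _ d ih =>
  by_cases h0 : U = ⊥
  · refine ⟨0, Fin.elim0, Fin.elim0, Fin.elim0, ⟨fun i => i.elim0, fun i => i.elim0,
      fun i => i.elim0, fun i => i.elim0, fun i => i.elim0, fun i => i.elim0, fun i => i.elim0,
      fun i => i.elim0, fun v hv => ?_⟩⟩
    rw [h0, Submodule.mem_bot] at hv
    simp [hv]
  obtain ⟨x', hx'U, hx'0, c, hc⟩ := exists_eigenvector_sq hsymm hpos hskew hU h0
  have hpx := hpos x' hx'0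
  set x : V := (Real.sqrt (B x' x'))⁻¹ • x' with hx
  have hsq := Real.mul_self_sqrt hpx.le
  have hsq0 : Real.sqrt (B x' x') ≠ 0 := (Real.sqrt_pos.2 hpx).ne'
  have hxU : x ∈ U := U.smul_mem _ hx'U
  have hxx : B x x = 1 := by
    simp only [hx, map_smul, LinearMap.smul_apply, smul_eq_mul]
    field_simp
    linarith
  have hx0 : x ≠ 0 := fun h => by rw [h] at hxx; simp at hxx
  have hax : a (a x) = c • x := by rw [hx, map_smul, map_smul, hc, smul_comm]
  have hax0 : a x ≠ 0 := fun h => hx0 (hinj x hxU h)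
  have hpa := hpos _ hax0
  set μ := Real.sqrt (B (a x) (a x)) with hμ
  have hμ0 : 0 < μ := Real.sqrt_pos.2 hpa
  have hμsq : μ * μ = B (a x) (a x) := Real.mul_self_sqrt hpa.le
  have hcμ : c = -(μ * μ) := by
    rw [hμsq, hskew, hax, map_smul, hxx, smul_eq_mul, mul_one, neg_neg]
  set y : V := μ⁻¹ • a x with hy
  have hyU : y ∈ U := U.smul_mem _ (hU x hxU)
  have haxy : a x = μ • y := by rw [hy, smul_smul, mul_inv_cancel₀ hμ0.ne', one_smul]
  have hay : a y = -(μ • x) := by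
    rw [hy, map_smul, hax, hcμ, neg_smul, smul_neg, smul_smul]
    congr 2
    field_simp
  have hyy : B y y = 1 := by
    simp only [hy, map_smul, LinearMap.smul_apply, smul_eq_mul, ← hμsq]
    field_simp
  have hxy : B x y = 0 := by
    have := hskew x x
    rw [hsymm (a x) x] at this
    rw [hy, map_smul, smul_eq_mul, show B x (a x) = 0 by linarith, mul_zero]
  have hyx : B y x = 0 := by rw [hsymm, hxy]
  clear hμ hy hx
  clear_value y
  clear_value μ
  clear_value x
  let U' : Submodule ℝ V := U ⊓ LinearMap.ker (B x) ⊓ LinearMap.ker (B y)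
  have hU'mem : ∀ v, v ∈ U' ↔ (v ∈ U ∧ B x v = 0) ∧ B y v = 0 := fun v => by
    simp [U']
  have hle : U' ≤ U := fun v hv => ((hU'mem v).1 hv).1.1
  have hlt : U' < U := by
    refine lt_of_le_of_ne hle fun h => ?_
    have : x ∈ U' := h ▸ hxU
    have := ((hU'mem x).1 this).1.2
    rw [hxx] at this
    exact one_ne_zero this
  have : FiniteDimensional ℝ U' := Submodule.finiteDimensional_of_le hle
  obtain ⟨k, p, q, ν, h⟩ := ih _ (hd ▸ Submodule.finrank_lt_finrank_of_lt hlt) U'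
    (fun v hv => by
      have hv := (hU'mem v).1 hv
      refine (hU'mem _).2 ⟨⟨hU v hv.1.1, ?_⟩, ?_⟩
      · rw [← neg_eq_zero, ← hskew, haxy, map_smul, LinearMap.smul_apply, hv.2, smul_zero]
      · rw [← neg_eq_zero, ← hskew, hay, map_neg, map_smul, LinearMap.neg_apply,
          LinearMap.smul_apply, hv.1.2, smul_zero, neg_zero])
    (fun v hv => hinj v (hle hv)) rfl
  have hp := fun i => (hU'mem _).1 (h.mem_left i)
  have hq := fun i => (hU'mem _).1 (h.mem_right i)
  refine ⟨k + 1, Fin.cons x p, Fin.cons y q, Fin.cons μ ν, ⟨?_, ?_, ?_, ?_, ?_, ?_, ?_, ?_, ?_⟩⟩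
  · exact Fin.cases hxU fun i => (hp i).1.1
  · exact Fin.cases hyU fun i => (hq i).1.1
  · exact Fin.cases hμ0 h.pos
  · exact Fin.cases haxy h.map_left
  · exact Fin.cases hay h.map_right
  · refine Fin.cases (Fin.cases (by simpa using hxx) fun j => ?_) fun i => Fin.cases ?_ fun j => ?_
    · simpa [Fin.succ_ne_zero, eq_comm] using (hp j).1.2
    · simpa [Fin.succ_ne_zero, hsymm _ x] using (hp i).1.2
    · simpa using h.left_left i j
  · refine Fin.cases (Fin.cases (by simpa using hyy) fun j => ?_) fun i => Fin.cases ?_ fun j => ?_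
    · simpa [Fin.succ_ne_zero, eq_comm] using (hq j).2
    · simpa [Fin.succ_ne_zero, hsymm _ y] using (hq i).2
    · simpa using h.right_right i j
  · refine Fin.cases (Fin.cases (by simpa using hxy) fun j => ?_) fun i => Fin.cases ?_ fun j => ?_
    · simpa using (hq j).1.2
    · simpa [hsymm _ y] using (hp i).2
    · simpa using h.left_right i j
  · intro v hv
    rw [Fin.sum_univ_succ]
    simp only [Fin.cons_zero, Fin.cons_succ]
    set v' := v - (B x v • x + B y v • y) with hv'
    have hv'U : v' ∈ U' := by
      refine (hU'mem _).2 ⟨⟨U.sub_mem hv (U.add_mem (U.smul_mem _ hxU) (U.smul_mem _ hyU)), ?_⟩, ?_⟩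
      · rw [hv', map_sub, map_add, map_smul, map_smul, hxx, hxy]; simp
      · rw [hv', map_sub, map_add, map_smul, map_smul, hyx, hyy]; simp
    have hs := h.sum_eq v' hv'U
    have h1 : ∀ i, B (p i) v' = B (p i) v := fun i => by
      rw [hv', map_sub, map_add, map_smul, map_smul, hsymm _ x, hsymm _ y, (hp i).1.2, (hp i).2]
      simp
    have h2 : ∀ i, B (q i) v' = B (q i) v := fun i => by
      rw [hv', map_sub, map_add, map_smul, map_smul, hsymm _ x, hsymm _ y, (hq i).1.2, (hq i).2]
      simp
    simp only [h1, h2] at hs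
    rw [hs, hv']
    abel

end SkewBasis

end

/-! ### Small logarithms are unique up to conjugation. -/

noncomputable section

open scoped Matrix unitInterval

section LogarithmUniqueness

variable {n : ℕ}

/-- A basis of the eigenspace of `A * A` for `-c ^ 2` that is adapted to `A`. The members are the
columns of `X` and of `Y`. -/
lemma exists_rotation_columns {A : Matrix (Fin n) (Fin n) ℝ} (hA : Aᵀ = -A) {c : ℝ} (hc : 0 < c) :
    ∃ (k : ℕ) (X Y : Matrix (Fin n) (Fin k) ℝ), Xᵀ * X = 1 ∧ Yᵀ * Y = 1 ∧ Xᵀ * Y = 0 ∧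
      A * X = c • Y ∧ A * Y = -(c • X) ∧
      ∀ v, A *ᵥ (A *ᵥ v) = -(c ^ 2 • v) → (X * Xᵀ + Y * Yᵀ) *ᵥ v = v := by
  let E : Submodule ℝ (Fin n → ℝ) :=
    LinearMap.ker ((A.mulVecLin ∘ₗ A.mulVecLin) + c ^ 2 • LinearMap.id)
  have hE : ∀ v, v ∈ E ↔ A *ᵥ (A *ᵥ v) = -(c ^ 2 • v) := fun v => by
    simp [E, eq_neg_iff_add_eq_zero]
  obtain ⟨k, x, y, μ, h⟩ := exists_isSkewBasis (B := dotProductBilin ℝ ℝ) (a := A.mulVecLin)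
    (fun x y => dotProduct_comm x y)
    (fun x hx => lt_of_le_of_ne
      (show 0 ≤ x ⬝ᵥ x from Finset.sum_nonneg fun i _ => mul_self_nonneg (x i))
      fun h => hx (dotProduct_self_eq_zero.1 h.symm)) (fun x y => dotProduct_mulVec_skew hA x y) E
    (fun v hv => (hE _).2 (by rw [Matrix.mulVecLin_apply, (hE v).1 hv, Matrix.mulVec_neg,
      Matrix.mulVec_smul]))
    (fun v hv h0 => by
      have := (hE v).1 hv
      rw [Matrix.mulVecLin_apply] at h0
      rw [h0, Matrix.mulVec_zero, eq_comm, neg_eq_zero, smul_eq_zero] at this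
      exact this.resolve_left (pow_ne_zero 2 hc.ne'))
  -- On a single eigenspace of the square all speeds coincide.
  have hμ : ∀ a, μ a = c := by
    intro a
    have h1 := (hE _).1 (h.mem_left a)
    have h2 : A *ᵥ (A *ᵥ x a) = -(μ a ^ 2 • x a) := by
      have h3 := h.map_left a
      have h4 := h.map_right a
      rw [Matrix.mulVecLin_apply] at h3 h4
      rw [h3, Matrix.mulVec_smul, h4, smul_neg, smul_smul, sq]
    rw [h2, neg_inj] at h1
    have hx : x a ≠ 0 := fun h0 => by
      have := h.left_left a a
      simp [h0] at this
    have := smul_left_injective ℝ hx h1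
    exact (sq_eq_sq₀ (h.pos a).le hc.le).1 this
  refine ⟨k, Matrix.of fun i a => x a i, Matrix.of fun i a => y a i, ?_, ?_, ?_, ?_, ?_, ?_⟩
  · ext a b
    rw [Matrix.one_apply]
    exact h.left_left a b
  · ext a b
    rw [Matrix.one_apply]
    exact h.right_right a b
  · ext a b
    exact h.left_right a b
  · ext i a
    exact (congrFun (h.map_left a) i).trans (by rw [hμ]; rfl)
  · ext i a
    exact (congrFun (h.map_right a) i).trans (by rw [hμ]; rfl)
  · intro v hv
    have := h.sum_eq v ((hE v).2 hv)
    rw [Matrix.add_mulVec, ← Matrix.mulVec_mulVec, ← Matrix.mulVec_mulVec]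
    conv_rhs => rw [← this]
    rw [Finset.sum_add_distrib]
    have key : ∀ z : Fin k → Fin n → ℝ, (Matrix.of fun i a => z a i) *ᵥ
        ((Matrix.of fun i a => z a i)ᵀ *ᵥ v) = ∑ a, (z a ⬝ᵥ v) • z a := fun z => by
      funext i
      rw [Finset.sum_apply]
      change ∑ a, z a i * (z a ⬝ᵥ v) = ∑ a, (z a ⬝ᵥ v) * z a i
      exact Finset.sum_congr rfl fun a _ => mul_comm _ _
    rw [key, key]
    rfl

/-- A skew-symmetric matrix with eigenvalues in `i [-c, c]` has a spanning family of vectors that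
are eigenvectors of its square, with the eigenvalues `-θ ^ 2`, `θ ∈ [0, c]`. -/
lemma exists_spanning_eigenvectors {A : Matrix (Fin n) (Fin n) ℝ} (hA : Aᵀ = -A) {c : ℝ}
    (hs : ∀ z ∈ spectrum ℂ (A.map (algebraMap ℝ ℂ)), ‖z‖ ≤ c) :
    ∃ (u : Fin n → Fin n → ℝ) (θ : Fin n → ℝ), (∀ v, (∀ i, u i ⬝ᵥ v = 0) → v = 0) ∧
      ∀ i, A *ᵥ (A *ᵥ u i) = -(θ i ^ 2 • u i) ∧ 0 ≤ θ i ∧ θ i ≤ c := by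
  obtain ⟨U, d, hU, hU', hUd⟩ := exists_diagonalization (S := -(A * A)) (by
    rw [Matrix.transpose_neg, Matrix.transpose_mul, hA, neg_mul_neg])
  have hu : ∀ i, A *ᵥ (A *ᵥ (U *ᵥ Pi.single i 1)) = -(d i • (U *ᵥ Pi.single i 1)) := by
    intro i
    rw [Matrix.mulVec_mulVec, ← neg_neg (A * A), hUd, Matrix.neg_mulVec, Matrix.mulVec_mulVec,
      mul_assoc, hU, mul_one, ← Matrix.mulVec_mulVec, Matrix.diagonal_mulVec_single,
      ← Matrix.mulVec_smul, ← Pi.single_smul, smul_eq_mul]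
  have hu1 : ∀ i, (U *ᵥ Pi.single i 1) ⬝ᵥ (U *ᵥ Pi.single i 1) = 1 := by
    intro i
    rw [Matrix.dotProduct_mulVec, ← Matrix.mulVec_transpose, Matrix.mulVec_mulVec, hU,
      Matrix.one_mulVec]
    simp
  have hd : ∀ i, 0 ≤ d i := by
    intro i
    have := dotProduct_mulVec_skew hA (U *ᵥ Pi.single i 1) (A *ᵥ (U *ᵥ Pi.single i 1))
    rw [hu, dotProduct_neg, neg_neg, dotProduct_smul, hu1, smul_eq_mul, mul_one] at this
    rw [← this]
    exact Finset.sum_nonneg fun i _ => mul_self_nonneg _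
  refine ⟨fun i => U *ᵥ Pi.single i 1, fun i => Real.sqrt (d i), fun v hv => ?_,
    fun i => ⟨by rw [Real.sq_sqrt (hd i), hu], Real.sqrt_nonneg _, ?_⟩⟩
  · rw [← Matrix.one_mulVec v, ← hU', ← Matrix.mulVec_mulVec]
    have : Uᵀ *ᵥ v = 0 := by
      funext i
      have := hv i
      rw [dotProduct_comm, Matrix.dotProduct_mulVec, ← Matrix.mulVec_transpose] at this
      simpa using this
    rw [this, Matrix.mulVec_zero]
  · set w : Fin n → ℝ := U *ᵥ Pi.single i 1 with hw
    have hsq : Real.sqrt (d i) * Real.sqrt (d i) = d i := Real.mul_self_sqrt (hd i)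
    set r := Real.sqrt (d i)
    let f : ℝ →+* ℂ := algebraMap ℝ ℂ
    let M : Matrix (Fin n) (Fin n) ℂ := A.map f
    have hM : ∀ v : Fin n → ℝ, M *ᵥ (f ∘ v) = f ∘ (A *ᵥ v) := fun v => by
      funext j
      simp [M, Matrix.mulVec, dotProduct]
    have hw0 : f ∘ w ≠ 0 := fun h0 => by
      have h1 := hu1 i
      rw [← hw] at h1
      have : w = 0 := funext fun j => by simpa [f] using congrFun h0 j
      rw [this] at h1
      simp at h1
    have hMM : M *ᵥ (M *ᵥ (f ∘ w)) = -((r : ℂ) * r) • (f ∘ w) := by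
      rw [hM, hM, hw, hu, ← hw]
      funext j
      simp [f, ← hsq]
    -- If `M ^ 2 = z ^ 2` on a vector and `M - z` does not kill it, then `M - z` maps it to an
    -- eigenvector for `-z`. So `i r` or `-i r` is an eigenvalue, and `r` is bounded by the spectral
    -- bound.
    have key : ∀ z : ℂ, z * z = -((r : ℂ) * r) → M *ᵥ (f ∘ w) - z • (f ∘ w) ≠ 0 →
        -z ∈ spectrum ℂ M := by
      intro z hz h0
      refine mem_spectrum_iff_exists_mulVec.2 ⟨_, h0, ?_⟩
      rw [Matrix.mulVec_sub, Matrix.mulVec_smul, hMM, ← hz]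
      module
    have hI : (Complex.I * r) * (Complex.I * r) = -((r : ℂ) * r) := by
      linear_combination (r : ℂ) * r * Complex.I_mul_I
    have hr : ‖Complex.I * (r : ℂ)‖ = r := by
      rw [norm_mul, Complex.norm_I, one_mul, Complex.norm_real, Real.norm_of_nonneg]
      exact Real.sqrt_nonneg _
    by_cases h0 : M *ᵥ (f ∘ w) - (Complex.I * r) • (f ∘ w) = 0
    · have := hs _ (mem_spectrum_iff_exists_mulVec.2 ⟨_, hw0, sub_eq_zero.1 h0⟩)
      rwa [hr] at this
    · have := hs _ (key _ hI h0)
      rwa [norm_neg, hr] at this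

lemma exp_add_mulVec_of_sq {A : Matrix (Fin n) (Fin n) ℝ} (hA : Aᵀ = -A) {v : Fin n → ℝ} {θ : ℝ}
    (h : A *ᵥ (A *ᵥ v) = -(θ ^ 2 • v)) :
    (NormedSpace.exp A + (NormedSpace.exp A)ᵀ) *ᵥ v = (2 * Real.cos θ) • v := by
  have h1 := exp_mulVec_of_sq hA h 1
  have h2 := exp_mulVec_of_sq hA h (-1)
  rw [← exp_smul_transpose hA, one_smul] at h2
  rw [one_smul] at h1
  rw [Matrix.add_mulVec, h1, h2, mul_one, mul_neg_one, Real.cos_neg, Real.sinc_neg]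
  module

lemma exp_sub_mulVec_of_sq {A : Matrix (Fin n) (Fin n) ℝ} (hA : Aᵀ = -A) {v : Fin n → ℝ} {θ : ℝ}
    (h : A *ᵥ (A *ᵥ v) = -(θ ^ 2 • v)) :
    (NormedSpace.exp A - (NormedSpace.exp A)ᵀ) *ᵥ v = (2 * Real.sinc θ) • (A *ᵥ v) := by
  have h1 := exp_mulVec_of_sq hA h 1
  have h2 := exp_mulVec_of_sq hA h (-1)
  rw [← exp_smul_transpose hA, one_smul] at h2
  rw [one_smul] at h1
  rw [Matrix.sub_mulVec, h1, h2, mul_one, mul_neg_one, Real.cos_neg, Real.sinc_neg]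
  module

lemma eq_of_mulVec_eq {m : ℕ} {M N : Matrix (Fin m) (Fin n) ℝ} {u : Fin n → Fin n → ℝ}
    (hu : ∀ v, (∀ i, u i ⬝ᵥ v = 0) → v = 0) (h : ∀ i, M *ᵥ u i = N *ᵥ u i) : M = N := by
  ext a b
  have : M a - N a = 0 := hu _ fun i => by
    rw [dotProduct_sub, dotProduct_comm, dotProduct_comm _ (N a)]
    exact sub_eq_zero.2 (congrFun (h i) a)
  exact congrFun (sub_eq_zero.1 this) b

/-- A matrix with eigenvalues of modulus at most `π` that is a skew-symmetric logarithm of a given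
matrix is determined up to the choice of its part on the eigenspace for `-1`. -/
lemma mul_self_eq_of_exp_eq {A A₀ : Matrix (Fin n) (Fin n) ℝ} (hA : Aᵀ = -A) (hA₀ : A₀ᵀ = -A₀)
    (hs : ∀ z ∈ spectrum ℂ (A.map (algebraMap ℝ ℂ)), ‖z‖ ≤ Real.pi)
    (hs₀ : ∀ z ∈ spectrum ℂ (A₀.map (algebraMap ℝ ℂ)), ‖z‖ ≤ Real.pi)
    (hexp : NormedSpace.exp A = NormedSpace.exp A₀) : A * A = A₀ * A₀ := by
  obtain ⟨u, θ, hu, hθ⟩ := exists_spanning_eigenvectors hA hs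
  obtain ⟨w, η, hw, hη⟩ := exists_spanning_eigenvectors hA₀ hs₀
  refine eq_of_mulVec_eq hu fun i => ?_
  rw [← Matrix.mulVec_mulVec, ← Matrix.mulVec_mulVec, (hθ i).1]
  refine sub_eq_zero.1 (hw _ fun j => ?_)
  -- Pair eigenvectors of the two squares. If they are not orthogonal, the common symmetric part of
  -- the exponentials gives `cos θ = cos η`, hence `θ = η` because cosine is injective on `[0, π]`.
  have h1 : w j ⬝ᵥ A₀ *ᵥ (A₀ *ᵥ u i) = -(η j ^ 2) * (w j ⬝ᵥ u i) := by
    rw [← neg_neg (w j ⬝ᵥ A₀ *ᵥ _), ← dotProduct_mulVec_skew hA₀, ← dotProduct_mulVec_skew hA₀,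
      (hη j).1, neg_dotProduct, smul_dotProduct, smul_eq_mul, neg_mul]
  rw [dotProduct_sub, h1, dotProduct_neg, dotProduct_smul, smul_eq_mul]
  by_cases h0 : w j ⬝ᵥ u i = 0
  · simp [h0]
  have h2 := exp_add_mulVec_of_sq hA (hθ i).1
  have h3 := exp_add_mulVec_of_sq hA₀ (hη j).1
  have h4 : w j ⬝ᵥ (NormedSpace.exp A + (NormedSpace.exp A)ᵀ) *ᵥ u i =
      ((NormedSpace.exp A₀ + (NormedSpace.exp A₀)ᵀ) *ᵥ w j) ⬝ᵥ u i := by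
    rw [Matrix.dotProduct_mulVec, ← Matrix.mulVec_transpose, Matrix.transpose_add,
      Matrix.transpose_transpose, hexp, add_comm]
  rw [h2, h3, dotProduct_smul, smul_dotProduct, smul_eq_mul, smul_eq_mul] at h4
  have h5 := mul_left_cancel₀ two_ne_zero (mul_right_cancel₀ h0 h4)
  rw [Real.injOn_cos ⟨(hθ i).2.1, (hθ i).2.2⟩ ⟨(hη j).2.1, (hη j).2.2⟩ h5]
  ring

/-- Two skew-symmetric logarithms of a matrix with eigenvalues of modulus at most `π` are conjugate
by an orthogonal matrix that is the identity away from the eigenspace for `-1`, on which `P` is the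
projection. -/
theorem exists_conj_of_exp_eq {A A₀ : Matrix (Fin n) (Fin n) ℝ} (hA : Aᵀ = -A) (hA₀ : A₀ᵀ = -A₀)
    (hs : ∀ z ∈ spectrum ℂ (A.map (algebraMap ℝ ℂ)), ‖z‖ ≤ Real.pi)
    (hs₀ : ∀ z ∈ spectrum ℂ (A₀.map (algebraMap ℝ ℂ)), ‖z‖ ≤ Real.pi)
    (hexp : NormedSpace.exp A = NormedSpace.exp A₀) :
    ∃ C P : Matrix (Fin n) (Fin n) ℝ, Cᵀ * C = 1 ∧ A * C = C * A₀ ∧ Pᵀ = P ∧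
      NormedSpace.exp A₀ * P = -P ∧ C * (1 - P) = 1 - P ∧
      (P ≠ 0 → ∃ x y : Fin n → ℝ, x ⬝ᵥ x = 1 ∧ y ⬝ᵥ y = 1 ∧ x ⬝ᵥ y = 0 ∧
        A₀ *ᵥ x = Real.pi • y ∧ A₀ *ᵥ y = -(Real.pi • x) ∧ P *ᵥ x = x) := by
  have hAA := mul_self_eq_of_exp_eq hA hA₀ hs hs₀ hexp
  obtain ⟨k, X, Y, hXX, hYY, hXY, hAX, hAY, hXP⟩ := exists_rotation_columns hA Real.pi_pos
  obtain ⟨l, Z, W, hZZ, hWW, hZW, hAZ, hAW, hZP⟩ := exists_rotation_columns hA₀ Real.pi_pos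
  -- The projection to the eigenspace for `-π ^ 2` of the common square of the two logarithms. `X`,
  -- `Y` and `Z`, `W` are bases of it adapted to `A` and to `A₀`.
  set P := Z * Zᵀ + W * Wᵀ with hP
  have hYX : Yᵀ * X = 0 := by simpa using congrArg Matrix.transpose hXY
  have hWZ : Wᵀ * Z = 0 := by simpa using congrArg Matrix.transpose hZW
  have hPT : Pᵀ = P := by
    rw [hP, Matrix.transpose_add, Matrix.transpose_mul, Matrix.transpose_mul,
      Matrix.transpose_transpose, Matrix.transpose_transpose]
  have hQT : (X * Xᵀ + Y * Yᵀ)ᵀ = X * Xᵀ + Y * Yᵀ := by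
    rw [Matrix.transpose_add, Matrix.transpose_mul, Matrix.transpose_mul,
      Matrix.transpose_transpose, Matrix.transpose_transpose]
  have hPZ : P * Z = Z := by
    rw [hP, Matrix.add_mul, Matrix.mul_assoc, Matrix.mul_assoc, hZZ, hWZ, Matrix.mul_one, Matrix.mul_zero,
      add_zero]
  have hPW : P * W = W := by
    rw [hP, Matrix.add_mul, Matrix.mul_assoc, Matrix.mul_assoc, hWW, hZW, Matrix.mul_one, Matrix.mul_zero,
      zero_add]
  have hAAX : A * (A * X) = -(Real.pi ^ 2 • X) := by
    rw [hAX, Matrix.mul_smul, hAY, smul_neg, smul_smul, sq]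
  have hAAY : A * (A * Y) = -(Real.pi ^ 2 • Y) := by
    rw [hAY, Matrix.mul_neg, Matrix.mul_smul, hAX, smul_smul, sq]
  have hAAZ : A₀ * (A₀ * Z) = -(Real.pi ^ 2 • Z) := by
    rw [hAZ, Matrix.mul_smul, hAW, smul_neg, smul_smul, sq]
  have hAAW : A₀ * (A₀ * W) = -(Real.pi ^ 2 • W) := by
    rw [hAW, Matrix.mul_neg, Matrix.mul_smul, hAZ, smul_smul, sq]
  have cols : ∀ {B R : Matrix (Fin n) (Fin n) ℝ} {j : ℕ} {M : Matrix (Fin n) (Fin j) ℝ},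
      (∀ v, B *ᵥ (B *ᵥ v) = -(Real.pi ^ 2 • v) → R *ᵥ v = v) →
      B * (B * M) = -(Real.pi ^ 2 • M) → R * M = M := by
    intro B R j M hR hM
    refine Matrix.ext_iff_mulVec.2 fun v => ?_
    rw [← Matrix.mulVec_mulVec]
    apply hR
    rw [Matrix.mulVec_mulVec, Matrix.mulVec_mulVec, Matrix.mul_assoc, hM, Matrix.neg_mulVec, Matrix.smul_mulVec]
  have hPX : P * X = X := cols hZP (by rw [← Matrix.mul_assoc, ← hAA, Matrix.mul_assoc, hAAX])
  have hPY : P * Y = Y := cols hZP (by rw [← Matrix.mul_assoc, ← hAA, Matrix.mul_assoc, hAAY])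
  have hQZ : (X * Xᵀ + Y * Yᵀ) * Z = Z :=
    cols hXP (by rw [← Matrix.mul_assoc, hAA, Matrix.mul_assoc, hAAZ])
  have hQW : (X * Xᵀ + Y * Yᵀ) * W = W :=
    cols hXP (by rw [← Matrix.mul_assoc, hAA, Matrix.mul_assoc, hAAW])
  have hPQ : X * Xᵀ + Y * Yᵀ = P := by
    have h1 : P * (X * Xᵀ + Y * Yᵀ) = X * Xᵀ + Y * Yᵀ := by
      rw [mul_add, ← Matrix.mul_assoc, ← Matrix.mul_assoc, hPX, hPY]
    have h2 : (X * Xᵀ + Y * Yᵀ) * P = P := by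
      conv_lhs => rw [hP]
      rw [mul_add, ← Matrix.mul_assoc, ← Matrix.mul_assoc, hQZ, hQW]
    have h3 := congrArg Matrix.transpose h1
    rw [Matrix.transpose_mul, hPT, hQT, h2] at h3
    exact h3.symm
  -- The trace of the projection counts both bases.
  have hkl : k = l := by
    have h1 := congrArg Matrix.trace hPQ
    rw [hP, Matrix.trace_add, Matrix.trace_add, Matrix.trace_mul_comm X, Matrix.trace_mul_comm Y,
      Matrix.trace_mul_comm Z, Matrix.trace_mul_comm W, hXX, hYY, hZZ, hWW, Matrix.trace_one,
      Matrix.trace_one, Fintype.card_fin, Fintype.card_fin] at h1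
    exact_mod_cast (by linarith : (k : ℝ) = l)
  subst hkl
  have hA₀T : ∀ {j : ℕ} (M : Matrix (Fin n) (Fin j) ℝ), Mᵀ * A₀ = -(A₀ * M)ᵀ := fun M => by
    rw [Matrix.transpose_mul, hA₀, Matrix.mul_neg, neg_neg]
  have hA₀P : A₀ * P = Real.pi • (W * Zᵀ - Z * Wᵀ) := by
    rw [hP, mul_add, ← Matrix.mul_assoc, ← Matrix.mul_assoc, hAZ, hAW, Matrix.neg_mul,
      Matrix.smul_mul, Matrix.smul_mul, smul_sub, sub_eq_add_neg]
  have hPA₀ : P * A₀ = Real.pi • (W * Zᵀ - Z * Wᵀ) := by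
    rw [hP, add_mul, Matrix.mul_assoc, Matrix.mul_assoc, hA₀T, hA₀T, hAZ, hAW,
      Matrix.transpose_neg, Matrix.transpose_smul, Matrix.transpose_smul, neg_neg, Matrix.mul_neg,
      Matrix.mul_smul, Matrix.mul_smul, smul_sub]
    abel
  -- away from the eigenspace the two logarithms agree
  have hdiff : A * (1 - P) = A₀ * (1 - P) := by
    obtain ⟨u, θ, hu, hθ⟩ := exists_spanning_eigenvectors hA hs
    refine eq_of_mulVec_eq hu fun i => ?_
    have hθ₀ : A₀ *ᵥ (A₀ *ᵥ u i) = -(θ i ^ 2 • u i) := by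
      rw [Matrix.mulVec_mulVec, ← hAA, ← Matrix.mulVec_mulVec, (hθ i).1]
    rw [← Matrix.mulVec_mulVec, ← Matrix.mulVec_mulVec, Matrix.sub_mulVec, Matrix.one_mulVec]
    by_cases hi : θ i = Real.pi
    · rw [hZP _ (by rw [hθ₀, hi]), sub_self, Matrix.mulVec_zero, Matrix.mulVec_zero]
    · have hlt : θ i < Real.pi := (hθ i).2.2.lt_of_ne hi
      have hPu : P *ᵥ u i = 0 := by
        have h1 : P * (A₀ * A₀) = -(Real.pi ^ 2 • P) := by
          rw [← mul_assoc, hPA₀, ← hA₀P, mul_assoc, hPA₀, ← hA₀P]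
          conv_lhs => rw [hP]
          rw [mul_add, mul_add, ← Matrix.mul_assoc, ← Matrix.mul_assoc, ← Matrix.mul_assoc,
            ← Matrix.mul_assoc, Matrix.mul_assoc A₀ A₀, Matrix.mul_assoc A₀ A₀, hAAZ, hAAW,
            Matrix.neg_mul, Matrix.neg_mul, Matrix.smul_mul, Matrix.smul_mul, hP, smul_add, neg_add]
        have h2 := congrArg (· *ᵥ u i) h1
        simp only [← Matrix.mulVec_mulVec, hθ₀, Matrix.neg_mulVec, Matrix.smul_mulVec,
          Matrix.mulVec_neg, Matrix.mulVec_smul, neg_inj] at h2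
        rw [← sub_eq_zero, ← sub_smul, smul_eq_zero] at h2
        refine h2.resolve_left fun h3 => hi ?_
        exact (sq_eq_sq₀ (hθ i).2.1 Real.pi_pos.le).1 (sub_eq_zero.1 h3)
      rw [hPu, sub_zero]
      have h1 := exp_sub_mulVec_of_sq hA (hθ i).1
      rw [hexp, exp_sub_mulVec_of_sq hA₀ hθ₀] at h1
      refine (smul_right_injective _ (mul_ne_zero two_ne_zero ?_) h1).symm
      rcases eq_or_ne (θ i) 0 with h0 | h0
      · simp [h0]
      · rw [Real.sinc_of_ne_zero h0]
        exact div_ne_zero (Real.sin_pos_of_pos_of_lt_pi ((hθ i).2.1.lt_of_ne' h0) hlt).ne' h0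
  -- `T` takes the basis adapted to `A₀` to the one adapted to `A` and is zero on the complement, so
  -- `1 - P + T` is the conjugating matrix.
  set T := X * Zᵀ + Y * Wᵀ with hT
  have hTT : Tᵀ * T = P := by
    rw [hT, Matrix.transpose_add, Matrix.transpose_mul, Matrix.transpose_mul,
      Matrix.transpose_transpose, Matrix.transpose_transpose, add_mul, mul_add, mul_add]
    have e : ∀ (a b : Matrix (Fin n) (Fin k) ℝ) (c d : Matrix (Fin k) (Fin n) ℝ),
      a * c * (b * d) = a * ((c * b) * d) := fun a b c d => by
        simp only [Matrix.mul_assoc]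
    rw [e, e, e, e, hXX, hXY, hYX, hYY, Matrix.one_mul, Matrix.one_mul, Matrix.zero_mul,
      Matrix.mul_zero, Matrix.zero_mul, Matrix.mul_zero, add_zero, zero_add]
  have hPT' : P * T = T := by
    rw [hT, mul_add, ← Matrix.mul_assoc, ← Matrix.mul_assoc, hPX, hPY]
  have hZPt : Zᵀ * P = Zᵀ := by
    have := congrArg Matrix.transpose hPZ
    rwa [Matrix.transpose_mul, hPT] at this
  have hWPt : Wᵀ * P = Wᵀ := by
    have := congrArg Matrix.transpose hPW
    rwa [Matrix.transpose_mul, hPT] at this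
  have hTP : T * P = T := by
    rw [hT, add_mul, Matrix.mul_assoc, Matrix.mul_assoc, hZPt, hWPt]
  have hPP : P * P = P := by
    conv_lhs => rw [hP, ← hP]
    conv_lhs => enter [2]; rw [hP]
    rw [mul_add, ← Matrix.mul_assoc, ← Matrix.mul_assoc, hPZ, hPW]
  have hTtP : Tᵀ * P = Tᵀ := by
    have := congrArg Matrix.transpose hPT'
    rwa [Matrix.transpose_mul, hPT] at this
  refine ⟨1 - P + T, P, ?_, ?_, hPT, ?_, ?_, ?_⟩
  · rw [Matrix.transpose_add, Matrix.transpose_sub, Matrix.transpose_one, hPT]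
    simp only [add_mul, mul_add, sub_mul, mul_sub, one_mul, mul_one, hTT, hPT', hTtP, hPP]
    abel
  · have hAT : A * T = Real.pi • (Y * Zᵀ - X * Wᵀ) := by
      rw [hT, mul_add, ← Matrix.mul_assoc, ← Matrix.mul_assoc, hAX, hAY, Matrix.neg_mul,
        Matrix.smul_mul, Matrix.smul_mul, smul_sub, sub_eq_add_neg]
    have hTA : T * A₀ = Real.pi • (Y * Zᵀ - X * Wᵀ) := by
      rw [hT, add_mul, Matrix.mul_assoc, Matrix.mul_assoc, hA₀T, hA₀T, hAZ, hAW,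
        Matrix.transpose_neg, Matrix.transpose_smul, Matrix.transpose_smul, neg_neg, Matrix.mul_neg,
        Matrix.mul_smul, Matrix.mul_smul, smul_sub]
      abel
    rw [mul_add, hdiff, add_mul, hAT, hTA, mul_sub, sub_mul, one_mul, mul_one, hA₀P, hPA₀]
  · have key : ∀ v, NormedSpace.exp A₀ *ᵥ (P *ᵥ v) = -(P *ᵥ v) := by
      intro v
      have hA₀v : A₀ *ᵥ (A₀ *ᵥ (P *ᵥ v)) = -(Real.pi ^ 2 • (P *ᵥ v)) := by
        have : A₀ * (A₀ * P) = -(Real.pi ^ 2 • P) := by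
          rw [hP, mul_add, mul_add, ← Matrix.mul_assoc, ← Matrix.mul_assoc, ← Matrix.mul_assoc,
            ← Matrix.mul_assoc, Matrix.mul_assoc A₀ A₀, Matrix.mul_assoc A₀ A₀, hAAZ, hAAW,
            Matrix.neg_mul, Matrix.neg_mul, Matrix.smul_mul, Matrix.smul_mul, smul_add, neg_add]
        rw [Matrix.mulVec_mulVec, Matrix.mulVec_mulVec, mul_assoc, this, Matrix.neg_mulVec, Matrix.smul_mulVec]
      have h1 := exp_mulVec_of_sq hA₀ hA₀v 1
      rw [one_smul, mul_one, one_mul, Real.cos_pi, Real.sinc_of_ne_zero Real.pi_ne_zero,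
        Real.sin_pi, zero_div, zero_smul, add_zero, neg_one_smul] at h1
      exact h1
    refine Matrix.ext_iff_mulVec.2 fun v => ?_
    rw [← Matrix.mulVec_mulVec, key, Matrix.neg_mulVec]
  · rw [add_mul, mul_sub, mul_sub, mul_one, mul_one, sub_mul, one_mul, hPP, hTP]
    abel
  · intro hP0
    rcases Nat.eq_zero_or_pos k with rfl | hk
    · exact absurd (by rw [hP, Subsingleton.elim Z 0, Subsingleton.elim W 0]; simp) hP0
    · refine ⟨fun i => Z i ⟨0, hk⟩, fun i => W i ⟨0, hk⟩, ?_, ?_, ?_, ?_, ?_, ?_⟩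
      · exact (congrFun (congrFun hZZ ⟨0, hk⟩) ⟨0, hk⟩).trans (Matrix.one_apply_eq _)
      · exact (congrFun (congrFun hWW ⟨0, hk⟩) ⟨0, hk⟩).trans (Matrix.one_apply_eq _)
      · exact congrFun (congrFun hZW ⟨0, hk⟩) ⟨0, hk⟩
      · funext i
        exact congrFun (congrFun hAZ i) ⟨0, hk⟩
      · funext i
        exact congrFun (congrFun hAW i) ⟨0, hk⟩
      · funext i
        exact congrFun (congrFun hPZ i) ⟨0, hk⟩

end LogarithmUniqueness

end

/-! ### Loops made from two logarithms of the same matrix. -/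

noncomputable section

open scoped Matrix unitInterval

section ExponentialLoops

variable {n : ℕ} {ℓ : ℝ}

/-- A logarithm joins `C` to the identity within `SO_n`. -/
lemma loopHomotopic_const {C : Matrix (Fin n) (Fin n) ℝ}
    (hC : C ∈ Matrix.specialOrthogonalGroup (Fin n) ℝ) :
    LoopHomotopic ℓ (fun _ => 1) fun _ => C := by
  obtain ⟨L, hL, hLC, -, -⟩ := exists_exp_eq hC
  refine ⟨fun a => NormedSpace.exp ((a.1 : ℝ) • L), ⟨?_, fun a => exp_smul_mem hL _,
    fun s t => rfl⟩, fun t => by simp [NormedSpace.exp_zero], fun t => by simp [hLC]⟩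
  exact continuous_matrix_exp.comp (by fun_prop)

lemma continuous_exp_smul (A : Matrix (Fin n) (Fin n) ℝ) :
    Continuous fun t : ℝ => NormedSpace.exp (t • A) :=
  continuous_matrix_exp.comp (by fun_prop)

/-- The commutator of an exponential with a matrix that is the identity away from an eigenspace
of `exp (ℓ A)` is a null-homotopic loop. -/
lemma loopHomotopic_commutator {A C P : Matrix (Fin n) (Fin n) ℝ} (hA : Aᵀ = -A)
    (hC : C ∈ Matrix.specialOrthogonalGroup (Fin n) ℝ) (hP : Pᵀ = P)
    (hAP : NormedSpace.exp (ℓ • A) * P = -P) (hCP : C * (1 - P) = 1 - P) :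
    LoopHomotopic ℓ (fun _ => 1) fun t =>
      NormedSpace.exp ((-t) • A) * C * NormedSpace.exp (t • A) * Cᵀ := by
  obtain ⟨L, hL, hLC, -, hfix⟩ := exists_exp_eq hC
  set h := NormedSpace.exp (ℓ • A) with hh
  have hmem := exp_smul_mem hA ℓ
  have hPh : P * h = -P := by
    have h1 := congrArg Matrix.transpose hAP
    rw [Matrix.transpose_mul, hP, Matrix.transpose_neg, hP] at h1
    have h2 := congrArg (· * h) h1
    simp only [mul_assoc] at h2
    rw [transpose_mul_of_mem hmem, mul_one, neg_mul] at h2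
    exact (neg_eq_iff_eq_neg.2 h2).symm
  have hLP : L * (1 - P) = 0 := by
    refine Matrix.ext_iff_mulVec.2 fun v => ?_
    rw [← Matrix.mulVec_mulVec, Matrix.zero_mulVec]
    exact hfix _ (by rw [Matrix.mulVec_mulVec, hCP])
  have hexpP : ∀ s : ℝ, NormedSpace.exp (s • L) * (1 - P) = 1 - P := by
    intro s
    refine Matrix.ext_iff_mulVec.2 fun v => ?_
    have hv : L *ᵥ ((1 - P) *ᵥ v) = 0 := by rw [Matrix.mulVec_mulVec, hLP, Matrix.zero_mulVec]
    rw [← Matrix.mulVec_mulVec,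
      exp_mulVec_of_rotation (w := 0) (μ := 0) (by simpa using hv) (by simp)]
    simp
  have hexpP' : ∀ s : ℝ, (1 - P) * NormedSpace.exp (s • L) = 1 - P := by
    intro s
    have := congrArg Matrix.transpose (hexpP (-s))
    rwa [Matrix.transpose_mul, exp_smul_transpose hL, neg_neg, Matrix.transpose_sub,
      Matrix.transpose_one, hP] at this
  -- `exp (s L)` is the identity off the range of `P`, on which `h = -1`; so it commutes with `h`.
  -- Therefore replacing `C` by `exp (s L)` in the commutator gives an `ℓ`-periodic function for
  -- every `s`.
  have hcomm : ∀ s : ℝ, NormedSpace.exp (s • L) * h = h * NormedSpace.exp (s • L) := by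
    intro s
    have e1 := hexpP s
    have e2 := hexpP' s
    set M := NormedSpace.exp (s • L)
    have e3 : M * P = M - (1 - P) := by rw [← e1, mul_sub, mul_one]; abel
    have e4 : P * M = M - (1 - P) := by rw [← e2, sub_mul, one_mul]; abel
    have e5 : M * h = M * (P * h) + (M * (1 - P)) * h := by rw [mul_sub, sub_mul, mul_one, mul_assoc]; abel
    have e6 : h * M = (h * P) * M + h * ((1 - P) * M) := by rw [sub_mul, mul_sub, one_mul, mul_assoc]; abel
    rw [e5, e6, hPh, hAP, e1, e2, mul_neg, neg_mul, e3, e4, sub_mul, mul_sub, hPh, hAP, one_mul, mul_one]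
  refine ⟨fun a => NormedSpace.exp ((-a.2) • A) * NormedSpace.exp ((a.1 : ℝ) • L) *
    NormedSpace.exp (a.2 • A) * NormedSpace.exp ((-(a.1 : ℝ)) • L), ⟨?_, fun a => ?_, fun s t => ?_⟩,
    fun t => ?_, fun t => ?_⟩
  · refine Continuous.mul (Continuous.mul (Continuous.mul ?_ ?_) ?_) ?_ <;>
      exact continuous_matrix_exp.comp (by fun_prop)
  · exact mul_mem (mul_mem (mul_mem (exp_smul_mem hA _) (exp_smul_mem hL _)) (exp_smul_mem hA _))
      (exp_smul_mem hL _)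
  · simp only
    congr 1
    rw [neg_add, exp_add_smul, add_comm t, exp_add_smul, ← hh]
    simp only [mul_assoc]
    rw [← mul_assoc _ h, hcomm, ← mul_assoc _ (h * _), ← mul_assoc _ h, exp_neg_smul_mul, one_mul]
  · simp only [Set.Icc.coe_zero, neg_zero, zero_smul, NormedSpace.exp_zero, mul_one]
    exact exp_neg_smul_mul A t
  · simp only [Set.Icc.coe_one, one_smul, hLC]
    rw [← exp_smul_transpose hL, one_smul, hLC]

lemma vecReflection_mul_vecReflection {x y : Fin n → ℝ} (hx : x ⬝ᵥ x = 1) (hy : y ⬝ᵥ y = 1)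
    (hxy : x ⬝ᵥ y = 0) (α : ℝ) :
    vecReflection (Real.cos α • x + Real.sin α • y) * vecReflection x =
      planeRotation x y (2 * α) := by
  have hyx : y ⬝ᵥ x = 0 := by rw [dotProduct_comm, hxy]
  have h1 := Real.cos_sq_add_sin_sq α
  have hu : (Real.cos α • x + Real.sin α • y) ⬝ᵥ (Real.cos α • x + Real.sin α • y) = 1 := by
    simp only [add_dotProduct, dotProduct_add, smul_dotProduct, dotProduct_smul, hx, hy, hxy, hyx,
      smul_eq_mul]
    linarith
  refine Matrix.ext_iff_mulVec.2 fun v => ?_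
  rw [← Matrix.mulVec_mulVec, vecReflection_mulVec, vecReflection_mulVec, planeRotation_mulVec, hu,
    hx]
  simp only [add_dotProduct, smul_dotProduct, dotProduct_smul, dotProduct_sub,
    hx, hyx, smul_eq_mul, Real.cos_two_mul, Real.sin_two_mul]
  funext i
  simp only [Pi.add_apply, Pi.sub_apply, Pi.smul_apply, smul_eq_mul]
  linear_combination (-2 * (y ⬝ᵥ v) * y i) * h1

lemma norm_le_of_mem_spectrum_smul {A : Matrix (Fin n) (Fin n) ℝ} {c : ℝ} (hℓ : 0 < ℓ)
    (hs : ∀ z ∈ spectrum ℂ (A.map (algebraMap ℝ ℂ)), ‖z‖ ≤ c / ℓ) :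
    ∀ z ∈ spectrum ℂ ((ℓ • A).map (algebraMap ℝ ℂ)), ‖z‖ ≤ c := by
  intro z hz
  obtain ⟨v, hv, h⟩ := mem_spectrum_iff_exists_mulVec.1 hz
  have hℓ' : (ℓ : ℂ) ≠ 0 := by exact_mod_cast hℓ.ne'
  have h1 : (ℓ • A).map (algebraMap ℝ ℂ) = (ℓ : ℂ) • A.map (algebraMap ℝ ℂ) := by
    ext i j
    simp
  rw [h1, Matrix.smul_mulVec] at h
  have h2 := hs (z / ℓ) (mem_spectrum_iff_exists_mulVec.2 ⟨v, hv, by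
    rw [div_eq_inv_mul, mul_smul, ← h, smul_smul, inv_mul_cancel₀ hℓ', one_smul]⟩)
  rw [norm_div, Complex.norm_real, Real.norm_of_nonneg hℓ.le] at h2
  exact (div_le_div_iff_of_pos_right hℓ).1 h2

/-- The comparison of two skew-symmetric logarithms with small eigenvalues of the same matrix. They
are conjugate by an orthogonal matrix, and its determinant detects whether the loop that is the
quotient of the one-parameter groups is null-homotopic. -/
theorem exists_conj_loopHomotopic_iff (hn : Even n) (hℓ : 0 < ℓ) {A A₀ : Matrix (Fin n) (Fin n) ℝ}
    (hA : Aᵀ = -A) (hA₀ : A₀ᵀ = -A₀)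
    (hs : ∀ z ∈ spectrum ℂ (A.map (algebraMap ℝ ℂ)), ‖z‖ ≤ Real.pi / ℓ)
    (hs₀ : ∀ z ∈ spectrum ℂ (A₀.map (algebraMap ℝ ℂ)), ‖z‖ ≤ Real.pi / ℓ)
    (hexp : NormedSpace.exp (ℓ • A) = NormedSpace.exp (ℓ • A₀)) :
    ∃ C : Matrix (Fin n) (Fin n) ℝ, Cᵀ * C = 1 ∧ A * C = C * A₀ ∧
      (∀ v, NormedSpace.exp (ℓ • A₀) *ᵥ v = v → C *ᵥ v = v) ∧
      (LoopHomotopic ℓ (fun _ => 1)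
        (fun t => NormedSpace.exp ((-t) • A₀) * NormedSpace.exp (t • A)) ↔ C.det = 1) := by
  have hℓA : (ℓ • A)ᵀ = -(ℓ • A) := by rw [Matrix.transpose_smul, hA, smul_neg]
  have hℓA₀ : (ℓ • A₀)ᵀ = -(ℓ • A₀) := by rw [Matrix.transpose_smul, hA₀, smul_neg]
  obtain ⟨C, P, hC, hAC, hP, hPexp, hCP, hxy⟩ := exists_conj_of_exp_eq hℓA hℓA₀
    (norm_le_of_mem_spectrum_smul hℓ hs) (norm_le_of_mem_spectrum_smul hℓ hs₀) hexp
  have hC' : C * Cᵀ = 1 := mul_eq_one_comm.1 hC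
  have hAC' : A * C = C * A₀ := by
    rw [smul_mul_assoc, mul_smul_comm] at hAC
    exact smul_right_injective _ hℓ.ne' hAC
  have hconj : ∀ t : ℝ, NormedSpace.exp (t • A) = C * NormedSpace.exp (t • A₀) * Cᵀ := by
    intro t
    have hCi : C⁻¹ = Cᵀ := Matrix.inv_eq_left_inv hC
    rw [← hCi, ← Matrix.exp_conj _ _ (IsUnit.of_mul_eq_one _ hC'), hCi, mul_smul_comm, ← hAC',
      smul_mul_assoc, mul_assoc, hC', mul_one]
  have hdet : C.det = 1 ∨ C.det = -1 := by
    have := congrArg Matrix.det hC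
    rw [Matrix.det_mul, Matrix.det_transpose, Matrix.det_one] at this
    exact mul_self_eq_one_iff.1 this
  refine ⟨C, hC, hAC', fun v hv => ?_, ?_⟩
  · have h1 : P *ᵥ v = 0 := by
      have h2 := congrArg Matrix.transpose hPexp
      have hm := exp_smul_mem hA₀ ℓ
      rw [Matrix.transpose_mul, hP, Matrix.transpose_neg, hP] at h2
      have h3 := congrArg (· *ᵥ v) h2
      simp only [← Matrix.mulVec_mulVec, Matrix.neg_mulVec] at h3
      have h4 : (NormedSpace.exp (ℓ • A₀))ᵀ *ᵥ v = v := by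
        conv_lhs => rw [← hv]
        rw [Matrix.mulVec_mulVec, transpose_mul_of_mem hm, Matrix.one_mulVec]
      rw [h4] at h3
      exact self_eq_neg.1 h3
    have h2 := congrArg (· *ᵥ v) hCP
    simp only [← Matrix.mulVec_mulVec, Matrix.sub_mulVec, h1, Matrix.one_mulVec, sub_zero] at h2
    exact h2
  have hγ : ∀ t : ℝ, NormedSpace.exp ((-t) • A₀) * NormedSpace.exp (t • A) =
      NormedSpace.exp ((-t) • A₀) * C * NormedSpace.exp (t • A₀) * Cᵀ := fun t => by
    rw [hconj]; simp only [mul_assoc]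
  simp only [hγ]
  refine ⟨fun h => hdet.resolve_right fun hdet' => ?_, fun hdet' =>
    loopHomotopic_commutator hA₀ (mem_specialOrthogonal_iff.2 ⟨hC, hdet'⟩) hP hPexp hCP⟩
  -- If `h` had no eigenvalue `-1`, then `C` would be the identity, which has determinant `1`.
  have hP0 : P ≠ 0 := by
    rintro rfl
    rw [sub_zero, mul_one] at hCP
    rw [hCP, Matrix.det_one] at hdet'
    norm_num at hdet'
  obtain ⟨x, y, hx, hy, hxy, hAx, hAy, hPx⟩ := hxy hP0
  have hx0 : x ≠ 0 := by
    rintro rfl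
    simp at hx
  -- The reflection in a vector of the eigenspace for `-1` corrects the determinant: `C * R` has
  -- determinant `1` and still is the identity away from this eigenspace, so its commutator is
  -- null-homotopic.
  set R := vecReflection x with hR
  have hRR : R * R = 1 := vecReflection_mul_self hx0
  have hRT : Rᵀ = R := vecReflection_transpose x
  have hRP : R * (1 - P) = 1 - P := by
    refine Matrix.ext_iff_mulVec.2 fun v => ?_
    have : x ⬝ᵥ ((1 - P) *ᵥ v) = 0 := by
      rw [Matrix.dotProduct_mulVec, ← Matrix.mulVec_transpose, Matrix.transpose_sub,
        Matrix.transpose_one, hP, Matrix.sub_mulVec, Matrix.one_mulVec, hPx, sub_self,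
        zero_dotProduct]
    rw [← Matrix.mulVec_mulVec, vecReflection_mulVec, this]
    simp
  have hCR : C * R ∈ Matrix.specialOrthogonalGroup (Fin n) ℝ := by
    refine mem_specialOrthogonal_iff.2 ⟨?_, ?_⟩
    · rw [Matrix.transpose_mul, hRT, mul_assoc, ← mul_assoc Cᵀ, hC, one_mul, hRR]
    · rw [Matrix.det_mul, hdet', vecReflection_det hx0, neg_mul_neg, one_mul]
  have h1 := loopHomotopic_commutator hA₀ hCR hP hPexp (by rw [mul_assoc, hRP, hCP])
  -- The discrepancy is the commutator with `R`. It is the product of the reflection in a vector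
  -- that turns by `π` in the time `ℓ` with the fixed reflection `R`, hence a rotation by twice that
  -- angle: a full turn.
  have hrot : ∀ t, NormedSpace.exp ((-t) • A₀) * R * NormedSpace.exp (t • A₀) * R =
      planeRotation x y (-(2 * Real.pi * t / ℓ)) := by
    intro t
    set M := NormedSpace.exp ((-t) • A₀) with hM
    have hm : M ∈ Matrix.specialOrthogonalGroup (Fin n) ℝ := exp_smul_mem hA₀ _
    have hMT : NormedSpace.exp (t • A₀) = Mᵀ := by rw [hM, exp_smul_transpose hA₀, neg_neg]
    have hMx : M *ᵥ x = Real.cos (-(Real.pi * t / ℓ)) • x + Real.sin (-(Real.pi * t / ℓ)) • y := by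
      have e : ∀ {u w : Fin n → ℝ}, (ℓ • A₀) *ᵥ u = w → A₀ *ᵥ u = ℓ⁻¹ • w := by
        rintro u w rfl
        rw [Matrix.smul_mulVec, smul_smul, inv_mul_cancel₀ hℓ.ne', one_smul]
      rw [hM, exp_mulVec_of_rotation (w := y) (μ := ℓ⁻¹ * Real.pi) (by rw [e hAx, smul_smul])
        (by rw [e hAy, smul_neg, smul_smul])]
      congr 3 <;> ring
    have h2 : M * R * Mᵀ = vecReflection (M *ᵥ x) := by
      have hMM : (M *ᵥ x) ⬝ᵥ (M *ᵥ x) = x ⬝ᵥ x := by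
        rw [Matrix.dotProduct_mulVec, ← Matrix.mulVec_transpose, Matrix.mulVec_mulVec,
          transpose_mul_of_mem hm, Matrix.one_mulVec]
      refine Matrix.ext_iff_mulVec.2 fun v => ?_
      rw [mul_assoc, ← Matrix.mulVec_mulVec, ← Matrix.mulVec_mulVec, vecReflection_mulVec,
        vecReflection_mulVec, Matrix.mulVec_sub, Matrix.mulVec_mulVec, mul_transpose_of_mem hm,
        Matrix.one_mulVec, Matrix.mulVec_smul, hMM, Matrix.dotProduct_mulVec,
        ← Matrix.mulVec_transpose, Matrix.transpose_transpose]
    rw [hMT, h2, hMx, vecReflection_mul_vecReflection hx hy hxy]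
    congr 1
    ring
  -- The quotient of the two commutators is conjugated by the constant `C * R`, which is homotopic
  -- to the identity. What is left is the full turn.
  have h2 := ((loopHomotopic_const (ℓ := ℓ) (transpose_mem_specialOrthogonal hCR)).mul
    (h1.transpose.mul h)).mul (loopHomotopic_const hCR)
  have h3 := h2.transpose
  simp only [Matrix.transpose_one, mul_one] at h3
  have h4 : ∀ t : ℝ, ((C * R)ᵀ * ((NormedSpace.exp ((-t) • A₀) * (C * R) *
      NormedSpace.exp (t • A₀) * (C * R)ᵀ)ᵀ * (NormedSpace.exp ((-t) • A₀) * C *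
      NormedSpace.exp (t • A₀) * Cᵀ)) * (C * R))ᵀ = planeRotation x y (2 * Real.pi * t / ℓ) := by
    intro t
    rw [← neg_neg (2 * Real.pi * t / ℓ), ← planeRotation_transpose, ← hrot]
    congr 1
    have e : NormedSpace.exp (t • A₀) * NormedSpace.exp ((-t) • A₀) = 1 := by
      rw [exp_mul_comm, exp_neg_smul_mul]
    simp only [Matrix.transpose_mul, Matrix.transpose_transpose, hRT, exp_smul_transpose hA₀,
      neg_neg, mul_assoc]
    rw [← mul_assoc Cᵀ C, hC, one_mul, ← mul_assoc R R, hRR, one_mul,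
      ← mul_assoc (NormedSpace.exp (t • A₀)) (NormedSpace.exp ((-t) • A₀)), e, one_mul,
      ← mul_assoc Cᵀ C, hC, one_mul, ← mul_assoc Cᵀ C, hC, one_mul]
  simp only [h4] at h3
  exact not_loopHomotopic_planeRotation hn hℓ hx hy hxy h3

end ExponentialLoops

end

/-! ### Pfaffians of matrices and of bilinear forms. -/

noncomputable section

open scoped Matrix

section Pfaffian

/-- The indices `2 i` and `2 i + 1` as the pair with the number `i`. -/
def pairEquiv (k : ℕ) : Fin k × Fin 2 ≃ Fin (2 * k) :=
  finProdFinEquiv.trans (finCongr (mul_comm k 2))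

lemma pairEquiv_zero {k : ℕ} (i : Fin k) : pairEquiv k (i, 0) = ⟨2 * i.1, by omega⟩ := by
  ext
  simp [pairEquiv]

lemma pairEquiv_one {k : ℕ} (i : Fin k) : pairEquiv k (i, 1) = ⟨2 * i.1 + 1, by omega⟩ := by
  ext
  simp [pairEquiv, add_comm]

lemma matrixPfaffian_eq {k : ℕ} (A : Matrix (Fin (2 * k)) (Fin (2 * k)) ℝ) :
    matrixPfaffian A = ((2 : ℝ) ^ k * (k.factorial : ℝ))⁻¹ *
      ∑ ρ : Equiv.Perm (Fin k × Fin 2), ((Equiv.Perm.sign ρ : ℤ) : ℝ) *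
        ∏ i : Fin k, A (pairEquiv k (ρ (i, 0))) (pairEquiv k (ρ (i, 1))) := by
  rw [matrixPfaffian]
  congr 1
  refine (Fintype.sum_equiv (pairEquiv k).permCongr _ _ fun ρ => ?_).symm
  rw [Equiv.Perm.sign_permCongr]
  congr 1
  refine Finset.prod_congr rfl fun i _ => ?_
  rw [← pairEquiv_zero, ← pairEquiv_one, Equiv.permCongr_apply, Equiv.permCongr_apply,
    Equiv.symm_apply_apply, Equiv.symm_apply_apply]

/-- The permutation of `Fin k × Fin 2` that permutes the pairs by `τ`, after it has permuted the
members of each pair. -/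
def pairPerm {k : ℕ} (a : Equiv.Perm (Fin k) × (Fin k → Equiv.Perm (Fin 2))) :
    Equiv.Perm (Fin k × Fin 2) :=
  (Equiv.prodCongrLeft fun _ => a.1) * Equiv.prodCongrRight a.2

lemma pairPerm_apply {k : ℕ} (a : Equiv.Perm (Fin k) × (Fin k → Equiv.Perm (Fin 2)))
    (b : Fin k × Fin 2) : pairPerm a b = (a.1 b.1, a.2 b.1 b.2) := rfl

/-- A permutation of the pairs acts in the same way on first and second members, so it contributes
the square of its sign. -/
lemma sign_pairPerm {k : ℕ} (a : Equiv.Perm (Fin k) × (Fin k → Equiv.Perm (Fin 2))) :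
    Equiv.Perm.sign (pairPerm a) = ∏ i, Equiv.Perm.sign (a.2 i) := by
  rw [pairPerm, Equiv.Perm.sign_mul, Equiv.Perm.sign_prodCongrLeft, Equiv.Perm.sign_prodCongrRight]
  simp

lemma pairPerm_injective (k : ℕ) : Function.Injective (pairPerm (k := k)) := by
  rintro ⟨τ, f⟩ ⟨τ', f'⟩ h
  have h1 := fun b => congrArg (fun ρ : Equiv.Perm (Fin k × Fin 2) => ρ b) h
  simp only [pairPerm_apply, Prod.mk.injEq] at h1
  refine Prod.ext (Equiv.ext fun i => (h1 (i, 0)).1) (funext fun i => Equiv.ext fun b => (h1 (i, b)).2)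

lemma exists_pairPerm_eq {k : ℕ} {ρ : Equiv.Perm (Fin k × Fin 2)}
    (h : ∀ i, (ρ (i, 0)).1 = (ρ (i, 1)).1) : ∃ a, pairPerm a = ρ := by
  have h' : ∀ i b, (ρ (i, b)).1 = (ρ (i, 0)).1 := fun i b => by
    fin_cases b
    · rfl
    · exact (h i).symm
  have hf : ∀ i, Function.Injective fun b => (ρ (i, b)).2 := fun i b c hbc => by
    have : ρ (i, b) = ρ (i, c) := Prod.ext (by rw [h', h' i c]) hbc
    simpa using ρ.injective this
  have hfb := fun i => Finite.injective_iff_bijective.1 (hf i)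
  have hτ : Function.Surjective fun i => (ρ (i, 0)).1 := fun j => by
    obtain ⟨⟨i, b⟩, hib⟩ := ρ.surjective (j, 0)
    exact ⟨i, by simp only; rw [← h' i b, hib]⟩
  have hτb := Finite.surjective_iff_bijective.1 hτ
  refine ⟨(Equiv.ofBijective _ hτb, fun i => Equiv.ofBijective _ (hfb i)), Equiv.ext ?_⟩
  rintro ⟨i, b⟩
  exact Prod.ext (h' i b).symm rfl

/-- The Pfaffian of a block diagonal matrix with skew-symmetric blocks of size two. -/
lemma matrixPfaffian_of_pairs {k : ℕ} {A : Matrix (Fin (2 * k)) (Fin (2 * k)) ℝ} {μ : Fin k → ℝ}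
    (h01 : ∀ i, A (pairEquiv k (i, 0)) (pairEquiv k (i, 1)) = μ i)
    (h10 : ∀ i, A (pairEquiv k (i, 1)) (pairEquiv k (i, 0)) = -μ i)
    (h0 : ∀ i j b c, i ≠ j → A (pairEquiv k (i, b)) (pairEquiv k (j, c)) = 0) :
    matrixPfaffian A = ∏ i, μ i := by
  have hterm : ∀ a : Equiv.Perm (Fin k) × (Fin k → Equiv.Perm (Fin 2)),
      ((Equiv.Perm.sign (pairPerm a) : ℤ) : ℝ) *
        ∏ i : Fin k, A (pairEquiv k (pairPerm a (i, 0))) (pairEquiv k (pairPerm a (i, 1))) =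
        ∏ i, μ i := by
    intro a
    rw [sign_pairPerm, ← Equiv.prod_comp a.1 μ]
    push_cast
    rw [← Finset.prod_mul_distrib]
    refine Finset.prod_congr rfl fun i _ => ?_
    rw [pairPerm_apply, pairPerm_apply]
    have key : ∀ p : Equiv.Perm (Fin 2), p = 1 ∨ p = Equiv.swap 0 1 := by decide
    rcases key (a.2 i) with h | h <;> rw [h]
    · simp [h01]
    · simp [h10]
  -- Only permutations that map pairs to pairs contribute. There are `2 ^ k * k!` of them with equal
  -- terms, which the normalizing factor cancels.
  rw [matrixPfaffian_eq, ← Finset.sum_of_injOn pairPerm (s := Finset.univ)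
    (f := fun _ => ∏ i, μ i) (pairPerm_injective k).injOn (fun _ _ => Finset.mem_coe.2 (Finset.mem_univ _))
    (fun ρ _ hρ => ?_) (fun a _ => (hterm a).symm)]
  · rw [Finset.sum_const, Finset.card_univ, Fintype.card_prod, Fintype.card_perm, Fintype.card_fin,
      Fintype.card_fun, Fintype.card_fin, Fintype.card_perm, Fintype.card_fin, nsmul_eq_mul]
    have : (k.factorial : ℝ) ≠ 0 := by exact_mod_cast k.factorial_ne_zero
    push_cast
    field_simp
    norm_num
  · by_contra hne
    refine hρ ?_
    obtain ⟨a, ha⟩ := exists_pairPerm_eq (ρ := ρ) fun i => by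
      by_contra hi
      exact hne (mul_eq_zero_of_right _ (Finset.prod_eq_zero (Finset.mem_univ i) (h0 _ _ _ _ hi)))
    exact ⟨a, Finset.mem_coe.2 (Finset.mem_univ _), ha⟩

variable {V : Type*} [AddCommGroup V] [Module ℝ V]

lemma prod_update_pair {k : ℕ} [DecidableEq (Fin (2 * k))] (a : V →ₗ[ℝ] V →ₗ[ℝ] ℝ)
    (w : Fin (2 * k) → V) (i : Fin k) (b : Fin 2) (x : V) :
    (∏ j, a (Function.update w (pairEquiv k (i, b)) x (pairEquiv k (j, 0)))
      (Function.update w (pairEquiv k (i, b)) x (pairEquiv k (j, 1)))) =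
    (if b = 0 then a x (w (pairEquiv k (i, 1))) else a (w (pairEquiv k (i, 0))) x) *
      ∏ j ∈ Finset.univ.erase i, a (w (pairEquiv k (j, 0))) (w (pairEquiv k (j, 1))) := by
  rw [← Finset.mul_prod_erase _ _ (Finset.mem_univ i)]
  congr 1
  · fin_cases b <;> simp
  · refine Finset.prod_congr rfl fun j hj => ?_
    have hji := Finset.ne_of_mem_erase hj
    simp [hji]

/-- The Pfaffian of the matrix of values of a bilinear form, as an alternating form. -/
def pfaffianForm (a : V →ₗ[ℝ] V →ₗ[ℝ] ℝ) (k : ℕ) : V [⋀^Fin (2 * k)]→ₗ[ℝ] ℝ :=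
  ((2 : ℝ) ^ k * (k.factorial : ℝ))⁻¹ • MultilinearMap.alternatization
    { toFun := fun w => ∏ i : Fin k, a (w (pairEquiv k (i, 0))) (w (pairEquiv k (i, 1)))
      map_update_add' := by
        intro _ w j x y
        obtain ⟨⟨i, b⟩, rfl⟩ := (pairEquiv k).surjective j
        simp only [prod_update_pair]
        split_ifs <;> simp [add_mul]
      map_update_smul' := by
        intro _ w j c x
        obtain ⟨⟨i, b⟩, rfl⟩ := (pairEquiv k).surjective j
        simp only [prod_update_pair]
        split_ifs <;> simp [mul_assoc] }

lemma pfaffianForm_apply (a : V →ₗ[ℝ] V →ₗ[ℝ] ℝ) (k : ℕ) (w : Fin (2 * k) → V) :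
    pfaffianForm a k w = matrixPfaffian (Matrix.of fun i j => a (w i) (w j)) := by
  rw [pfaffianForm, AlternatingMap.smul_apply, MultilinearMap.alternatization_apply,
    matrixPfaffian, smul_eq_mul]
  congr 1
  refine Finset.sum_congr rfl fun ρ _ => ?_
  simp [Units.smul_def, pairEquiv_zero, pairEquiv_one]

/-- The Pfaffian of `M A Mᵀ`. -/
lemma matrixPfaffian_conj {k : ℕ} (M A : Matrix (Fin (2 * k)) (Fin (2 * k)) ℝ) :
    matrixPfaffian (M * A * Mᵀ) = M.det * matrixPfaffian A := by
  have h : ∀ N : Fin (2 * k) → Fin (2 * k) → ℝ, pfaffianForm (Matrix.toBilin' A) k N =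
      matrixPfaffian (Matrix.of N * A * (Matrix.of N)ᵀ) := fun N => by
    rw [pfaffianForm_apply]
    congr 1
    ext i j
    rw [Matrix.of_apply, Matrix.toBilin'_apply', mul_assoc]
    rw [Matrix.mul_apply]
    refine Finset.sum_congr rfl fun l _ => ?_
    congr 1
  -- As a function of the rows of `M`, the left side is an alternating form of top degree, hence a
  -- multiple of the determinant. The factor is found at `M = 1`.
  have h1 := AlternatingMap.eq_smul_basis_det (Pi.basisFun ℝ (Fin (2 * k)))
    (pfaffianForm (Matrix.toBilin' A) k)
  have h2 := congrArg (fun f => f fun i => M i) h1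
  simp only [Pi.basisFun_det, AlternatingMap.smul_apply, smul_eq_mul] at h2
  rw [h, h] at h2
  have h3 : Matrix.of (Pi.basisFun ℝ (Fin (2 * k))) = (1 : Matrix (Fin (2 * k)) (Fin (2 * k)) ℝ) := by
    ext i j
    simp [Matrix.one_apply, Pi.single_apply, eq_comm]
  rw [h3, one_mul, Matrix.transpose_one, mul_one] at h2
  exact h2.trans (mul_comm _ _)

lemma AlternatingMap.eq_of_basis {ι : Type*} [Fintype ι] [DecidableEq ι] {f g : V [⋀^ι]→ₗ[ℝ] ℝ}
    (b : Module.Basis ι ℝ V) (h : f b = g b) : f = g := by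
  rw [f.eq_smul_basis_det b, g.eq_smul_basis_det b, h]

/-- The alternating form in the left half of the arguments. -/
def AlternatingMap.fixRight {ι κ : Type*} (f : V [⋀^ι ⊕ κ]→ₗ[ℝ] ℝ) (w : κ → V) :
    V [⋀^ι]→ₗ[ℝ] ℝ where
  toFun u := f (Sum.elim u w)
  map_update_add' u i x y := by
    classical simp [-Sum.update_elim_inl]
  map_update_smul' u i c x := by
    classical simp [-Sum.update_elim_inl]
  map_eq_zero_of_eq' u i j h hij := f.map_eq_zero_of_eq _ (i := Sum.inl i) (j := Sum.inl j)
    (by simpa using h) (by simpa using hij)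

/-- The alternating form in the right half of the arguments. -/
def AlternatingMap.fixLeft {ι κ : Type*} (f : V [⋀^ι ⊕ κ]→ₗ[ℝ] ℝ) (u : ι → V) :
    V [⋀^κ]→ₗ[ℝ] ℝ where
  toFun w := f (Sum.elim u w)
  map_update_add' w i x y := by
    classical simp [-Sum.update_elim_inr]
  map_update_smul' w i c x := by
    classical simp [-Sum.update_elim_inr]
  map_eq_zero_of_eq' w i j h hij := f.map_eq_zero_of_eq _ (i := Sum.inr i) (j := Sum.inr j)
    (by simpa using h) (by simpa using hij)

/-- The members `x 0, y 0, x 1, y 1, …` of a skew basis. -/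
def skewFamily {k : ℕ} (x y : Fin k → V) (j : Fin (2 * k)) : V :=
  if ((pairEquiv k).symm j).2 = 0 then x ((pairEquiv k).symm j).1 else y ((pairEquiv k).symm j).1

lemma skewFamily_zero {k : ℕ} (x y : Fin k → V) (i : Fin k) :
    skewFamily x y (pairEquiv k (i, 0)) = x i := by
  simp [skewFamily]

lemma skewFamily_one {k : ℕ} (x y : Fin k → V) (i : Fin k) :
    skewFamily x y (pairEquiv k (i, 1)) = y i := by
  simp [skewFamily]

namespace IsSkewBasis

variable {B : V →ₗ[ℝ] V →ₗ[ℝ] ℝ} {a : V →ₗ[ℝ] V} {U : Submodule ℝ V} {k : ℕ} {x y : Fin k → V}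
  {μ : Fin k → ℝ} (h : IsSkewBasis B a U x y μ) (hsymm : ∀ x y, B x y = B y x)
include h

lemma skewFamily_mem (j : Fin (2 * k)) : skewFamily x y j ∈ U := by
  unfold skewFamily
  split_ifs
  exacts [h.mem_left _, h.mem_right _]

include hsymm in
lemma map_skewFamily (i j : Fin (2 * k)) :
    B (skewFamily x y i) (skewFamily x y j) = if i = j then 1 else 0 := by
  obtain ⟨⟨i, b⟩, rfl⟩ := (pairEquiv k).surjective i
  obtain ⟨⟨j, c⟩, rfl⟩ := (pairEquiv k).surjective j
  fin_cases b <;> fin_cases c <;>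
    simp [skewFamily_zero, skewFamily_one, h.left_left, h.right_right, h.left_right,
      hsymm (y _) (x _)]

include hsymm in
lemma exists_basis : ∃ b : Module.Basis (Fin (2 * k)) ℝ U, ∀ j, (b j : V) = skewFamily x y j := by
  have hli : LinearIndependent ℝ fun j => (⟨skewFamily x y j, h.skewFamily_mem j⟩ : U) := by
    refine Fintype.linearIndependent_iff.2 fun c hc j => ?_
    have h1 := congrArg (fun v : U => B (skewFamily x y j) v) hc
    simpa [h.map_skewFamily hsymm] using h1
  have hsp : ⊤ ≤ Submodule.span ℝ
      (Set.range fun j => (⟨skewFamily x y j, h.skewFamily_mem j⟩ : U)) := by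
    rintro ⟨v, hv⟩ -
    have h1 : (⟨v, hv⟩ : U) = ∑ i, (B (x i) v • (⟨x i, h.mem_left i⟩ : U) +
        B (y i) v • (⟨y i, h.mem_right i⟩ : U)) := by
      ext
      simp [h.sum_eq v hv]
    rw [h1]
    refine Submodule.sum_mem _ fun i _ => Submodule.add_mem _ (Submodule.smul_mem _ _ ?_)
      (Submodule.smul_mem _ _ ?_)
    · exact Submodule.subset_span ⟨pairEquiv k (i, 0), Subtype.ext (skewFamily_zero x y i)⟩
    · exact Submodule.subset_span ⟨pairEquiv k (i, 1), Subtype.ext (skewFamily_one x y i)⟩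
  exact ⟨Module.Basis.mk hli hsp, fun j => by rw [Module.Basis.mk_apply]⟩

include hsymm in
lemma finrank_eq : Module.finrank ℝ U = 2 * k := by
  obtain ⟨b, -⟩ := h.exists_basis hsymm
  rw [Module.finrank_eq_card_basis b, Fintype.card_fin]

include hsymm in
lemma form_skewFamily (i j : Fin k) (b c : Fin 2) :
    B (skewFamily x y (pairEquiv k (i, b))) (a (skewFamily x y (pairEquiv k (j, c)))) =
      if i = j then (if b = c then 0 else if b = 0 then -μ i else μ i) else 0 := by
  fin_cases b <;> fin_cases c <;>
    by_cases hij : i = j <;>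
    simp [skewFamily_zero, skewFamily_one, h.map_left, h.map_right, h.left_left, h.right_right,
      h.left_right, hsymm (y _) (x _), hij]

end IsSkewBasis

end Pfaffian

end

/-! ### Multiplicativity of the Pfaffian on orthogonal sums. -/

noncomputable section

open scoped Matrix

section PfaffianSum

variable {V : Type*} [AddCommGroup V] [Module ℝ V]

/-- The first `2 p` indices and the last `2 q` indices. -/
def splitEquiv (p q : ℕ) : Fin (2 * (p + q)) ≃ Fin (2 * p) ⊕ Fin (2 * q) :=
  (finCongr (mul_add 2 p q)).trans finSumFinEquiv.symm

lemma splitEquiv_castAdd {p q : ℕ} (i : Fin p) (b : Fin 2) :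
    splitEquiv p q (pairEquiv (p + q) (Fin.castAdd q i, b)) = Sum.inl (pairEquiv p (i, b)) := by
  rw [splitEquiv, Equiv.trans_apply, Equiv.symm_apply_eq, finSumFinEquiv_apply_left]
  ext
  simp [pairEquiv]

lemma splitEquiv_natAdd {p q : ℕ} (i : Fin q) (b : Fin 2) :
    splitEquiv p q (pairEquiv (p + q) (Fin.natAdd p i, b)) = Sum.inr (pairEquiv q (i, b)) := by
  rw [splitEquiv, Equiv.trans_apply, Equiv.symm_apply_eq, finSumFinEquiv_apply_right]
  ext
  simp [pairEquiv]
  ring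

variable {B : V →ₗ[ℝ] V →ₗ[ℝ] ℝ} {a : V →ₗ[ℝ] V} (hsymm : ∀ x y, B x y = B y x)
include hsymm

lemma IsSkewBasis.pfaffianForm_eq {U : Submodule ℝ V} {k : ℕ} {x y : Fin k → V} {μ : Fin k → ℝ}
    (h : IsSkewBasis B a U x y μ) :
    pfaffianForm (B.compl₂ a) k (skewFamily x y) = ∏ i, -μ i := by
  rw [pfaffianForm_apply]
  refine matrixPfaffian_of_pairs ?_ ?_ ?_
  · intro i
    simpa using h.form_skewFamily hsymm i i 0 1
  · intro i
    simpa using h.form_skewFamily hsymm i i 1 0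
  · intro i j b c hij
    simpa [hij] using h.form_skewFamily hsymm i j b c

lemma IsSkewBasis.pfaffianForm_ne_zero {U : Submodule ℝ V} {k : ℕ} {x y : Fin k → V}
    {μ : Fin k → ℝ} (h : IsSkewBasis B a U x y μ) :
    pfaffianForm (B.compl₂ a) k (skewFamily x y) ≠ 0 := by
  rw [h.pfaffianForm_eq hsymm]
  exact Finset.prod_ne_zero_iff.2 fun i _ => neg_ne_zero.2 (h.pos i).ne'

lemma IsSkewBasis.pfaffianForm_elim {U U' : Submodule ℝ V} {p q : ℕ} {x y : Fin p → V}
    {x' y' : Fin q → V} {μ : Fin p → ℝ} {μ' : Fin q → ℝ} (h : IsSkewBasis B a U x y μ)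
    (h' : IsSkewBasis B a U' x' y' μ') (hU : ∀ v ∈ U, a v ∈ U) (hU' : ∀ v ∈ U', a v ∈ U')
    (horth : ∀ v ∈ U, ∀ w ∈ U', B v w = 0) :
    pfaffianForm (B.compl₂ a) (p + q)
      (fun i => Sum.elim (skewFamily x y) (skewFamily x' y') (splitEquiv p q i)) =
      (∏ i, -μ i) * ∏ i, -μ' i := by
  have hprod : (∏ i, -μ i) * ∏ i, -μ' i =
      ∏ i, Fin.append (fun i => -μ i) (fun i => -μ' i) i := by
    rw [Fin.prod_univ_add]
    simp only [Fin.append_left, Fin.append_right]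
  have h1 : ∀ i j, B (skewFamily x y i) (a (skewFamily x' y' j)) = 0 := fun i j =>
    horth _ (h.skewFamily_mem i) _ (hU' _ (h'.skewFamily_mem j))
  have h2 : ∀ i j, B (skewFamily x' y' i) (a (skewFamily x y j)) = 0 := fun i j => by
    rw [hsymm]
    exact horth _ (hU _ (h.skewFamily_mem j)) _ (h'.skewFamily_mem i)
  rw [pfaffianForm_apply, hprod]
  refine matrixPfaffian_of_pairs ?_ ?_ ?_
  · intro i
    refine Fin.addCases (fun i => ?_) (fun i => ?_) i
    · simpa [splitEquiv_castAdd] using h.form_skewFamily hsymm i i 0 1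
    · simpa [splitEquiv_natAdd] using h'.form_skewFamily hsymm i i 0 1
  · intro i
    refine Fin.addCases (fun i => ?_) (fun i => ?_) i
    · simpa [splitEquiv_castAdd] using h.form_skewFamily hsymm i i 1 0
    · simpa [splitEquiv_natAdd] using h'.form_skewFamily hsymm i i 1 0
  · intro i j b c
    refine Fin.addCases (fun i => ?_) (fun i => ?_) i <;>
      refine Fin.addCases (fun j => ?_) (fun j => ?_) j <;> intro hij
    · have hij' : i ≠ j := fun h => hij (by rw [h])
      simpa [splitEquiv_castAdd, hij'] using h.form_skewFamily hsymm i j b c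
    · simpa [splitEquiv_castAdd, splitEquiv_natAdd] using h1 _ _
    · simpa [splitEquiv_castAdd, splitEquiv_natAdd] using h2 _ _
    · have hij' : i ≠ j := fun h => hij (by rw [h])
      simpa [splitEquiv_natAdd, hij'] using h'.form_skewFamily hsymm i j b c

variable (hpos : ∀ x, x ≠ 0 → 0 < B x x) (hskew : ∀ x y, B (a x) y = -B x (a y))
include hpos hskew

/-- Both sides are alternating in `u` and in `w` separately, in top degree on `U` and on `U'`, so
one basis of each suffices. For skew bases the matrix consists of blocks of size two, and both sides
are the product of the speeds with signs. -/
theorem pfaffianForm_elim {U U' : Submodule ℝ V} [FiniteDimensional ℝ U] [FiniteDimensional ℝ U']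
    {p q : ℕ} (hp : Module.finrank ℝ U = 2 * p) (hq : Module.finrank ℝ U' = 2 * q)
    (hU : ∀ v ∈ U, a v ∈ U) (hU' : ∀ v ∈ U', a v ∈ U') (hinj : ∀ v ∈ U, a v = 0 → v = 0)
    (hinj' : ∀ v ∈ U', a v = 0 → v = 0) (horth : ∀ v ∈ U, ∀ w ∈ U', B v w = 0)
    {u : Fin (2 * p) → V} {w : Fin (2 * q) → V} (hu : ∀ i, u i ∈ U) (hw : ∀ i, w i ∈ U') :
    pfaffianForm (B.compl₂ a) (p + q) (fun i => Sum.elim u w (splitEquiv p q i)) =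
      pfaffianForm (B.compl₂ a) p u * pfaffianForm (B.compl₂ a) q w := by
  obtain ⟨p', x, y, μ, h⟩ := exists_isSkewBasis hsymm hpos hskew U hU hinj
  obtain ⟨q', x', y', μ', h'⟩ := exists_isSkewBasis hsymm hpos hskew U' hU' hinj'
  obtain rfl : p' = p := by have := h.finrank_eq hsymm; omega
  obtain rfl : q' = q := by have := h'.finrank_eq hsymm; omega
  obtain ⟨b, hb⟩ := h.exists_basis hsymm
  obtain ⟨b', hb'⟩ := h'.exists_basis hsymm
  let F : V [⋀^Fin (2 * p') ⊕ Fin (2 * q')]→ₗ[ℝ] ℝ :=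
    (pfaffianForm (B.compl₂ a) (p' + q')).domDomCongr (splitEquiv p' q')
  have hbs : (fun j => (b j : V)) = skewFamily x y := funext hb
  have hbs' : (fun j => (b' j : V)) = skewFamily x' y' := funext hb'
  have h1 : F (Sum.elim (skewFamily x y) (skewFamily x' y')) =
      pfaffianForm (B.compl₂ a) p' (skewFamily x y) *
        pfaffianForm (B.compl₂ a) q' (skewFamily x' y') := by
    rw [h.pfaffianForm_eq hsymm, h'.pfaffianForm_eq hsymm]
    exact h.pfaffianForm_elim hsymm h' hU hU' horth
  have h2 : (F.fixRight (skewFamily x' y')).compLinearMap U.subtype =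
      pfaffianForm (B.compl₂ a) q' (skewFamily x' y') •
        (pfaffianForm (B.compl₂ a) p').compLinearMap U.subtype := by
    refine AlternatingMap.eq_of_basis b ?_
    simp only [AlternatingMap.compLinearMap_apply, AlternatingMap.smul_apply, Submodule.subtype_apply]
    rw [hbs]
    exact h1.trans (mul_comm _ _)
  have h3 : F (Sum.elim u (skewFamily x' y')) = pfaffianForm (B.compl₂ a) p' u *
      pfaffianForm (B.compl₂ a) q' (skewFamily x' y') := by
    have := congrArg (fun f => f fun i => ⟨u i, hu i⟩) h2
    simp only [AlternatingMap.compLinearMap_apply, AlternatingMap.smul_apply,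
      Submodule.subtype_apply, smul_eq_mul] at this
    exact this.trans (mul_comm _ _)
  have h4 : (F.fixLeft u).compLinearMap U'.subtype = pfaffianForm (B.compl₂ a) p' u •
      (pfaffianForm (B.compl₂ a) q').compLinearMap U'.subtype := by
    refine AlternatingMap.eq_of_basis b' ?_
    simp only [AlternatingMap.compLinearMap_apply, AlternatingMap.smul_apply, Submodule.subtype_apply]
    rw [hbs']
    exact h3
  have := congrArg (fun f => f fun i => ⟨w i, hw i⟩) h4
  simp only [AlternatingMap.compLinearMap_apply, AlternatingMap.smul_apply,
    Submodule.subtype_apply, smul_eq_mul] at this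
  exact this

end PfaffianSum

end

/-! ### The derivative on twisted periodic functions and its perturbation. -/

noncomputable section

open scoped Matrix

section TwistedFields

variable {n : ℕ}

/-- The smooth functions with `u (t + ℓ) = h u(t)`. -/
def twistedFields (ℓ : ℝ) (h : Matrix (Fin n) (Fin n) ℝ) : Submodule ℝ (ℝ → Fin n → ℝ) where
  carrier := {u | ContDiff ℝ ∞ u ∧ ∀ t, u (t + ℓ) = h *ᵥ u t}
  add_mem' hu hv := ⟨hu.1.add hv.1, fun t => by
    rw [Pi.add_apply, Pi.add_apply, hu.2, hv.2, Matrix.mulVec_add]⟩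
  zero_mem' := ⟨contDiff_const, fun t => by simp⟩
  smul_mem' c u hu := ⟨contDiff_const.smul hu.1, fun t => by
    rw [Pi.smul_apply, Pi.smul_apply, hu.2, Matrix.mulVec_smul]⟩

namespace twistedFields

variable {ℓ : ℝ} {h : Matrix (Fin n) (Fin n) ℝ}

lemma continuous (u : twistedFields ℓ h) : Continuous u.1 := u.2.1.continuous

lemma differentiable (u : twistedFields ℓ h) : Differentiable ℝ u.1 :=
  u.2.1.differentiable (by simp)

variable (ℓ h) in
/-- The derivative of twisted fields. -/
def derivation : twistedFields ℓ h →ₗ[ℝ] twistedFields ℓ h where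
  toFun u := ⟨deriv u.1, (contDiff_infty_iff_deriv.1 u.2.1).2, fun t => by
    have h1 : (fun t => u.1 (t + ℓ)) = fun t => h *ᵥ u.1 t := funext u.2.2
    rw [← deriv_comp_add_const, h1]
    exact ((LinearMap.toContinuousLinearMap h.mulVecLin).hasFDerivAt.comp_hasDerivAt t
      (differentiable u t).hasDerivAt).deriv⟩
  map_add' u v := Subtype.ext (funext fun t => deriv_add (differentiable u t) (differentiable v t))
  map_smul' c u := Subtype.ext (funext fun t => deriv_const_smul c (differentiable u t))

lemma derivation_coe (u : twistedFields ℓ h) : (derivation ℓ h u).1 = deriv u.1 := rfl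

variable (ℓ h) in
/-- The `L²` inner product. -/
def form : twistedFields ℓ h →ₗ[ℝ] twistedFields ℓ h →ₗ[ℝ] ℝ :=
  LinearMap.mk₂ ℝ (fun u v => ∫ t in (0 : ℝ)..ℓ, u.1 t ⬝ᵥ v.1 t)
    (fun u u' v => by
      rw [← intervalIntegral.integral_add
        (((continuous u).dotProduct (continuous v)).intervalIntegrable _ _)
        (((continuous u').dotProduct (continuous v)).intervalIntegrable _ _)]
      simp [add_dotProduct])
    (fun c u v => by
      rw [smul_eq_mul, ← intervalIntegral.integral_const_mul]
      simp [smul_dotProduct])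
    (fun u v v' => by
      rw [← intervalIntegral.integral_add
        (((continuous u).dotProduct (continuous v)).intervalIntegrable _ _)
        (((continuous u).dotProduct (continuous v')).intervalIntegrable _ _)]
      simp [dotProduct_add])
    (fun c u v => by
      rw [smul_eq_mul, ← intervalIntegral.integral_const_mul]
      simp [dotProduct_smul])

lemma form_apply (u v : twistedFields ℓ h) :
    form ℓ h u v = ∫ t in (0 : ℝ)..ℓ, u.1 t ⬝ᵥ v.1 t := rfl

lemma form_symm (u v : twistedFields ℓ h) : form ℓ h u v = form ℓ h v u := by
  simp only [form_apply, dotProduct_comm]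

variable (ℓ h) in
/-- The integral over a period. -/
def integral : twistedFields ℓ h →ₗ[ℝ] (Fin n → ℝ) where
  toFun u := ∫ t in (0 : ℝ)..ℓ, u.1 t
  map_add' u v := intervalIntegral.integral_add ((continuous u).intervalIntegrable _ _)
    ((continuous v).intervalIntegrable _ _)
  map_smul' c _ := intervalIntegral.integral_smul c _

lemma form_of_eq_const {u : twistedFields ℓ h} {c : Fin n → ℝ} (hu : ∀ t, u.1 t = c)
    (v : twistedFields ℓ h) : form ℓ h u v = c ⬝ᵥ integral ℓ h v := by
  rw [form_apply]
  simp only [hu]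
  let L : (Fin n → ℝ) →L[ℝ] ℝ := LinearMap.toContinuousLinearMap (dotProductBilin ℝ ℝ c)
  exact L.intervalIntegral_comp_comm ((continuous v).intervalIntegrable _ _)

/-- As `h` is orthogonal, the pointwise norm is periodic, so a nonzero value occurs already in one
period. -/
lemma form_pos (hℓ : 0 < ℓ) (hh : hᵀ * h = 1) (u : twistedFields ℓ h) (hu : u ≠ 0) :
    0 < form ℓ h u u := by
  have hper : Function.Periodic (fun t => u.1 t ⬝ᵥ u.1 t) ℓ := fun t => by
    simp only
    rw [u.2.2, Matrix.dotProduct_mulVec, ← Matrix.mulVec_transpose, Matrix.mulVec_mulVec, hh,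
      Matrix.one_mulVec]
  have hnn : ∀ t, 0 ≤ u.1 t ⬝ᵥ u.1 t := fun t => Finset.sum_nonneg fun i _ => mul_self_nonneg _
  obtain ⟨t, ht⟩ : ∃ t, u.1 t ≠ 0 := by
    by_contra! h0
    exact hu (Subtype.ext (funext h0))
  obtain ⟨s, hs, hst⟩ := hper.exists_mem_Ico₀ hℓ t
  refine intervalIntegral.integral_pos hℓ ((continuous u).dotProduct (continuous u)).continuousOn
    (fun t _ => hnn t) ⟨s, Set.Ico_subset_Icc_self hs, ?_⟩
  have : u.1 s ⬝ᵥ u.1 s = u.1 t ⬝ᵥ u.1 t := hst.symm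
  rw [this]
  exact (hnn t).lt_of_ne' fun h => ht (dotProduct_self_eq_zero.1 h)

/-- Integration by parts. The boundary terms at `0` and `ℓ` cancel because `h` is orthogonal. -/
lemma form_derivation (hh : hᵀ * h = 1) (u v : twistedFields ℓ h) :
    form ℓ h (derivation ℓ h u) v = -form ℓ h u (derivation ℓ h v) := by
  rw [form_apply, form_apply, eq_neg_iff_add_eq_zero]
  have hd : ∀ t, HasDerivAt (fun t => u.1 t ⬝ᵥ v.1 t)
      ((derivation ℓ h u).1 t ⬝ᵥ v.1 t + u.1 t ⬝ᵥ (derivation ℓ h v).1 t) t := by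
    intro t
    have h1 := hasDerivAt_pi.1 (differentiable u t).hasDerivAt
    have h2 := hasDerivAt_pi.1 (differentiable v t).hasDerivAt
    refine (HasDerivAt.fun_sum fun i (_ : i ∈ Finset.univ) => (h1 i).mul (h2 i)).congr_deriv ?_
    rw [Finset.sum_add_distrib]
    rfl
  rw [← intervalIntegral.integral_add
    (((continuous (derivation ℓ h u)).dotProduct (continuous v)).intervalIntegrable _ _)
    (((continuous u).dotProduct (continuous (derivation ℓ h v))).intervalIntegrable _ _),
    intervalIntegral.integral_eq_sub_of_hasDerivAt (fun t _ => hd t)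
      ((((continuous (derivation ℓ h u)).dotProduct (continuous v)).add
        ((continuous u).dotProduct (continuous (derivation ℓ h v)))).intervalIntegrable _ _)]
  have h1 := u.2.2 0
  have h2 := v.2.2 0
  rw [zero_add] at h1 h2
  rw [h1, h2, Matrix.dotProduct_mulVec, ← Matrix.mulVec_transpose, Matrix.mulVec_mulVec, hh,
    Matrix.one_mulVec, sub_self]

lemma derivation_eq_zero_iff {u : twistedFields ℓ h} :
    derivation ℓ h u = 0 ↔ ∀ t, u.1 t = u.1 0 := by
  constructor
  · intro h0 t
    exact is_const_of_deriv_eq_zero (differentiable u) (fun t => congrFun (congrArg Subtype.val h0) t)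
      t 0
  · intro h0
    refine Subtype.ext ?_
    rw [derivation_coe, funext h0]
    exact deriv_const' _

/-- The endomorphism that takes a field to the constant field with the value `K` times the mean of
the field. -/
def meanMap (ℓ : ℝ) {h K : Matrix (Fin n) (Fin n) ℝ} (hK : h * K = K) :
    twistedFields ℓ h →ₗ[ℝ] twistedFields ℓ h where
  toFun u := ⟨fun _ => ℓ⁻¹ • (K *ᵥ integral ℓ h u), contDiff_const, fun t => by
    rw [Matrix.mulVec_smul, Matrix.mulVec_mulVec, hK]⟩
  map_add' u v := Subtype.ext (funext fun t => by
    simp only [map_add, Matrix.mulVec_add, smul_add]; rfl)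
  map_smul' c u := Subtype.ext (funext fun t => by
    simp only [map_smul, Matrix.mulVec_smul, smul_comm ℓ⁻¹]; rfl)

variable {K : Matrix (Fin n) (Fin n) ℝ} (hK : h * K = K)

lemma meanMap_coe (u : twistedFields ℓ h) (t : ℝ) :
    (meanMap ℓ hK u).1 t = ℓ⁻¹ • (K *ᵥ integral ℓ h u) := rfl

lemma derivation_meanMap (u : twistedFields ℓ h) : derivation ℓ h (meanMap ℓ hK u) = 0 :=
  derivation_eq_zero_iff.2 fun _ => rfl

lemma form_meanMap (hKT : Kᵀ = -K) (u v : twistedFields ℓ h) :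
    form ℓ h (meanMap ℓ hK u) v = -form ℓ h u (meanMap ℓ hK v) := by
  rw [form_symm u, form_of_eq_const (meanMap_coe hK u), form_of_eq_const (meanMap_coe hK v),
    smul_dotProduct, smul_dotProduct, dotProduct_mulVec_skew hKT, dotProduct_comm, smul_neg]

/-- The derivation, perturbed on its kernel. -/
def perturbed (ℓ : ℝ) {h K : Matrix (Fin n) (Fin n) ℝ} (hK : h * K = K) :
    twistedFields ℓ h →ₗ[ℝ] twistedFields ℓ h :=
  derivation ℓ h + meanMap ℓ hK

lemma form_perturbed (hh : hᵀ * h = 1) (hKT : Kᵀ = -K) (u v : twistedFields ℓ h) :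
    form ℓ h (perturbed ℓ hK u) v = -form ℓ h u (perturbed ℓ hK v) := by
  simp only [perturbed, LinearMap.add_apply, map_add, form_derivation hh, form_meanMap hK hKT]
  ring

/-- The mean map takes values in the constant fields, which the derivative kills. By skew-symmetry
of the derivative they are orthogonal to its image, so both summands of the perturbed operator
vanish separately. Then `u` is a constant vector fixed by `h` and killed by `K`. -/
lemma perturbed_injective (hℓ : 0 < ℓ) (hh : hᵀ * h = 1)
    (hK0 : ∀ x, h *ᵥ x = x → K *ᵥ x = 0 → x = 0) (u : twistedFields ℓ h)
    (hu : perturbed ℓ hK u = 0) : u = 0 := by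
  have hm : meanMap ℓ hK u = 0 := by
    by_contra h0
    have h1 := form_pos hℓ hh _ h0
    have h2 : meanMap ℓ hK u = -derivation ℓ h u := by
      rw [eq_neg_iff_add_eq_zero, add_comm]; exact hu
    conv_rhs at h1 => arg 1; rw [h2]
    rw [map_neg, LinearMap.neg_apply, form_derivation hh, derivation_meanMap, map_zero] at h1
    simp at h1
  have hd : derivation ℓ h u = 0 := by
    rw [perturbed, LinearMap.add_apply, hm, add_zero] at hu
    exact hu
  have hc := derivation_eq_zero_iff.1 hd
  have hx : u.1 0 = 0 := by
    refine hK0 _ ?_ ?_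
    · rw [← u.2.2, hc]
    · have h1 := congrFun (congrArg Subtype.val hm) 0
      rw [meanMap_coe] at h1
      have h2 : integral ℓ h u = ℓ • u.1 0 := by
        change ∫ t in (0 : ℝ)..ℓ, u.1 t = _
        simp only [hc]
        rw [intervalIntegral.integral_const, sub_zero]
      rw [h2, Matrix.mulVec_smul, smul_smul, inv_mul_cancel₀ hℓ.ne', one_smul] at h1
      exact h1
  exact Subtype.ext (funext fun t => (hc t).trans hx)

end twistedFields

end TwistedFields

end

/-! ### Invariant spaces and the Pfaffian of the perturbed derivative. -/

noncomputable section

open scoped Matrix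

section FormComplement

variable {V : Type*} [AddCommGroup V] [Module ℝ V] (B : V →ₗ[ℝ] V →ₗ[ℝ] ℝ)

/-- The orthogonal complement of `U` in `U'`, for a bilinear form. -/
def formComplement (U U' : Submodule ℝ V) : Submodule ℝ V where
  carrier := {w | w ∈ U' ∧ ∀ v ∈ U, B v w = 0}
  add_mem' h h' := ⟨U'.add_mem h.1 h'.1, fun v hv => by rw [map_add, h.2 v hv, h'.2 v hv, add_zero]⟩
  zero_mem' := ⟨U'.zero_mem, fun v _ => map_zero _⟩
  smul_mem' c w h := ⟨U'.smul_mem c h.1, fun v hv => by rw [map_smul, h.2 v hv, smul_zero]⟩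

lemma formComplement_le (U U' : Submodule ℝ V) : formComplement B U U' ≤ U' := fun _ h => h.1

/-- The form identifies `U` with its dual by positivity. So restriction of functionals maps `U'`
onto the dual of `U`, with the complement as its kernel. -/
lemma finrank_add_finrank_formComplement {B : V →ₗ[ℝ] V →ₗ[ℝ] ℝ} (hpos : ∀ x, x ≠ 0 → 0 < B x x)
    {U U' : Submodule ℝ V} [FiniteDimensional ℝ U'] (hle : U ≤ U') :
    Module.finrank ℝ U + Module.finrank ℝ (formComplement B U U') = Module.finrank ℝ U' := by
  have : FiniteDimensional ℝ U := Submodule.finiteDimensional_of_le hle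
  let f : U' →ₗ[ℝ] Module.Dual ℝ U :=
    { toFun := fun v => (B.flip v.1).domRestrict U
      map_add' := fun v w => by ext; simp
      map_smul' := fun c v => by ext; simp }
  have hf : ∀ (v : U') (u : U), f v u = B u v := fun v u => rfl
  have hsurj : Function.Surjective f := by
    have hinj : Function.Injective (f ∘ₗ Submodule.inclusion hle) := by
      refine (injective_iff_map_eq_zero _).2 fun u hu => ?_
      by_contra h0
      have h1 := congrArg (fun g => g u) hu
      simp only [LinearMap.comp_apply, hf, LinearMap.zero_apply] at h1
      exact (hpos u fun h => h0 (Subtype.ext h)).ne' h1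
    have h2 := (LinearMap.injective_iff_surjective_of_finrank_eq_finrank
      Subspace.dual_finrank_eq.symm).1 hinj
    exact fun g => (h2 g).imp' (Submodule.inclusion hle) fun _ h => h
  have hker : formComplement B U U' = (LinearMap.ker f).map U'.subtype := by
    ext w
    simp only [Submodule.mem_map, LinearMap.mem_ker, Submodule.subtype_apply]
    constructor
    · exact fun hw => ⟨⟨w, hw.1⟩, LinearMap.ext fun u => hw.2 u u.2, rfl⟩
    · rintro ⟨w, hw, rfl⟩
      exact ⟨w.2, fun v hv => congrArg (fun g => g ⟨v, hv⟩) hw⟩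
  have h3 := LinearMap.finrank_range_add_finrank_ker f
  rw [LinearMap.range_eq_top.2 hsurj, finrank_top, Subspace.dual_finrank_eq] at h3
  rw [hker, Submodule.finrank_map_subtype_eq, h3]

end FormComplement

namespace twistedFields

variable {n : ℕ} {ℓ : ℝ} {h K : Matrix (Fin n) (Fin n) ℝ}

/-- The skew-symmetric matrix `K` acts on the vectors that are fixed by the orthogonal matrix `h`,
and is nondegenerate there. -/
structure _root_.IsKernelForm (h K : Matrix (Fin n) (Fin n) ℝ) : Prop where
  orthogonal : hᵀ * h = 1
  skew : Kᵀ = -K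
  mul_eq : h * K = K
  inj : ∀ x, h *ᵥ x = x → K *ᵥ x = 0 → x = 0

/-- The invariant spaces of the derivation that contain its kernel. -/
structure IsInvariant (V : Submodule ℝ (twistedFields ℓ h)) : Prop where
  finite : FiniteDimensional ℝ V
  map_mem : ∀ v ∈ V, derivation ℓ h v ∈ V
  ker_le : ∀ v, derivation ℓ h v = 0 → v ∈ V

lemma IsInvariant.perturbed_mem {V : Submodule ℝ (twistedFields ℓ h)} (hV : IsInvariant V)
    (hK : h * K = K) {v : twistedFields ℓ h} (hv : v ∈ V) : perturbed ℓ hK v ∈ V :=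
  V.add_mem (hV.map_mem v hv) (hV.ker_le _ (derivation_meanMap hK v))

/-- The bilinear form of the perturbed derivation. -/
def perturbedForm (ℓ : ℝ) {h K : Matrix (Fin n) (Fin n) ℝ} (hK : IsKernelForm h K) :
    twistedFields ℓ h →ₗ[ℝ] twistedFields ℓ h →ₗ[ℝ] ℝ :=
  (form ℓ h).compl₂ (perturbed ℓ hK.mul_eq)

variable (hℓ : 0 < ℓ) (hK : IsKernelForm h K)
include hℓ

lemma IsInvariant.exists_isSkewBasis {V : Submodule ℝ (twistedFields ℓ h)} (hV : IsInvariant V) :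
    ∃ (k : ℕ) (x y : Fin k → twistedFields ℓ h) (μ : Fin k → ℝ),
      IsSkewBasis (form ℓ h) (perturbed ℓ hK.mul_eq) V x y μ := by
  have := hV.finite
  exact _root_.exists_isSkewBasis form_symm (form_pos hℓ hK.orthogonal)
    (form_perturbed hK.mul_eq hK.orthogonal hK.skew) V (fun v hv => hV.perturbed_mem _ hv)
    (fun v _ => perturbed_injective hK.mul_eq hℓ hK.orthogonal hK.inj v)

include hK in
lemma IsInvariant.even_finrank {V : Submodule ℝ (twistedFields ℓ h)} (hV : IsInvariant V) :
    ∃ k, Module.finrank ℝ V = 2 * k := by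
  obtain ⟨k, x, y, μ, hs⟩ := hV.exists_isSkewBasis hℓ hK
  exact ⟨k, hs.finrank_eq form_symm⟩

/-- On a skew basis the value is a product of nonzero speeds, and a nonzero form of top degree does
not vanish on any basis. -/
lemma IsInvariant.pfaffianForm_basis_ne_zero {V : Submodule ℝ (twistedFields ℓ h)}
    (hV : IsInvariant V) {k : ℕ} (b : Module.Basis (Fin (2 * k)) ℝ V) :
    pfaffianForm (perturbedForm ℓ hK) k (fun i => (b i : twistedFields ℓ h)) ≠ 0 := by
  obtain ⟨k', x, y, μ, hs⟩ := hV.exists_isSkewBasis hℓ hK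
  have h1 := hs.finrank_eq form_symm
  rw [Module.finrank_eq_card_basis b, Fintype.card_fin] at h1
  obtain rfl : k' = k := by omega
  intro h0
  have h2 : (pfaffianForm (perturbedForm ℓ hK) k').compLinearMap V.subtype = 0 := by
    refine AlternatingMap.eq_of_basis (V := V) (g := 0) b ?_
    rw [AlternatingMap.compLinearMap_apply, AlternatingMap.zero_apply]
    exact h0
  refine hs.pfaffianForm_ne_zero form_symm ?_
  exact congrArg (fun f => f fun j => ⟨_, hs.skewFamily_mem j⟩) h2

/-- The mean map is skew-symmetric with values in the kernel of the derivative, which is contained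
in `V`. So it vanishes on everything orthogonal to `V`. -/
lemma perturbed_eq_of_mem_complement {V V' : Submodule ℝ (twistedFields ℓ h)} (hV : IsInvariant V)
    {w : twistedFields ℓ h} (hw : w ∈ formComplement (form ℓ h) V V') :
    perturbed ℓ hK.mul_eq w = derivation ℓ h w := by
  have : meanMap ℓ hK.mul_eq w = 0 := by
    by_contra h0
    have h1 := form_pos hℓ hK.orthogonal _ h0
    rw [form_meanMap hK.mul_eq hK.skew, form_symm,
      hw.2 _ (hV.ker_le _ (derivation_meanMap hK.mul_eq _))] at h1
    simp at h1
  rw [perturbed, LinearMap.add_apply, this, add_zero]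

include hK in
lemma perturbed_mem_complement {V V' : Submodule ℝ (twistedFields ℓ h)} (hV : IsInvariant V)
    (hV' : IsInvariant V') {w : twistedFields ℓ h} (hw : w ∈ formComplement (form ℓ h) V V') :
    perturbed ℓ hK.mul_eq w ∈ formComplement (form ℓ h) V V' := by
  refine ⟨hV'.perturbed_mem hK.mul_eq hw.1, fun v hv => ?_⟩
  rw [← neg_eq_zero, ← form_perturbed hK.mul_eq hK.orthogonal hK.skew]
  exact hw.2 _ (hV.perturbed_mem hK.mul_eq hv)

/-- The Pfaffian form is multiplicative. -/
lemma pfaffianForm_append {V V' : Submodule ℝ (twistedFields ℓ h)} (hV : IsInvariant V)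
    (hV' : IsInvariant V') (hle : V ≤ V') {p k : ℕ} (hp : Module.finrank ℝ V = 2 * p)
    (hk : Module.finrank ℝ V' = 2 * p + 2 * k) {u : Fin (2 * p) → twistedFields ℓ h}
    {w : Fin (2 * k) → twistedFields ℓ h} (hu : ∀ i, u i ∈ V)
    (hw : ∀ i, w i ∈ formComplement (form ℓ h) V V') :
    pfaffianForm (perturbedForm ℓ hK) (p + k) (fun i => Fin.append u w (finCongr (mul_add 2 p k) i)) =
      pfaffianForm (perturbedForm ℓ hK) p u *
        matrixPfaffian (Matrix.of fun i j => form ℓ h (w i) (derivation ℓ h (w j))) := by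
  have := hV.finite
  have := hV'.finite
  have : FiniteDimensional ℝ (formComplement (form ℓ h) V V') :=
    Submodule.finiteDimensional_of_le (formComplement_le _ _ _)
  have hd := finrank_add_finrank_formComplement (form_pos hℓ hK.orthogonal) hle
  -- The complement does not see the perturbation: this is why the Pfaffians of the perturbed
  -- operator satisfy the gluing rule of the Pfaffian line.
  have hw2 : pfaffianForm (perturbedForm ℓ hK) k w =
      matrixPfaffian (Matrix.of fun i j => form ℓ h (w i) (derivation ℓ h (w j))) := by
    rw [pfaffianForm_apply]
    congr 1
    ext i j
    rw [Matrix.of_apply, Matrix.of_apply, perturbedForm, LinearMap.compl₂_apply,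
      perturbed_eq_of_mem_complement hℓ hK hV (hw j)]
  rw [← hw2]
  have hinj := perturbed_injective hK.mul_eq hℓ hK.orthogonal hK.inj
  refine Eq.trans ?_ (pfaffianForm_elim (form_symm) (form_pos hℓ hK.orthogonal)
    (form_perturbed hK.mul_eq hK.orthogonal hK.skew) (U := V) (U' := formComplement (form ℓ h) V V') hp
    (by omega)
    (fun v hv => hV.perturbed_mem _ hv) (fun v hv => perturbed_mem_complement hℓ hK hV hV' hv)
    (fun v _ => hinj v) (fun v _ => hinj v) (fun v hv w hw => hw.2 v hv) hu hw)
  rw [perturbedForm]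
  congr 1
  funext i
  obtain ⟨s, hs⟩ := finSumFinEquiv.surjective (finCongr (mul_add 2 p k) i)
  rw [splitEquiv, Equiv.trans_apply, ← hs, Equiv.symm_apply_apply]
  rcases s with s | s <;> simp

end twistedFields

end

/-! ### The Pfaffian line in terms of components. -/

noncomputable section

open scoped Matrix

lemma CircleSpin.sign_mul_self (spin : CircleSpin) : spin.sign * spin.sign = 1 := by
  cases spin <;> simp [CircleSpin.sign]

section AlongCurve

variable {n : ℕ} {X : Type*} [TopologicalSpace X] [ChartedSpace (EuclideanSpace ℝ (Fin n)) X]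
  [IsManifold (𝓡 n) ∞ X] {φ : ℝ → X} {ℓ : ℝ}
  [Bundle.RiemannianBundle (fun x : X => TangentSpace (𝓡 n) x)]
  [IsContMDiffRiemannianBundle (𝓡 n) ∞ (EuclideanSpace ℝ (Fin n))
      (fun x : X => TangentSpace (𝓡 n) x)] [T2Space X]
  {cov : CovariantDerivative (𝓡 n) (EuclideanSpace ℝ (Fin n))
      (fun x : X => TangentSpace (𝓡 n) x)} {o : ManifoldOrientation (n := n) X}

namespace ParallelFrame

variable (P : ParallelFrame cov o ℓ φ) (spin : CircleSpin)

/-- The matrix `h` such that the spinor fields have the components `u` with `u (t + ℓ) = h u(t)`. -/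
def monodromy : Matrix (Fin n) (Fin n) ℝ := spin.sign • P.holonomyᵀ

lemma holonomy_mul_eq_iff {k : ℕ} (M N : Matrix (Fin n) (Fin k) ℝ) :
    P.holonomy * M = spin.sign • N ↔ M = P.monodromy spin * N := by
  rw [monodromy, Matrix.smul_mul]
  constructor
  · intro h
    rw [← Matrix.mul_smul, ← h, ← Matrix.mul_assoc, transpose_mul_of_mem P.holonomy_mem,
      Matrix.one_mul]
  · rintro rfl
    rw [Matrix.mul_smul, ← Matrix.mul_assoc, mul_transpose_of_mem P.holonomy_mem, Matrix.one_mul]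

lemma holonomy_mulVec_eq_iff (v w : Fin n → ℝ) :
    P.holonomy *ᵥ v = spin.sign • w ↔ v = P.monodromy spin *ᵥ w := by
  rw [monodromy, Matrix.smul_mulVec]
  constructor
  · intro h
    rw [← Matrix.mulVec_smul, ← h, Matrix.mulVec_mulVec, transpose_mul_of_mem P.holonomy_mem,
      Matrix.one_mulVec]
  · rintro rfl
    rw [Matrix.mulVec_smul, Matrix.mulVec_mulVec, mul_transpose_of_mem P.holonomy_mem,
      Matrix.one_mulVec]

/-- The sign of the spin structure does not affect the determinant because `n` is even. -/
lemma monodromy_mem (hn : Even n) :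
    P.monodromy spin ∈ Matrix.specialOrthogonalGroup (Fin n) ℝ := by
  rw [mem_specialOrthogonal_iff, monodromy, Matrix.det_smul, Fintype.card_fin,
    Matrix.det_transpose, (mem_specialOrthogonal_iff.1 P.holonomy_mem).2, mul_one,
    Matrix.transpose_smul, Matrix.transpose_transpose, smul_mul_smul_comm, spin.sign_mul_self,
    mul_transpose_of_mem P.holonomy_mem, one_smul]
  refine ⟨rfl, ?_⟩
  obtain ⟨k, rfl⟩ := hn
  rw [pow_add, ← mul_pow, spin.sign_mul_self, one_pow]

variable {spin} (hφ : ContMDiff 𝓘(ℝ, ℝ) (𝓡 n) ∞ φ) (hper : Function.Periodic φ ℓ)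
include hφ hper

lemma isSpinorField_iff_mem (u : ℝ → Fin n → ℝ) :
    IsSpinorField ℓ spin φ (P.field u) ↔ u ∈ twistedFields ℓ (P.monodromy spin) := by
  rw [P.isSpinorField_iff hφ hper]
  simp only [P.holonomy_mulVec_eq_iff]
  rfl

/-- The components of the members of an invariant space. -/
def components (V : DiracInvariantSpace ℓ spin cov φ) :
    V.space →ₗ[ℝ] twistedFields ℓ (P.monodromy spin) where
  toFun s := ⟨P.field.symm s, (P.isSpinorField_iff_mem hφ hper _).1 (by
    rw [LinearEquiv.apply_symm_apply]; exact V.isSpinorField s s.2)⟩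
  map_add' s s' := Subtype.ext (map_add P.field.symm _ _)
  map_smul' c s := Subtype.ext (map_smul P.field.symm _ _)

lemma field_components (V : DiracInvariantSpace ℓ spin cov φ) (s : V.space) :
    P.field (P.components hφ hper V s).1 = s := P.field.apply_symm_apply _

lemma components_eq_iff (V : DiracInvariantSpace ℓ spin cov φ) (s : V.space)
    (u : twistedFields ℓ (P.monodromy spin)) :
    P.components hφ hper V s = u ↔ (s : FieldAlong (n := n) φ) = P.field u.1 := by
  rw [← P.field_components hφ hper V s, P.field.injective.eq_iff, Subtype.ext_iff]

lemma components_injective (V : DiracInvariantSpace ℓ spin cov φ) :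
    Function.Injective (P.components hφ hper V) := fun s s' h => by
  rw [P.components_eq_iff, P.field_components] at h
  exact Subtype.ext h

lemma dirac_field_twisted (u : twistedFields ℓ (P.monodromy spin)) :
    dirac cov φ (P.field u.1) = P.field (twistedFields.derivation ℓ (P.monodromy spin) u).1 :=
  P.dirac_field hφ u.2.1

lemma spinorInner_field (u v : twistedFields ℓ (P.monodromy spin)) :
    spinorInner ℓ (P.field u.1) (P.field v.1) = twistedFields.form ℓ (P.monodromy spin) u v := by
  simp only [spinorInner, P.inner_field]
  rfl

lemma isInvariant_range (V : DiracInvariantSpace ℓ spin cov φ) :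
    twistedFields.IsInvariant (LinearMap.range (P.components hφ hper V)) := by
  refine ⟨?_, ?_, ?_⟩
  · have := V.finite
    infer_instance
  · rintro _ ⟨s, rfl⟩
    refine ⟨⟨_, V.invariant s s.2⟩, ?_⟩
    rw [P.components_eq_iff, ← P.dirac_field_twisted hφ hper, P.field_components]
  · intro u hu
    have h1 : IsSpinorField ℓ spin φ (P.field u.1) := (P.isSpinorField_iff_mem hφ hper _).2 u.2
    refine ⟨⟨P.field u.1, V.kernel_le _ h1 ?_⟩, ?_⟩
    · rw [P.dirac_field_twisted hφ hper, hu]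
      exact map_zero P.field
    · rw [P.components_eq_iff]

lemma finrank_range_components (V : DiracInvariantSpace ℓ spin cov φ) :
    Module.finrank ℝ (LinearMap.range (P.components hφ hper V)) = Module.finrank ℝ V.space :=
  LinearMap.finrank_range_of_inj (P.components_injective hφ hper V)

/-- The invariant space of spinor fields with the components in a given space. -/
def ofSubmodule {V : Submodule ℝ (twistedFields ℓ (P.monodromy spin))}
    (hV : twistedFields.IsInvariant V) : DiracInvariantSpace ℓ spin cov φ where
  space := (V.map (twistedFields ℓ (P.monodromy spin)).subtype).map P.field.toLinearMap
  finite := by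
    have := hV.finite
    infer_instance
  isSpinorField := by
    rintro _ ⟨_, ⟨u, hu, rfl⟩, rfl⟩
    exact (P.isSpinorField_iff_mem hφ hper _).2 u.2
  invariant := by
    rintro _ ⟨_, ⟨u, hu, rfl⟩, rfl⟩
    exact ⟨_, ⟨_, hV.map_mem u hu, rfl⟩, (P.dirac_field_twisted hφ hper u).symm⟩
  kernel_le := by
    intro s hs hd
    obtain ⟨u, rfl⟩ := P.field.surjective s
    let u' : twistedFields ℓ (P.monodromy spin) := ⟨u, (P.isSpinorField_iff_mem hφ hper _).1 hs⟩
    refine ⟨_, ⟨u', hV.ker_le u' (Subtype.ext (P.field.injective ?_)), rfl⟩, rfl⟩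
    rw [← P.dirac_field_twisted hφ hper, hd]
    exact (map_zero P.field).symm

lemma mem_ofSubmodule {V : Submodule ℝ (twistedFields ℓ (P.monodromy spin))}
    (hV : twistedFields.IsInvariant V) (s : FieldAlong (n := n) φ) :
    s ∈ (P.ofSubmodule hφ hper hV).space ↔ ∃ u ∈ V, P.field u.1 = s := by
  constructor
  · rintro ⟨_, ⟨u, hu, rfl⟩, rfl⟩
    exact ⟨u, hu, rfl⟩
  · rintro ⟨u, hu, rfl⟩
    exact ⟨_, ⟨u, hu, rfl⟩, rfl⟩

lemma isInvariant_ker :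
    twistedFields.IsInvariant (LinearMap.ker (twistedFields.derivation ℓ (P.monodromy spin))) := by
  refine ⟨?_, fun v hv => ?_, fun v hv => hv⟩
  · let f : LinearMap.ker (twistedFields.derivation ℓ (P.monodromy spin)) →ₗ[ℝ] (Fin n → ℝ) :=
      { toFun := fun u => u.1.1 0
        map_add' := fun _ _ => rfl
        map_smul' := fun _ _ => rfl }
    refine FiniteDimensional.of_injective f fun u v huv => ?_
    have hu := twistedFields.derivation_eq_zero_iff.1 u.2
    have hv := twistedFields.derivation_eq_zero_iff.1 v.2
    exact Subtype.ext (Subtype.ext (funext fun t => by rw [hu, hv]; exact huv))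
  · rw [LinearMap.mem_ker] at hv
    rw [hv]
    exact Submodule.zero_mem _

variable (spin) in
/-- The kernel of the Dirac operator. -/
def kernelSpace : DiracInvariantSpace ℓ spin cov φ :=
  P.ofSubmodule hφ hper (P.isInvariant_ker hφ hper)

lemma kernelSpace_le (V : DiracInvariantSpace ℓ spin cov φ) :
    (P.kernelSpace spin hφ hper).space ≤ V.space := by
  intro s hs
  obtain ⟨u, hu, rfl⟩ := (P.mem_ofSubmodule hφ hper _ s).1 hs
  refine V.kernel_le _ ((P.isSpinorField_iff_mem hφ hper _).2 u.2) ?_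
  rw [P.dirac_field_twisted hφ hper, hu]
  exact map_zero P.field

variable (hℓ : 0 < ℓ) {K : Matrix (Fin n) (Fin n) ℝ} (hK : IsKernelForm (P.monodromy spin) K)
include hℓ hK

lemma components_append_mem {V V' : DiracInvariantSpace ℓ spin cov φ} {w : V'.space}
    (hw : ∀ v ∈ V.space, spinorInner ℓ v (w : FieldAlong (n := n) φ) = 0) :
    P.components hφ hper V' w ∈ formComplement (twistedFields.form ℓ (P.monodromy spin))
      (LinearMap.range (P.components hφ hper V)) (LinearMap.range (P.components hφ hper V')) := by
  refine ⟨⟨w, rfl⟩, ?_⟩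
  rintro _ ⟨v, rfl⟩
  rw [← P.spinorInner_field hφ hper, P.field_components, P.field_components]
  exact hw v v.2

/-- The element of the Pfaffian line that is given by the Pfaffian of the perturbed operator. -/
theorem exists_pfaffianLine :
    ∃ η : PfaffianLine ℓ spin cov φ, ∀ (V : DiracInvariantSpace ℓ spin cov φ) (k : ℕ)
      (hk : 2 * k = Module.finrank ℝ V.space) (u : Fin (Module.finrank ℝ V.space) → V.space),
      η.1 V u = pfaffianForm (twistedFields.perturbedForm ℓ hK) k
        (fun i => P.components hφ hper V (u (Fin.cast hk i))) := by
  -- The perturbed operator is skew-symmetric and injective on the space of components, so the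
  -- dimension is even.
  have hev : ∀ V : DiracInvariantSpace ℓ spin cov φ, ∃ k, 2 * k = Module.finrank ℝ V.space := by
    intro V
    obtain ⟨k, hk⟩ := (P.isInvariant_range hφ hper V).even_finrank hℓ hK
    exact ⟨k, by rw [← hk, P.finrank_range_components]⟩
  choose p hp using hev
  let η : (V : DiracInvariantSpace ℓ spin cov φ) →
      V.space [⋀^Fin (Module.finrank ℝ V.space)]→ₗ[ℝ] ℝ := fun V =>
    ((pfaffianForm (twistedFields.perturbedForm ℓ hK) (p V)).domDomCongr
      (finCongr (hp V))).compLinearMap (P.components hφ hper V)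
  have hη : ∀ (V : DiracInvariantSpace ℓ spin cov φ) (k : ℕ)
      (hk : 2 * k = Module.finrank ℝ V.space) (u : Fin (Module.finrank ℝ V.space) → V.space),
      η V u = pfaffianForm (twistedFields.perturbedForm ℓ hK) k
        (fun i => P.components hφ hper V (u (Fin.cast hk i))) := by
    intro V k hk u
    obtain rfl : k = p V := by have := hp V; omega
    rfl
  refine ⟨⟨η, ?_⟩, hη⟩
  intro V V' hle k hk u w hw
  have hk' : 2 * (p V + k) = Module.finrank ℝ V'.space := by rw [hk, ← hp V]; ring
  rw [hη V' _ hk', hη V _ (hp V)]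
  have hle' : LinearMap.range (P.components hφ hper V) ≤
      LinearMap.range (P.components hφ hper V') := by
    rintro _ ⟨s, rfl⟩
    exact ⟨⟨s, hle s.2⟩, rfl⟩
  have h1 := twistedFields.pfaffianForm_append hℓ hK (P.isInvariant_range hφ hper V)
    (P.isInvariant_range hφ hper V') hle' (p := p V) (k := k)
    (by rw [P.finrank_range_components, hp V]) (by rw [P.finrank_range_components, hk, hp V])
    (u := fun i => P.components hφ hper V (u (Fin.cast (hp V) i)))
    (w := fun i => P.components hφ hper V' (w i)) (fun i => ⟨_, rfl⟩)
    (fun i => P.components_append_mem hφ hper hℓ hK (hw i))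
  have h2 : (Matrix.of fun i j => twistedFields.form ℓ (P.monodromy spin)
      (P.components hφ hper V' (w i)) (twistedFields.derivation ℓ (P.monodromy spin)
        (P.components hφ hper V' (w j)))) = Matrix.of fun i j =>
        spinorInner ℓ (w i : FieldAlong (n := n) φ) (dirac cov φ (w j)) := by
    ext i j
    rw [Matrix.of_apply, Matrix.of_apply, ← P.spinorInner_field hφ hper,
      ← P.dirac_field_twisted hφ hper, P.field_components, P.field_components]
  rw [h2] at h1
  rw [← h1]
  congr 1
  funext i
  obtain ⟨s, hs⟩ := finSumFinEquiv.surjective (finCongr (mul_add 2 (p V) k) i)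
  rw [← hs]
  obtain rfl : i = (finCongr (mul_add 2 (p V) k)).symm (finSumFinEquiv s) := by
    rw [hs, Equiv.symm_apply_apply]
  rcases s with s | s
  · rw [finSumFinEquiv_apply_left, Fin.append_left]
    have : Fin.cast hk (Fin.cast hk' ((finCongr (mul_add 2 (p V) k)).symm (Fin.castAdd (2 * k) s))) =
        Fin.castAdd (2 * k) (Fin.cast (hp V) s) := by
      ext; simp
    rw [this, Fin.append_left]
    rfl
  · rw [finSumFinEquiv_apply_right, Fin.append_right]
    have : Fin.cast hk (Fin.cast hk' ((finCongr (mul_add 2 (p V) k)).symm (Fin.natAdd (2 * p V) s))) =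
        Fin.natAdd (Module.finrank ℝ V.space) s := by
      ext; simp
    rw [this, Fin.append_right]

/-- The components of a basis are a basis of the space of components, so the Pfaffian does not
vanish. -/
lemma pfaffianForm_components_ne_zero {V : DiracInvariantSpace ℓ spin cov φ} {k : ℕ}
    (b : Module.Basis (Fin (2 * k)) ℝ V.space) :
    pfaffianForm (twistedFields.perturbedForm ℓ hK) k
      (fun i => P.components hφ hper V (b i)) ≠ 0 := by
  have := (P.isInvariant_range hφ hper V).pfaffianForm_basis_ne_zero hℓ hK
    (b.map (LinearEquiv.ofInjective _ (P.components_injective hφ hper V)))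
  simpa using this

end ParallelFrame

end AlongCurve

end

/-! ### The Pfaffian line is one-dimensional. -/

noncomputable section

open scoped Matrix

lemma Submodule.exists_linearIndependent_of_finrank_eq {V : Type*} [AddCommGroup V] [Module ℝ V]
    (U : Submodule ℝ V) [FiniteDimensional ℝ U] {k : ℕ} (hk : Module.finrank ℝ U = k) :
    ∃ b : Fin k → V, LinearIndependent ℝ b ∧ ∀ i, b i ∈ U := by
  obtain ⟨b⟩ : Nonempty (Module.Basis (Fin k) ℝ U) :=
    ⟨(Module.finBasis ℝ U).reindex (finCongr hk)⟩
  exact ⟨U.subtype ∘ b, b.linearIndependent.map' U.subtype U.ker_subtype, fun i => (b i).2⟩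

section AlongCurve

variable {n : ℕ} {X : Type*} [TopologicalSpace X] [ChartedSpace (EuclideanSpace ℝ (Fin n)) X]
  [IsManifold (𝓡 n) ∞ X] {φ : ℝ → X} {ℓ : ℝ}
  [Bundle.RiemannianBundle (fun x : X => TangentSpace (𝓡 n) x)]
  [IsContMDiffRiemannianBundle (𝓡 n) ∞ (EuclideanSpace ℝ (Fin n))
      (fun x : X => TangentSpace (𝓡 n) x)] [T2Space X]
  {cov : CovariantDerivative (𝓡 n) (EuclideanSpace ℝ (Fin n))
      (fun x : X => TangentSpace (𝓡 n) x)} {o : ManifoldOrientation (n := n) X}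

namespace ParallelFrame

variable (P : ParallelFrame cov o ℓ φ) {spin : CircleSpin}
  (hφ : ContMDiff 𝓘(ℝ, ℝ) (𝓡 n) ∞ φ) (hper : Function.Periodic φ ℓ) (hℓ : 0 < ℓ)
  {K : Matrix (Fin n) (Fin n) ℝ} (hK : IsKernelForm (P.monodromy spin) K)
include hφ hper hℓ hK

lemma spinorInner_pos (V : DiracInvariantSpace ℓ spin cov φ) (v : V.space) (hv : v ≠ 0) :
    0 < spinorInner ℓ (v : FieldAlong (n := n) φ) v := by
  rw [← P.field_components hφ hper V v, P.spinorInner_field hφ hper]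
  exact twistedFields.form_pos hℓ hK.orthogonal _ fun h =>
    hv (P.components_injective hφ hper V (by rw [h, map_zero]))

/-- An orthogonal complement of the kernel of the Dirac operator, as a family. -/
lemma exists_complementary_family (V : DiracInvariantSpace ℓ spin cov φ) :
    ∃ (k : ℕ) (_ : Module.finrank ℝ V.space =
        Module.finrank ℝ (P.kernelSpace spin hφ hper).space + 2 * k)
      (w : Fin (2 * k) → V.space), LinearIndependent ℝ w ∧
      ∀ i, ∀ v ∈ (P.kernelSpace spin hφ hper).space,
        spinorInner ℓ v (w i : FieldAlong (n := n) φ) = 0 := by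
  set N := P.kernelSpace spin hφ hper with hN
  have hNV := P.isInvariant_range hφ hper N
  have hV := P.isInvariant_range hφ hper V
  have := hV.finite
  have hle : LinearMap.range (P.components hφ hper N) ≤
      LinearMap.range (P.components hφ hper V) := by
    rintro _ ⟨s, rfl⟩
    exact ⟨⟨s, P.kernelSpace_le hφ hper V s.2⟩, rfl⟩
  have hd := finrank_add_finrank_formComplement
    (twistedFields.form_pos (ℓ := ℓ) hℓ hK.orthogonal) hle
  set U := formComplement (twistedFields.form ℓ (P.monodromy spin))
    (LinearMap.range (P.components hφ hper N)) (LinearMap.range (P.components hφ hper V)) with hU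
  have : FiniteDimensional ℝ U := Submodule.finiteDimensional_of_le (formComplement_le _ _ _)
  obtain ⟨p, hp⟩ := hNV.even_finrank hℓ hK
  obtain ⟨q, hq⟩ := hV.even_finrank hℓ hK
  have hk : Module.finrank ℝ U = 2 * (q - p) := by omega
  obtain ⟨b, hbi, hbU⟩ := U.exists_linearIndependent_of_finrank_eq hk
  have hb : ∀ i, ∃ s, P.components hφ hper V s = b i := fun i => (hbU i).1
  choose w hw using hb
  refine ⟨q - p, ?_, w, ?_, fun i v hv => ?_⟩
  · rw [← P.finrank_range_components hφ hper V, ← P.finrank_range_components hφ hper N]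
    omega
  · refine LinearIndependent.of_comp (P.components hφ hper V) ?_
    have : (P.components hφ hper V) ∘ w = b := funext hw
    rwa [this]
  · have h1 := (hbU i).2 (P.components hφ hper N ⟨v, hv⟩) ⟨_, rfl⟩
    rw [← hw, ← P.spinorInner_field hφ hper, P.field_components, P.field_components] at h1
    exact h1

/-- On a basis of `V` that extends a basis of the kernel by an orthogonal family, the gluing rule
expresses the value of `η` as a multiple of its value on the kernel. -/
lemma eq_zero_of_apply_kernelSpace {η : PfaffianLine ℓ spin cov φ}
    (h0 : η.1 (P.kernelSpace spin hφ hper) = 0) : η = 0 := by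
  refine Subtype.ext (funext fun V => ?_)
  obtain ⟨k, hk, w, hw, horth⟩ := P.exists_complementary_family hφ hper hℓ hK V
  have hle := P.kernelSpace_le (spin := spin) hφ hper V
  have hη := fun u => η.2 (P.kernelSpace spin hφ hper) V hle k hk u w horth
  set N := P.kernelSpace spin hφ hper
  have := N.finite
  have := V.finite
  let b := Module.finBasis ℝ N.space
  -- A common vector of the two spans would be orthogonal to itself.
  have h1 : LinearIndependent ℝ (Sum.elim (fun j => Submodule.inclusion hle (b j)) w) := by
    refine LinearIndependent.sum_type ?_ hw ?_
    · exact b.linearIndependent.map' _ (Submodule.ker_inclusion _ _ hle)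
    · rw [Submodule.disjoint_def]
      intro x hx hxw
      have hxN : (x : FieldAlong (n := n) φ) ∈ N.space := by
        have : Submodule.span ℝ (Set.range fun j => Submodule.inclusion hle (b j)) ≤
            N.space.comap V.space.subtype := by
          refine Submodule.span_le.2 ?_
          rintro _ ⟨j, rfl⟩
          exact (b j).2
        exact this hx
      have hxo : x ∈ (formComplement (twistedFields.form ℓ (P.monodromy spin))
          (LinearMap.range (P.components hφ hper N)) (LinearMap.range
            (P.components hφ hper V))).comap (P.components hφ hper V) := by
        refine (Submodule.span_le.2 ?_ : Submodule.span ℝ (Set.range w) ≤ _) hxw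
        rintro _ ⟨j, rfl⟩
        exact P.components_append_mem hφ hper hℓ hK (horth j)
      by_contra hx0
      refine (P.spinorInner_pos hφ hper hℓ hK V x hx0).ne' ?_
      have h2 := hxo.2 (P.components hφ hper N ⟨x, hxN⟩) ⟨_, rfl⟩
      rwa [← P.spinorInner_field hφ hper, P.field_components, P.field_components] at h2
  have h2 : LinearIndependent ℝ fun i =>
      Fin.append (fun j => Submodule.inclusion hle (b j)) w (Fin.cast hk i) := by
    have h3 := h1.comp (fun i => finSumFinEquiv.symm (Fin.cast hk i))
      (finSumFinEquiv.symm.injective.comp (Fin.cast_injective hk))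
    convert h3 using 1
    funext i
    obtain ⟨s, hs⟩ := finSumFinEquiv.surjective (Fin.cast hk i)
    rw [← hs, Function.comp_apply, ← hs, Equiv.symm_apply_apply]
    rcases s with s | s
    · rw [finSumFinEquiv_apply_left, Fin.append_left, Sum.elim_inl]
    · rw [finSumFinEquiv_apply_right, Fin.append_right, Sum.elim_inr]
  let b' : Module.Basis (Fin (Module.finrank ℝ V.space)) ℝ V.space :=
    Module.Basis.mk h2 (by
      rw [LinearIndependent.span_eq_top_of_card_eq_finrank' h2 (Fintype.card_fin _)])
  refine AlternatingMap.eq_of_basis b' ?_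
  have h4 := hη b
  rw [h0, AlternatingMap.zero_apply, zero_mul] at h4
  rw [Module.Basis.coe_mk]
  exact h4

lemma apply_basis_ne_zero {η₀ : PfaffianLine ℓ spin cov φ}
    (hη₀ : ∀ (V : DiracInvariantSpace ℓ spin cov φ) (k : ℕ)
      (hk : 2 * k = Module.finrank ℝ V.space) (u : Fin (Module.finrank ℝ V.space) → V.space),
      η₀.1 V u = pfaffianForm (twistedFields.perturbedForm ℓ hK) k
        (fun i => P.components hφ hper V (u (Fin.cast hk i))))
    (V : DiracInvariantSpace ℓ spin cov φ)
    (b : Module.Basis (Fin (Module.finrank ℝ V.space)) ℝ V.space) : η₀.1 V b ≠ 0 := by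
  obtain ⟨k, hk⟩ := (P.isInvariant_range hφ hper V).even_finrank hℓ hK
  rw [P.finrank_range_components] at hk
  rw [hη₀ V k hk.symm]
  have := P.pfaffianForm_components_ne_zero hφ hper hℓ hK (b.reindex (finCongr hk))
  simpa using this

/-- The top forms on the kernel are a line, on which `η₀` does not vanish. Two elements of the
Pfaffian line with the same value there are equal. -/
lemma exists_eq_smul {η₀ : PfaffianLine ℓ spin cov φ}
    (hη₀ : ∀ (V : DiracInvariantSpace ℓ spin cov φ) (k : ℕ)
      (hk : 2 * k = Module.finrank ℝ V.space) (u : Fin (Module.finrank ℝ V.space) → V.space),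
      η₀.1 V u = pfaffianForm (twistedFields.perturbedForm ℓ hK) k
        (fun i => P.components hφ hper V (u (Fin.cast hk i))))
    (η : PfaffianLine ℓ spin cov φ) : ∃ c : ℝ, c • η₀ = η := by
  set N := P.kernelSpace spin hφ hper with hN
  have := N.finite
  let b := Module.finBasis ℝ N.space
  have h0 := P.apply_basis_ne_zero hφ hper hℓ hK hη₀ N b
  refine ⟨η.1 N b / η₀.1 N b, sub_eq_zero.1 (P.eq_zero_of_apply_kernelSpace hφ hper hℓ hK ?_)⟩
  refine AlternatingMap.eq_of_basis b ?_
  change η.1 N b / η₀.1 N b * η₀.1 N b - η.1 N b = 0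
  rw [div_mul_cancel₀ _ h0, sub_self]

end ParallelFrame

end AlongCurve

end

/-! ### Components of a real line without its origin. -/

noncomputable section

open scoped Matrix

section Line

variable {M : Type*} [AddCommGroup M] [Module ℝ M]

/-- A coordinate on a line. -/
lemma exists_linearEquiv_of_exists_smul_eq {v : M}
    (hv : v ≠ 0) (h : ∀ w : M, ∃ c : ℝ, c • v = w) :
    ∃ f : M ≃ₗ[ℝ] ℝ, (∀ w, f w • v = w) ∧ ∀ c : ℝ, f (c • v) = c := by
  let g := LinearEquiv.ofBijective (LinearMap.toSpanSingleton ℝ M v)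
    ⟨smul_left_injective ℝ hv, h⟩
  exact ⟨g.symm, fun w => g.apply_symm_apply w, fun c => g.symm_apply_apply c⟩

/-- Two nonzero elements of a line are in the same component if and only if they have the same
sign. -/
theorem joined_iff_of_isInducing [TopologicalSpace M] [IsModuleTopology ℝ M] (f : M ≃ₗ[ℝ] ℝ)
    {Z : Type*} [TopologicalSpace Z] {ι : Z → M} (hι : Topology.IsInducing ι) (hinj : Function.Injective ι)
    (hne : ∀ z, ι z ≠ 0) (hsurj : ∀ v, v ≠ 0 → ∃ z, ι z = v) (z w : Z) :
    Joined z w ↔ 0 < f (ι z) * f (ι w) := by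
  have := IsModuleTopology.toContinuousAdd ℝ M
  have hne : ∀ z, f (ι z) ≠ 0 := fun z => (map_ne_zero_iff f f.injective).2 (hne z)
  have hf : Continuous f := IsModuleTopology.continuous_of_linearMap f.toLinearMap
  have hf' : Continuous f.symm := IsModuleTopology.continuous_of_linearMap f.symm.toLinearMap
  constructor
  · rintro ⟨γ⟩
    by_contra! h
    have hc : Continuous fun r => f (ι (γ r)) * f (ι w) :=
      (hf.comp (hι.continuous.comp γ.continuous)).mul continuous_const
    obtain ⟨r, hr⟩ := mem_range_of_exists_le_of_exists_ge (c := 0) hc ⟨0, by rwa [γ.source]⟩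
      ⟨1, by rw [γ.target]; exact mul_self_nonneg _⟩
    exact mul_ne_zero (hne _) (hne _) hr
  · intro h
    -- Coordinates of equal sign are joined by a segment, which avoids `0`.
    have hne' : ∀ r : unitInterval, (1 - (r : ℝ)) * f (ι z) + r * f (ι w) ≠ 0 := by
      intro r h0
      have h1 : ((1 - (r : ℝ)) * f (ι z) + r * f (ι w)) * f (ι w) =
          (1 - (r : ℝ)) * (f (ι z) * f (ι w)) + r * (f (ι w) * f (ι w)) := by ring
      rw [h0, zero_mul] at h1
      have h2 := mul_self_pos.2 (hne w)
      have h3 := mul_nonneg (sub_nonneg.2 r.2.2) h.le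
      rcases r.2.1.eq_or_lt with h5 | h5
      · rw [← h5] at h1
        linarith
      · have := mul_pos h5 h2
        linarith
    choose γ hγ using fun r : unitInterval =>
      hsurj (f.symm ((1 - (r : ℝ)) * f (ι z) + r * f (ι w))) fun h0 =>
        hne' r ((LinearEquiv.map_eq_zero_iff _).1 h0)
    refine ⟨⟨⟨γ, hι.continuous_iff.2 ?_⟩, hinj ?_, hinj ?_⟩⟩
    · rw [show ι ∘ γ = _ from funext hγ]
      exact hf'.comp (by fun_prop)
    · simp [hγ]
    · simp [hγ]

end Line

section PfaffianNonzero

variable {n : ℕ} {X : Type*} [TopologicalSpace X] [ChartedSpace (EuclideanSpace ℝ (Fin n)) X]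
  [IsManifold (𝓡 n) ∞ X] {φ : ℝ → X} {ℓ : ℝ}
  [Bundle.RiemannianBundle (fun x : X => TangentSpace (𝓡 n) x)]
  {cov : CovariantDerivative (𝓡 n) (EuclideanSpace ℝ (Fin n))
      (fun x : X => TangentSpace (𝓡 n) x)} {spin : CircleSpin}

namespace PfaffianNonzero

variable (f : PfaffianLine ℓ spin cov φ ≃ₗ[ℝ] ℝ)

lemma coordinate_ne_zero (η : PfaffianNonzero ℓ spin cov φ) : f η.1 ≠ 0 :=
  (map_ne_zero_iff f f.injective).2 η.2

lemma coordinate_neg (η : PfaffianNonzero ℓ spin cov φ) : f (-η).1 = -f η.1 :=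
  map_neg f η.1

theorem joined_iff (η η' : PfaffianNonzero ℓ spin cov φ) :
    Joined η η' ↔ 0 < f η.1 * f η'.1 :=
  let _ : TopologicalSpace (PfaffianLine ℓ spin cov φ) := moduleTopology ℝ _
  have : IsModuleTopology ℝ (PfaffianLine ℓ spin cov φ) := ⟨rfl⟩
  joined_iff_of_isInducing f (ι := fun ζ : PfaffianNonzero ℓ spin cov φ => ζ.1) ⟨rfl⟩
    (fun _ _ h => Subtype.ext h) (fun ζ => ζ.2) (fun v hv => ⟨⟨v, hv⟩, rfl⟩) η η'

include f in
lemma not_joined_neg (η : PfaffianNonzero ℓ spin cov φ) : ¬Joined η (-η) := by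
  rw [joined_iff f, coordinate_neg, mul_neg, neg_pos, not_lt]
  exact mul_self_nonneg _

include f in
lemma joined_or_joined_neg (η η' : PfaffianNonzero ℓ spin cov φ) : Joined η η' ∨ Joined (-η) η' := by
  rw [joined_iff f, joined_iff f, coordinate_neg]
  generalize h : f η.1 = a
  generalize h' : f η'.1 = b
  have ha : a ≠ 0 := h ▸ coordinate_ne_zero f η
  have hb : b ≠ 0 := h' ▸ coordinate_ne_zero f η'
  rcases lt_or_gt_of_ne (mul_ne_zero ha hb) with h1 | h1
  · exact Or.inr (by linarith)
  · exact Or.inl h1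

end PfaffianNonzero

end PfaffianNonzero

end

/-! ### A nondegenerate skew-symmetric form on the kernel of a skew-symmetric matrix. -/

noncomputable section

open scoped Matrix

section KernelForm

variable {n : ℕ} {A : Matrix (Fin n) (Fin n) ℝ}

/-- The image of `A` is orthogonal to its kernel, so `A` is injective on its image, which therefore
has a skew basis. -/
lemma even_rank_of_skew (hA : Aᵀ = -A) : Even A.rank := by
  have hsymm : ∀ x y : Fin n → ℝ, dotProductBilin ℝ ℝ x y = dotProductBilin ℝ ℝ y x :=
    fun x y => dotProduct_comm x y
  obtain ⟨k, x, y, μ, hs⟩ := exists_isSkewBasis (B := dotProductBilin ℝ ℝ) (a := A.mulVecLin)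
    hsymm (fun x hx => by
      have := Matrix.dotProduct_self_star_pos_iff.2 hx
      simpa using this)
    (fun x y => dotProduct_mulVec_skew hA x y) (LinearMap.range A.mulVecLin)
    (fun x _ => ⟨x, rfl⟩) (by
      rintro _ ⟨v, rfl⟩ h
      have h1 := dotProduct_mulVec_skew hA v (A *ᵥ v)
      change A *ᵥ (A *ᵥ v) = 0 at h
      rw [h, dotProduct_zero, neg_zero] at h1
      exact dotProduct_self_eq_zero.1 h1)
  rw [Matrix.rank, hs.finrank_eq hsymm]
  exact even_two_mul k

/-- A skew-symmetric matrix of even size has a nondegenerate skew-symmetric form on its kernel. -/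
theorem exists_kernel_form (hn : Even n) (hA : Aᵀ = -A) :
    ∃ K : Matrix (Fin n) (Fin n) ℝ, Kᵀ = -K ∧ A * K = 0 ∧
      ∀ v, A *ᵥ v = 0 → K *ᵥ v = 0 → v = 0 := by
  classical
  obtain ⟨U, d, hU, hU', hd⟩ := exists_diagonalization (S := A * A)
    (by rw [Matrix.transpose_mul, hA, neg_mul_neg])
  have hrank : (A * A).rank = A.rank := by
    have := Matrix.rank_transpose_mul_self A
    rwa [hA, neg_mul, ← neg_one_mul, Matrix.rank_mul_eq_right_of_isUnit_det _ _ (by simp [Matrix.det_neg])] at this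
  have hrank' : (A * A).rank = Fintype.card {i // d i ≠ 0} := by
    have h1 : IsUnit U.det := (Matrix.isUnit_iff_isUnit_det U).1 (IsUnit.of_mul_eq_one _ hU')
    have h2 : IsUnit Uᵀ.det := by rwa [Matrix.det_transpose]
    rw [hd, Matrix.rank_mul_eq_left_of_isUnit_det _ _ h2, Matrix.rank_mul_eq_right_of_isUnit_det _ _ h1,
      Matrix.rank_diagonal]
  -- The size and the rank are even, hence so is the dimension of the kernel, and it carries a
  -- complex structure.
  have hcard : Even (Fintype.card {i // d i = 0}) := by
    have h1 := Fintype.card_subtype_compl fun i => d i = 0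
    have h2 := Fintype.card_subtype_le fun i => d i = 0
    rw [Fintype.card_fin] at h1 h2
    have h3 : Even (Fintype.card {i // d i ≠ 0}) := by
      rw [← hrank', hrank]; exact even_rank_of_skew hA
    rw [h1] at h3
    exact (Nat.even_sub h2).1 h3 |>.1 hn
  obtain ⟨J, hJ, hJJ, hJd⟩ := exists_complexStructure hcard
  have hKA2 : U * J * Uᵀ * (A * A) = 0 := by
    rw [hd, show U * J * Uᵀ * (U * Matrix.diagonal d * Uᵀ) =
      U * (J * ((Uᵀ * U) * Matrix.diagonal d)) * Uᵀ by simp only [Matrix.mul_assoc], hU,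
      Matrix.one_mul, hJd d fun i hi => hi, Matrix.mul_zero, Matrix.zero_mul]
  have hK : (U * J * Uᵀ)ᵀ = -(U * J * Uᵀ) := by
    simp [Matrix.transpose_mul, hJ, Matrix.mul_assoc]
  refine ⟨U * J * Uᵀ, hK, ?_, fun v hv hv' => ?_⟩
  · set K := U * J * Uᵀ
    -- The construction gives `K * (A * A) = 0`, and by skew-symmetry this Gram matrix is `K * (A *
    -- A) * K`.
    have h1 : (A * K)ᵀ * (A * K) = 0 := by
      rw [Matrix.transpose_mul, hK, hA, neg_mul_neg, Matrix.mul_assoc, ← Matrix.mul_assoc A,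
        ← Matrix.mul_assoc, hKA2, Matrix.zero_mul]
    rw [← Matrix.conjTranspose_eq_transpose_of_trivial] at h1
    exact Matrix.conjTranspose_mul_self_eq_zero.1 h1
  · have h1 : Matrix.diagonal d *ᵥ (Uᵀ *ᵥ v) = 0 := by
      have h2 : Uᵀ *ᵥ ((A * A) *ᵥ v) = 0 := by
        rw [← Matrix.mulVec_mulVec, hv, Matrix.mulVec_zero, Matrix.mulVec_zero]
      rwa [hd, Matrix.mulVec_mulVec, ← Matrix.mul_assoc, ← Matrix.mul_assoc, hU, Matrix.one_mul,
        ← Matrix.mulVec_mulVec] at h2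
    have h2 : (J * J) *ᵥ (Uᵀ *ᵥ v) = 0 := by
      have h3 : J *ᵥ (Uᵀ *ᵥ ((U * J * Uᵀ) *ᵥ v)) = 0 := by
        rw [hv', Matrix.mulVec_zero, Matrix.mulVec_zero]
      rwa [Matrix.mulVec_mulVec, Matrix.mulVec_mulVec, ← Matrix.mul_assoc, ← Matrix.mul_assoc,
        Matrix.mul_assoc J, hU, Matrix.mul_one, ← Matrix.mulVec_mulVec] at h3
    have h3 : Uᵀ *ᵥ v = 0 := by
      rw [hJJ] at h2
      funext i
      have e1 := congrFun h1 i
      have e2 := congrFun h2 i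
      rw [Matrix.neg_mulVec, Pi.neg_apply, Matrix.mulVec_diagonal] at e2
      rw [Matrix.mulVec_diagonal] at e1
      by_cases hi : d i = 0
      · simpa [hi] using e2
      · simpa [hi] using e1
    rw [← Matrix.one_mulVec v, ← hU', ← Matrix.mulVec_mulVec, h3, Matrix.mulVec_zero]

end KernelForm

end

/-! ### Small logarithms and the fields they generate. -/

noncomputable section

open scoped Matrix

section SmallLogarithm

variable {n : ℕ} {ℓ : ℝ} {h A A₀ : Matrix (Fin n) (Fin n) ℝ}

lemma exp_smul_mulVec_eq_self {v : Fin n → ℝ} (hv : A *ᵥ v = 0) (t : ℝ) :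
    NormedSpace.exp (t • A) *ᵥ v = v :=
  (eq_exp_mulVec (u := fun _ => v) (fun t => by rw [hv]; exact hasDerivAt_const t v) t).symm

/-- `A` is a skew-symmetric logarithm of `h`, up to the factor `ℓ`, whose eigenvalues lie between
`-iπ/ℓ` and `iπ/ℓ`. -/
structure IsSmallLogarithm (ℓ : ℝ) (h A : Matrix (Fin n) (Fin n) ℝ) : Prop where
  skew : Aᵀ = -A
  exp_eq : NormedSpace.exp (ℓ • A) = h
  spectrum_le : ∀ z ∈ spectrum ℂ (A.map (algebraMap ℝ ℂ)), ‖z‖ ≤ Real.pi / ℓ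
  mulVec_eq_zero : ∀ v, h *ᵥ v = v → A *ᵥ v = 0

theorem exists_isSmallLogarithm (hℓ : 0 < ℓ) (hh : h ∈ Matrix.specialOrthogonalGroup (Fin n) ℝ) :
    ∃ A, IsSmallLogarithm ℓ h A := by
  obtain ⟨L, hL, hexp, hs, h0⟩ := exists_exp_eq hh
  have hL' : ℓ • ℓ⁻¹ • L = L := by rw [smul_smul, mul_inv_cancel₀ hℓ.ne', one_smul]
  refine ⟨ℓ⁻¹ • L, by rw [Matrix.transpose_smul, hL, smul_neg], by rwa [hL'],
    norm_le_of_mem_spectrum_smul (inv_pos.2 hℓ) ?_, fun v hv => ?_⟩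
  · rwa [div_inv_eq_mul, div_mul_cancel₀ _ hℓ.ne']
  · rw [Matrix.smul_mulVec, h0 v hv, smul_zero]

/-- The comparison of small logarithms. -/
theorem IsSmallLogarithm.exists_conj (hA₀ : IsSmallLogarithm ℓ h A₀) (hn : Even n) (hℓ : 0 < ℓ)
    (hA : Aᵀ = -A) (hexp : NormedSpace.exp (ℓ • A) = h)
    (hs : ∀ z ∈ spectrum ℂ (A.map (algebraMap ℝ ℂ)), ‖z‖ ≤ Real.pi / ℓ) :
    IsSmallLogarithm ℓ h A ∧ ∃ C : Matrix (Fin n) (Fin n) ℝ, Cᵀ * C = 1 ∧ A = C * A₀ * Cᵀ ∧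
      (∀ v, h *ᵥ v = v → C *ᵥ v = v) ∧
      (LoopHomotopic ℓ (fun _ => 1)
        (fun t => NormedSpace.exp ((-t) • A₀) * NormedSpace.exp (t • A)) ↔ C.det = 1) := by
  obtain ⟨C, hC, hAC, hfix, hiff⟩ := exists_conj_loopHomotopic_iff hn hℓ hA hA₀.skew hs
    hA₀.spectrum_le (hexp.trans hA₀.exp_eq.symm)
  rw [hA₀.exp_eq] at hfix
  refine ⟨⟨hA, hexp, hs, fun v hv => ?_⟩, C, hC, ?_, hfix, hiff⟩
  · rw [← hfix v hv, Matrix.mulVec_mulVec, hAC, ← Matrix.mulVec_mulVec, hA₀.mulVec_eq_zero v hv,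
      Matrix.mulVec_zero]
  · rw [← hAC, Matrix.mul_assoc, mul_eq_one_comm.1 hC, Matrix.mul_one]

/-- The vectors fixed by `h` are exactly the kernel of a small logarithm: no nonzero eigenvalue of
`ℓ A` is large enough to have exponential `1`. -/
lemma IsSmallLogarithm.exists_isKernelForm (hA : IsSmallLogarithm ℓ h A) (hn : Even n) :
    ∃ K, IsKernelForm h K := by
  obtain ⟨K, hK, hAK, hinj⟩ := exists_kernel_form hn hA.skew
  refine ⟨K, ?_, hK, ?_, fun v hv => hinj v (hA.mulVec_eq_zero v hv)⟩
  · rw [← hA.exp_eq]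
    exact transpose_mul_of_mem (exp_smul_mem hA.skew ℓ)
  · refine Matrix.ext_iff_mulVec.2 fun v => ?_
    rw [← hA.exp_eq, ← Matrix.mulVec_mulVec]
    exact exp_smul_mulVec_eq_self (by rw [Matrix.mulVec_mulVec, hAK, Matrix.zero_mulVec]) ℓ

variable {K : Matrix (Fin n) (Fin n) ℝ}

/-- The values of `K` are fixed by `h`, hence by all `exp (t A)`. Transposition moves this to the
other side of `K`. -/
lemma IsKernelForm.mulVec_exp_mulVec (hK : IsKernelForm h K) (hA : IsSmallLogarithm ℓ h A) (t : ℝ)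
    (v : Fin n → ℝ) : K *ᵥ (NormedSpace.exp (t • A) *ᵥ v) = K *ᵥ v := by
  have h1 : NormedSpace.exp ((-t) • A) * K = K := by
    refine Matrix.ext_iff_mulVec.2 fun v => ?_
    rw [← Matrix.mulVec_mulVec]
    refine exp_smul_mulVec_eq_self (hA.mulVec_eq_zero _ ?_) _
    rw [Matrix.mulVec_mulVec, hK.mul_eq]
  have h2 := congrArg Matrix.transpose h1
  rw [Matrix.transpose_mul, exp_smul_transpose hA.skew, neg_neg, hK.skew, neg_mul, neg_inj] at h2
  rw [Matrix.mulVec_mulVec, h2]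

/-- `C` is the identity on the range of `K`, and by skew-symmetry the same holds on the other side.
So a change of the logarithm does not change the perturbation. -/
lemma IsKernelForm.conj_eq (hK : IsKernelForm h K) {C : Matrix (Fin n) (Fin n) ℝ}
    (hC : ∀ v, h *ᵥ v = v → C *ᵥ v = v) : C * K * Cᵀ = K := by
  have h1 : C * K = K := Matrix.ext_iff_mulVec.2 fun v => by
    rw [← Matrix.mulVec_mulVec, hC]
    rw [Matrix.mulVec_mulVec, hK.mul_eq]
  have h2 := congrArg Matrix.transpose h1
  rw [Matrix.transpose_mul, hK.skew, neg_mul, neg_inj] at h2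
  rw [h1, h2]

end SmallLogarithm

namespace twistedFields

variable {n : ℕ} {ℓ : ℝ} {h A K : Matrix (Fin n) (Fin n) ℝ}

/-- The fields `t ↦ exp (t A) v`. -/
def expField (hA : IsSmallLogarithm ℓ h A) : (Fin n → ℝ) →ₗ[ℝ] twistedFields ℓ h where
  toFun v := ⟨fun t => NormedSpace.exp (t • A) *ᵥ v, contDiff_exp_mulVec A v, fun t => by
    beta_reduce
    rw [exp_add_smul, exp_mul_comm, ← Matrix.mulVec_mulVec, hA.exp_eq]⟩
  map_add' v w := Subtype.ext (funext fun t => Matrix.mulVec_add _ v w)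
  map_smul' c v := Subtype.ext (funext fun t => Matrix.mulVec_smul _ c v)

variable (hA : IsSmallLogarithm ℓ h A)

lemma expField_coe (v : Fin n → ℝ) (t : ℝ) :
    (expField hA v).1 t = NormedSpace.exp (t • A) *ᵥ v := rfl

lemma expField_injective : Function.Injective (expField hA) := fun v w hvw => by
  simpa [expField_coe] using congrFun (congrArg Subtype.val hvw) 0

lemma derivation_expField (v : Fin n → ℝ) :
    derivation ℓ h (expField hA v) = expField hA (A *ᵥ v) :=
  Subtype.ext (deriv_exp_mulVec A v)

lemma isInvariant_range_expField : IsInvariant (LinearMap.range (expField hA)) := by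
  refine ⟨inferInstance, ?_, fun u hu => ?_⟩
  · rintro _ ⟨v, rfl⟩
    exact ⟨A *ᵥ v, (derivation_expField hA v).symm⟩
  · rw [derivation_eq_zero_iff] at hu
    refine ⟨u.1 0, Subtype.ext (funext fun t => ?_)⟩
    rw [expField_coe, hu t, exp_smul_mulVec_eq_self (hA.mulVec_eq_zero _ _)]
    rw [← u.2.2, hu]

lemma form_expField (v w : Fin n → ℝ) :
    form ℓ h (expField hA v) (expField hA w) = ℓ * (v ⬝ᵥ w) := by
  rw [form_apply]
  have : ∀ t : ℝ, (expField hA v).1 t ⬝ᵥ (expField hA w).1 t = v ⬝ᵥ w := fun t => by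
    rw [expField_coe, expField_coe, Matrix.dotProduct_mulVec, ← Matrix.mulVec_transpose,
      Matrix.mulVec_mulVec, transpose_mul_of_mem (exp_smul_mem hA.skew t), Matrix.one_mulVec]
  simp [this]

lemma mulVec_integral_expField (hK : IsKernelForm h K) (v : Fin n → ℝ) :
    K *ᵥ integral ℓ h (expField hA v) = ℓ • (K *ᵥ v) := by
  have h1 : K *ᵥ integral ℓ h (expField hA v) =
      ∫ t in (0 : ℝ)..ℓ, K *ᵥ (expField hA v).1 t :=
    ((LinearMap.toContinuousLinearMap K.mulVecLin).intervalIntegral_comp_comm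
      ((twistedFields.continuous _).intervalIntegrable _ _)).symm
  rw [h1]
  simp [expField_coe, hK.mulVec_exp_mulVec hA]

/-- On the fields `t ↦ exp (t A) v` the derivative is `A` and the mean map is `K`, while the `L²`
product contributes the length `ℓ`. -/
theorem perturbedForm_expField (hℓ : 0 < ℓ) (hK : IsKernelForm h K) (v w : Fin n → ℝ) :
    perturbedForm ℓ hK (expField hA v) (expField hA w) = v ⬝ᵥ ((ℓ • (A + K)) *ᵥ w) := by
  have h1 : form ℓ h (expField hA v) (meanMap ℓ hK.mul_eq (expField hA w)) = ℓ * (v ⬝ᵥ K *ᵥ w) := by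
    rw [form_symm, form_of_eq_const (meanMap_coe hK.mul_eq _), mulVec_integral_expField hA hK,
      smul_smul, inv_mul_cancel₀ hℓ.ne', one_smul, dotProduct_mulVec_skew hK.skew,
      mulVec_integral_expField hA hK, dotProduct_smul, smul_eq_mul, dotProduct_comm,
      dotProduct_mulVec_skew hK.skew, mul_neg, neg_neg]
  change form ℓ h (expField hA v) (perturbed ℓ hK.mul_eq (expField hA w)) = _
  rw [perturbed, LinearMap.add_apply, map_add, derivation_expField, form_expField, h1,
    Matrix.smul_mulVec, dotProduct_smul, Matrix.add_mulVec, dotProduct_add, smul_eq_mul, mul_add]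

end twistedFields

/-- The Pfaffian form on the columns of a matrix. -/
theorem pfaffianForm_expField {m : ℕ} {ℓ : ℝ} {h A K B : Matrix (Fin (2 * m)) (Fin (2 * m)) ℝ}
    (hA : IsSmallLogarithm ℓ h A) (hℓ : 0 < ℓ) (hK : IsKernelForm h K) :
    pfaffianForm (twistedFields.perturbedForm ℓ hK) m
        (fun j => twistedFields.expField hA fun i => B i j) =
      B.det * matrixPfaffian (ℓ • (A + K)) := by
  rw [pfaffianForm_apply, ← Matrix.det_transpose, ← matrixPfaffian_conj]
  congr 1
  ext i j
  rw [Matrix.of_apply, twistedFields.perturbedForm_expField hA hℓ, Matrix.transpose_transpose,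
    Matrix.mul_assoc, Matrix.mul_apply]
  rfl

end

/-! ### Frames with constant connection matrix. -/

noncomputable section

open scoped Matrix

section Conjugation

variable {n : ℕ} {A B : Matrix (Fin n) (Fin n) ℝ}

lemma exp_smul_conj (hB : B * Bᵀ = 1) (t : ℝ) :
    NormedSpace.exp (t • (B * A * Bᵀ)) = B * NormedSpace.exp (t • A) * Bᵀ := by
  have h1 : B⁻¹ = Bᵀ := Matrix.inv_eq_right_inv hB
  rw [← h1, ← Matrix.exp_conj _ _ (IsUnit.of_mul_eq_one _ hB), h1, mul_smul_comm, smul_mul_assoc]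

lemma norm_le_of_mem_spectrum_conj (hB : Bᵀ * B = 1) {c : ℝ}
    (hs : ∀ z ∈ spectrum ℂ (A.map (algebraMap ℝ ℂ)), ‖z‖ ≤ c) :
    ∀ z ∈ spectrum ℂ ((B * A * Bᵀ).map (algebraMap ℝ ℂ)), ‖z‖ ≤ c := by
  intro z hz
  obtain ⟨v, hv, h⟩ := mem_spectrum_iff_exists_mulVec.1 hz
  let f : Matrix (Fin n) (Fin n) ℝ →+* Matrix (Fin n) (Fin n) ℂ := (algebraMap ℝ ℂ).mapMatrix
  have h1 : f Bᵀ * f B = 1 := by rw [← map_mul, hB, map_one]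
  change f (B * A * Bᵀ) *ᵥ v = z • v at h
  refine hs z (mem_spectrum_iff_exists_mulVec.2 ⟨f Bᵀ *ᵥ v, fun h0 => hv ?_, ?_⟩)
  · rw [← Matrix.one_mulVec v, ← mul_eq_one_comm.1 h1, ← Matrix.mulVec_mulVec, h0,
      Matrix.mulVec_zero]
  · change f A *ᵥ (f Bᵀ *ᵥ v) = _
    rw [← Matrix.mulVec_smul, ← h, map_mul, map_mul, Matrix.mulVec_mulVec, Matrix.mulVec_mulVec,
      ← mul_assoc, ← mul_assoc, h1, one_mul]

end Conjugation

section AlongCurve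

variable {n : ℕ} {X : Type*} [TopologicalSpace X] [ChartedSpace (EuclideanSpace ℝ (Fin n)) X]
  [IsManifold (𝓡 n) ∞ X] {φ : ℝ → X} {ℓ : ℝ}
  [Bundle.RiemannianBundle (fun x : X => TangentSpace (𝓡 n) x)]
  [IsContMDiffRiemannianBundle (𝓡 n) ∞ (EuclideanSpace ℝ (Fin n))
      (fun x : X => TangentSpace (𝓡 n) x)] [T2Space X]
  {cov : CovariantDerivative (𝓡 n) (EuclideanSpace ℝ (Fin n))
      (fun x : X => TangentSpace (𝓡 n) x)} {o : ManifoldOrientation (n := n) X}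

namespace ParallelFrame

variable (P : ParallelFrame cov o ℓ φ) {spin : CircleSpin}
  (hφ : ContMDiff 𝓘(ℝ, ℝ) (𝓡 n) ∞ φ) (hper : Function.Periodic φ ℓ)
include hφ hper

omit hφ hper in
lemma sum_smul_frame (F : ℝ → Matrix (Fin n) (Fin n) ℝ) (A : Matrix (Fin n) (Fin n) ℝ) (j : Fin n) :
    ∑ i, A i j • P.frame F i = P.frame (fun t => F t * A) j := by
  funext t
  exact (Finset.sum_apply t _ _).trans (P.frame_mul_apply F (fun _ => A) j t).symm

/-- A frame with a constant connection matrix consists of fields `t ↦ exp (t A) v`. -/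
theorem exists_eq_frame_exp {e : Fin n → FieldAlong (n := n) φ} {A : Matrix (Fin n) (Fin n) ℝ}
    (he : IsLowEnergyFrame ℓ spin cov o φ e A) :
    ∃ A' B : Matrix (Fin n) (Fin n) ℝ, B ∈ Matrix.specialOrthogonalGroup (Fin n) ℝ ∧
      A'ᵀ = -A' ∧ NormedSpace.exp (ℓ • A') = P.monodromy spin ∧
      (∀ z ∈ spectrum ℂ (A'.map (algebraMap ℝ ℂ)), ‖z‖ ≤ Real.pi / ℓ) ∧
      e = P.frame fun t => NormedSpace.exp (t • A') * B := by
  obtain ⟨F, rfl⟩ := P.exists_frame_eq e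
  obtain ⟨-, hmem, hhol⟩ := (P.isFrameField_iff hφ.continuous hper F).1 he.frame
  have hsmooth : ∀ j, ContDiff ℝ ∞ fun t i => F t i j := fun j =>
    ((P.isSpinorField_iff hφ hper _).1 (he.isSpinorField j)).1
  have hderiv : ∀ t i j, HasDerivAt (fun t => F t i j) ((F t * A) i j) t := by
    intro t i j
    have h1 := ((hsmooth j).differentiable (by simp) t).hasDerivAt
    have h2 : deriv (fun t i => F t i j) = fun t i => (F t * A) i j := by
      refine P.field.injective ?_
      rw [← P.dirac_field hφ (hsmooth j)]
      exact (he.dirac_eq j).trans (P.sum_smul_frame F A j)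
    rw [h2] at h1
    exact hasDerivAt_pi.1 h1 i
  -- Each row of `F` solves the equation with the matrix `Aᵀ`, because `F' = F A`.
  have hF : ∀ t, F t = F 0 * NormedSpace.exp (t • A) := by
    intro t
    ext i j
    have h1 := eq_exp_mulVec (A := Aᵀ) (u := fun t j => F t i j) (fun t => by
      refine hasDerivAt_pi.2 fun j => ?_
      have h2 : (Aᵀ *ᵥ fun j => F t i j) j = (F t * A) i j := by
        rw [Matrix.mulVec_transpose]
        rfl
      rw [h2]
      exact hderiv t i j) t
    rw [← Matrix.transpose_smul, Matrix.exp_transpose, Matrix.mulVec_transpose] at h1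
    exact congrFun h1 j
  have hB := mul_transpose_of_mem (hmem 0)
  have hB' := transpose_mul_of_mem (hmem 0)
  -- Conjugation by the initial value puts the exponential on the left, where the holonomy acts. The
  -- conjugate of `A` is then a logarithm of the monodromy.
  have hexp : ∀ t : ℝ, F t = NormedSpace.exp (t • (F 0 * A * (F 0)ᵀ)) * F 0 := fun t => by
    rw [exp_smul_conj hB, Matrix.mul_assoc, hB', Matrix.mul_one, hF]
  refine ⟨F 0 * A * (F 0)ᵀ, F 0, hmem 0, ?_, ?_, norm_le_of_mem_spectrum_conj hB' he.spectrum_le,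
    congrArg P.frame (funext hexp)⟩
  · rw [Matrix.transpose_mul, Matrix.transpose_mul, he.skew, Matrix.transpose_transpose,
      Matrix.neg_mul, Matrix.mul_neg, Matrix.mul_assoc]
  · have h1 := (P.holonomy_mul_eq_iff spin _ _).1 (hhol 0)
    rw [zero_add, hexp ℓ] at h1
    have h2 := congrArg (· * (F 0)ᵀ) h1
    simpa only [Matrix.mul_assoc, hB, Matrix.mul_one] using h2

variable {A : Matrix (Fin n) (Fin n) ℝ} (hA : IsSmallLogarithm ℓ (P.monodromy spin) A)

include hA

/-- The frame of the fields `t ↦ exp (t A) v`. -/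
theorem isLowEnergyFrame_exp :
    IsLowEnergyFrame ℓ spin cov o φ (P.frame fun t => NormedSpace.exp (t • A)) A := by
  have hcol : ∀ j, (fun (t : ℝ) i => NormedSpace.exp (t • A) i j) =
      (twistedFields.expField hA (Pi.single j 1)).1 := fun j => by
    funext t i
    rw [twistedFields.expField_coe, Matrix.mulVec_single_one]
    rfl
  refine ⟨?_, fun j => ?_, hA.skew, fun j => ?_, hA.spectrum_le⟩
  · rw [P.isFrameField_iff hφ.continuous hper]
    refine ⟨continuous_exp_smul A, exp_smul_mem hA.skew, fun t => ?_⟩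
    rw [P.holonomy_mul_eq_iff, ← hA.exp_eq, ← exp_add_smul, add_comm]
  · rw [frame, hcol, P.isSpinorField_iff_mem hφ hper]
    exact (twistedFields.expField hA _).2
  · rw [frame, hcol, P.dirac_field_twisted hφ hper, twistedFields.derivation_expField]
    refine Eq.trans ?_ (P.sum_smul_frame _ A j).symm
    congr 1
    funext t i
    rw [twistedFields.expField_coe, Matrix.mulVec_single_one]
    rfl

/-- The span of the fields `t ↦ exp (t A) v`. -/
def expSpace : DiracInvariantSpace ℓ spin cov φ :=
  P.ofSubmodule hφ hper (twistedFields.isInvariant_range_expField hA)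

lemma frame_exp_mul_apply (B : Matrix (Fin n) (Fin n) ℝ) (j : Fin n) :
    P.frame (fun t => NormedSpace.exp (t • A) * B) j =
      P.field (twistedFields.expField hA fun i => B i j).1 := rfl

lemma expSpace_eq_span : (P.expSpace hφ hper hA).space =
    Submodule.span ℝ (Set.range (P.frame fun t => NormedSpace.exp (t • A))) := by
  refine le_antisymm (fun s hs => ?_) (Submodule.span_le.2 ?_)
  · obtain ⟨_, ⟨v, rfl⟩, rfl⟩ := (P.mem_ofSubmodule hφ hper _ s).1 hs
    have : P.field (twistedFields.expField hA v).1 =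
        ∑ j, v j • P.frame (fun t => NormedSpace.exp (t • A)) j := by
      simp only [frame, ← map_smul, ← map_sum]
      congr 1
      funext t i
      simp [twistedFields.expField_coe, Matrix.mulVec, dotProduct, mul_comm]
    rw [this]
    exact Submodule.sum_mem _ fun j _ => Submodule.smul_mem _ _ (Submodule.subset_span ⟨j, rfl⟩)
  · rintro _ ⟨j, rfl⟩
    refine (P.mem_ofSubmodule hφ hper _ _).2
      ⟨_, ⟨fun i => (1 : Matrix (Fin n) (Fin n) ℝ) i j, rfl⟩, ?_⟩
    rw [← P.frame_exp_mul_apply hφ hper hA]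
    simp

end ParallelFrame

end AlongCurve

end

/-! ### From frames of `L ⊗ E` to frames of `E`. -/

noncomputable section

open scoped Matrix

section Twist

variable {n : ℕ} {ℓ : ℝ}

/-- A function on `[0, ℓ]` with equal values at the ends descends to the circle, through
`AddCircle.liftIco`. -/
lemma exists_isLoop_eqOn (hℓ : 0 < ℓ) {F : ℝ → Matrix (Fin n) (Fin n) ℝ}
    (hF : ContinuousOn F (Set.Icc 0 ℓ))
    (hmem : ∀ t ∈ Set.Icc 0 ℓ, F t ∈ Matrix.specialOrthogonalGroup (Fin n) ℝ) (h0 : F 0 = F ℓ) :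
    ∃ G, IsLoop ℓ G ∧ Set.EqOn G F (Set.Icc 0 ℓ) := by
  have : Fact (0 < ℓ) := ⟨hℓ⟩
  have heq : Set.EqOn (fun t : ℝ => AddCircle.liftIco ℓ 0 F t) F (Set.Icc 0 ℓ) := by
    intro t ht
    rcases ht.2.eq_or_lt with rfl | h
    · beta_reduce
      rw [AddCircle.coe_period, ← h0, ← AddCircle.liftIco_zero_coe_apply (f := F) ⟨le_rfl, hℓ⟩]
      rfl
    · exact AddCircle.liftIco_zero_coe_apply ⟨ht.1, h⟩
  have hper : Function.Periodic (fun t : ℝ => AddCircle.liftIco ℓ 0 F t) ℓ := fun t => by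
    beta_reduce
    rw [AddCircle.coe_add_period]
  refine ⟨fun t => AddCircle.liftIco ℓ 0 F t, ⟨(AddCircle.liftIco_zero_continuous h0 hF).comp
    (AddCircle.continuous_mk' ℓ), fun t => ?_, hper⟩, heq⟩
  obtain ⟨s, hs, hst⟩ := hper.exists_mem_Ico₀ hℓ t
  have h1 := heq (Set.Ico_subset_Icc_self hs)
  beta_reduce at hst h1 ⊢
  rw [hst, h1]
  exact hmem s (Set.Ico_subset_Icc_self hs)

/-- A path from `1` to `-1` extends to an antiperiodic function. -/
lemma exists_antiperiodic (hn : Even n) (hℓ : 0 < ℓ)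
    (g : Path (1 : Matrix (Fin n) (Fin n) ℝ) (-1))
    (hg : ∀ r, g r ∈ Matrix.specialOrthogonalGroup (Fin n) ℝ) :
    ∃ G : ℝ → Matrix (Fin n) (Fin n) ℝ, Continuous G ∧
      (∀ t, G t ∈ Matrix.specialOrthogonalGroup (Fin n) ℝ) ∧ (∀ t, G (t + ℓ) = -G t) ∧
      ∀ t ∈ Set.Icc 0 ℓ, G t = g.extend (t / ℓ) := by
  -- `t ↦ exp (t A)` is a smooth antiperiodic model that goes from `1` to `-1`. The quotient of `g`
  -- by it is closed, so it extends periodically, and multiplication by the model restores `g`.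
  obtain ⟨A, hA⟩ := exists_isSmallLogarithm (n := n) (h := -1) hℓ (by
    rw [mem_specialOrthogonal_iff, Matrix.det_neg, Fintype.card_fin, hn.neg_one_pow]
    simp)
  have hge : ∀ r, g.extend r ∈ Matrix.specialOrthogonalGroup (Fin n) ℝ := fun r => hg _
  obtain ⟨K, hK, hKeq⟩ := exists_isLoop_eqOn hℓ
    (F := fun t => g.extend (t / ℓ) * NormedSpace.exp ((-t) • A))
    (((g.continuous_extend.comp (continuous_id.div_const ℓ)).mul
      ((continuous_exp_smul A).comp continuous_neg)).continuousOn)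
    (fun t _ => mul_mem (hge _) (exp_smul_mem hA.skew _)) (by
      have h1 : NormedSpace.exp ((-ℓ) • A) = -1 := by
        rw [← exp_smul_transpose hA.skew, hA.exp_eq, Matrix.transpose_neg, Matrix.transpose_one]
      rw [h1]
      simp [div_self hℓ.ne'])
  refine ⟨fun t => K t * NormedSpace.exp (t • A), hK.1.mul (continuous_exp_smul A),
    fun t => mul_mem (hK.2 t) (exp_smul_mem hA.skew t), fun t => ?_, fun t ht => ?_⟩
  · beta_reduce
    rw [hK.3, exp_add_smul, hA.exp_eq, mul_neg, mul_one, mul_neg]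
  · beta_reduce
    rw [hKeq ht, Matrix.mul_assoc, exp_neg_smul_mul, Matrix.mul_one]

/-- Conjugation by a function that is periodic up to a sign. -/
lemma LoopHomotopic.conj {F G : ℝ → Matrix (Fin n) (Fin n) ℝ} {c : ℝ} (hc : c * c = 1)
    (hG : Continuous G) (hmem : ∀ t, G t ∈ Matrix.specialOrthogonalGroup (Fin n) ℝ)
    (hper : ∀ t, G (t + ℓ) = c • G t) (h : LoopHomotopic ℓ (fun _ => 1) F) :
    LoopHomotopic ℓ (fun _ => 1) fun t => (G t)ᵀ * F t * G t := by
  obtain ⟨H, hH, h0, h1⟩ := h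
  refine ⟨fun a => (G a.2)ᵀ * H a * G a.2, ⟨?_, fun a => ?_, fun s t => ?_⟩, fun t => ?_, fun t => ?_⟩
  · exact ((hG.comp continuous_snd).matrix_transpose.mul hH.continuous).mul
      (hG.comp continuous_snd)
  · exact mul_mem (mul_mem (transpose_mem_specialOrthogonal (hmem _)) (hH.mem a)) (hmem _)
  -- The sign enters through `G` and through its transpose, and cancels.
  · simp only [hper, hH.periodic, Matrix.transpose_smul, Matrix.smul_mul, Matrix.mul_smul,
      smul_smul, hc, one_smul]
  · simp only [h0, Matrix.mul_one, transpose_mul_of_mem (hmem t)]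
  · simp only [h1]

lemma loopHomotopic_conj_iff {F G : ℝ → Matrix (Fin n) (Fin n) ℝ} {c : ℝ} (hc : c * c = 1)
    (hG : Continuous G) (hmem : ∀ t, G t ∈ Matrix.specialOrthogonalGroup (Fin n) ℝ)
    (hper : ∀ t, G (t + ℓ) = c • G t) :
    LoopHomotopic ℓ (fun _ => 1) (fun t => (G t)ᵀ * F t * G t) ↔
      LoopHomotopic ℓ (fun _ => 1) F := by
  refine ⟨fun h => ?_, fun h => h.conj hc hG hmem hper⟩
  have h1 := h.conj (G := fun t => (G t)ᵀ) hc hG.matrix_transpose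
    (fun t => transpose_mem_specialOrthogonal (hmem t))
    (fun t => by rw [hper, Matrix.transpose_smul])
  have h2 : ∀ t, (G t)ᵀᵀ * ((G t)ᵀ * F t * G t) * (G t)ᵀ = F t := fun t => by
    rw [Matrix.transpose_transpose, ← Matrix.mul_assoc, ← Matrix.mul_assoc,
      mul_transpose_of_mem (hmem t), Matrix.one_mul, Matrix.mul_assoc,
      mul_transpose_of_mem (hmem t), Matrix.mul_one]
  simpa only [h2] using h1

lemma loopHomotopic_mul_const_iff {F : ℝ → Matrix (Fin n) (Fin n) ℝ}
    {B : Matrix (Fin n) (Fin n) ℝ} (hB : B ∈ Matrix.specialOrthogonalGroup (Fin n) ℝ) :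
    LoopHomotopic ℓ (fun _ => 1) (fun t => F t * B) ↔ LoopHomotopic ℓ (fun _ => 1) F := by
  refine ⟨fun h => ?_, fun h => ?_⟩
  · have h1 := h.mul (loopHomotopic_const (ℓ := ℓ) (transpose_mem_specialOrthogonal hB))
    simpa only [Matrix.mul_assoc, mul_transpose_of_mem hB, Matrix.mul_one] using h1
  · simpa only [Matrix.mul_one] using h.mul (loopHomotopic_const (ℓ := ℓ) hB)

end Twist

section AlongCurve

variable {n : ℕ} {X : Type*} [TopologicalSpace X] [ChartedSpace (EuclideanSpace ℝ (Fin n)) X]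
  [IsManifold (𝓡 n) ∞ X] {φ : ℝ → X} {ℓ : ℝ}
  [Bundle.RiemannianBundle (fun x : X => TangentSpace (𝓡 n) x)]
  [IsContMDiffRiemannianBundle (𝓡 n) ∞ (EuclideanSpace ℝ (Fin n))
      (fun x : X => TangentSpace (𝓡 n) x)] [T2Space X]
  {cov : CovariantDerivative (𝓡 n) (EuclideanSpace ℝ (Fin n))
      (fun x : X => TangentSpace (𝓡 n) x)} {o : ManifoldOrientation (n := n) X}

/-- A function that turns frames of `L ⊗ E` into frames of `E`. -/
structure IsUntwisting (ℓ : ℝ) (spin : CircleSpin) (g G : ℝ → Matrix (Fin n) (Fin n) ℝ) :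
    Prop where
  continuous : Continuous G
  mem : ∀ t, G t ∈ Matrix.specialOrthogonalGroup (Fin n) ℝ
  add_period : ∀ t, G (t + ℓ) = spin.sign • G t
  eqOn : spin = .bounding → ∀ t ∈ Set.Icc 0 ℓ, G t = g (t / ℓ)
  eq_one : spin = .nonbounding → ∀ t, G t = 1

lemma exists_isUntwisting (hn : Even n) (hℓ : 0 < ℓ)
    (g : Path (1 : Matrix (Fin n) (Fin n) ℝ) (-1))
    (hg : ∀ r, g r ∈ Matrix.specialOrthogonalGroup (Fin n) ℝ) (spin : CircleSpin) :
    ∃ G, IsUntwisting ℓ spin g.extend G := by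
  cases spin with
  | nonbounding =>
    exact ⟨fun _ => 1, continuous_const, fun _ => one_mem _, fun t => by simp [CircleSpin.sign],
      by simp, fun _ _ => rfl⟩
  | bounding =>
    obtain ⟨G, h1, h2, h3, h4⟩ := exists_antiperiodic hn hℓ g hg
    exact ⟨G, h1, h2, fun t => by rw [h3, CircleSpin.sign, neg_one_smul], fun _ => h4, by simp⟩

namespace ParallelFrame

variable (P : ParallelFrame cov o ℓ φ) {spin : CircleSpin}

lemma _root_.IsUntwisting.isSection {g G F : ℝ → Matrix (Fin n) (Fin n) ℝ}
    (hG : IsUntwisting ℓ spin g G) (hF : Continuous F)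
    (hmem : ∀ t, F t ∈ Matrix.specialOrthogonalGroup (Fin n) ℝ)
    (hper : ∀ t, P.holonomy * F (t + ℓ) = spin.sign • F t) :
    P.IsSection fun t => F t * G t :=
  ⟨hF.mul hG.1, fun t => mul_mem (hmem t) (hG.2 t), fun t => by
    rw [hG.add_period, Matrix.mul_smul, Matrix.mul_smul, ← Matrix.mul_assoc, hper, Matrix.smul_mul, smul_smul,
      spin.sign_mul_self, one_smul]⟩

lemma _root_.IsUntwisting.isUntwisted {g G : ℝ → Matrix (Fin n) (Fin n) ℝ}
    (hG : IsUntwisting ℓ spin g G) (F : ℝ → Matrix (Fin n) (Fin n) ℝ) :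
    IsUntwisted ℓ (P.frame F) (P.frame fun t => F t * G t) g spin := by
  cases spin with
  | nonbounding => simp only [IsUntwisted, hG.eq_one rfl, Matrix.mul_one]
  | bounding =>
    intro t ht j
    rw [P.frame_mul_apply, hG.eqOn rfl t ht]

/-- For the bounding structure the rule prescribes the section only on `[0, ℓ]`. The difference of
two sections is periodic, so agreement there is agreement on the line. -/
lemma _root_.IsUntwisting.eq_of_isUntwisted (hℓ : 0 < ℓ) {g G F F' : ℝ → Matrix (Fin n) (Fin n) ℝ}
    (hG : IsUntwisting ℓ spin g G) (hF : P.IsSection fun t => F t * G t) (hF' : P.IsSection F')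
    (h : IsUntwisted ℓ (P.frame F) (P.frame F') g spin) (t : ℝ) : F' t = F t * G t := by
  cases spin with
  | nonbounding => rw [P.frame_injective h, hG.eq_one rfl, Matrix.mul_one]
  | bounding =>
    have hI : ∀ t ∈ Set.Icc 0 ℓ, F' t = F t * G t := by
      intro t ht
      ext i j
      have h1 := h t ht j
      rw [← hG.eqOn rfl t ht, ← P.frame_mul_apply] at h1
      exact congrFun (P.field_apply_inj h1) i
    have hloop := hF.transpose_mul hF'
    obtain ⟨s, hs, hst⟩ :=
      Function.Periodic.exists_mem_Ico₀ (f := fun t => (F t * G t)ᵀ * F' t) hloop.periodic hℓ t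
    rw [hI s (Set.Ico_subset_Icc_self hs), transpose_mul_of_mem (hF.mem s)] at hst
    have h2 := hF.mul_transpose_mul (G := F') t
    beta_reduce at h2
    rw [← h2, hst, Matrix.mul_one]

end ParallelFrame

end AlongCurve

end

/-! ### Comparison of the sign of the Pfaffian with the component of the frame. -/

noncomputable section

open scoped Matrix

section Components

lemma zerothHomotopy_mk_eq_iff {Z : Type*} [TopologicalSpace Z] {a b : Z} :
    ZerothHomotopy.mk a = ZerothHomotopy.mk b ↔ Joined a b :=
  Quotient.eq

lemma exists_zerothHomotopy_equiv_prop {Y : Type*} [TopologicalSpace Y] {s : Y → Prop}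
    (hs : ∀ y y', Joined y y' ↔ (s y ↔ s y')) (h : ∃ y, s y) (h' : ∃ y, ¬ s y) :
    ∃ Φ : ZerothHomotopy Y ≃ Prop, ∀ y, Φ (ZerothHomotopy.mk y) = s y := by
  refine ⟨Equiv.ofBijective (Quotient.lift s fun y y' hy => propext ((hs y y').1 hy)) ⟨?_, ?_⟩,
    fun y => rfl⟩
  · intro a b
    induction a using Quotient.inductionOn
    induction b using Quotient.inductionOn
    exact fun hab => Quotient.sound ((hs _ _).2 (iff_of_eq hab))
  · intro p
    by_cases hp : p
    · obtain ⟨y, hy⟩ := h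
      exact ⟨ZerothHomotopy.mk y, propext ⟨fun _ => hp, fun _ => hy⟩⟩
    · obtain ⟨y, hy⟩ := h'
      exact ⟨ZerothHomotopy.mk y, propext ⟨fun h => absurd h hy, fun h => absurd h hp⟩⟩

/-- The bijection of sets with two components, that are told apart by properties of the points. -/
lemma exists_zerothHomotopy_equiv {Y Z : Type*} [TopologicalSpace Y] [TopologicalSpace Z]
    {s : Y → Prop} {r : Z → Prop} (hs : ∀ y y', Joined y y' ↔ (s y ↔ s y')) (h : ∃ y, s y)
    (h' : ∃ y, ¬ s y) (hr : ∀ z z', Joined z z' ↔ (r z ↔ r z')) (k : ∃ z, r z)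
    (k' : ∃ z, ¬ r z) : ∃ Φ : ZerothHomotopy Y ≃ ZerothHomotopy Z, ∀ y z,
      Φ (ZerothHomotopy.mk y) = ZerothHomotopy.mk z ↔ (s y ↔ r z) := by
  obtain ⟨Φ, hΦ⟩ := exists_zerothHomotopy_equiv_prop hs h h'
  obtain ⟨Ψ, hΨ⟩ := exists_zerothHomotopy_equiv_prop hr k k'
  refine ⟨Φ.trans Ψ.symm, fun y z => ?_⟩
  rw [Equiv.trans_apply, Equiv.symm_apply_eq, hΦ, hΨ, eq_iff_iff]

/-- A bijection of sets of components is determined by one value if there are two components. -/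
lemma zerothHomotopy_equiv_apply_iff {Y Z : Type*} [TopologicalSpace Y] [TopologicalSpace Z]
    {s : Y → Prop} {r : Z → Prop} (hs : ∀ y y', Joined y y' ↔ (s y ↔ s y'))
    (hr : ∀ z z', Joined z z' ↔ (r z ↔ r z')) {y₀ : Y} {z₀ : Z} (hy₀ : s y₀) (hz₀ : r z₀)
    (Φ : ZerothHomotopy Y ≃ ZerothHomotopy Z)
    (hΦ : Φ (ZerothHomotopy.mk y₀) = ZerothHomotopy.mk z₀) {y : Y} {z : Z}
    (h : Φ (ZerothHomotopy.mk y) = ZerothHomotopy.mk z) : s y ↔ r z := by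
  have h1 : s y ↔ ZerothHomotopy.mk y = ZerothHomotopy.mk y₀ := by
    rw [zerothHomotopy_mk_eq_iff, hs]
    exact ⟨fun h => ⟨fun _ => hy₀, fun _ => h⟩, fun h => h.2 hy₀⟩
  have h2 : r z ↔ ZerothHomotopy.mk z = ZerothHomotopy.mk z₀ := by
    rw [zerothHomotopy_mk_eq_iff, hr]
    exact ⟨fun h => ⟨fun _ => hz₀, fun _ => h⟩, fun h => h.2 hz₀⟩
  rw [h1, h2, ← Φ.injective.eq_iff, h, hΦ]

end Components

section AlongCurve

variable {m : ℕ} {X : Type*} [TopologicalSpace X]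
  [ChartedSpace (EuclideanSpace ℝ (Fin (2 * m))) X]
  [IsManifold (𝓡 (2 * m)) ∞ X] {φ : ℝ → X} {ℓ : ℝ}
  [Bundle.RiemannianBundle (fun x : X => TangentSpace (𝓡 (2 * m)) x)]
  [IsContMDiffRiemannianBundle (𝓡 (2 * m)) ∞ (EuclideanSpace ℝ (Fin (2 * m)))
      (fun x : X => TangentSpace (𝓡 (2 * m)) x)] [T2Space X]
  {cov : CovariantDerivative (𝓡 (2 * m)) (EuclideanSpace ℝ (Fin (2 * m)))
      (fun x : X => TangentSpace (𝓡 (2 * m)) x)} {o : ManifoldOrientation (n := 2 * m) X}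

namespace ParallelFrame

variable (P : ParallelFrame cov o ℓ φ) {spin : CircleSpin}
  (hφ : ContMDiff 𝓘(ℝ, ℝ) (𝓡 (2 * m)) ∞ φ) (hper : Function.Periodic φ ℓ) (hℓ : 0 < ℓ)
  {K : Matrix (Fin (2 * m)) (Fin (2 * m)) ℝ} (hK : IsKernelForm (P.monodromy spin) K)
  {η₀ : PfaffianLine ℓ spin cov φ}
  (hη₀ : ∀ (V : DiracInvariantSpace ℓ spin cov φ) (k : ℕ)
    (hk : 2 * k = Module.finrank ℝ V.space) (u : Fin (Module.finrank ℝ V.space) → V.space),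
    η₀.1 V u = pfaffianForm (twistedFields.perturbedForm ℓ hK) k
      (fun i => P.components hφ hper V (u (Fin.cast hk i))))
include hφ hper hℓ hK hη₀

/-- The value on a frame depends on its components only, and these are the exponential fields of the
columns of `B`. -/
lemma pfaffianLine_apply_frame {A B : Matrix (Fin (2 * m)) (Fin (2 * m)) ℝ}
    (hA : IsSmallLogarithm ℓ (P.monodromy spin) A) {e : Fin (2 * m) → FieldAlong (n := 2 * m) φ}
    (he : e = P.frame fun t => NormedSpace.exp (t • A) * B) (W : DiracInvariantSpace ℓ spin cov φ)
    (hdim : Module.finrank ℝ W.space = 2 * m) (heW : ∀ j, e j ∈ W.space) :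
    η₀.1 W (fun i => ⟨e (Fin.cast hdim i), heW _⟩) =
      B.det * matrixPfaffian (ℓ • (A + K)) := by
  rw [hη₀ W m hdim.symm, ← pfaffianForm_expField hA hℓ hK]
  congr 1
  funext j
  rw [P.components_eq_iff, ← P.frame_exp_mul_apply hφ hper hA, ← he]
  rfl

variable {A₀ : Matrix (Fin (2 * m)) (Fin (2 * m)) ℝ}
  (hA₀ : IsSmallLogarithm ℓ (P.monodromy spin) A₀)
  {g G : ℝ → Matrix (Fin (2 * m)) (Fin (2 * m)) ℝ} (hG : IsUntwisting ℓ spin g G)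
  {f₀ : FrameSections ℓ o φ} (hf₀ : f₀.1 = P.frame fun t => NormedSpace.exp (t • A₀) * G t)
include hA₀ hG hf₀

/-- The sign of an element of the Pfaffian line that is positive on a frame with constant
connection matrix, and the component of the frame. -/
theorem sign_iff_joined {e : Fin (2 * m) → FieldAlong (n := 2 * m) φ}
    {A : Matrix (Fin (2 * m)) (Fin (2 * m)) ℝ} (he : IsLowEnergyFrame ℓ spin cov o φ e A)
    (W : DiracInvariantSpace ℓ spin cov φ) (hdim : Module.finrank ℝ W.space = 2 * m)
    (heW : ∀ j, e j ∈ W.space) {c : ℝ}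
    (hpos : 0 < (c • η₀).1 W fun i => ⟨e (Fin.cast hdim i), heW _⟩) {f : FrameSections ℓ o φ}
    (hf : IsUntwisted ℓ e f.1 g spin) :
    0 < c * matrixPfaffian (ℓ • (A₀ + K)) ↔ Joined f₀ f := by
  have heven : Even (2 * m) := even_two_mul m
  obtain ⟨A', B, hB, hA'T, hexp, hs, rfl⟩ := P.exists_eq_frame_exp hφ hper he
  obtain ⟨hA', C, hC, hAC, hfix, hiff⟩ := hA₀.exists_conj heven hℓ hA'T hexp hs
  obtain ⟨F', hF', hFf⟩ := P.exists_isSection_eq hφ.continuous hper f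
  have hsec : P.IsSection fun t => NormedSpace.exp (t • A') * B * G t := by
    have h1 := (P.isFrameField_iff hφ.continuous hper _).1 he.frame
    exact hG.isSection P h1.1 h1.2.1 h1.2.2
  rw [← hFf] at hf
  have hFeq := hG.eq_of_isUntwisted P hℓ hsec hF' hf
  obtain rfl : F' = fun t => NormedSpace.exp (t • A') * B * G t := funext hFeq
  -- The difference of the two sections is the loop of the two logarithms, multiplied by the
  -- constant `B` and conjugated by `G`. Neither changes whether it is null-homotopic.
  have hloop : Joined f₀ f ↔ C.det = 1 := by
    rw [P.joined_iff hφ.continuous hper hf₀.symm hFf]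
    have h1 := (loopHomotopic_conj_iff spin.sign_mul_self hG.continuous hG.mem hG.add_period).trans
      ((loopHomotopic_mul_const_iff hB).trans hiff)
    simp only [Matrix.mul_assoc] at h1
    simpa only [Matrix.transpose_mul, exp_smul_transpose hA₀.skew, Matrix.mul_assoc] using h1
  have hval : (c • η₀).1 W (fun i =>
      ⟨P.frame (fun t => NormedSpace.exp (t • A') * B) (Fin.cast hdim i), heW _⟩) =
      c * (C.det * matrixPfaffian (ℓ • (A₀ + K))) := by
    -- Since `C` fixes `K`, it conjugates the whole matrix of the perturbed operator, and the
    -- Pfaffian acquires the factor `det C`, the same number that decides about the loop.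
    have h1 := P.pfaffianLine_apply_frame hφ hper hℓ hK hη₀ hA' rfl W hdim heW
    have h2 : ℓ • (A' + K) = C * (ℓ • (A₀ + K)) * Cᵀ := by
      rw [Matrix.mul_smul, Matrix.smul_mul, Matrix.mul_add, Matrix.add_mul, ← hAC,
        hK.conj_eq hfix]
    rw [(mem_specialOrthogonal_iff.1 hB).2, one_mul, h2, matrixPfaffian_conj] at h1
    change c * η₀.1 W _ = _
    rw [h1]
  rw [hval] at hpos
  have hdet : C.det = 1 ∨ C.det = -1 := by
    have := congrArg Matrix.det hC
    rw [Matrix.det_mul, Matrix.det_transpose, Matrix.det_one] at this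
    exact mul_self_eq_one_iff.1 this
  rw [hloop]
  rcases hdet with h | h
  · rw [h, one_mul] at hpos
    exact ⟨fun _ => h, fun _ => hpos⟩
  · rw [h, neg_one_mul, mul_neg, neg_pos] at hpos
    exact ⟨fun h' => absurd h' hpos.not_gt, fun h' => by rw [h] at h'; norm_num at h'⟩

end ParallelFrame

end AlongCurve

end

/-! ### Proof of the theorem. -/

noncomputable section

open scoped Matrix

lemma mul_pos_iff_of_ne_zero {a b p : ℝ} (ha : a ≠ 0) (hb : b ≠ 0) (hp : p ≠ 0) :
    0 < a * b ↔ (0 < a * p ↔ 0 < b * p) := by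
  rcases lt_or_gt_of_ne ha with ha | ha <;> rcases lt_or_gt_of_ne hb with hb | hb <;>
    rcases lt_or_gt_of_ne hp with hp | hp <;>
    simp [mul_pos_iff, ha, hb, hp, ha.not_gt, hb.not_gt, hp.not_gt]

section AlongCurve

variable {m : ℕ} {X : Type*} [TopologicalSpace X]
  [ChartedSpace (EuclideanSpace ℝ (Fin (2 * m))) X]
  [IsManifold (𝓡 (2 * m)) ∞ X] {φ : ℝ → X} {ℓ : ℝ}
  [Bundle.RiemannianBundle (fun x : X => TangentSpace (𝓡 (2 * m)) x)]
  [IsContMDiffRiemannianBundle (𝓡 (2 * m)) ∞ (EuclideanSpace ℝ (Fin (2 * m)))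
      (fun x : X => TangentSpace (𝓡 (2 * m)) x)] [T2Space X]
  {cov : CovariantDerivative (𝓡 (2 * m)) (EuclideanSpace ℝ (Fin (2 * m)))
      (fun x : X => TangentSpace (𝓡 (2 * m)) x)} {o : ManifoldOrientation (n := 2 * m) X}

/-- It is the Pfaffian of the injective perturbed operator in a basis of exponential fields. -/
lemma matrixPfaffian_add_ne_zero {h A K : Matrix (Fin (2 * m)) (Fin (2 * m)) ℝ} (hℓ : 0 < ℓ)
    (hA : IsSmallLogarithm ℓ h A) (hK : IsKernelForm h K) :
    matrixPfaffian (ℓ • (A + K)) ≠ 0 := by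
  have h1 := (twistedFields.isInvariant_range_expField hA).pfaffianForm_basis_ne_zero hℓ hK
    ((Pi.basisFun ℝ (Fin (2 * m))).map
      (LinearEquiv.ofInjective _ (twistedFields.expField_injective hA)))
  have h2 := pfaffianForm_expField (B := 1) hA hℓ hK
  rw [Matrix.det_one, one_mul] at h2
  rw [← h2]
  convert h1 using 2
  funext j
  rw [Module.Basis.map_apply, LinearEquiv.ofInjective_apply, Pi.basisFun_apply]
  congr 1
  funext i
  rw [Matrix.one_apply, Pi.single_apply]

lemma ParallelFrame.finrank_expSpace (P : ParallelFrame cov o ℓ φ) {spin : CircleSpin}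
    (hφ : ContMDiff 𝓘(ℝ, ℝ) (𝓡 (2 * m)) ∞ φ) (hper : Function.Periodic φ ℓ)
    {A : Matrix (Fin (2 * m)) (Fin (2 * m)) ℝ} (hA : IsSmallLogarithm ℓ (P.monodromy spin) A) :
    Module.finrank ℝ (P.expSpace hφ hper hA).space = 2 * m := by
  have h1 := LinearEquiv.finrank_map_eq P.field ((LinearMap.range
    (twistedFields.expField hA)).map (twistedFields ℓ (P.monodromy spin)).subtype)
  refine h1.trans ?_
  rw [Submodule.finrank_map_subtype_eq,
    LinearMap.finrank_range_of_inj (twistedFields.expField_injective hA), Module.finrank_fin_fun]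

end AlongCurve

end

set_option maxHeartbeats 1000000 in
theorem mainTheorem2 (m : ℕ) (hm : 2 ≤ m)
    (g : Path (1 : Matrix (Fin (2 * m)) (Fin (2 * m)) ℝ) (-1))
    (hg : ∀ r, g r ∈ Matrix.specialOrthogonalGroup (Fin (2 * m)) ℝ)
    {X : Type*} [TopologicalSpace X] [T2Space X] [SecondCountableTopology X]
    [ChartedSpace (EuclideanSpace ℝ (Fin (2 * m))) X] [IsManifold (𝓡 (2 * m)) ∞ X]
    [Bundle.RiemannianBundle (fun x : X => TangentSpace (𝓡 (2 * m)) x)]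
    [IsContMDiffRiemannianBundle (𝓡 (2 * m)) ∞ (EuclideanSpace ℝ (Fin (2 * m)))
      (fun x : X => TangentSpace (𝓡 (2 * m)) x)]
    (o : ManifoldOrientation (n := 2 * m) X)
    (cov : CovariantDerivative (𝓡 (2 * m)) (EuclideanSpace ℝ (Fin (2 * m)))
      (fun x : X => TangentSpace (𝓡 (2 * m)) x))
    (hcov : IsSmoothMetricConnection cov)
    (ℓ : ℝ) (hℓ : 0 < ℓ) (spin : CircleSpin)
    (φ : ℝ → X) (hφ : ContMDiff 𝓘(ℝ, ℝ) (𝓡 (2 * m)) ∞ φ) (hφ_periodic : Function.Periodic φ ℓ) :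
    -- `Pfaff D_φ` is a line, and `π_0(Pfaff D_φ \ {0})` is a torsor under `{1, -1}`
    Module.finrank ℝ (PfaffianLine ℓ spin cov φ) = 1 ∧
    Nat.card (ZerothHomotopy (PfaffianNonzero ℓ spin cov φ)) = 2 ∧
    (∀ η : PfaffianNonzero ℓ spin cov φ, ZerothHomotopy.mk (-η) ≠ ZerothHomotopy.mk η) ∧
    -- `π_0(Map(S¹, SO_{2m}))` has order two, and `π_0(Γ_φ)` is a torsor under it
    Nat.card (ZerothHomotopy
      C(AddCircle ℓ, Matrix.specialOrthogonalGroup (Fin (2 * m)) ℝ)) = 2 ∧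
    Nat.card (ZerothHomotopy (FrameSections ℓ o φ)) = 2 ∧
    (∀ (e f : FrameSections ℓ o φ)
      (γ : C(AddCircle ℓ, Matrix.specialOrthogonalGroup (Fin (2 * m)) ℝ)),
      IsRightTranslate e f γ →
        (ZerothHomotopy.mk f = ZerothHomotopy.mk e ↔ Joined 1 γ)) ∧
    -- the canonical isomorphism of torsors
    ∃! Φ : ZerothHomotopy (PfaffianNonzero ℓ spin cov φ) ≃ ZerothHomotopy (FrameSections ℓ o φ),
      (∀ (η : PfaffianNonzero ℓ spin cov φ) (e f : FrameSections ℓ o φ)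
        (γ : C(AddCircle ℓ, Matrix.specialOrthogonalGroup (Fin (2 * m)) ℝ)),
        IsRightTranslate e f γ → ¬ Joined 1 γ →
        Φ (ZerothHomotopy.mk η) = ZerothHomotopy.mk e →
        Φ (ZerothHomotopy.mk (-η)) = ZerothHomotopy.mk f) ∧
      FollowsFrameRule g.extend Φ := by
  have heven : Even (2 * m) := even_two_mul m
  obtain ⟨P⟩ := nonempty_parallelFrame (ℓ := ℓ) (o := o) (by omega) hcov hφ hφ_periodic
  obtain ⟨A₀, hA₀⟩ := exists_isSmallLogarithm hℓ (P.monodromy_mem (spin := spin) heven)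
  obtain ⟨K, hK⟩ := hA₀.exists_isKernelForm heven
  obtain ⟨η₀, hη₀⟩ := P.exists_pfaffianLine hφ hφ_periodic hℓ hK
  obtain ⟨G, hG⟩ := exists_isUntwisting heven hℓ g hg spin
  have hφc := hφ.continuous
  have hp := matrixPfaffian_add_ne_zero hℓ hA₀ hK
  have he₀ := P.isLowEnergyFrame_exp hφ hφ_periodic hA₀
  have hW₀ := P.expSpace_eq_span hφ hφ_periodic hA₀
  have hdim := P.finrank_expSpace hφ hφ_periodic hA₀
  have heW : ∀ j, P.frame (fun t => NormedSpace.exp (t • A₀)) j ∈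
      (P.expSpace hφ hφ_periodic hA₀).space := fun j => hW₀ ▸ Submodule.subset_span ⟨j, rfl⟩
  have hval : η₀.1 (P.expSpace hφ hφ_periodic hA₀) (fun i => ⟨_, heW (Fin.cast hdim i)⟩) =
      matrixPfaffian (ℓ • (A₀ + K)) := by
    rw [P.pfaffianLine_apply_frame (B := 1) hφ hφ_periodic hℓ hK hη₀ hA₀ (by simp) _ hdim heW,
      Matrix.det_one, one_mul]
  have hη₀0 : η₀ ≠ 0 := by
    rintro rfl
    exact hp hval.symm
  obtain ⟨c, hcη, hc⟩ := exists_linearEquiv_of_exists_smul_eq (M := PfaffianLine ℓ spin cov φ) hη₀0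
    (P.exists_eq_smul hφ hφ_periodic hℓ hK hη₀)
  have hsec : P.IsSection fun t => NormedSpace.exp (t • A₀) * G t := by
    have h1 := (P.isFrameField_iff hφc hφ_periodic _).1 he₀.frame
    exact hG.isSection P h1.1 h1.2.1 h1.2.2
  obtain ⟨f₀, hf₀⟩ := P.exists_frameSections_eq hφc hφ_periodic hsec
  obtain ⟨f₁, hf₁⟩ := P.exists_not_joined heven (by omega) hℓ hφc hφ_periodic f₀
  have hu₀ := hG.isUntwisted P fun t => NormedSpace.exp (t • A₀)
  rw [← hf₀] at hu₀
  -- The value of `η₀` on the reference frame. Its sign is unknown, so positivity of an element on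
  -- this frame is tested by its coordinate times `p`.
  set p := matrixPfaffian (ℓ • (A₀ + K)) with hpdef
  let η₁ : PfaffianNonzero ℓ spin cov φ := ⟨p • η₀, smul_ne_zero hp hη₀0⟩
  have hη₁ : 0 < c η₁.1 * p := by
    change 0 < c (p • η₀) * p
    rw [hc]
    exact mul_self_pos.2 hp
  have hs : ∀ η η' : PfaffianNonzero ℓ spin cov φ,
      Joined η η' ↔ (0 < c η.1 * p ↔ 0 < c η'.1 * p) := fun η η' => by
    rw [PfaffianNonzero.joined_iff c, mul_pos_iff_of_ne_zero (PfaffianNonzero.coordinate_ne_zero c η)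
      (PfaffianNonzero.coordinate_ne_zero c η') hp]
  have hneg : ∀ η : PfaffianNonzero ℓ spin cov φ, 0 < c (-η).1 * p ↔ ¬ 0 < c η.1 * p := fun η => by
    have h1 := PfaffianNonzero.not_joined_neg c η
    rw [hs] at h1
    tauto
  -- At most two components: sections not joined to `f₀` are joined to each other.
  have hr : ∀ f f' : FrameSections ℓ o φ, Joined f f' ↔ (Joined f₀ f ↔ Joined f₀ f') := by
    intro f f'
    refine ⟨fun h => ⟨fun h' => h'.trans h, fun h' => h'.trans h.symm⟩, fun h => ?_⟩
    by_cases h' : Joined f₀ f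
    · exact h'.symm.trans (h.1 h')
    · exact P.joined_of_not_joined (by omega) hℓ hφc hφ_periodic h' fun h'' => h' (h.2 h'')
  have hrule : ∀ (e : Fin (2 * m) → FieldAlong (n := 2 * m) φ)
      (A : Matrix (Fin (2 * m)) (Fin (2 * m)) ℝ), IsLowEnergyFrame ℓ spin cov o φ e A →
      ∀ (W : DiracInvariantSpace ℓ spin cov φ) (hdim : Module.finrank ℝ W.space = 2 * m)
        (he : ∀ j, e j ∈ W.space) (η : PfaffianNonzero ℓ spin cov φ) (f : FrameSections ℓ o φ),
        0 < η.1.1 W (fun i => ⟨e (Fin.cast hdim i), he _⟩) → IsUntwisted ℓ e f.1 g.extend spin →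
        (0 < c η.1 * p ↔ Joined f₀ f) := by
    intro e A he W hdim heW η f hpos hf
    rw [← hcη η.1] at hpos
    exact P.sign_iff_joined hφ hφ_periodic hℓ hK hη₀ hA₀ hG hf₀ he W hdim heW hpos hf
  refine ⟨(LinearEquiv.finrank_eq c).trans (Module.finrank_self ℝ),
    card_zerothHomotopy_eq_two (PfaffianNonzero.not_joined_neg c η₁)
      (PfaffianNonzero.joined_or_joined_neg c η₁),
    fun η h => PfaffianNonzero.not_joined_neg c η (zerothHomotopy_mk_eq_iff.1 h).symm,
    card_zerothHomotopy_loops heven (by omega) hℓ,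
    card_zerothHomotopy_eq_two hf₁ fun f => or_iff_not_imp_left.2 fun h =>
      P.joined_of_not_joined (by omega) hℓ hφc hφ_periodic hf₁ h, fun e f γ h => ?_, ?_⟩
  · rw [zerothHomotopy_mk_eq_iff, ← P.joined_iff_of_isRightTranslate hℓ hφc hφ_periodic h]
    exact ⟨Joined.symm, Joined.symm⟩
  -- Both sides have two components. `Φ` matches the elements positive on the reference frame with
  -- the sections joined to `f₀`.
  obtain ⟨Φ, hΦ⟩ := exists_zerothHomotopy_equiv hs ⟨η₁, hη₁⟩ ⟨-η₁, fun h => (hneg η₁).1 h hη₁⟩ hr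
    ⟨f₀, Joined.refl f₀⟩ ⟨f₁, hf₁⟩
  refine ⟨Φ, ⟨fun η e f γ h hγ heq => ?_, fun e A he W _ hdim heW η f hpos hf =>
    (hΦ η f).2 (hrule e A he W hdim heW η f hpos hf)⟩, fun Ψ hΨ => ?_⟩
  · rw [hΦ] at heq ⊢
    rw [← P.joined_iff_of_isRightTranslate hℓ hφc hφ_periodic h, hr] at hγ
    rw [hneg]
    tauto
  -- Uniqueness: the rule for the reference frame prescribes one value of `Ψ`, which determines a
  -- bijection of two-element sets.
  · have h1 : Ψ (ZerothHomotopy.mk η₁) = ZerothHomotopy.mk f₀ := by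
      refine hΨ.2 _ A₀ he₀ _ hW₀ hdim heW η₁ f₀ ?_ hu₀
      change 0 < p * η₀.1 _ _
      rw [hval]
      exact mul_self_pos.2 hp
    refine Equiv.ext fun a => ?_
    obtain ⟨η, rfl⟩ := Quotient.exists_rep a
    obtain ⟨f, hf⟩ := Quotient.exists_rep (Ψ (ZerothHomotopy.mk η))
    have h2 := zerothHomotopy_equiv_apply_iff hs hr hη₁ (Joined.refl f₀) Ψ h1 (y := η) (z := f)
      hf.symm
    exact hf.symm.trans ((hΦ η f).2 h2).symm
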